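/- Let $B_0>0$. For $(x,p)\in\mathbb R^2\times\mathbb R^2$ put $$z_1=\sqrt{\tfrac{B_0}{2}}\Big(x_2-\frac{p_1}{B_0}\Big)+\frac{i\,p_2}{\sqrt{2B_0}},\qquad z_2=\sqrt{\tfrac{B_0}{2}}\Big(x_1-\frac{p_2}{B_0}\Big)+\frac{i\,p_1}{\sqrt{2B_0}} .$$ Let $f$ be a real analytic function on the torus $\mathbb T^n=(\mathbb R/2\pi\mathbb Z)^n$ with Fourier coefficients $\hat f(k)$ and $\hat f(0)=0$. For $\omega\in[0,2\pi]^n$ and $\varepsilon\in\mathbb R$ put $B(t)=B_0+\varepsilon f(\omega t)$ and consider the Hamilton equations of the classical Landau-gauge Hamiltonian $$h_L(t,x,p)=(p_1-B(t)x_2)^2+p_2^2 .$$ Let $\mathcal D_0$ be the set of $\omega\in[0,2\pi]^n$ for which there are $\gamma,\tau>0$ with $$(1)\quad |\omega\cdot k+2B_0|\ge\frac{\gamma}{1+|k|^\tau}\ \ (k\in\mathbb Z^n),\qquad (2)\quad |\omega\cdot k|\ge\frac{\gamma}{|k|^\tau}\ \ (k\in\mathbb Z^n\setminus\{0\}).$$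 For fixed $\gamma,\tau>0$ let $\mathcal D_{\gamma,\tau}\subset\mathcal D_0$ be the set of $\omega\in[0,2\pi]^n$ which satisfy (1) and (2) with these constants, and also $|\omega\cdot k+4B_0|\ge\gamma/(1+|k|^\tau)$ for all $k\in\mathbb Z^n$. For $\omega\in\mathcal D_0$ let $$g_\omega(\theta)=-\frac1{\sqrt{2B_0}}\sum_{k\ne0}\frac{\omega\cdot k}{\omega\cdot k+2B_0}\hat f(k)e^{ik\cdot\theta},\qquad c_\omega=-\frac1{(2\pi)^n}\int_{\mathbb T^n}g_\omega(\theta)^2\,d\theta .$$ There is a constant $\alpha\neq0$ depending only on $B_0$ such that, for every such $n$ and $f$, there are $\varepsilon_0>0$, measurable sets $\mathcal C_\varepsilon\subset\mathcal D_0$ ($|\varepsilon|<\varepsilon_0$) with $\lim_{\varepsilon\to0}\operatorname{meas}(\mathcal D_0\setminus\mathcal C_\varepsilon)=0$, and real numbers $b(\varepsilon)=b(\varepsilon,\omega)$, $c(\varepsilon)=c(\varepsilon,\omega)$ with the following properties for $|\varepsilon|<\varepsilon_0$. One has $B(t)>0$ for all $t$ and all $\omega$, and Hamilton's equations have exactly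 one solution, defined for all $t\in\mathbb R$, for each initial datum. For $\omega\in\mathcal C_\varepsilon$: * $b(\varepsilon)=2B_0+O(\varepsilon^2)$ and $c(\varepsilon)=c_\omega\varepsilon^2+O(\varepsilon^3)$. * A linear symplectic change of variables $\tau(t)=\mathbb I+O(\varepsilon)$ conjugates the flow of $h_L(t)$ to the flow of the normal form $b(\varepsilon)|z_1|^2+c(\varepsilon)(z_2-\bar z_2)^2$. * For all solutions and all $t\in\mathbb R$, $$x_1(t)=x_1(0)+\alpha\,c(\varepsilon)\,p_1(0)\,t+\frac1{B(t)}\big(p_2(t)-p_2(0)\big)+a(t)\cdot x(0)+b'(t)\cdot p(0),\qquad |a(t)|+|b'(t)|=O(\varepsilon).$$ * $p_1(t)=p_1(0)$. Up to error terms of the form $\tilde a(t)\cdot x(0)+\tilde b(t)\cdot p(0)$ with $|\tilde a(t)|+|\tilde b(t)|=O(\varepsilon)$, $$p_2(t)=\sqrt{2B_0}\,\operatorname{Im}z_1(t),\qquad x_2(t)=\frac{p_1(0)}{B(t)}+\frac{\sqrt2\,B_0^{3/2}}{B(t)^2}\operatorname{Re}z_1(t),\qquad z_1(t):=e^{-i\,b(\varepsilon)t}z_1(0),$$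 where $z_1(0)$ is the value of $z_1$ at the initial datum. The coefficients $a,b',\tilde a,\tilde b$ depend on $t,\varepsilon,\omega$ but not on the initial datum. All the $O$'s are uniform in $t\in\mathbb R$. For all $\gamma,\tau>0$ they are uniform in $\omega\in\mathcal C_\varepsilon\cap\mathcal D_{\gamma,\tau}$. They are also uniform in $\omega\in\mathcal C_\varepsilon$ if, for any fixed $\eta\in(0,1)$, each $O(\varepsilon^m)$ is replaced by $O(|\varepsilon|^{m-\eta})$. In particular, let $\omega\in\mathcal D_0$ with $c_\omega\ne0$. If $\varepsilon\neq0$ is small enough (depending on $\omega$) and $\omega\in\mathcal C_\varepsilon$, then for every solution with $p_1(0)\ne0$ one has $x_1(t)/t\to\alpha\,c(\varepsilon)\,p_1(0)\neq0$ as $t\to\pm\infty$, and $x_1$ is unbounded on $[0,\infty)$. -/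

import Mathlib

open MeasureTheory Filter Topology
open scoped BigOperators ComplexConjugate

noncomputable section

/-- The scalar product `k · θ` of an integer vector with a real vector. -/
def kdot {n : ℕ} (k : Fin n → ℤ) (θ : Fin n → ℝ) : ℝ := ∑ i, (k i : ℝ) * θ i

/-- Real analytic functions on the torus `(ℝ / 2πℤ)ⁿ`, seen as functions on `ℝⁿ` that are
real analytic and `2π`-periodic in each variable. -/
structure TorusAnalytic {n : ℕ} (f : (Fin n → ℝ) → ℝ) : Prop where
  analytic : AnalyticOnNhd ℝ f Set.univ
  periodic : ∀ (θ : Fin n → ℝ) (k : Fin n → ℤ),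
    f (fun i => θ i + 2 * Real.pi * (k i : ℝ)) = f θ

/-- The fundamental cell `[0, 2π]ⁿ`. -/
def cell (n : ℕ) : Set (Fin n → ℝ) := Set.Icc (fun _ => 0) (fun _ => 2 * Real.pi)

/-- The Fourier coefficient `(2π)⁻ⁿ ∫ f(θ) exp(-i k·θ) dθ`. -/
def fourierCoef {n : ℕ} (f : (Fin n → ℝ) → ℝ) (k : Fin n → ℤ) : ℂ :=
  (((2 * Real.pi) ^ n)⁻¹ : ℝ) *
    ∫ θ in cell n, (f θ : ℂ) * Complex.exp (-(Complex.I * (kdot k θ : ℂ)))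

/-- The nonresonant frequencies: those in `[0, 2π]ⁿ` for which there are positive `γ`, `τ` with
`|ω·k + 2 B₀| ≥ γ / (1 + |k|^τ)` for all `k`, and `|ω·k| ≥ γ / |k|^τ` for all `k ≠ 0`. -/
def nonresonant (B₀ : ℝ) (n : ℕ) : Set (Fin n → ℝ) :=
  {ω | ω ∈ cell n ∧ ∃ γ τ : ℝ, 0 < γ ∧ 0 < τ ∧
    (∀ k : Fin n → ℤ, γ / (1 + ‖k‖ ^ τ) ≤ |kdot k ω + 2 * B₀|) ∧
    (∀ k : Fin n → ℤ, k ≠ 0 → γ / ‖k‖ ^ τ ≤ |kdot k ω|)}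

/-- The quantitative nonresonance class with fixed constants `γ`, `τ`; it also controls the
divisors `ω·k + 4 B₀`. -/
def diophantine (B₀ : ℝ) (n : ℕ) (γ τ : ℝ) : Set (Fin n → ℝ) :=
  {ω | ω ∈ cell n ∧
    (∀ k : Fin n → ℤ, γ / (1 + ‖k‖ ^ τ) ≤ |kdot k ω + 2 * B₀|) ∧
    (∀ k : Fin n → ℤ, γ / (1 + ‖k‖ ^ τ) ≤ |kdot k ω + 4 * B₀|) ∧
    (∀ k : Fin n → ℤ, k ≠ 0 → γ / ‖k‖ ^ τ ≤ |kdot k ω|)}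

/-- The function `g_ω` (the term `k = 0` of the sum vanishes). -/
def gOmega (B₀ : ℝ) {n : ℕ} (f : (Fin n → ℝ) → ℝ) (ω θ : Fin n → ℝ) : ℂ :=
  -((1 / Real.sqrt (2 * B₀) : ℝ) : ℂ) *
    ∑' k : Fin n → ℤ, ((kdot k ω / (kdot k ω + 2 * B₀) : ℝ) : ℂ) * fourierCoef f k *
      Complex.exp (Complex.I * (kdot k θ : ℂ))

/-- The constant `c_ω`, minus the mean over the torus of `g_ω ^ 2`. -/
def cOmega (B₀ : ℝ) {n : ℕ} (f : (Fin n → ℝ) → ℝ) (ω : Fin n → ℝ) : ℂ :=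
  -((((2 * Real.pi) ^ n)⁻¹ : ℝ) * ∫ θ in cell n, gOmega B₀ f ω θ ^ 2)

/-- The phase space: pairs `(x, p)` with `x, p ∈ ℝ²`. The coordinates `x₁, x₂, p₁, p₂` of `v` are
`v.1 0, v.1 1, v.2 0, v.2 1`. -/
abbrev Phase : Type := (Fin 2 → ℝ) × (Fin 2 → ℝ)

/-- `γ` is a solution, defined for all times, of Hamilton's equations
`x' = ∂h/∂p`, `p' = -∂h/∂x` of the time dependent Hamiltonian `h`. -/
def IsHamiltonSol (h : ℝ → Phase → ℝ) (γ : ℝ → Phase) : Prop :=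
  ∀ (t : ℝ) (i : Fin 2),
    HasDerivAt (fun s => (γ s).1 i) (fderiv ℝ (h t) (γ t) (0, Pi.single i 1)) t ∧
    HasDerivAt (fun s => (γ s).2 i) (-fderiv ℝ (h t) (γ t) (Pi.single i 1, 0)) t

/-- The standard symplectic form on the phase space. -/
def sympForm (u v : Phase) : ℝ := ∑ i, (u.1 i * v.2 i - u.2 i * v.1 i)

/-- The magnetic field `B(t) = B₀ + ε f(ω t)`. -/
def magB (B₀ : ℝ) {n : ℕ} (f : (Fin n → ℝ) → ℝ) (ε : ℝ) (ω : Fin n → ℝ) (t : ℝ) : ℝ :=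
  B₀ + ε * f (t • ω)

/-- The classical Landau gauge Hamiltonian `(p₁ - B(t) x₂)² + p₂²`. -/
def hLandau (B₀ : ℝ) {n : ℕ} (f : (Fin n → ℝ) → ℝ) (ε : ℝ) (ω : Fin n → ℝ)
    (t : ℝ) (v : Phase) : ℝ :=
  (v.2 0 - magB B₀ f ε ω t * v.1 1) ^ 2 + v.2 1 ^ 2

/-- First complex coordinate. -/
def zOne (B₀ : ℝ) (v : Phase) : ℂ :=
  ((B₀ / Real.sqrt (2 * B₀) * ((B₀ * v.1 1 - v.2 0) / B₀) : ℝ) : ℂ) +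
    Complex.I * ((v.2 1 / Real.sqrt (2 * B₀) : ℝ) : ℂ)

/-- Second complex coordinate. -/
def zTwo (B₀ : ℝ) (v : Phase) : ℂ :=
  ((B₀ / Real.sqrt (2 * B₀) * ((B₀ * v.1 0 - v.2 1) / B₀) : ℝ) : ℂ) +
    Complex.I * ((v.2 0 / Real.sqrt (2 * B₀) : ℝ) : ℂ)

/-- The normal form `b |z₁|² + c (z₂ - conj z₂)²` (a real number). -/
def hNormal (B₀ b c : ℝ) (v : Phase) : ℝ :=
  b * ‖zOne B₀ v‖ ^ 2 + c * ((zTwo B₀ v - conj (zTwo B₀ v)) ^ 2).re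

/-- The Landau flow is conjugated to the normal form with coefficients `b`, `c` by a linear
symplectic change of variables that is `δ`-close to the identity for all times. -/
def ConjugatedToNormal (B₀ : ℝ) {n : ℕ} (f : (Fin n → ℝ) → ℝ) (ε : ℝ) (ω : Fin n → ℝ)
    (b c δ : ℝ) : Prop :=
  ∃ T : ℝ → (Phase ≃L[ℝ] Phase),
    (∀ t u v, sympForm (T t u) (T t v) = sympForm u v) ∧
    (∀ t, ‖(T t : Phase →L[ℝ] Phase) - ContinuousLinearMap.id ℝ Phase‖ ≤ δ) ∧
    ∀ γ : ℝ → Phase, IsHamiltonSol (hLandau B₀ f ε ω) γ →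
      IsHamiltonSol (fun _ => hNormal B₀ b c) (fun t => (T t).symm (γ t))

/-- `y γ t`, a function of the trajectory `γ` and the time, equals `y₀ γ t` up to an error
`a(t)·x(0) + b(t)·p(0)` with `|a(t)| + |b(t)| ≤ δ` for all times; `a` and `b` do not depend on the
trajectory `γ` of `h`. -/
def EqUpTo (h : ℝ → Phase → ℝ) (δ : ℝ) (y y₀ : (ℝ → Phase) → ℝ → ℝ) : Prop :=
  ∃ a b : ℝ → Fin 2 → ℝ, (∀ t, ‖a t‖ + ‖b t‖ ≤ δ) ∧
    ∀ γ : ℝ → Phase, IsHamiltonSol h γ → ∀ t,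
      y γ t = y₀ γ t + (∑ i, a t i * (γ 0).1 i + ∑ i, b t i * (γ 0).2 i)

/-- The description of the Landau flow with normal form coefficients `b`, `c`, drift constant `α`
and errors of size `δ`. -/
structure LandauFlow (B₀ : ℝ) {n : ℕ} (f : (Fin n → ℝ) → ℝ) (ε : ℝ) (ω : Fin n → ℝ)
    (α b c δ : ℝ) : Prop where
  conjugated : ConjugatedToNormal B₀ f ε ω b c δ
  x_one : EqUpTo (hLandau B₀ f ε ω) δ (fun γ t => (γ t).1 0)
    (fun γ t => (γ 0).1 0 + α * c * (γ 0).2 0 * t +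
      1 / magB B₀ f ε ω t * ((γ t).2 1 - (γ 0).2 1))
  p_two : EqUpTo (hLandau B₀ f ε ω) δ (fun γ t => (γ t).2 1)
    (fun γ t => Real.sqrt (2 * B₀) *
      (Complex.exp (-(Complex.I * ((b * t : ℝ) : ℂ))) * zOne B₀ (γ 0)).im)
  p_one : ∀ γ : ℝ → Phase, IsHamiltonSol (hLandau B₀ f ε ω) γ → ∀ t, (γ t).2 0 = (γ 0).2 0
  x_two : EqUpTo (hLandau B₀ f ε ω) δ (fun γ t => (γ t).1 1)
    (fun γ t => (γ 0).2 0 / magB B₀ f ε ω t +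
      Real.sqrt 2 * B₀ ^ (3 / 2 : ℝ) / magB B₀ f ε ω t ^ 2 *
        (Complex.exp (-(Complex.I * ((b * t : ℝ) : ℂ))) * zOne B₀ (γ 0)).re)

end

open scoped ENNReal NNReal Nat

noncomputable section

/-! ### The convolution algebra of absolutely convergent Fourier series -/

/-! The momentum `p₁` is conserved, and `x₂'' + 4B²x₂ = 4Bp₁`. Let `q` be the quasiperiodic solution
of `q'' + 4B²q = 4B`, let `r = q'`, and put `X = x₂ - p₁q`, `P = X'/2`. Then `X'' + 4B²X = 0` and
`x₁' = 2(1 - Bq)p₁ - 2BX`. Since `-2BX` is the derivative of `qP - rX/2`, it adds only a bounded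
term to `x₁`, and the linear growth comes from the mean of `2(1 - Bq)`. Everything thus reduces to
the homogeneous Hill equation and to the response `q`.

The homogeneous equation is made autonomous through a quasiperiodic solution `σ` of the Riccati
equation `σ' + σ² + 4B² = 0` near `2iB₀`. It is found in a Banach algebra of Fourier coefficients
with weights `exp(s|k|)`. Newton's linearised equation `h' + 2σh = -E` is solved by the integrating
factor `exp(2S)`, where `S' = σ - σ₀` and `σ₀` is the mean of `σ`; the new error is exactly `h²`
(`IsRiccati.newtonStep`). The divisors are `ik·ω + 2σ₀`, close to `i(k·ω + 4B₀)`, and `ik·ω` for the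
primitive. Each step excludes the frequencies with too small divisors. All families are Lipschitz in
`ω`, so the excluded sets are thin slabs of small total measure (`RiccatiStart.good`,
`RiccatiStart.volume_sdiff_riccatiGood_le`). Constancy of the Wronskian of `exp(∫σ)` and its
conjugate forces `σ₀ = ib` with `b` real (`riccati_mean_re_and_invariant`), and real and imaginary
parts give a Floquet matrix of determinant one.

The same `σ` factors the Hill operator as `(∂ + σ)(∂ - σ)`, which yields `q` with divisors `k·ω ± b`
(`isDeriv_green`). Expanding `q` to second order and comparing Fourier coefficients identifies the
mean drift with `-(4/B₀) c_ω ε²` up to `O(ε³)` (`mean_identity`,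
`ResponseSetting.norm_drift_zero_sub_le`); hence `α = -4/B₀`.

Two divisor constants are kept apart. The iteration runs with a nonresonance constant that decays
like an inverse logarithm of `|ε|`. This makes the excluded measure tend to zero, while powers of
the divisor constant `L` cost only powers of a logarithm. The iteration starts from a formal
solution with error `O(ε³)`, and the response is likewise expanded explicitly to second order, so
the corrections are at most `ε²`: the third power of `ε` absorbs every power of `L`. Only explicit
terms of low order remain. They are bounded by any constant `l` valid for the unperturbed divisors:
a fixed one on a class `diophantine B₀ n γ τ`, or `L` itself, at the price of an arbitrarily small
power of `|ε|`. -/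

/-- Absolutely summable families of Fourier coefficients on the torus of dimension `n`. -/
def FourierAlg (n : ℕ) : Type := lp (fun _ : Fin n → ℤ => ℂ) 1

namespace FourierAlg

variable {n : ℕ}

instance : NormedAddCommGroup (FourierAlg n) :=
  inferInstanceAs (NormedAddCommGroup (lp (fun _ : Fin n → ℤ => ℂ) 1))
instance : NormedSpace ℂ (FourierAlg n) :=
  inferInstanceAs (NormedSpace ℂ (lp (fun _ : Fin n → ℤ => ℂ) 1))
instance : CompleteSpace (FourierAlg n) :=
  inferInstanceAs (CompleteSpace (lp (fun _ : Fin n → ℤ => ℂ) 1))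

/-- The family of coefficients. -/
def coeff (c : FourierAlg n) : (Fin n → ℤ) → ℂ := c.1

instance : CoeFun (FourierAlg n) (fun _ => (Fin n → ℤ) → ℂ) := ⟨coeff⟩

/-- The weighted sum `∑ exp(s|k|) |c k|` of a family of coefficients. -/
def wsum (s : ℝ) (c : (Fin n → ℤ) → ℂ) : ℝ≥0∞ :=
  ∑' k, ENNReal.ofReal (Real.exp (s * ‖k‖)) * ‖c k‖ₑ

theorem wsum_zero_eq (c : (Fin n → ℤ) → ℂ) : wsum 0 c = ∑' k, ‖c k‖ₑ := by
  simp [wsum]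

theorem summable_norm_iff_wsum {c : (Fin n → ℤ) → ℂ} :
    Summable (fun k => ‖c k‖) ↔ wsum 0 c ≠ ∞ := by
  rw [wsum_zero_eq, tsum_enorm_ne_top_iff_summable_nnnorm, ← NNReal.summable_coe]
  rfl

theorem wsum_mono {s t : ℝ} (h : s ≤ t) (c : (Fin n → ℤ) → ℂ) : wsum s c ≤ wsum t c := by
  refine ENNReal.tsum_le_tsum fun k => ?_
  gcongr

theorem wsum_le_of_le {s : ℝ} {c d : (Fin n → ℤ) → ℂ} (h : ∀ k, ‖c k‖ ≤ ‖d k‖) :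
    wsum s c ≤ wsum s d := by
  refine ENNReal.tsum_le_tsum fun k => ?_
  gcongr
  exact enorm_le_iff_norm_le.2 (h k)

theorem memℓp_one_iff {c : (Fin n → ℤ) → ℂ} : Memℓp c 1 ↔ Summable (fun k => ‖c k‖) := by
  rw [memℓp_gen_iff (by norm_num)]
  simp

/-- The element with given absolutely summable coefficients. -/
def mk (c : (Fin n → ℤ) → ℂ) (h : Summable (fun k => ‖c k‖)) : FourierAlg n :=
  (⟨c, memℓp_one_iff.2 h⟩ : lp (fun _ : Fin n → ℤ => ℂ) 1)

@[simp] theorem mk_apply (c : (Fin n → ℤ) → ℂ) (h : Summable (fun k => ‖c k‖)) (k : Fin n → ℤ) :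
    mk c h k = c k := rfl

/-- The element with given coefficients, or zero if they are not absolutely summable. -/
def ofFun (c : (Fin n → ℤ) → ℂ) : FourierAlg n :=
  open Classical in if h : Summable (fun k => ‖c k‖) then mk c h else 0

@[simp] theorem zero_apply (k : Fin n → ℤ) : (0 : FourierAlg n) k = 0 := rfl
@[simp] theorem add_apply (c d : FourierAlg n) (k : Fin n → ℤ) : (c + d) k = c k + d k := rfl
@[simp] theorem sub_apply (c d : FourierAlg n) (k : Fin n → ℤ) : (c - d) k = c k - d k := rfl
@[simp] theorem neg_apply (c : FourierAlg n) (k : Fin n → ℤ) : (-c) k = -c k := rfl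
@[simp] theorem smul_apply (a : ℂ) (c : FourierAlg n) (k : Fin n → ℤ) :
    (a • c) k = a * c k := rfl

theorem ext' {c d : FourierAlg n} (h : ∀ k, c k = d k) : c = d :=
  Subtype.ext (funext h)

theorem ofFun_apply {c : (Fin n → ℤ) → ℂ} (h : Summable (fun k => ‖c k‖)) (k : Fin n → ℤ) :
    ofFun c k = c k := by
  unfold ofFun
  rw [dif_pos h, mk_apply]

theorem wsum_ofFun_le (s : ℝ) (c : (Fin n → ℤ) → ℂ) : wsum s (ofFun c) ≤ wsum s c := by
  by_cases h : Summable (fun k => ‖c k‖)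
  · exact wsum_le_of_le fun k => by rw [ofFun_apply h]
  · refine wsum_le_of_le fun k => ?_
    simp [ofFun, h]

theorem summable_norm (c : FourierAlg n) : Summable (fun k => ‖c k‖) :=
  memℓp_one_iff.1 c.2

theorem norm_eq (c : FourierAlg n) : ‖c‖ = ∑' k, ‖c k‖ := by
  have := lp.norm_eq_tsum_rpow (p := 1) (by norm_num) (show lp (fun _ : Fin n → ℤ => ℂ) 1 from c)
  simp only [ENNReal.toReal_one, Real.rpow_one, div_one] at this
  exact this

theorem enorm_eq (c : FourierAlg n) : ‖c‖ₑ = wsum 0 c := by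
  rw [wsum_zero_eq, ← ofReal_norm, norm_eq,
    ENNReal.ofReal_tsum_of_nonneg (fun _ => norm_nonneg _) c.summable_norm]
  simp

theorem norm_apply_le (c : FourierAlg n) (k : Fin n → ℤ) : ‖c k‖ ≤ ‖c‖ := by
  rw [norm_eq]
  exact c.summable_norm.le_tsum k fun _ _ => norm_nonneg _

/-- The `k`-th coefficient, as a continuous linear functional. -/
def coeffCLM (k : Fin n → ℤ) : FourierAlg n →L[ℂ] ℂ :=
  LinearMap.mkContinuous ⟨⟨fun c => c k, fun _ _ => rfl⟩, fun _ _ => rfl⟩ 1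
    fun c => by rw [one_mul]; exact c.norm_apply_le k

@[simp] theorem coeffCLM_apply (k : Fin n → ℤ) (c : FourierAlg n) : coeffCLM k c = c k := rfl

/-! #### Convolution -/

/-- The map `(l, m) ↦ (l + m, l)`. -/
def convEquiv (n : ℕ) : (Fin n → ℤ) × (Fin n → ℤ) ≃ (Fin n → ℤ) × (Fin n → ℤ) where
  toFun p := (p.1 + p.2, p.1)
  invFun p := (p.2, p.1 - p.2)
  left_inv p := by simp
  right_inv p := by simp

theorem summable_conv_prod (c d : FourierAlg n) :
    Summable fun p : (Fin n → ℤ) × (Fin n → ℤ) => ‖c p.2 * d (p.1 - p.2)‖ := by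
  have h := c.summable_norm.mul_norm d.summable_norm
  rw [← (convEquiv n).symm.summable_iff] at h
  exact h

theorem summable_conv (c d : FourierAlg n) (k : Fin n → ℤ) :
    Summable fun l => ‖c l * d (k - l)‖ :=
  (summable_conv_prod c d).prod_factor k

/-- The weight is submultiplicative, by the triangle inequality for `k = l + (k - l)`. With values
in `[0, ∞]`, Tonelli applies without any summability hypothesis. -/
theorem wsum_conv_le {s : ℝ} (hs : 0 ≤ s) (c d : (Fin n → ℤ) → ℂ) :
    wsum s (fun k => ∑' l, c l * d (k - l)) ≤ wsum s c * wsum s d := by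
  calc wsum s (fun k => ∑' l, c l * d (k - l))
      ≤ ∑' k, ∑' l, (ENNReal.ofReal (Real.exp (s * ‖l‖)) * ‖c l‖ₑ) *
          (ENNReal.ofReal (Real.exp (s * ‖k - l‖)) * ‖d (k - l)‖ₑ) := by
        refine ENNReal.tsum_le_tsum fun k => ?_
        calc _ ≤ ENNReal.ofReal (Real.exp (s * ‖k‖)) * ∑' l, ‖c l * d (k - l)‖ₑ := by
              gcongr; exact enorm_tsum_le_tsum_enorm
          _ = ∑' l, ENNReal.ofReal (Real.exp (s * ‖k‖)) * ‖c l * d (k - l)‖ₑ :=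
              ENNReal.tsum_mul_left.symm
          _ ≤ _ := by
              refine ENNReal.tsum_le_tsum fun l => ?_
              have h1 : ENNReal.ofReal (Real.exp (s * ‖k‖)) ≤
                  ENNReal.ofReal (Real.exp (s * ‖l‖)) * ENNReal.ofReal (Real.exp (s * ‖k - l‖)) := by
                rw [← ENNReal.ofReal_mul (Real.exp_pos _).le, ← Real.exp_add, ← mul_add]
                gcongr
                simpa using norm_add_le l (k - l)
              calc _ ≤ (ENNReal.ofReal (Real.exp (s * ‖l‖)) *
                    ENNReal.ofReal (Real.exp (s * ‖k - l‖))) * (‖c l‖ₑ * ‖d (k - l)‖ₑ) := by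
                    rw [enorm_mul]; gcongr
                _ = _ := by ring
    _ = ∑' l, ∑' k, (ENNReal.ofReal (Real.exp (s * ‖l‖)) * ‖c l‖ₑ) *
          (ENNReal.ofReal (Real.exp (s * ‖k - l‖)) * ‖d (k - l)‖ₑ) := ENNReal.tsum_comm
    _ = ∑' l, (ENNReal.ofReal (Real.exp (s * ‖l‖)) * ‖c l‖ₑ) * wsum s d := by
        refine tsum_congr fun l => ?_
        rw [ENNReal.tsum_mul_left]
        congr 1
        exact (Equiv.subRight l).tsum_eq
          (fun k => ENNReal.ofReal (Real.exp (s * ‖k‖)) * ‖d k‖ₑ)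
    _ = wsum s c * wsum s d := ENNReal.tsum_mul_right

theorem wsum_zero_ne_top (c : FourierAlg n) : wsum 0 c ≠ ∞ :=
  summable_norm_iff_wsum.1 c.summable_norm

theorem summable_norm_conv (c d : FourierAlg n) :
    Summable fun k => ‖∑' l, c l * d (k - l)‖ :=
  summable_norm_iff_wsum.2 (ne_top_of_le_ne_top
    (ENNReal.mul_ne_top c.wsum_zero_ne_top d.wsum_zero_ne_top) (wsum_conv_le le_rfl _ _))

instance : Mul (FourierAlg n) :=
  ⟨fun c d => mk (fun k => ∑' l, c l * d (k - l)) (summable_norm_conv c d)⟩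

theorem mul_apply (c d : FourierAlg n) (k : Fin n → ℤ) :
    (c * d) k = ∑' l, c l * d (k - l) := rfl

instance : One (FourierAlg n) :=
  ⟨ofFun (Pi.single 0 1)⟩

theorem one_apply (k : Fin n → ℤ) : (1 : FourierAlg n) k = if k = 0 then 1 else 0 := by
  have h : Summable fun k : Fin n → ℤ => ‖(Pi.single 0 1 : (Fin n → ℤ) → ℂ) k‖ := by
    refine summable_of_ne_finset_zero (s := {0}) fun b hb => ?_
    simp at hb
    simp [hb]
  have := ofFun_apply h k
  refine this.trans ?_
  rw [Pi.single_apply]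

protected theorem mul_comm' (c d : FourierAlg n) : c * d = d * c := by
  refine ext' fun k => ?_
  rw [mul_apply, mul_apply, ← (Equiv.subLeft k).tsum_eq]
  simp [mul_comm]

protected theorem mul_add' (c d e : FourierAlg n) : c * (d + e) = c * d + c * e := by
  refine ext' fun k => ?_
  rw [add_apply, mul_apply, mul_apply, mul_apply,
    ← (summable_conv c d k).of_norm.tsum_add (summable_conv c e k).of_norm]
  simp [mul_add]

protected theorem one_mul' (c : FourierAlg n) : 1 * c = c := by
  refine ext' fun k => ?_
  rw [mul_apply, tsum_eq_single 0]
  · simp [one_apply]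
  · intro l hl
    simp [one_apply, hl]

protected theorem mul_assoc' (c d e : FourierAlg n) : c * d * e = c * (d * e) := by
  refine ext' fun k => ?_
  have hs : Summable fun p : (Fin n → ℤ) × (Fin n → ℤ) =>
      c p.2 * d (p.1 - p.2) * e (k - p.1) := by
    refine Summable.of_norm_bounded ((summable_conv_prod c d).mul_right ‖e‖) fun p => ?_
    rw [norm_mul]
    gcongr
    exact e.norm_apply_le _
  have h1 : ∀ l, (c * d) l * e (k - l) = ∑' m, c m * d (l - m) * e (k - l) := fun l => by
    rw [mul_apply, tsum_mul_right]
  have h2 : ∀ m, c m * (d * e) (k - m) = ∑' l, c m * d (l - m) * e (k - l) := fun m => by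
    rw [mul_apply, ← tsum_mul_left, ← (Equiv.subRight m).tsum_eq]
    refine tsum_congr fun j => ?_
    rw [Equiv.subRight_apply, sub_sub_sub_cancel_right, mul_assoc]
  rw [mul_apply, mul_apply, tsum_congr h1, tsum_congr h2]
  exact (Summable.tsum_comm (f := fun l m => c m * d (l - m) * e (k - l)) hs).symm

instance : NormedCommRing (FourierAlg n) where
  mul_assoc := FourierAlg.mul_assoc'
  mul_comm := FourierAlg.mul_comm'
  one_mul := FourierAlg.one_mul'
  mul_one c := by rw [FourierAlg.mul_comm', FourierAlg.one_mul']
  left_distrib := FourierAlg.mul_add'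
  right_distrib c d e := by
    rw [FourierAlg.mul_comm', FourierAlg.mul_add', FourierAlg.mul_comm' e, FourierAlg.mul_comm' e]
  zero_mul c := ext' fun k => by simp [mul_apply]
  mul_zero c := ext' fun k => by simp [mul_apply]
  dist_eq := dist_eq_norm_neg_add
  norm_mul_le c d := by
    have h : ‖c * d‖ₑ ≤ ‖c‖ₑ * ‖d‖ₑ := by
      rw [enorm_eq, enorm_eq, enorm_eq]
      exact wsum_conv_le le_rfl _ _
    rw [← ofReal_norm, ← ofReal_norm, ← ofReal_norm,
      ← ENNReal.ofReal_mul (norm_nonneg _)] at h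
    exact (ENNReal.ofReal_le_ofReal_iff (by positivity)).1 h

instance : Algebra ℂ (FourierAlg n) :=
  Algebra.ofModule
    (fun a c d => ext' fun k => by simp only [mul_apply, smul_apply, mul_assoc, tsum_mul_left])
    (fun a c d => ext' fun k => by
      simp only [mul_apply, smul_apply, mul_left_comm _ a, tsum_mul_left])

instance : NormedAlgebra ℂ (FourierAlg n) where
  norm_smul_le := norm_smul_le

instance : NormedAlgebra ℚ (FourierAlg n) := NormedAlgebra.restrictScalars ℚ ℂ (FourierAlg n)

end FourierAlg

/-! ### Weighted norms, families depending on the frequency, differentiation and evaluation -/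

namespace FourierAlg

variable {n : ℕ}

theorem one_def' : (1 : FourierAlg n) 0 = 1 := by simp [one_apply]

theorem wsum_add_le (s : ℝ) (c d : FourierAlg n) : wsum s (c + d) ≤ wsum s c + wsum s d := by
  unfold wsum
  rw [← ENNReal.tsum_add]
  refine ENNReal.tsum_le_tsum fun k => ?_
  rw [← mul_add]
  gcongr
  exact enorm_add_le _ _

theorem wsum_smul (s : ℝ) (a : ℂ) (c : FourierAlg n) : wsum s (a • c) = ‖a‖ₑ * wsum s c := by
  unfold wsum
  rw [← ENNReal.tsum_mul_left]
  refine tsum_congr fun k => ?_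
  rw [smul_apply, enorm_mul]
  ring

@[simp] theorem wsum_zero (s : ℝ) : wsum s (0 : FourierAlg n) = 0 := by
  simp [wsum]

theorem wsum_mul_le {s : ℝ} (hs : 0 ≤ s) (c d : FourierAlg n) :
    wsum s (c * d) ≤ wsum s c * wsum s d :=
  wsum_conv_le hs _ _

theorem wsum_one (s : ℝ) : wsum s (1 : FourierAlg n) = 1 := by
  unfold wsum
  rw [tsum_eq_single 0]
  · simp [one_apply]
  · intro k hk
    simp [one_apply, hk]

theorem tsum_apply {ι : Type*} {x : ι → FourierAlg n} (hx : Summable x) (k : Fin n → ℤ) :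
    (∑' i, x i) k = ∑' i, x i k :=
  (coeffCLM k).map_tsum hx

theorem wsum_tsum_le {ι : Type*} (s : ℝ) {x : ι → FourierAlg n} (hx : Summable x) :
    wsum s (∑' i, x i : FourierAlg n) ≤ ∑' i, wsum s (x i) := by
  unfold wsum
  rw [ENNReal.tsum_comm]
  refine ENNReal.tsum_le_tsum fun k => ?_
  rw [tsum_apply hx, ENNReal.tsum_mul_left]
  gcongr
  exact enorm_tsum_le_tsum_enorm

theorem enorm_coeff_le {s : ℝ} (hs : 0 ≤ s) (c : FourierAlg n) (k : Fin n → ℤ) :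
    ‖c k‖ₑ ≤ wsum s c := by
  refine le_trans ?_ (wsum_mono hs c)
  rw [wsum_zero_eq]
  exact ENNReal.le_tsum k

/-! #### Families depending on a frequency -/

/-- The supremum over `O` of the weighted norm, plus the Lipschitz constant on `O`. -/
def famNorm (s : ℝ) (O : Set (Fin n → ℝ)) (x : (Fin n → ℝ) → FourierAlg n) : ℝ≥0∞ :=
  (⨆ ω ∈ O, wsum s (x ω)) + ⨆ ω ∈ O, ⨆ ω' ∈ O, wsum s (x ω - x ω') / edist ω ω'

variable {s : ℝ} {O : Set (Fin n → ℝ)} {x y : (Fin n → ℝ) → FourierAlg n}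

theorem famNorm_le {A B : ℝ≥0∞} (h1 : ∀ ω ∈ O, wsum s (x ω) ≤ A)
    (h2 : ∀ ω ∈ O, ∀ ω' ∈ O, wsum s (x ω - x ω') / edist ω ω' ≤ B) : famNorm s O x ≤ A + B :=
  add_le_add (iSup₂_le h1) (iSup₂_le fun ω hω => iSup₂_le fun ω' hω' => h2 ω hω ω' hω')

theorem wsum_le_famNorm {ω : Fin n → ℝ} (hω : ω ∈ O) : wsum s (x ω) ≤ famNorm s O x :=
  (le_iSup₂ (f := fun ω (_ : ω ∈ O) => wsum s (x ω)) ω hω).trans le_self_add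

theorem lip_le_famNorm {ω ω' : Fin n → ℝ} (hω : ω ∈ O) (hω' : ω' ∈ O) :
    wsum s (x ω - x ω') / edist ω ω' ≤ famNorm s O x := by
  refine le_trans ?_ le_add_self
  exact (le_iSup₂ (f := fun ω' (_ : ω' ∈ O) => wsum s (x ω - x ω') / edist ω ω') ω' hω').trans
    (le_iSup₂ (f := fun ω (_ : ω ∈ O) => ⨆ ω' ∈ O, wsum s (x ω - x ω') / edist ω ω') ω hω)

theorem famNorm_mono {t : ℝ} (h : s ≤ t) {O' : Set (Fin n → ℝ)} (hO : O ⊆ O') :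
    famNorm s O x ≤ famNorm t O' x := by
  refine add_le_add (iSup₂_le fun ω hω => ?_)
    (iSup₂_le fun ω hω => iSup₂_le fun ω' hω' => ?_)
  · exact (wsum_mono h _).trans
      (le_iSup₂ (f := fun ω (_ : ω ∈ O') => wsum t (x ω)) ω (hO hω))
  · refine (ENNReal.div_le_div_right (wsum_mono h _) _).trans ?_
    exact (le_iSup₂ (f := fun ω' (_ : ω' ∈ O') => wsum t (x ω - x ω') / edist ω ω') ω' (hO hω')).trans
      (le_iSup₂ (f := fun ω (_ : ω ∈ O') => ⨆ ω' ∈ O', wsum t (x ω - x ω') / edist ω ω') ω (hO hω))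

theorem famNorm_congr (h : ∀ ω ∈ O, x ω = y ω) : famNorm s O x = famNorm s O y := by
  have h1 : ∀ {x y : (Fin n → ℝ) → FourierAlg n}, (∀ ω ∈ O, x ω = y ω) →
      famNorm s O x ≤ famNorm s O y := by
    intro x y h
    refine add_le_add (iSup₂_mono fun ω hω => ?_)
      (iSup₂_mono fun ω hω => iSup₂_mono fun ω' hω' => ?_)
    · rw [h ω hω]
    · rw [h ω hω, h ω' hω']
  exact le_antisymm (h1 h) (h1 fun ω hω => (h ω hω).symm)

theorem famNorm_const_le (s : ℝ) (O : Set (Fin n → ℝ)) (c : FourierAlg n) :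
    famNorm s O (fun _ => c) ≤ wsum s c := by
  refine (famNorm_le (fun _ _ => le_rfl) (B := 0) fun _ _ _ _ => ?_).trans_eq (add_zero _)
  simp

theorem famNorm_add_le : famNorm s O (fun ω => x ω + y ω) ≤ famNorm s O x + famNorm s O y := by
  unfold famNorm
  rw [add_add_add_comm]
  refine add_le_add (iSup₂_le fun ω hω => (wsum_add_le _ _ _).trans (add_le_add ?_ ?_))
    (iSup₂_le fun ω hω => iSup₂_le fun ω' hω' => ?_)
  · exact le_iSup₂ (f := fun ω (_ : ω ∈ O) => wsum s (x ω)) ω hω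
  · exact le_iSup₂ (f := fun ω (_ : ω ∈ O) => wsum s (y ω)) ω hω
  · rw [add_sub_add_comm]
    refine (ENNReal.div_le_div_right (wsum_add_le _ _ _) _).trans ?_
    rw [ENNReal.add_div]
    have h : ∀ x : (Fin n → ℝ) → FourierAlg n, wsum s (x ω - x ω') / edist ω ω' ≤
        ⨆ ω ∈ O, ⨆ ω' ∈ O, wsum s (x ω - x ω') / edist ω ω' := fun x =>
      (le_iSup₂ (f := fun ω' (_ : ω' ∈ O) => wsum s (x ω - x ω') / edist ω ω') ω' hω').trans
      (le_iSup₂ (f := fun ω (_ : ω ∈ O) => ⨆ ω' ∈ O, wsum s (x ω - x ω') / edist ω ω') ω hω)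
    exact add_le_add (h x) (h y)

/-- Discrete Leibniz rule: the product of the two norms contains the terms sup·sup, sup·Lip and
Lip·sup that are needed, and the surplus Lip·Lip is nonnegative. -/
theorem famNorm_mul_le (hs : 0 ≤ s) :
    famNorm s O (fun ω => x ω * y ω) ≤ famNorm s O x * famNorm s O y := by
  set sx := ⨆ ω ∈ O, wsum s (x ω) with hsx
  set sy := ⨆ ω ∈ O, wsum s (y ω) with hsy
  set lx := ⨆ ω ∈ O, ⨆ ω' ∈ O, wsum s (x ω - x ω') / edist ω ω' with hlx
  set ly := ⨆ ω ∈ O, ⨆ ω' ∈ O, wsum s (y ω - y ω') / edist ω ω' with hly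
  have bx : ∀ ω ∈ O, wsum s (x ω) ≤ sx := fun ω hω =>
    le_iSup₂ (f := fun ω (_ : ω ∈ O) => wsum s (x ω)) ω hω
  have bY : ∀ ω ∈ O, wsum s (y ω) ≤ sy := fun ω hω =>
    le_iSup₂ (f := fun ω (_ : ω ∈ O) => wsum s (y ω)) ω hω
  have h : ∀ x : (Fin n → ℝ) → FourierAlg n, ∀ ω ∈ O, ∀ ω' ∈ O,
      wsum s (x ω - x ω') / edist ω ω' ≤
        ⨆ ω ∈ O, ⨆ ω' ∈ O, wsum s (x ω - x ω') / edist ω ω' := fun x ω hω ω' hω' =>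
    (le_iSup₂ (f := fun ω' (_ : ω' ∈ O) => wsum s (x ω - x ω') / edist ω ω') ω' hω').trans
    (le_iSup₂ (f := fun ω (_ : ω ∈ O) => ⨆ ω' ∈ O, wsum s (x ω - x ω') / edist ω ω') ω hω)
  have h1 : famNorm s O (fun ω => x ω * y ω) ≤ sx * sy + (sx * ly + lx * sy) := by
    refine famNorm_le (fun ω hω => (wsum_mul_le hs _ _).trans ?_) fun ω hω ω' hω' => ?_
    · gcongr
      exacts [bx ω hω, bY ω hω]
    · rw [show x ω * y ω - x ω' * y ω' = x ω * (y ω - y ω') + (x ω - x ω') * y ω' by ring]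
      refine (ENNReal.div_le_div_right ((wsum_add_le _ _ _).trans
        (add_le_add (wsum_mul_le hs _ _) (wsum_mul_le hs _ _))) _).trans ?_
      rw [ENNReal.add_div, mul_div_assoc, ENNReal.mul_div_right_comm]
      gcongr
      exacts [bx ω hω, h y ω hω ω' hω', h x ω hω ω' hω', bY ω' hω']
  calc _ ≤ sx * sy + (sx * ly + lx * sy) := h1
    _ ≤ sx * sy + (sx * ly + lx * sy) + lx * ly := le_self_add
    _ = (sx + lx) * (sy + ly) := by ring
    _ = famNorm s O x * famNorm s O y := rfl

theorem famNorm_smul_le (a : ℂ) : famNorm s O (fun ω => a • x ω) ≤ ‖a‖ₑ * famNorm s O x := by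
  unfold famNorm
  rw [mul_add]
  refine add_le_add (iSup₂_le fun ω hω => ?_) (iSup₂_le fun ω hω => iSup₂_le fun ω' hω' => ?_)
  · rw [wsum_smul]
    gcongr
    exact le_iSup₂ (f := fun ω (_ : ω ∈ O) => wsum s (x ω)) ω hω
  · rw [← smul_sub, wsum_smul, mul_div_assoc]
    gcongr
    exact (le_iSup₂ (f := fun ω' (_ : ω' ∈ O) => wsum s (x ω - x ω') / edist ω ω') ω' hω').trans
      (le_iSup₂ (f := fun ω (_ : ω ∈ O) => ⨆ ω' ∈ O, wsum s (x ω - x ω') / edist ω ω') ω hω)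

theorem famNorm_neg_le : famNorm s O (fun ω => -x ω) ≤ famNorm s O x := by
  simpa using famNorm_smul_le (s := s) (O := O) (x := x) (-1)

theorem famNorm_pow_le (hs : 0 ≤ s) (m : ℕ) :
    famNorm s O (fun ω => x ω ^ m) ≤ famNorm s O x ^ m := by
  induction m with
  | zero =>
    simp only [pow_zero]
    exact (famNorm_const_le s O 1).trans_eq (wsum_one s)
  | succ m ih =>
    simp only [pow_succ]
    exact (famNorm_mul_le hs (x := fun ω => x ω ^ m)).trans (by gcongr)

theorem famNorm_tsum_le {ι : Type*} {z : ι → (Fin n → ℝ) → FourierAlg n}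
    (hz : ∀ ω ∈ O, Summable fun i => z i ω) :
    famNorm s O (fun ω => ∑' i, z i ω) ≤ ∑' i, famNorm s O (z i) := by
  unfold famNorm
  rw [ENNReal.tsum_add]
  refine add_le_add (iSup₂_le fun ω hω => (wsum_tsum_le s (hz ω hω)).trans
    (ENNReal.tsum_le_tsum fun i => ?_))
    (iSup₂_le fun ω hω => iSup₂_le fun ω' hω' => ?_)
  · exact le_iSup₂ (f := fun ω (_ : ω ∈ O) => wsum s (z i ω)) ω hω
  · rw [← (hz ω hω).tsum_sub (hz ω' hω')]
    refine (ENNReal.div_le_div_right (wsum_tsum_le s ((hz ω hω).sub (hz ω' hω'))) _).trans ?_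
    rw [div_eq_mul_inv, ← ENNReal.tsum_mul_right]
    refine ENNReal.tsum_le_tsum fun i => ?_
    rw [← div_eq_mul_inv]
    exact (le_iSup₂ (f := fun ω' (_ : ω' ∈ O) => wsum s (z i ω - z i ω') / edist ω ω') ω' hω').trans
      (le_iSup₂ (f := fun ω (_ : ω ∈ O) => ⨆ ω' ∈ O, wsum s (z i ω - z i ω') / edist ω ω') ω hω)

/-- The norm is submultiplicative, so the power series can be estimated term by term. -/
theorem famNorm_exp_le (hs : 0 ≤ s) {M : ℝ} (hM : 0 ≤ M) (hx : famNorm s O x ≤ ENNReal.ofReal M) :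
    famNorm s O (fun ω => NormedSpace.exp (x ω)) ≤ ENNReal.ofReal (Real.exp M) := by
  have h := fun ω => NormedSpace.exp_series_hasSum_exp' (𝕂 := ℂ) (x ω)
  have h1 : (fun ω => NormedSpace.exp (x ω)) = fun ω => ∑' m : ℕ, (m !⁻¹ : ℂ) • x ω ^ m :=
    funext fun ω => (h ω).tsum_eq.symm
  rw [h1]
  refine (famNorm_tsum_le fun ω _ => (h ω).summable).trans ?_
  have h2 := NormedSpace.expSeries_div_hasSum_exp M
  rw [← Real.exp_eq_exp_ℝ] at h2
  rw [← h2.tsum_eq, ENNReal.ofReal_tsum_of_nonneg (fun m => by positivity) h2.summable]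
  refine ENNReal.tsum_le_tsum fun m => ?_
  refine (famNorm_smul_le (x := fun ω => x ω ^ m) _).trans ?_
  rw [div_eq_inv_mul, ENNReal.ofReal_mul (by positivity), ENNReal.ofReal_pow hM]
  gcongr
  · rw [← ofReal_norm]
    simp
  · exact (famNorm_pow_le hs m).trans (by gcongr)

/-! #### Differentiation along a frequency vector -/

/-- `y` is the derivative of `x` in the direction `ω`. -/
def IsDeriv (ω : Fin n → ℝ) (x y : FourierAlg n) : Prop :=
  ∀ k, Complex.I * (kdot k ω : ℂ) * x k = y k

theorem kdot_sub (k l : Fin n → ℤ) (θ : Fin n → ℝ) : kdot (k - l) θ = kdot k θ - kdot l θ := by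
  simp [kdot, sub_mul, Finset.sum_sub_distrib]

theorem kdot_zero (θ : Fin n → ℝ) : kdot (0 : Fin n → ℤ) θ = 0 := by
  simp [kdot]

theorem kdot_smul (k : Fin n → ℤ) (t : ℝ) (θ : Fin n → ℝ) : kdot k (t • θ) = t * kdot k θ := by
  simp [kdot, Finset.mul_sum, mul_left_comm]

theorem kdot_sub_right (k : Fin n → ℤ) (θ θ' : Fin n → ℝ) :
    kdot k (θ - θ') = kdot k θ - kdot k θ' := by
  simp [kdot, mul_sub, Finset.sum_sub_distrib]

theorem abs_kdot_le (k : Fin n → ℤ) (θ : Fin n → ℝ) : |kdot k θ| ≤ n * ‖k‖ * ‖θ‖ := by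
  unfold kdot
  refine (Finset.abs_sum_le_sum_abs _ _).trans ?_
  calc ∑ i, |(k i : ℝ) * θ i| ≤ ∑ _i : Fin n, ‖k‖ * ‖θ‖ := by
        refine Finset.sum_le_sum fun i _ => ?_
        rw [abs_mul]
        gcongr
        · rw [← Int.norm_eq_abs]; exact norm_le_pi_norm k i
        · exact norm_le_pi_norm θ i
    _ = n * ‖k‖ * ‖θ‖ := by simp [mul_assoc]

namespace IsDeriv

variable {ω : Fin n → ℝ} {x x' y y' : FourierAlg n}

theorem add (hx : IsDeriv ω x x') (hy : IsDeriv ω y y') : IsDeriv ω (x + y) (x' + y') :=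
  fun k => by rw [add_apply, add_apply, mul_add, hx k, hy k]

theorem neg (hx : IsDeriv ω x x') : IsDeriv ω (-x) (-x') :=
  fun k => by rw [neg_apply, neg_apply, mul_neg, hx k]

theorem smul (a : ℂ) (hx : IsDeriv ω x x') : IsDeriv ω (a • x) (a • x') :=
  fun k => by rw [smul_apply, smul_apply, mul_left_comm, hx k]

theorem one : IsDeriv ω (1 : FourierAlg n) 0 := fun k => by
  rw [one_apply, zero_apply]
  split_ifs with h
  · simp [h, kdot_zero]
  · simp

theorem mul (hx : IsDeriv ω x x') (hy : IsDeriv ω y y') :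
    IsDeriv ω (x * y) (x' * y + x * y') := fun k => by
  rw [add_apply, mul_apply, mul_apply, mul_apply, ← tsum_mul_left,
    ← (summable_conv x' y k).of_norm.tsum_add (summable_conv x y' k).of_norm]
  refine tsum_congr fun l => ?_
  rw [← hx l, ← hy (k - l), kdot_sub]
  push_cast
  ring

theorem pow_succ (hx : IsDeriv ω x x') (m : ℕ) :
    IsDeriv ω (x ^ (m + 1)) ((m + 1 : ℂ) • (x ^ m * x')) := by
  induction m with
  | zero => simpa using hx
  | succ m ih =>
    have := ih.mul hx
    rw [_root_.pow_succ]
    convert this using 1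
    simp only [Algebra.smul_def, map_add, map_natCast, map_one, Nat.cast_add, Nat.cast_one]
    ring

theorem hasSum {ι : Type*} {z z' : ι → FourierAlg n} {a a' : FourierAlg n}
    (h : ∀ i, IsDeriv ω (z i) (z' i)) (ha : HasSum z a) (ha' : HasSum z' a') : IsDeriv ω a a' :=
  fun k => by
    have h1 := ((coeffCLM k).hasSum ha).mul_left (Complex.I * (kdot k ω : ℂ))
    have h2 := (coeffCLM k).hasSum ha'
    simp only [coeffCLM_apply] at h1 h2
    simp only [h _ k] at h1
    exact h1.unique h2

/-- Differentiation along `ω` is unbounded on the algebra, but its graph is closed: the relation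
only involves one continuous coefficient at a time. -/
theorem of_tendsto {z z' : ℕ → FourierAlg n} {a a' : FourierAlg n}
    (h : ∀ i, IsDeriv ω (z i) (z' i)) (ha : Tendsto z atTop (𝓝 a))
    (ha' : Tendsto z' atTop (𝓝 a')) : IsDeriv ω a a' := fun k => by
  have h1 := (((coeffCLM k).continuous.tendsto a).comp ha).const_mul
    (Complex.I * (kdot k ω : ℂ))
  have h2 := ((coeffCLM k).continuous.tendsto a').comp ha'
  refine tendsto_nhds_unique h1 (h2.congr fun i => ?_)
  exact (h i k).symm

/-- The algebra is commutative, so the derivative of `x ^ (m + 1) / (m + 1)!` is `x' * x ^ m / m!`.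
The constant term is split off and restored at the end. -/
theorem exp (hx : IsDeriv ω x x') : IsDeriv ω (NormedSpace.exp x) (x' * NormedSpace.exp x) := by
  have h := NormedSpace.exp_series_hasSum_exp' (𝕂 := ℂ) x
  have h1 := (hasSum_nat_add_iff' 1).2 h
  have h2 := h.mul_left x'
  have h3 : IsDeriv ω (NormedSpace.exp x - ∑ i ∈ Finset.range 1, (i !⁻¹ : ℂ) • x ^ i)
      (x' * NormedSpace.exp x) := by
    refine hasSum (fun m => ?_) h1 h2
    have h4 := (hx.pow_succ m).smul ((m + 1)!⁻¹ : ℂ)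
    convert h4 using 1
    rw [mul_smul_comm, smul_smul, mul_comm x']
    congr 1
    rw [Nat.factorial_succ]
    push_cast
    have : (m + 1 : ℂ) ≠ 0 := by exact_mod_cast Nat.succ_ne_zero m
    rw [mul_inv, mul_assoc, mul_comm _ (m + 1 : ℂ), ← mul_assoc, inv_mul_cancel₀ this, one_mul]
  have h5 := h3.add one
  simpa using h5

end IsDeriv

/-! #### Evaluation -/

/-- The value at `θ` of the sum of the Fourier series. -/
def eval (θ : Fin n → ℝ) (c : FourierAlg n) : ℂ :=
  ∑' k, c k * Complex.exp (Complex.I * (kdot k θ : ℂ))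

theorem norm_cexp_I_mul (r : ℝ) : ‖Complex.exp (Complex.I * (r : ℂ))‖ = 1 := by
  rw [mul_comm]; exact Complex.norm_exp_ofReal_mul_I r

theorem summable_norm_eval (θ : Fin n → ℝ) (c : FourierAlg n) :
    Summable fun k => ‖c k * Complex.exp (Complex.I * (kdot k θ : ℂ))‖ := by
  simpa [norm_cexp_I_mul] using c.summable_norm

theorem norm_eval_le (θ : Fin n → ℝ) (c : FourierAlg n) : ‖eval θ c‖ ≤ ‖c‖ := by
  rw [norm_eq]
  refine (norm_tsum_le_tsum_norm (summable_norm_eval θ c)).trans_eq (tsum_congr fun k => ?_)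
  rw [norm_mul, norm_cexp_I_mul, mul_one]

theorem eval_mul (θ : Fin n → ℝ) (c d : FourierAlg n) :
    eval θ (c * d) = eval θ c * eval θ d := by
  unfold eval
  rw [tsum_mul_tsum_of_summable_norm (summable_norm_eval θ c) (summable_norm_eval θ d),
    ← (convEquiv n).symm.tsum_eq, Summable.tsum_prod]
  · refine tsum_congr fun k => ?_
    rw [mul_apply, ← tsum_mul_right]
    refine tsum_congr fun l => ?_
    show _ = c l * _ * (d (k - l) * _)
    rw [mul_mul_mul_comm, ← Complex.exp_add, ← mul_add]
    congr 3
    simp only [convEquiv, Equiv.coe_fn_symm_mk, kdot_sub]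
    push_cast
    ring
  · exact ((convEquiv n).symm.summable_iff.2 ((summable_norm_eval θ c).mul_norm
      (summable_norm_eval θ d)).of_norm)

/-- Evaluation, as a homomorphism. -/
def evalHom (θ : Fin n → ℝ) : FourierAlg n →ₐ[ℂ] ℂ :=
  AlgHom.ofLinearMap
    { toFun := eval θ
      map_add' := fun c d => by
        unfold eval
        rw [← (summable_norm_eval θ c).of_norm.tsum_add (summable_norm_eval θ d).of_norm]
        simp [add_mul]
      map_smul' := fun a c => by
        unfold eval
        simp [mul_assoc, tsum_mul_left] }
    (by
      show eval θ 1 = 1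
      unfold eval
      rw [tsum_eq_single 0]
      · simp [one_apply, kdot_zero]
      · intro k hk
        simp [one_apply, hk])
    (eval_mul θ)

theorem evalHom_apply (θ : Fin n → ℝ) (c : FourierAlg n) : evalHom θ c = eval θ c := rfl

theorem norm_evalHom_le (θ : Fin n → ℝ) (c : FourierAlg n) : ‖evalHom θ c‖ ≤ ‖c‖ :=
  norm_eval_le θ c

theorem continuous_evalHom (θ : Fin n → ℝ) : Continuous (evalHom θ : FourierAlg n → ℂ) :=
  (LinearMap.mkContinuous (evalHom θ).toLinearMap 1
    fun c => by rw [one_mul]; exact norm_eval_le θ c).continuous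

theorem evalHom_exp (θ : Fin n → ℝ) (c : FourierAlg n) :
    evalHom θ (NormedSpace.exp c) = Complex.exp (evalHom θ c) := by
  rw [Complex.exp_eq_exp_ℂ]
  exact NormedSpace.map_exp (evalHom θ) (continuous_evalHom θ) c

/-- The differentiated series is dominated by the absolutely summable coefficients of `y`. This
turns identities in the algebra into differential equations along the orbit `t • ω`. -/
theorem IsDeriv.hasDerivAt {ω : Fin n → ℝ} {x y : FourierAlg n} (h : IsDeriv ω x y) (t : ℝ) :
    HasDerivAt (fun t : ℝ => evalHom (t • ω) x) (evalHom (t • ω) y) t := by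
  have h1 : ∀ (k : Fin n → ℤ) (t : ℝ), HasDerivAt
      (fun t : ℝ => x k * Complex.exp (Complex.I * (kdot k (t • ω) : ℂ)))
      (y k * Complex.exp (Complex.I * (kdot k (t • ω) : ℂ))) t := by
    intro k t
    have h2 : HasDerivAt (fun t : ℝ => Complex.I * (kdot k (t • ω) : ℂ))
        (Complex.I * (kdot k ω : ℂ)) t := by
      simp only [kdot_smul]
      push_cast
      have := ((hasDerivAt_id t).ofReal_comp.mul_const (kdot k ω : ℂ)).const_mul Complex.I
      simpa using this
    have h3 := (h2.cexp).const_mul (x k)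
    refine h3.congr_deriv ?_
    rw [← h k]
    ring
  exact hasDerivAt_tsum (u := fun k => ‖y k‖) y.summable_norm h1
    (fun k t => by rw [norm_mul, norm_cexp_I_mul, mul_one])
    (summable_norm_eval (0 • ω) x).of_norm t

end FourierAlg

namespace FourierAlg

variable {n : ℕ} {s : ℝ} {O : Set (Fin n → ℝ)} {x y : (Fin n → ℝ) → FourierAlg n} {a b : ℝ}

/-! #### Real bounds for families -/

/-- The family `x` is bounded by the nonnegative number `a` in the norm `famNorm s O`. -/
def FBound (s : ℝ) (O : Set (Fin n → ℝ)) (x : (Fin n → ℝ) → FourierAlg n) (a : ℝ) : Prop :=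
  0 ≤ a ∧ famNorm s O x ≤ ENNReal.ofReal a

namespace FBound

theorem mono (h : FBound s O x a) {t : ℝ} (hst : t ≤ s) {O' : Set (Fin n → ℝ)} (hO : O' ⊆ O)
    (hab : a ≤ b) : FBound t O' x b :=
  ⟨h.1.trans hab, (famNorm_mono hst hO).trans (h.2.trans (ENNReal.ofReal_le_ofReal hab))⟩

theorem le (h : FBound s O x a) (hab : a ≤ b) : FBound s O x b := h.mono le_rfl subset_rfl hab

theorem congr (h : FBound s O x a) (hxy : ∀ ω ∈ O, x ω = y ω) : FBound s O y a :=
  ⟨h.1, (famNorm_congr hxy).symm.trans_le h.2⟩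

theorem add (hx : FBound s O x a) (hy : FBound s O y b) :
    FBound s O (fun ω => x ω + y ω) (a + b) :=
  ⟨add_nonneg hx.1 hy.1, famNorm_add_le.trans
    ((add_le_add hx.2 hy.2).trans_eq (ENNReal.ofReal_add hx.1 hy.1).symm)⟩

theorem neg (hx : FBound s O x a) : FBound s O (fun ω => -x ω) a :=
  ⟨hx.1, famNorm_neg_le.trans hx.2⟩

theorem sub (hx : FBound s O x a) (hy : FBound s O y b) :
    FBound s O (fun ω => x ω - y ω) (a + b) := by
  simpa only [sub_eq_add_neg] using hx.add hy.neg

theorem smul (c : ℂ) (hx : FBound s O x a) : FBound s O (fun ω => c • x ω) (‖c‖ * a) := by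
  refine ⟨mul_nonneg (norm_nonneg _) hx.1, (famNorm_smul_le c).trans ?_⟩
  rw [ENNReal.ofReal_mul (norm_nonneg _), ofReal_norm]
  gcongr
  exact hx.2

theorem mul (hs : 0 ≤ s) (hx : FBound s O x a) (hy : FBound s O y b) :
    FBound s O (fun ω => x ω * y ω) (a * b) := by
  refine ⟨mul_nonneg hx.1 hy.1, (famNorm_mul_le hs).trans ?_⟩
  rw [ENNReal.ofReal_mul hx.1]
  exact mul_le_mul' hx.2 hy.2

theorem exp (hs : 0 ≤ s) (hx : FBound s O x a) :
    FBound s O (fun ω => NormedSpace.exp (x ω)) (Real.exp a) :=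
  ⟨(Real.exp_pos _).le, famNorm_exp_le hs hx.1 hx.2⟩

theorem const {c : FourierAlg n} (h : wsum s c ≤ ENNReal.ofReal a) (ha : 0 ≤ a) :
    FBound s O (fun _ => c) a :=
  ⟨ha, (famNorm_const_le s O c).trans h⟩

theorem one : FBound s O (fun _ => 1) 1 :=
  const (by rw [wsum_one, ENNReal.ofReal_one]) zero_le_one

theorem tsum {z : ℕ → (Fin n → ℝ) → FourierAlg n} {a : ℕ → ℝ} (h : ∀ i, FBound s O (z i) (a i))
    (hz : ∀ ω ∈ O, Summable fun i => z i ω) (ha : Summable a) :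
    FBound s O (fun ω => ∑' i, z i ω) (∑' i, a i) := by
  refine ⟨tsum_nonneg fun i => (h i).1, (famNorm_tsum_le hz).trans ?_⟩
  rw [ENNReal.ofReal_tsum_of_nonneg (fun i => (h i).1) ha]
  exact ENNReal.tsum_le_tsum fun i => (h i).2

theorem wsum_le (h : FBound s O x a) {ω : Fin n → ℝ} (hω : ω ∈ O) :
    wsum s (x ω) ≤ ENNReal.ofReal a := (wsum_le_famNorm hω).trans h.2

theorem wsum_ne_top (h : FBound s O x a) {ω : Fin n → ℝ} (hω : ω ∈ O) :
    wsum s (x ω) ≠ ∞ := ne_top_of_le_ne_top ENNReal.ofReal_ne_top (h.wsum_le hω)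

theorem norm_le (hs : 0 ≤ s) (h : FBound s O x a) {ω : Fin n → ℝ} (hω : ω ∈ O) : ‖x ω‖ ≤ a := by
  have h1 : ‖x ω‖ₑ ≤ ENNReal.ofReal a := by
    rw [enorm_eq]; exact (wsum_mono hs _).trans (h.wsum_le hω)
  rw [← ofReal_norm] at h1
  exact (ENNReal.ofReal_le_ofReal_iff h.1).1 h1

theorem coeff_le (hs : 0 ≤ s) (h : FBound s O x a) {ω : Fin n → ℝ} (hω : ω ∈ O)
    (k : Fin n → ℤ) : ‖x ω k‖ ≤ a :=
  (norm_apply_le _ k).trans (h.norm_le hs hω)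

/-- For `k = 0` this makes the mean of a family Lipschitz in the frequency, as needed both for the
divisors containing that mean and for the measure of the resonant sets. -/
theorem coeff_lip (hs : 0 ≤ s) (h : FBound s O x a) {ω ω' : Fin n → ℝ} (hω : ω ∈ O)
    (hω' : ω' ∈ O) (k : Fin n → ℤ) : ‖x ω k - x ω' k‖ ≤ a * dist ω ω' := by
  -- On the diagonal the difference quotient is `0 / 0` and carries no information.
  rcases eq_or_ne ω ω' with rfl | hne
  · simp
  have h1 := (lip_le_famNorm (s := s) (x := x) hω hω').trans h.2
  have h2 : edist ω ω' ≠ 0 := by simpa using hne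
  rw [ENNReal.div_le_iff h2 (edist_ne_top _ _)] at h1
  have h3 := (enorm_coeff_le hs (x ω - x ω') k).trans h1
  rw [edist_dist, ← ENNReal.ofReal_mul h.1, ← ofReal_norm] at h3
  exact (ENNReal.ofReal_le_ofReal_iff (mul_nonneg h.1 dist_nonneg)).1 h3

theorem singleton {ω : Fin n → ℝ} (h : FBound s O x a) (hω : ω ∈ O) : FBound s {ω} x a :=
  h.mono le_rfl (Set.singleton_subset_iff.2 hω) le_rfl

end FBound

/-! #### Multipliers and resolvents -/

theorem summable_mul_of_le {r : (Fin n → ℤ) → ℂ} {l δ : ℝ} (hl : 0 ≤ l)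
    (hr : ∀ k, ‖r k‖ ≤ l * Real.exp (δ * ‖k‖)) {c : FourierAlg n} (hc : wsum δ c ≠ ∞) :
    Summable fun k => ‖r k * c k‖ := by
  rw [summable_norm_iff_wsum]
  refine ne_top_of_le_ne_top (ENNReal.mul_ne_top (ENNReal.ofReal_ne_top (r := l)) hc) ?_
  unfold wsum
  rw [← ENNReal.tsum_mul_left]
  refine ENNReal.tsum_le_tsum fun k => ?_
  rw [zero_mul, Real.exp_zero, ENNReal.ofReal_one, one_mul, enorm_mul, ← mul_assoc,
    ← ENNReal.ofReal_mul hl]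
  gcongr
  rw [← ofReal_norm]
  exact ENNReal.ofReal_le_ofReal (hr k)

theorem wsum_mul_le_of_le {r : (Fin n → ℤ) → ℂ} {l δ s : ℝ} (hl : 0 ≤ l)
    (hr : ∀ k, ‖r k‖ ≤ l * Real.exp (δ * ‖k‖)) (c : (Fin n → ℤ) → ℂ) :
    wsum s (fun k => r k * c k) ≤ ENNReal.ofReal l * wsum (s + δ) c := by
  unfold wsum
  rw [← ENNReal.tsum_mul_left]
  refine ENNReal.tsum_le_tsum fun k => ?_
  rw [enorm_mul, ← mul_assoc, ← mul_assoc, ← ENNReal.ofReal_mul hl, add_mul, Real.exp_add,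
    mul_left_comm, ENNReal.ofReal_mul (Real.exp_pos _).le]
  gcongr
  rw [← ofReal_norm]
  exact ENNReal.ofReal_le_ofReal (hr k)

/-- The solution operator of `y' + μ y = c` along the frequency `ω`; coefficients with vanishing
divisor are set to zero. -/
def resolvent (ω : Fin n → ℝ) (μ : ℂ) (c : FourierAlg n) : FourierAlg n :=
  ofFun fun k => (Complex.I * (kdot k ω : ℂ) + μ)⁻¹ * c k

/-- Bounds for the small divisors of `resolvent` and for their dependence on the frequency. -/
def ResBound (O : Set (Fin n → ℝ)) (μ : (Fin n → ℝ) → ℂ) (l δ : ℝ) : Prop :=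
  0 < l ∧ (∀ ω ∈ O, ∀ k : Fin n → ℤ,
    ‖(Complex.I * (kdot k ω : ℂ) + μ ω)⁻¹‖ ≤ l * Real.exp (δ * ‖k‖)) ∧
  (∀ ω ∈ O, ∀ ω' ∈ O, ∀ k : Fin n → ℤ,
    ‖(Complex.I * (kdot k ω : ℂ) + μ ω)⁻¹ - (Complex.I * (kdot k ω' : ℂ) + μ ω')⁻¹‖ ≤
      l * dist ω ω' * Real.exp (δ * ‖k‖))

variable {μ : (Fin n → ℝ) → ℂ} {l δ : ℝ}

/-- At a single frequency the Lipschitz requirement is void; identities at fixed `ω` then need only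
a lower bound for the divisors. -/
theorem ResBound.singleton {ω : Fin n → ℝ} (hl : 0 < l) (h : ∀ k : Fin n → ℤ,
    ‖(Complex.I * (kdot k ω : ℂ) + μ ω)⁻¹‖ ≤ l * Real.exp (δ * ‖k‖)) : ResBound {ω} μ l δ := by
  refine ⟨hl, fun ω' h' k => ?_, fun ω₁ h₁ ω₂ h₂ k => ?_⟩
  · rw [Set.mem_singleton_iff.1 h']; exact h k
  · rw [Set.mem_singleton_iff.1 h₁, Set.mem_singleton_iff.1 h₂]; simp

theorem ResBound.mono (h : ResBound O μ l δ) {O' : Set (Fin n → ℝ)} (hO : O' ⊆ O) :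
    ResBound O' μ l δ :=
  ⟨h.1, fun ω hω => h.2.1 ω (hO hω), fun ω hω ω' hω' => h.2.2 ω (hO hω) ω' (hO hω')⟩

theorem resolvent_apply (h : ResBound O μ l δ) {ω : Fin n → ℝ} (hω : ω ∈ O) {c : FourierAlg n}
    (hc : wsum δ c ≠ ∞) (k : Fin n → ℤ) :
    resolvent ω (μ ω) c k = (Complex.I * (kdot k ω : ℂ) + μ ω)⁻¹ * c k :=
  ofFun_apply (summable_mul_of_le h.1.le (h.2.1 ω hω) hc) k

/-- The inverse divisors grow at most like `exp(δ|k|)`, which costs the width `δ`. The factor 2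
arises because the supremum enters twice: once as itself, and once in the Lipschitz constant,
through the variation of the divisors. -/
theorem FBound.resolvent (hs : 0 ≤ s) (hR : ResBound O μ l δ) (hx : FBound (s + δ) O x a) :
    FBound s O (fun ω => resolvent ω (μ ω) (x ω)) (2 * l * a) := by
  have hl := hR.1
  refine ⟨by have := hx.1; positivity, ?_⟩
  have hc : ∀ ω ∈ O, wsum δ (x ω) ≠ ∞ := fun ω hω =>
    ne_top_of_le_ne_top (hx.wsum_ne_top hω) (wsum_mono (by linarith) _)
  have key : famNorm s O (fun ω => FourierAlg.resolvent ω (μ ω) (x ω)) ≤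
      ENNReal.ofReal l * ENNReal.ofReal a +
        (ENNReal.ofReal l * ((⨆ ω ∈ O, ⨆ ω' ∈ O, wsum (s + δ) (x ω - x ω') / edist ω ω')
          + ⨆ ω ∈ O, wsum (s + δ) (x ω))) := by
    refine famNorm_le (fun ω hω => ?_) fun ω hω ω' hω' => ?_
    · refine (wsum_ofFun_le _ _).trans ((wsum_mul_le_of_le hl.le (hR.2.1 ω hω) _).trans ?_)
      gcongr
      exact hx.wsum_le hω
    · set r : (Fin n → ℤ) → ℂ := fun k => (Complex.I * (kdot k ω : ℂ) + μ ω)⁻¹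
      set r' : (Fin n → ℤ) → ℂ := fun k => (Complex.I * (kdot k ω' : ℂ) + μ ω')⁻¹
      have h1 : wsum s (FourierAlg.resolvent ω (μ ω) (x ω) -
          FourierAlg.resolvent ω' (μ ω') (x ω')) ≤
          wsum s (fun k => r k * (x ω - x ω') k) + wsum s (fun k => (r k - r' k) * x ω' k) := by
        unfold wsum
        rw [← ENNReal.tsum_add]
        refine ENNReal.tsum_le_tsum fun k => ?_
        rw [← mul_add, sub_apply, resolvent_apply hR hω (hc ω hω),
          resolvent_apply hR hω' (hc ω' hω')]
        gcongr
        refine le_trans (le_of_eq ?_) (enorm_add_le _ _)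
        congr 1
        show _ = r k * (x ω k - x ω' k) + (r k - r' k) * x ω' k
        ring
      have h2 := wsum_mul_le_of_le (s := s) hl.le (hR.2.1 ω hω) (x ω - x ω')
      have h3 := wsum_mul_le_of_le (s := s) (mul_nonneg hl.le dist_nonneg)
        (hR.2.2 ω hω ω' hω') (x ω')
      refine (ENNReal.div_le_div_right (h1.trans (add_le_add h2 h3)) _).trans ?_
      rw [ENNReal.add_div, mul_add, mul_div_assoc]
      refine add_le_add ?_ ?_
      · gcongr
        exact (le_iSup₂ (f := fun ω' (_ : ω' ∈ O) =>
            wsum (s + δ) (x ω - x ω') / edist ω ω') ω' hω').trans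
          (le_iSup₂ (f := fun ω (_ : ω ∈ O) => ⨆ ω' ∈ O,
            wsum (s + δ) (x ω - x ω') / edist ω ω') ω hω)
      · rw [ENNReal.ofReal_mul hl.le, ← edist_dist, mul_right_comm]
        refine ENNReal.div_le_of_le_mul ?_
        gcongr
        exact le_iSup₂ (f := fun ω (_ : ω ∈ O) => wsum (s + δ) (x ω)) ω' hω'
  refine key.trans ?_
  rw [add_comm (⨆ ω ∈ O, ⨆ ω' ∈ O, _)]
  calc _ ≤ ENNReal.ofReal l * ENNReal.ofReal a + ENNReal.ofReal l * ENNReal.ofReal a := by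
        gcongr
        exact hx.2
    _ = ENNReal.ofReal (2 * l * a) := by
        rw [← ENNReal.ofReal_mul hl.le, ← ENNReal.ofReal_add (by have := hx.1; positivity)
          (by have := hx.1; positivity)]
        congr 1
        ring

theorem isDeriv_resolvent (h : ResBound O μ l δ) {ω : Fin n → ℝ} (hω : ω ∈ O) {c : FourierAlg n}
    (hc : wsum δ c ≠ ∞) (h0 : ∀ k : Fin n → ℤ, Complex.I * (kdot k ω : ℂ) + μ ω ≠ 0) :
    IsDeriv ω (resolvent ω (μ ω) c) (c - μ ω • resolvent ω (μ ω) c) := fun k => by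
  rw [sub_apply, smul_apply, resolvent_apply h hω hc, eq_sub_iff_add_eq, ← add_mul, ← mul_assoc,
    mul_inv_cancel₀ (h0 k), one_mul]

/-- At `k = 0` the divisor vanishes, and the convention `0⁻¹ = 0` selects the primitive of mean zero
of `c` minus its mean. -/
theorem isDeriv_resolvent_zero (h : ResBound O 0 l δ) {ω : Fin n → ℝ} (hω : ω ∈ O)
    {c : FourierAlg n} (hc : wsum δ c ≠ ∞) (h0 : ∀ k : Fin n → ℤ, k ≠ 0 → kdot k ω ≠ 0) :
    IsDeriv ω (resolvent ω 0 c) (c - c 0 • 1) := fun k => by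
  have h1 := resolvent_apply h hω hc k
  simp only [Pi.zero_apply] at h1
  rw [sub_apply, smul_apply, h1, one_apply]
  by_cases hk : k = 0
  · simp [hk, kdot_zero]
  · have : (kdot k ω : ℂ) ≠ 0 := by exact_mod_cast h0 k hk
    simp only [add_zero, hk, if_false, mul_zero, sub_zero]
    rw [← mul_assoc, mul_inv_cancel₀ (mul_ne_zero Complex.I_ne_zero this), one_mul]

/-- A single term of the exponential series at `δ(1 + x)`. -/
theorem one_add_pow_le_exp (m : ℕ) {δ x : ℝ} (hδ : 0 < δ) (hx : 0 ≤ x) :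
    (1 + x) ^ m ≤ m ! * Real.exp δ / δ ^ m * Real.exp (δ * x) := by
  have h := Real.pow_div_factorial_le_exp (δ * (1 + x)) (by positivity) m
  rw [div_le_iff₀ (by positivity), mul_pow, mul_one_add, Real.exp_add] at h
  rw [div_mul_eq_mul_div, le_div_iff₀ (by positivity)]
  linarith

/-- The constant in the bounds for the small divisors. -/
def divConst (n m : ℕ) (γ δ : ℝ) : ℝ :=
  (n + 1) * γ⁻¹ ^ 2 * ((2 * m + 1)! * Real.exp δ / δ ^ (2 * m + 1))

theorem divConst_pos (n m : ℕ) {γ δ : ℝ} (hγ : 0 < γ) (hδ : 0 < δ) : 0 < divConst n m γ δ := by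
  unfold divConst
  positivity

/-- Lower bounds for the divisors yield bounds for the resolvents. -/
theorem resBound_of_lower {γ δ : ℝ} {m : ℕ} (hγ : 0 < γ) (hγ1 : γ ≤ 1) (hδ : 0 < δ)
    (hD : ∀ k : Fin n → ℤ, (∀ ω ∈ O, Complex.I * (kdot k ω : ℂ) + μ ω = 0) ∨
      ∀ ω ∈ O, γ / (1 + ‖k‖) ^ m ≤ ‖Complex.I * (kdot k ω : ℂ) + μ ω‖)
    (hμ : ∀ ω ∈ O, ∀ ω' ∈ O, ‖μ ω - μ ω'‖ ≤ dist ω ω') :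
    ResBound O μ (divConst n m γ δ) δ := by
  -- Exponent `2m + 1`: the difference of two inverses contains two divisors, each costing `(1 +
  -- |k|)^m`, and the variation of `k·ω` costs one more factor.
  have hpow : ∀ k : Fin n → ℤ, (n + 1) * γ⁻¹ ^ 2 * (1 + ‖k‖) ^ (2 * m + 1) ≤
      divConst n m γ δ * Real.exp (δ * ‖k‖) := fun k => by
    have := one_add_pow_le_exp (2 * m + 1) hδ (norm_nonneg k)
    unfold divConst
    rw [mul_assoc _ _ (Real.exp (δ * ‖k‖))]
    gcongr
  have hγi : 1 ≤ γ⁻¹ := (one_le_inv₀ hγ).2 hγ1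
  refine ⟨divConst_pos n m hγ hδ, fun ω hω k => ?_, fun ω hω ω' hω' k => ?_⟩
  -- The alternative of a divisor vanishing on all of `O` covers `k = 0` for primitives; there the
  -- inverse is `0`.
  · rcases hD k with h | h
    · rw [h ω hω]
      simp only [inv_zero, norm_zero]
      have := divConst_pos n m hγ hδ
      positivity
    · refine le_trans ?_ (hpow k)
      rw [norm_inv]
      calc _ ≤ (γ / (1 + ‖k‖) ^ m)⁻¹ := by
            gcongr
            exact h ω hω
        _ = 1 * γ⁻¹ ^ 1 * (1 + ‖k‖) ^ m := by
            rw [inv_div, div_eq_inv_mul]; ring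
        _ ≤ _ := by
            gcongr
            · linarith [(Nat.cast_nonneg n : (0 : ℝ) ≤ n)]
            · norm_num
            · linarith [norm_nonneg k]
            · omega
  · rcases hD k with h | h
    · rw [h ω hω, h ω' hω']
      simp only [sub_self, norm_zero]
      have := divConst_pos n m hγ hδ
      positivity
    · have p1 : 0 < γ / (1 + ‖k‖) ^ m := by positivity
      have q1 : 0 < ‖Complex.I * (kdot k ω : ℂ) + μ ω‖ := p1.trans_le (h ω hω)
      have q2 : 0 < ‖Complex.I * (kdot k ω' : ℂ) + μ ω'‖ := p1.trans_le (h ω' hω')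
      have hdiff : ‖(Complex.I * (kdot k ω' : ℂ) + μ ω') - (Complex.I * (kdot k ω : ℂ) + μ ω)‖ ≤
          (n + 1) * (1 + ‖k‖) * dist ω ω' := by
        have e1 : (Complex.I * (kdot k ω' : ℂ) + μ ω') - (Complex.I * (kdot k ω : ℂ) + μ ω) =
            Complex.I * ((kdot k (ω' - ω) : ℝ) : ℂ) + (μ ω' - μ ω) := by
          rw [kdot_sub_right]; push_cast; ring
        rw [e1]
        refine (norm_add_le _ _).trans ?_
        have e2 := hμ ω' hω' ω hω
        have e3 := abs_kdot_le k (ω' - ω)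
        rw [← dist_eq_norm] at e3
        rw [norm_mul, Complex.norm_I, one_mul, Complex.norm_real, Real.norm_eq_abs]
        rw [dist_comm] at e2 e3
        have := norm_nonneg k
        have := dist_nonneg (x := ω) (y := ω')
        have hn : (0 : ℝ) ≤ n := Nat.cast_nonneg n
        nlinarith [mul_nonneg hn this, mul_nonneg (norm_nonneg k) this]
      rw [inv_sub_inv (norm_pos_iff.1 q1) (norm_pos_iff.1 q2), norm_div, norm_mul]
      calc _ ≤ ((n + 1) * (1 + ‖k‖) * dist ω ω') / ((γ / (1 + ‖k‖) ^ m) * (γ / (1 + ‖k‖) ^ m)) := by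
            gcongr
            exacts [h ω hω, h ω' hω']
        _ = ((n + 1) * γ⁻¹ ^ 2 * (1 + ‖k‖) ^ (2 * m + 1)) * dist ω ω' := by
            have : (1 + ‖k‖) ≠ 0 := by positivity
            field_simp
            ring
        _ ≤ (divConst n m γ δ * Real.exp (δ * ‖k‖)) * dist ω ω' := 
            mul_le_mul_of_nonneg_right (hpow k) dist_nonneg
        _ = _ := by ring

end FourierAlg

namespace FourierAlg

variable {n : ℕ}

/-! ### Newton iteration for the Riccati equation -/

/-- An approximate solution `σ` of the Riccati equation `σ' + σ² + F = 0`, together with a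
primitive `S` of `σ` minus its mean, and the error `E`. -/
structure RiccatiState (n : ℕ) where
  σ : FourierAlg n
  S : FourierAlg n
  E : FourierAlg n

/-- The defining relations of an approximate solution. -/
structure IsRiccati (ω : Fin n → ℝ) (F : FourierAlg n) (x : RiccatiState n) : Prop where
  deriv_S : IsDeriv ω x.S (x.σ - x.σ 0 • 1)
  deriv_σ : IsDeriv ω x.σ (x.E - x.σ ^ 2 - F)

/-- The Newton correction. -/
def newtonInc (ω : Fin n → ℝ) (x : RiccatiState n) : FourierAlg n :=
  -(NormedSpace.exp ((-2 : ℂ) • x.S) *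
    resolvent ω (2 * x.σ 0) (NormedSpace.exp ((2 : ℂ) • x.S) * x.E))

/-- The Newton step; the new error is the square of the correction. -/
def newtonStep (ω : Fin n → ℝ) (x : RiccatiState n) : RiccatiState n where
  σ := x.σ + newtonInc ω x
  S := x.S + resolvent ω 0 (newtonInc ω x)
  E := newtonInc ω x ^ 2

theorem exp_neg_mul_exp (S : FourierAlg n) :
    NormedSpace.exp ((-2 : ℂ) • S) * NormedSpace.exp ((2 : ℂ) • S) = 1 := by
  rw [← NormedSpace.exp_add_of_commute (Commute.all _ _), ← add_smul]
  simp

/-- With `S' = σ - σ₀`, the factor `exp(2S)` turns `h' + 2σh = -E` into an equation with the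
constant coefficient `2σ₀`. The Riccati equation is quadratic, so what the linearisation leaves over
is exactly `h²`, with no Taylor remainder. -/
theorem IsRiccati.newtonStep {ω : Fin n → ℝ} {F : FourierAlg n} {x : RiccatiState n} {l δ : ℝ}
    (hx : IsRiccati ω F x) (h2 : ResBound {ω} (fun _ => 2 * x.σ 0) l δ)
    (h0 : ResBound {ω} 0 l δ)
    (hE : wsum δ (NormedSpace.exp ((2 : ℂ) • x.S) * x.E) ≠ ∞) (hh : wsum δ (newtonInc ω x) ≠ ∞)
    (hdiv2 : ∀ k : Fin n → ℤ, Complex.I * (kdot k ω : ℂ) + 2 * x.σ 0 ≠ 0)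
    (hdiv0 : ∀ k : Fin n → ℤ, k ≠ 0 → kdot k ω ≠ 0) :
    IsRiccati ω F (FourierAlg.newtonStep ω x) := by
  set y := resolvent ω (2 * x.σ 0) (NormedSpace.exp ((2 : ℂ) • x.S) * x.E) with hy
  have hy' : IsDeriv ω y (NormedSpace.exp ((2 : ℂ) • x.S) * x.E - (2 * x.σ 0) • y) :=
    isDeriv_resolvent h2 (Set.mem_singleton ω) hE hdiv2
  have hexp := (hx.deriv_S.smul (-2 : ℂ)).exp
  have hinc : newtonInc ω x = -(NormedSpace.exp ((-2 : ℂ) • x.S) * y) := rfl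
  have hh' : IsDeriv ω (newtonInc ω x) (-(2 : ℂ) • (x.σ * newtonInc ω x) - x.E) := by
    have h3 := (hexp.mul hy').neg
    rw [← hinc] at h3
    have h4 := exp_neg_mul_exp x.S
    convert h3 using 1
    rw [hinc, mul_sub, ← mul_assoc (NormedSpace.exp ((-2 : ℂ) • x.S)), h4]
    simp only [Algebra.smul_def, map_neg, map_mul, map_ofNat]
    ring
  refine ⟨?_, ?_⟩
  · have h5 := hx.deriv_S.add (isDeriv_resolvent_zero h0 (Set.mem_singleton ω) hh hdiv0)
    show IsDeriv ω (x.S + resolvent ω 0 (newtonInc ω x))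
      (x.σ + newtonInc ω x - (x.σ + newtonInc ω x) 0 • 1)
    convert h5 using 1
    rw [add_apply, add_smul]
    abel
  · have h5 := hx.deriv_σ.add hh'
    show IsDeriv ω (x.σ + newtonInc ω x)
      (newtonInc ω x ^ 2 - (x.σ + newtonInc ω x) ^ 2 - F)
    convert h5 using 1
    simp only [Algebra.smul_def, map_neg, map_ofNat]
    ring

/-- When `S` is bounded by 1, each of `exp(±2S)` contributes `e²`; together with the factor `2l` of
the resolvent this is the `120 * l` in `FBound.newtonInc`. -/
theorem exp_four_le : Real.exp 2 * Real.exp 2 ≤ 60 := by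
  have h := Real.exp_one_lt_d9
  have h1 : Real.exp 2 = Real.exp 1 ^ 2 := by
    rw [← Real.exp_nat_mul]; norm_num
  have h0 := Real.exp_pos 1
  have h2 : Real.exp 1 ^ 2 ≤ 7.4 := by nlinarith
  rw [h1]
  nlinarith [sq_nonneg (Real.exp 1)]

section Step

variable {s δ l a : ℝ} {O : Set (Fin n → ℝ)} {x : (Fin n → ℝ) → RiccatiState n}

theorem FBound.exp_mul_error (hs : 0 ≤ s) (hS : FBound s O (fun ω => (x ω).S) 1)
    (hE : FBound s O (fun ω => (x ω).E) a) :
    FBound s O (fun ω => NormedSpace.exp ((2 : ℂ) • (x ω).S) * (x ω).E) (Real.exp 2 * a) := by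
  have h := ((hS.smul 2).exp hs).mul hs hE
  simpa using h

theorem FBound.newtonInc (hs : 0 ≤ s) (hδ : 0 ≤ δ)
    (hS : FBound (s + δ) O (fun ω => (x ω).S) 1) (hE : FBound (s + δ) O (fun ω => (x ω).E) a)
    (hR : ResBound O (fun ω => 2 * (x ω).σ 0) l δ) :
    FBound s O (fun ω => newtonInc ω (x ω)) (120 * l * a) := by
  have h1 := FBound.resolvent hs hR (FBound.exp_mul_error (by positivity) hS hE)
  have h2 := (((hS.mono (by linarith) subset_rfl le_rfl : FBound s O _ 1).smul (-2)).exp hs).mul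
    hs h1
  refine h2.neg.le ?_
  have h3 := exp_four_le
  have := hE.1
  have := hR.1
  have h4 : ‖(-2 : ℂ)‖ * 1 = 2 := by simp
  rw [h4]
  nlinarith [mul_nonneg this.le hE.1]

end Step

/-! #### The iteration -/

/-- The Newton iterates. -/
def riccatiIter (x : (Fin n → ℝ) → RiccatiState n) (j : ℕ) (ω : Fin n → ℝ) : RiccatiState n :=
  (newtonStep ω)^[j] (x ω)

theorem riccatiIter_succ (x : (Fin n → ℝ) → RiccatiState n) (j : ℕ) (ω : Fin n → ℝ) :
    riccatiIter x (j + 1) ω = newtonStep ω (riccatiIter x j ω) :=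
  Function.iterate_succ_apply' _ _ _

/-- The frequencies that are nonresonant for the first `j` Newton steps. -/
def riccatiSet (x : (Fin n → ℝ) → RiccatiState n) (O : Set (Fin n → ℝ)) (γ : ℝ) (m j : ℕ) :
    Set (Fin n → ℝ) :=
  {ω ∈ O | ∀ i < j, ∀ k : Fin n → ℤ,
    γ / 2 ^ i / (1 + ‖k‖) ^ m ≤ |kdot k ω + 2 * ((riccatiIter x i ω).σ 0).im|}

/-- The frequencies that are nonresonant for all Newton steps. -/
def riccatiSetInf (x : (Fin n → ℝ) → RiccatiState n) (O : Set (Fin n → ℝ)) (γ : ℝ) (m : ℕ) :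
    Set (Fin n → ℝ) := ⋂ j, riccatiSet x O γ m j

theorem riccatiSet_subset (x : (Fin n → ℝ) → RiccatiState n) (O : Set (Fin n → ℝ)) (γ : ℝ)
    (m j : ℕ) : riccatiSet x O γ m j ⊆ O := fun _ h => h.1

theorem riccatiSet_succ_subset (x : (Fin n → ℝ) → RiccatiState n) (O : Set (Fin n → ℝ)) (γ : ℝ)
    (m j : ℕ) : riccatiSet x O γ m (j + 1) ⊆ riccatiSet x O γ m j :=
  fun _ h => ⟨h.1, fun i hi => h.2 i (hi.trans (Nat.lt_succ_self j))⟩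

theorem ResBound.le {O : Set (Fin n → ℝ)} {μ : (Fin n → ℝ) → ℂ} {l l' δ : ℝ}
    (h : ResBound O μ l δ) (hl : l ≤ l') : ResBound O μ l' δ :=
  ⟨h.1.trans_le hl, fun ω hω k => (h.2.1 ω hω k).trans (by gcongr),
    fun ω hω ω' hω' k => (h.2.2 ω hω ω' hω' k).trans (by gcongr)⟩

theorem abs_add_im_le (r : ℝ) (z : ℂ) : |r + z.im| ≤ ‖Complex.I * (r : ℂ) + z‖ := by
  have := Complex.abs_im_le_norm (Complex.I * (r : ℂ) + z)
  simpa using this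

/-- The constant `divConst` for the divisors of the `j`-th step. -/
theorem divConst_iter_le (n m : ℕ) {γ s : ℝ} (hγ : 0 < γ) (hs : 0 < s) (j : ℕ) :
    divConst n m (γ / 2 ^ j) (s / 2 ^ j) ≤ divConst n m γ s * (2 ^ (2 * m + 3)) ^ j := by
  have h1 : Real.exp (s / 2 ^ j) ≤ Real.exp s := by
    apply Real.exp_le_exp.2
    exact div_le_self hs.le (one_le_pow₀ one_le_two)
  -- Halving `γ` and the width multiplies the constant by `2²` and `2^(2m + 1)`, hence the base
  -- `2^(2m + 3)`.
  have e : divConst n m γ s * (2 ^ (2 * m + 3)) ^ j = (n + 1) * (γ / 2 ^ j)⁻¹ ^ 2 *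
      ((2 * m + 1)! * Real.exp s / (s / 2 ^ j) ^ (2 * m + 1)) := by
    unfold divConst
    rw [← pow_mul, mul_comm _ j, pow_mul, inv_div, div_pow s]
    field_simp
    ring
  rw [e]
  unfold divConst
  gcongr

theorem one_le_divConst (n m : ℕ) {γ δ : ℝ} (hγ : 0 < γ) (hγ1 : γ ≤ 1) (hδ : 0 < δ) :
    1 ≤ divConst n m γ δ := by
  have h1 : 1 ≤ γ⁻¹ := (one_le_inv₀ hγ).2 hγ1
  have h2 : 1 ≤ γ⁻¹ ^ 2 := one_le_pow₀ h1
  have h3 : 1 ≤ (2 * m + 1)! * Real.exp δ / δ ^ (2 * m + 1) := by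
    rw [one_le_div (by positivity)]
    have := Real.pow_div_factorial_le_exp δ hδ.le (2 * m + 1)
    rw [div_le_iff₀ (by positivity)] at this
    linarith
  have h4 : (1 : ℝ) ≤ n + 1 := by linarith [(Nat.cast_nonneg n : (0 : ℝ) ≤ n)]
  unfold divConst
  exact one_le_mul_of_one_le_of_one_le (one_le_mul_of_one_le_of_one_le h4 h2) h3

/-- The hypotheses of the convergence theorem for the Newton iteration. -/
structure RiccatiStart (x : (Fin n → ℝ) → RiccatiState n) (F : FourierAlg n)
    (O : Set (Fin n → ℝ)) (γ s : ℝ) (m : ℕ) (σ₀ : ℂ) (r a : ℝ) : Prop where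
  γ_pos : 0 < γ
  γ_le : γ ≤ 1
  s_pos : 0 < s
  lower : ∀ ω ∈ O, ∀ k : Fin n → ℤ, k ≠ 0 → γ / (1 + ‖k‖) ^ m ≤ |kdot k ω|
  r_le : r ≤ 1 / 4
  im_pos : γ ≤ σ₀.im - r
  isRiccati : ∀ ω ∈ O, IsRiccati ω F (x ω)
  bound_S : FBound s O (fun ω => (x ω).S) (1 / 2)
  bound_σ : FBound s O (fun ω => (x ω).σ - σ₀ • 1) (r / 2)
  bound_E : FBound s O (fun ω => (x ω).E) a
  small_r : 480 * divConst n m γ (s / 8) * a ≤ r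
  small : 28800 * (divConst n m γ (s / 8)) ^ 2 * (2 ^ (2 * m + 3)) ^ 2 * a ≤ 1

namespace RiccatiStart

variable {x : (Fin n → ℝ) → RiccatiState n} {F : FourierAlg n} {O : Set (Fin n → ℝ)} {γ s : ℝ}
  {m : ℕ} {σ₀ : ℂ} {r a : ℝ}

/-- The width of analyticity after `j` steps. -/
def width (s : ℝ) (j : ℕ) : ℝ := s / 2 + s / 2 / 2 ^ j

/-- Each step loses width twice: once for the Newton correction and once for its primitive. -/
theorem width_succ (s : ℝ) (j : ℕ) :
    width s (j + 1) + s / 8 / 2 ^ j + s / 8 / 2 ^ j = width s j := by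
  unfold width
  rw [pow_succ]
  field_simp
  ring

theorem resBound_zero (h : RiccatiStart x F O γ s m σ₀ r a) (j : ℕ) :
    ResBound O 0 (divConst n m γ (s / 8) * (2 ^ (2 * m + 3)) ^ j) (s / 8 / 2 ^ j) := by
  have hγ := h.γ_pos
  have hs := h.s_pos
  have h2 : (1 : ℝ) ≤ 2 ^ j := one_le_pow₀ one_le_two
  refine (resBound_of_lower (γ := γ / 2 ^ j) (m := m) (by positivity)
    ((div_le_self hγ.le h2).trans h.γ_le) (by positivity) (fun k => ?_) (by simp)).le
    (divConst_iter_le n m hγ (by positivity) j)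
  by_cases hk : k = 0
  · left
    intro ω _
    simp [hk, kdot_zero]
  · right
    intro ω hω
    simp only [Pi.zero_apply, add_zero, norm_mul, Complex.norm_I, one_mul, Complex.norm_real,
      Real.norm_eq_abs]
    refine le_trans ?_ (h.lower ω hω k hk)
    gcongr
    exact div_le_self hγ.le h2

/-- The nonresonance condition controls only the imaginary part of the divisor, which already bounds
its modulus from below. The coefficient `2σ₀` has Lipschitz constant `2r ≤ 1/2`. -/
theorem resBound_two (h : RiccatiStart x F O γ s m σ₀ r a) (j : ℕ) {t : ℝ} (ht : 0 ≤ t)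
    (hσ : FBound t (riccatiSet x O γ m j) (fun ω => (riccatiIter x j ω).σ - σ₀ • 1) r) :
    ResBound (riccatiSet x O γ m (j + 1)) (fun ω => 2 * (riccatiIter x j ω).σ 0)
      (divConst n m γ (s / 8) * (2 ^ (2 * m + 3)) ^ j) (s / 8 / 2 ^ j) := by
  have hγ := h.γ_pos
  have hs := h.s_pos
  have h2 : (1 : ℝ) ≤ 2 ^ j := one_le_pow₀ one_le_two
  refine (resBound_of_lower (γ := γ / 2 ^ j) (m := m) (by positivity)
    ((div_le_self hγ.le h2).trans h.γ_le) (by positivity) (fun k => Or.inr fun ω hω => ?_)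
    fun ω hω ω' hω' => ?_).le (divConst_iter_le n m hγ (by positivity) j)
  · refine (hω.2 j (Nat.lt_succ_self j) k).trans ?_
    have := abs_add_im_le (kdot k ω) (2 * (riccatiIter x j ω).σ 0)
    simpa using this
  · have := hσ.coeff_lip ht (riccatiSet_succ_subset _ _ _ _ _ hω)
      (riccatiSet_succ_subset _ _ _ _ _ hω') 0
    rw [← mul_sub, norm_mul]
    simp only [sub_apply, smul_apply, sub_sub_sub_cancel_right] at this
    simp only [Complex.norm_ofNat]
    have := dist_nonneg (x := ω) (y := ω')
    have := mul_le_mul_of_nonneg_right h.r_le this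
    linarith

/-- The bounds satisfied by the `j`-th iterate. -/
structure Good (x : (Fin n → ℝ) → RiccatiState n) (F : FourierAlg n) (O : Set (Fin n → ℝ))
    (γ s : ℝ) (m : ℕ) (σ₀ : ℂ) (r a : ℝ) (j : ℕ) : Prop where
  isRiccati : ∀ ω ∈ riccatiSet x O γ m j, IsRiccati ω F (riccatiIter x j ω)
  bound_S : FBound (width s j) (riccatiSet x O γ m j) (fun ω => (riccatiIter x j ω).S)
    (1 - 1 / 2 / 2 ^ j)
  bound_σ : FBound (width s j) (riccatiSet x O γ m j) (fun ω => (riccatiIter x j ω).σ - σ₀ • 1)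
    (r - r / 2 / 2 ^ j)
  bound_E : FBound (width s j) (riccatiSet x O γ m j) (fun ω => (riccatiIter x j ω).E)
    (a / (2 * (2 ^ (2 * m + 3)) ^ 2) ^ j)

theorem width_nonneg (h : RiccatiStart x F O γ s m σ₀ r a) (j : ℕ) : 0 ≤ width s j := by
  have := h.s_pos
  unfold width
  positivity

theorem bound_inc (h : RiccatiStart x F O γ s m σ₀ r a) {j : ℕ} (hj : Good x F O γ s m σ₀ r a j) :
    FBound (width s (j + 1) + s / 8 / 2 ^ j) (riccatiSet x O γ m (j + 1))
      (fun ω => newtonInc ω (riccatiIter x j ω))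
      (120 * (divConst n m γ (s / 8) * (2 ^ (2 * m + 3)) ^ j) *
        (a / (2 * (2 ^ (2 * m + 3)) ^ 2) ^ j)) := by
  have hs := h.s_pos
  have hsub := riccatiSet_succ_subset x O γ m j
  have e := width_succ s j
  have hp : (0 : ℝ) ≤ 1 / 2 / 2 ^ j := by positivity
  have hp' : (0 : ℝ) ≤ r / 2 / 2 ^ j := by have := h.bound_σ.1; positivity
  refine FBound.newtonInc (by have := h.width_nonneg (j + 1); positivity)
    (by positivity) (hj.bound_S.mono e.le hsub (by linarith)) (hj.bound_E.mono e.le hsub le_rfl)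
    (h.resBound_two j (h.width_nonneg j) (hj.bound_σ.le (by linarith)))

theorem bound_resolvent_inc (h : RiccatiStart x F O γ s m σ₀ r a) {j : ℕ}
    (hj : Good x F O γ s m σ₀ r a j) :
    FBound (width s (j + 1)) (riccatiSet x O γ m (j + 1))
      (fun ω => resolvent ω 0 (newtonInc ω (riccatiIter x j ω)))
      (2 * (divConst n m γ (s / 8) * (2 ^ (2 * m + 3)) ^ j) *
        (120 * (divConst n m γ (s / 8) * (2 ^ (2 * m + 3)) ^ j) *
        (a / (2 * (2 ^ (2 * m + 3)) ^ 2) ^ j))) :=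
  FBound.resolvent (h.width_nonneg _)
    ((h.resBound_zero j).mono (riccatiSet_subset x O γ m (j + 1))) (h.bound_inc hj)

theorem inc_le (h : RiccatiStart x F O γ s m σ₀ r a) (j : ℕ) :
    120 * (divConst n m γ (s / 8) * (2 ^ (2 * m + 3)) ^ j) *
        (a / (2 * (2 ^ (2 * m + 3)) ^ 2) ^ j) ≤ 120 * divConst n m γ (s / 8) * a / 2 ^ j := by
  have hL := divConst_pos n m h.γ_pos (by linarith [h.s_pos] : 0 < s / 8)
  have ha := h.bound_E.1
  have hQ : (1 : ℝ) ≤ (2 ^ (2 * m + 3)) ^ j := one_le_pow₀ (one_le_pow₀ one_le_two)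
  have e : 120 * (divConst n m γ (s / 8) * (2 ^ (2 * m + 3)) ^ j) *
        (a / (2 * (2 ^ (2 * m + 3)) ^ 2) ^ j) =
      120 * divConst n m γ (s / 8) * a / 2 ^ j / (2 ^ (2 * m + 3)) ^ j := by
    rw [mul_pow, ← pow_mul (2 ^ (2 * m + 3)) 2 j, mul_comm 2 j, pow_mul (2 ^ (2 * m + 3)) j 2]
    field_simp
  rw [e]
  exact div_le_self (by positivity) hQ

/-- The rate `(2Q²)^(-j)` of the errors, with `Q = 2^(2m + 3)`, is chosen so that two divisor
constants, each growing like `Q^j`, still leave `2^(-j)`. -/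
theorem resolvent_inc_le (j : ℕ) :
    2 * (divConst n m γ (s / 8) * (2 ^ (2 * m + 3)) ^ j) *
        (120 * (divConst n m γ (s / 8) * (2 ^ (2 * m + 3)) ^ j) *
        (a / (2 * (2 ^ (2 * m + 3)) ^ 2) ^ j)) = 240 * divConst n m γ (s / 8) ^ 2 * a / 2 ^ j := by
  rw [mul_pow, ← pow_mul (2 ^ (2 * m + 3)) 2 j, mul_comm 2 j, pow_mul (2 ^ (2 * m + 3)) j 2]
  field_simp
  ring

theorem small' (h : RiccatiStart x F O γ s m σ₀ r a) :
    28800 * divConst n m γ (s / 8) * a ≤ 1 ∧ 28800 * divConst n m γ (s / 8) ^ 2 * a ≤ 1 := by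
  have hL := one_le_divConst n m h.γ_pos h.γ_le (by linarith [h.s_pos] : 0 < s / 8)
  have ha := h.bound_E.1
  have hQ : (1 : ℝ) ≤ (2 ^ (2 * m + 3)) ^ 2 := one_le_pow₀ (one_le_pow₀ one_le_two)
  have h1 : 28800 * divConst n m γ (s / 8) ^ 2 * a ≤ 1 := by
    refine le_trans ?_ h.small
    have : 0 ≤ 28800 * divConst n m γ (s / 8) ^ 2 * a := by positivity
    nlinarith
  refine ⟨le_trans ?_ h1, h1⟩
  gcongr
  exact le_self_pow₀ hL two_ne_zero

/-- Although the scheme is quadratic, only geometric decay of the error is retained. It beats the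
geometric growth of the divisor constants, so the corrections are summable and the bounds on `S` and
`σ` never exhaust their allowances 1 and `r`. -/
theorem good (h : RiccatiStart x F O γ s m σ₀ r a) (j : ℕ) : Good x F O γ s m σ₀ r a j := by
  have hs := h.s_pos
  have hγ := h.γ_pos
  have ha := h.bound_E.1
  induction j with
  | zero =>
    have hw : width s 0 = s := by simp [width]
    have hO := riccatiSet_subset x O γ m 0
    refine ⟨fun ω hω => h.isRiccati ω (hO hω), ?_, ?_, ?_⟩
    · exact h.bound_S.mono hw.le hO (by norm_num)
    · exact h.bound_σ.mono hw.le hO (by rw [pow_zero, div_one]; linarith)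
    · exact h.bound_E.mono hw.le hO (by simp)
  | succ j ih =>
    have hsub := riccatiSet_succ_subset x O γ m j
    have hL := divConst_pos n m h.γ_pos (by linarith [h.s_pos] : 0 < s / 8)
    have e := width_succ s j
    have hδ : 0 < s / 8 / 2 ^ j := by positivity
    have hw := h.width_nonneg (j + 1)
    have hinc := h.bound_inc ih
    have hres := h.bound_resolvent_inc ih
    have hp : (0 : ℝ) ≤ 1 / 2 / 2 ^ j := by positivity
    have hp' : (0 : ℝ) ≤ r / 2 / 2 ^ j := by have := h.bound_σ.1; positivity
    have hr := h.small_r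
    have h2j : (0 : ℝ) < 2 ^ j := by positivity
    have hsmall := h.small'
    refine ⟨fun ω hω => ?_, ?_, ?_, ?_⟩
    · rw [riccatiIter_succ]
      have hω' := hsub hω
      have hr2 := h.resBound_two j (h.width_nonneg j) (ih.bound_σ.le (by linarith))
      refine (ih.isRiccati ω hω').newtonStep (l := _) (δ := s / 8 / 2 ^ j)
        (ResBound.singleton hr2.1 fun k => hr2.2.1 ω hω k)
        ((h.resBound_zero j).mono (Set.singleton_subset_iff.2 hω.1)) ?_ ?_ (fun k => ?_)
        fun k hk => ?_
      · have := FBound.exp_mul_error (h.width_nonneg j) (ih.bound_S.le (b := 1) (by linarith))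
          ih.bound_E
        exact ne_top_of_le_ne_top (this.wsum_ne_top hω') (wsum_mono (by linarith) _)
      · exact ne_top_of_le_ne_top (hinc.wsum_ne_top hω) (wsum_mono (by linarith) _)
      -- The divisor is nonzero because its imaginary part is.
      · rw [← norm_pos_iff]
        have h1 := hω.2 j (Nat.lt_succ_self j) k
        have h2 := abs_add_im_le (kdot k ω) (2 * (riccatiIter x j ω).σ 0)
        have h3 : 0 < γ / 2 ^ j / (1 + ‖k‖) ^ m := by positivity
        have h4 : (2 * (riccatiIter x j ω).σ 0).im = 2 * ((riccatiIter x j ω).σ 0).im := by simp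
        rw [h4] at h2
        linarith
      · have h1 := h.lower ω hω.1 k hk
        have h3 : 0 < γ / (1 + ‖k‖) ^ m := by positivity
        exact abs_pos.1 (h3.trans_le h1)
    · have h1 : FBound (width s (j + 1)) (riccatiSet x O γ m (j + 1))
          (fun ω => (riccatiIter x j ω).S) (1 - 1 / 2 / 2 ^ j) :=
        ih.bound_S.mono (by linarith) hsub le_rfl
      refine ((h1.add hres).le ?_).congr fun ω hω => by rw [riccatiIter_succ]; rfl
      rw [resolvent_inc_le, pow_succ (2 : ℝ) j]
      have : 240 * divConst n m γ (s / 8) ^ 2 * a / 2 ^ j ≤ 1 / 4 / 2 ^ j := by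
        gcongr
        linarith
      have e2 : (1 : ℝ) / 2 / (2 ^ j * 2) = 1 / 2 / 2 ^ j - 1 / 4 / 2 ^ j := by
        field_simp; ring
      rw [e2]
      linarith
    · have h1 : FBound (width s (j + 1)) (riccatiSet x O γ m (j + 1))
          (fun ω => (riccatiIter x j ω).σ - σ₀ • 1) (r - r / 2 / 2 ^ j) :=
        ih.bound_σ.mono (by linarith) hsub le_rfl
      refine ((h1.add (hinc.mono (by linarith) subset_rfl (h.inc_le j))).le ?_).congr
        fun ω hω => by
          rw [riccatiIter_succ]
          show _ = (riccatiIter x j ω).σ + newtonInc ω (riccatiIter x j ω) - σ₀ • 1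
          ring
      rw [pow_succ (2 : ℝ) j]
      have : 120 * divConst n m γ (s / 8) * a / 2 ^ j ≤ r / 4 / 2 ^ j := by
        gcongr
        linarith
      have e2 : r / 2 / (2 ^ j * 2) = r / 2 / 2 ^ j - r / 4 / 2 ^ j := by
        field_simp; ring
      rw [e2]
      linarith
    · have h1 : FBound (width s (j + 1)) (riccatiSet x O γ m (j + 1)) _ _ :=
        (hinc.mono (by linarith) subset_rfl le_rfl)
      refine ((h1.mul hw h1).le ?_).congr fun ω hω => by
        rw [riccatiIter_succ]
        show _ = newtonInc ω (riccatiIter x j ω) ^ 2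
        ring
      set L := divConst n m γ (s / 8) with hLdef
      set Q : ℝ := 2 ^ (2 * m + 3) with hQdef
      have hQ : 0 < Q := by positivity
      -- The new error is the square of the correction. One of the two factors `a` is spent on the
      -- smallness hypothesis, the other keeps the geometric rate.
      have e3 : 120 * (L * Q ^ j) * (a / (2 * Q ^ 2) ^ j) * (120 * (L * Q ^ j) *
          (a / (2 * Q ^ 2) ^ j)) = (28800 * L ^ 2 * Q ^ 2 * a / 2 ^ j) * (a / (2 * Q ^ 2) ^ (j + 1)) := by
        rw [pow_succ (2 * Q ^ 2) j, mul_pow, ← pow_mul Q 2 j, mul_comm 2 j, pow_mul Q j 2]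
        field_simp
        ring
      rw [e3]
      refine mul_le_of_le_one_left (by positivity) ?_
      rw [div_le_one (by positivity)]
      exact h.small.trans (one_le_pow₀ one_le_two)

end RiccatiStart

end FourierAlg

/-! ### The limit of the Newton iteration -/

namespace FourierAlg

variable {n : ℕ}

/-- The limit of the Newton iterates `σ`. -/
def riccatiSol (x : (Fin n → ℝ) → RiccatiState n) (ω : Fin n → ℝ) : FourierAlg n :=
  (x ω).σ + ∑' j, newtonInc ω (riccatiIter x j ω)

/-- The limit of the Newton iterates `S`. -/
def riccatiPrim (x : (Fin n → ℝ) → RiccatiState n) (ω : Fin n → ℝ) : FourierAlg n :=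
  (x ω).S + ∑' j, resolvent ω 0 (newtonInc ω (riccatiIter x j ω))

theorem riccatiIter_σ (x : (Fin n → ℝ) → RiccatiState n) (ω : Fin n → ℝ) (N : ℕ) :
    (riccatiIter x N ω).σ = (x ω).σ + ∑ j ∈ Finset.range N, newtonInc ω (riccatiIter x j ω) := by
  induction N with
  | zero => simp [riccatiIter]
  | succ N ih =>
    rw [riccatiIter_succ, Finset.sum_range_succ, ← add_assoc, ← ih]
    rfl

theorem riccatiIter_S (x : (Fin n → ℝ) → RiccatiState n) (ω : Fin n → ℝ) (N : ℕ) :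
    (riccatiIter x N ω).S = (x ω).S +
      ∑ j ∈ Finset.range N, resolvent ω 0 (newtonInc ω (riccatiIter x j ω)) := by
  induction N with
  | zero => simp [riccatiIter]
  | succ N ih =>
    rw [riccatiIter_succ, Finset.sum_range_succ, ← add_assoc, ← ih]
    rfl

theorem FBound.summable {s : ℝ} (hs : 0 ≤ s) {O : Set (Fin n → ℝ)}
    {z : ℕ → (Fin n → ℝ) → FourierAlg n} {a : ℕ → ℝ} (h : ∀ i, FBound s O (z i) (a i))
    (ha : Summable a) {ω : Fin n → ℝ} (hω : ω ∈ O) : Summable fun i => z i ω :=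
  Summable.of_norm_bounded ha fun i => (h i).norm_le hs hω

theorem summable_div_two_pow (c : ℝ) : Summable fun j : ℕ => c / 2 ^ j := by
  have h := summable_geometric_two.mul_left c
  simpa [div_eq_mul_inv] using h

theorem tsum_div_two_pow (c : ℝ) : ∑' j : ℕ, c / 2 ^ j = 2 * c := by
  have h := tsum_geometric_two
  have : ∀ j : ℕ, c / 2 ^ j = c * (1 / 2) ^ j := fun j => by
    rw [div_pow, one_pow, mul_one_div]
  simp_rw [this, tsum_mul_left, h]
  ring

namespace RiccatiStart

variable {x : (Fin n → ℝ) → RiccatiState n} {F : FourierAlg n} {O : Set (Fin n → ℝ)} {γ s : ℝ}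
  {m : ℕ} {σ₀ : ℂ} {r a : ℝ}

theorem half_le_width (h : RiccatiStart x F O γ s m σ₀ r a) (j : ℕ) : s / 2 ≤ width s j := by
  have := h.s_pos
  unfold width
  have : 0 < s / 2 / 2 ^ j := by positivity
  linarith

theorem bound_inc_inf (h : RiccatiStart x F O γ s m σ₀ r a) (j : ℕ) :
    FBound (s / 2) (riccatiSetInf x O γ m) (fun ω => newtonInc ω (riccatiIter x j ω))
      (120 * divConst n m γ (s / 8) * a / 2 ^ j) := by
  have hs := h.s_pos
  have : 0 < s / 8 / 2 ^ j := by positivity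
  exact (h.bound_inc (h.good j)).mono (by linarith [h.half_le_width (j + 1)])
    (Set.iInter_subset _ (j + 1)) (h.inc_le j)

theorem bound_resolvent_inc_inf (h : RiccatiStart x F O γ s m σ₀ r a) (j : ℕ) :
    FBound (s / 2) (riccatiSetInf x O γ m)
      (fun ω => resolvent ω 0 (newtonInc ω (riccatiIter x j ω)))
      (240 * divConst n m γ (s / 8) ^ 2 * a / 2 ^ j) :=
  (h.bound_resolvent_inc (h.good j)).mono (h.half_le_width (j + 1))
    (Set.iInter_subset _ (j + 1)) (resolvent_inc_le j).le

theorem bound_riccatiSol (h : RiccatiStart x F O γ s m σ₀ r a) :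
    FBound (s / 2) (riccatiSetInf x O γ m) (fun ω => riccatiSol x ω - (x ω).σ)
      (240 * divConst n m γ (s / 8) * a) := by
  have hs := h.s_pos
  have h1 := FBound.tsum h.bound_inc_inf (fun ω hω => FBound.summable (by positivity)
    h.bound_inc_inf (summable_div_two_pow _) hω) (summable_div_two_pow _)
  rw [tsum_div_two_pow] at h1
  refine (h1.le (by linarith)).congr fun ω _ => ?_
  rw [riccatiSol, add_sub_cancel_left]

theorem bound_riccatiPrim (h : RiccatiStart x F O γ s m σ₀ r a) :
    FBound (s / 2) (riccatiSetInf x O γ m) (fun ω => riccatiPrim x ω - (x ω).S)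
      (480 * divConst n m γ (s / 8) ^ 2 * a) := by
  have hs := h.s_pos
  have h1 := FBound.tsum h.bound_resolvent_inc_inf (fun ω hω => FBound.summable (by positivity)
    h.bound_resolvent_inc_inf (summable_div_two_pow _) hω) (summable_div_two_pow _)
  rw [tsum_div_two_pow] at h1
  refine (h1.le (by linarith)).congr fun ω _ => ?_
  rw [riccatiPrim, add_sub_cancel_left]

theorem tendsto_σ (h : RiccatiStart x F O γ s m σ₀ r a) {ω : Fin n → ℝ}
    (hω : ω ∈ riccatiSetInf x O γ m) :
    Tendsto (fun j => (riccatiIter x j ω).σ) atTop (𝓝 (riccatiSol x ω)) := by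
  have hs := h.s_pos
  have h1 := FBound.summable (by positivity) h.bound_inc_inf (summable_div_two_pow _) hω
  simp only [riccatiIter_σ]
  exact h1.hasSum.tendsto_sum_nat.const_add _

theorem tendsto_S (h : RiccatiStart x F O γ s m σ₀ r a) {ω : Fin n → ℝ}
    (hω : ω ∈ riccatiSetInf x O γ m) :
    Tendsto (fun j => (riccatiIter x j ω).S) atTop (𝓝 (riccatiPrim x ω)) := by
  have hs := h.s_pos
  have h1 := FBound.summable (by positivity) h.bound_resolvent_inc_inf (summable_div_two_pow _) hω
  simp only [riccatiIter_S]
  exact h1.hasSum.tendsto_sum_nat.const_add _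

theorem tendsto_E (h : RiccatiStart x F O γ s m σ₀ r a) {ω : Fin n → ℝ}
    (hω : ω ∈ riccatiSetInf x O γ m) :
    Tendsto (fun j => (riccatiIter x j ω).E) atTop (𝓝 0) := by
  have ha := h.bound_E.1
  refine squeeze_zero_norm (a := fun j : ℕ => a / 2 ^ j) (fun j => ?_)
    (summable_div_two_pow a).tendsto_atTop_zero
  refine ((h.good j).bound_E.norm_le (h.width_nonneg j) (Set.mem_iInter.1 hω j)).trans ?_
  have h1 : (1 : ℝ) ≤ (2 ^ (2 * m + 3)) ^ 2 := one_le_pow₀ (one_le_pow₀ one_le_two)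
  gcongr
  linarith

/-- The errors tend to zero and the graph of the derivation is closed, so the equation passes to the
limit although the derivatives were not estimated. -/
theorem isDeriv_riccatiSol (h : RiccatiStart x F O γ s m σ₀ r a) {ω : Fin n → ℝ}
    (hω : ω ∈ riccatiSetInf x O γ m) :
    IsDeriv ω (riccatiSol x ω) (-riccatiSol x ω ^ 2 - F) := by
  refine IsDeriv.of_tendsto (fun j => ((h.good j).isRiccati ω (Set.mem_iInter.1 hω j)).deriv_σ)
    (h.tendsto_σ hω) ?_
  have := ((h.tendsto_E hω).sub ((h.tendsto_σ hω).pow 2)).sub_const F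
  simpa using this

theorem isDeriv_riccatiPrim (h : RiccatiStart x F O γ s m σ₀ r a) {ω : Fin n → ℝ}
    (hω : ω ∈ riccatiSetInf x O γ m) :
    IsDeriv ω (riccatiPrim x ω) (riccatiSol x ω - riccatiSol x ω 0 • 1) := by
  refine IsDeriv.of_tendsto (fun j => ((h.good j).isRiccati ω (Set.mem_iInter.1 hω j)).deriv_S)
    (h.tendsto_S hω) ?_
  have h1 := h.tendsto_σ hω
  exact h1.sub ((((coeffCLM (0 : Fin n → ℤ)).continuous.tendsto _).comp h1).smul_const 1)

/-- The mean of the solution is Lipschitz continuous in the frequency. -/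
theorem bound_riccatiSol_sub (h : RiccatiStart x F O γ s m σ₀ r a) :
    FBound (s / 2) (riccatiSetInf x O γ m) (fun ω => riccatiSol x ω - σ₀ • 1) r := by
  have hs := h.s_pos
  have hL := divConst_pos n m h.γ_pos (by linarith [h.s_pos] : 0 < s / 8)
  have h1 := h.bound_riccatiSol.add (h.bound_σ.mono (by linarith : s / 2 ≤ s)
    (fun ω hω => (Set.mem_iInter.1 hω 0).1) le_rfl)
  refine (h1.le (by have := h.small_r; linarith)).congr fun ω _ => ?_
  abel

end RiccatiStart

end FourierAlg

/-! ### The measure of resonant sets -/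

theorem summable_pi_prod {f : ℤ → ℝ} (h0 : ∀ k, 0 ≤ f k) (hf : Summable f) (n : ℕ) :
    Summable fun k : Fin n → ℤ => ∏ i, f (k i) := by
  induction n with
  | zero => exact Summable.of_finite
  | succ n ih =>
    rw [← (Fin.consEquiv (fun _ => ℤ)).summable_iff]
    have := hf.mul_of_nonneg ih h0 (fun k => Finset.prod_nonneg fun i _ => h0 _)
    refine this.congr fun p => ?_
    simp [Fin.consEquiv, Fin.prod_univ_succ]

theorem summable_one_add_abs_sq_inv : Summable fun k : ℤ => ((1 + |(k : ℝ)|) ^ 2)⁻¹ := by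
  have h : Summable fun k : ℕ => ((1 + (k : ℝ)) ^ 2)⁻¹ := by
    have := (summable_nat_add_iff 1).2 (Real.summable_nat_pow_inv.2 one_lt_two)
    refine this.congr fun k => ?_
    push_cast
    rw [add_comm]
  refine Summable.of_nat_of_neg ?_ ?_
  · simpa using h
  · simpa using h

/-- Comparison with the product of `(1 + |kᵢ|)⁻²` over the `n` coordinates; hence the exponent `2n`
in the nonresonance conditions of the iteration. -/
theorem summable_one_add_norm_pow_inv (n : ℕ) :
    Summable fun k : Fin n → ℤ => ((1 + ‖k‖) ^ (2 * n))⁻¹ := by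
  refine Summable.of_nonneg_of_le (fun k => by positivity) (fun k => ?_)
    (summable_pi_prod (fun k => by positivity) summable_one_add_abs_sq_inv n)
  rw [Finset.prod_inv_distrib]
  refine inv_anti₀ (Finset.prod_pos fun i _ => by positivity) ?_
  calc ∏ i, (1 + |((k i : ℤ) : ℝ)|) ^ 2 ≤ ∏ _i : Fin n, (1 + ‖k‖) ^ 2 := by
        refine Finset.prod_le_prod (fun i _ => by positivity) fun i _ => ?_
        gcongr
        rw [← Int.norm_eq_abs]
        exact norm_le_pi_norm k i
    _ = (1 + ‖k‖) ^ (2 * n) := by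
        rw [Finset.prod_const, Finset.card_univ, Fintype.card_fin, ← pow_mul]

theorem volume_cell (n : ℕ) : volume (cell n) = ENNReal.ofReal (2 * Real.pi) ^ n := by
  unfold cell
  rw [Real.volume_Icc_pi]
  simp

/-- A subset of the cell whose slices in one direction have diameter at most `d`. -/
theorem volume_le_of_slice_diam {n : ℕ} {S : Set (Fin n → ℝ)} (hS : MeasurableSet S)
    (hcell : S ⊆ cell n) (i : Fin n) {d : ℝ}
    (h : ∀ ω ∈ S, ∀ ω' ∈ S, (∀ j, j ≠ i → ω j = ω' j) → |ω i - ω' i| ≤ d) :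
    volume S ≤ ENNReal.ofReal d * ENNReal.ofReal (2 * Real.pi) ^ (n - 1) := by
  obtain ⟨n, rfl⟩ : ∃ n', n = n' + 1 := ⟨n - 1, by have := i.pos; omega⟩
  set e := (MeasurableEquiv.piFinSuccAbove (fun _ : Fin (n + 1) => ℝ) i).symm
  have he : MeasurePreserving e volume volume :=
    (volume_preserving_piFinSuccAbove (fun _ : Fin (n + 1) => ℝ) i).symm
  have happ : ∀ p : ℝ × (Fin n → ℝ), e p = i.insertNth p.1 p.2 := fun p => rfl
  rw [← he.measure_preimage hS.nullMeasurableSet]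
  have hm : MeasurableSet (e ⁻¹' S) := e.measurable hS
  -- Fubini, integrating the lengths of the slices over the other coordinates.
  rw [show (volume : Measure (ℝ × (Fin n → ℝ))) = volume.prod volume from rfl,
    Measure.prod_apply_symm hm]
  calc ∫⁻ y, volume ((fun x => (x, y)) ⁻¹' (e ⁻¹' S))
      ≤ ∫⁻ y, (cell n).indicator (fun _ => ENNReal.ofReal d) y := by
        refine lintegral_mono fun y => ?_
        by_cases hy : y ∈ cell n
        · simp only [Set.indicator_of_mem hy]
          refine (Real.volume_le_diam _).trans (Metric.ediam_le fun t ht t' ht' => ?_)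
          have := h _ ht _ ht' fun j hj => by
            obtain ⟨j, rfl⟩ := Fin.exists_succAbove_eq hj
            simp [happ]
          rw [edist_dist]
          refine ENNReal.ofReal_le_ofReal ?_
          simpa [happ, Real.dist_eq] using this
        · simp only [Set.indicator_of_notMem hy]
          refine le_of_eq ?_
          convert measure_empty (μ := (volume : Measure ℝ))
          refine Set.eq_empty_of_forall_notMem fun t ht => hy ?_
          have := hcell ht
          refine ⟨fun j => ?_, fun j => ?_⟩
          · simpa [happ] using this.1 (i.succAbove j)
          · simpa [happ] using this.2 (i.succAbove j)
    _ = ENNReal.ofReal d * volume (cell n) := by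
        rw [lintegral_indicator (show MeasurableSet (cell n) from measurableSet_Icc), setLIntegral_const]
    _ = _ := by rw [volume_cell]; rfl

/-- Along a coordinate with `kᵢ ≠ 0`, the function `k·ω` varies at unit speed at least and `β` at
half that speed at most. Two resonant points of a slice are therefore at most `4d` apart. Extending
`β` as a Lipschitz function to the whole space gives a measurable set to which Fubini applies,
without any measurability of `O`. -/
theorem volume_resonance_le {n : ℕ} {O : Set (Fin n → ℝ)} (hO : O ⊆ cell n)
    {β : (Fin n → ℝ) → ℝ} (hβ : ∀ ω ∈ O, ∀ ω' ∈ O, |β ω - β ω'| ≤ 1 / 2 * dist ω ω')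
    {k : Fin n → ℤ} (hk : k ≠ 0) (d : ℝ) :
    volume {ω ∈ O | |kdot k ω + β ω| < d} ≤
      ENNReal.ofReal (4 * d) * ENNReal.ofReal (2 * Real.pi) ^ (n - 1) := by
  have hL : LipschitzOnWith (1 / 2) β O := LipschitzOnWith.of_dist_le_mul fun ω hω ω' hω' => by
    simpa [Real.dist_eq] using hβ ω hω ω' hω'
  obtain ⟨g, hg, hgO⟩ := hL.extend_real
  have hcont : Continuous fun ω : Fin n → ℝ => |kdot k ω + g ω| := by
    have : Continuous fun ω : Fin n → ℝ => kdot k ω := by unfold kdot; fun_prop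
    exact (this.add hg.continuous).abs
  set S := cell n ∩ {ω | |kdot k ω + g ω| < d}
  have hS : MeasurableSet S :=
    measurableSet_Icc.inter (isOpen_lt hcont continuous_const).measurableSet
  have hsub : {ω ∈ O | |kdot k ω + β ω| < d} ⊆ S := fun ω hω => by
    refine ⟨hO hω.1, ?_⟩
    show |kdot k ω + g ω| < d
    rw [← hgO hω.1]
    exact hω.2
  obtain ⟨i, hi⟩ : ∃ i, k i ≠ 0 := Function.ne_iff.1 hk
  refine (measure_mono hsub).trans (volume_le_of_slice_diam hS Set.inter_subset_left i ?_)
  intro ω hω ω' hω' hne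
  have h1 : |kdot k ω + g ω| < d := hω.2
  have h2 : |kdot k ω' + g ω'| < d := hω'.2
  have h3 : kdot k ω - kdot k ω' = k i * (ω i - ω' i) := by
    unfold kdot
    rw [← Finset.sum_sub_distrib, Finset.sum_eq_single i]
    · ring
    · intro j _ hj
      rw [hne j hj, sub_self]
    · simp
  have h4 : dist ω ω' ≤ |ω i - ω' i| := by
    refine (dist_pi_le_iff (abs_nonneg _)).2 fun j => ?_
    by_cases hj : j = i
    · rw [hj, Real.dist_eq]
    · rw [hne j hj, dist_self]
      exact abs_nonneg _
  have h5 : |g ω - g ω'| ≤ 1 / 2 * dist ω ω' := by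
    have := hg.dist_le_mul ω ω'
    simpa [Real.dist_eq] using this
  have h6 : (1 : ℝ) ≤ |(k i : ℝ)| := by exact_mod_cast Int.one_le_abs hi
  have h7 : |(k i : ℝ)| * |ω i - ω' i| ≤ d + d + 1 / 2 * |ω i - ω' i| := by
    rw [← abs_mul, ← h3]
    calc |kdot k ω - kdot k ω'|
        = |(kdot k ω + g ω) - (kdot k ω' + g ω') - (g ω - g ω')| := by ring_nf
      _ ≤ |kdot k ω + g ω| + |kdot k ω' + g ω'| + |g ω - g ω'| :=
          (abs_sub _ _).trans (add_le_add_left (abs_sub _ _) _)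
      _ ≤ _ := by linarith
  nlinarith [abs_nonneg (ω i - ω' i)]

/-- The constant in `volume_resonances_le`. -/
def resonanceConst (n : ℕ) : ℝ≥0∞ :=
  (∑' k : Fin n → ℤ, ENNReal.ofReal (4 * ((1 + ‖k‖) ^ (2 * n))⁻¹)) *
    ENNReal.ofReal (2 * Real.pi) ^ (n - 1)

theorem resonanceConst_ne_top (n : ℕ) : resonanceConst n ≠ ∞ := by
  refine ENNReal.mul_ne_top ?_ (ENNReal.pow_ne_top ENNReal.ofReal_ne_top)
  exact ((summable_one_add_norm_pow_inv n).mul_left 4).tsum_ofReal_ne_top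

theorem volume_resonances_le {n : ℕ} {O : Set (Fin n → ℝ)} (hO : O ⊆ cell n)
    {β : (Fin n → ℝ) → ℝ} (hβ : ∀ ω ∈ O, ∀ ω' ∈ O, |β ω - β ω'| ≤ 1 / 2 * dist ω ω')
    {γ : ℝ} (hγ : 0 ≤ γ) :
    volume {ω ∈ O | ∃ k : Fin n → ℤ, k ≠ 0 ∧ |kdot k ω + β ω| < γ / (1 + ‖k‖) ^ (2 * n)} ≤
      ENNReal.ofReal γ * resonanceConst n := by
  have hsub : {ω ∈ O | ∃ k : Fin n → ℤ, k ≠ 0 ∧ |kdot k ω + β ω| < γ / (1 + ‖k‖) ^ (2 * n)} ⊆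
      ⋃ k : Fin n → ℤ, {ω | k ≠ 0 ∧ ω ∈ {ω ∈ O | |kdot k ω + β ω| < γ / (1 + ‖k‖) ^ (2 * n)}} := by
    rintro ω ⟨hω, k, hk, h⟩
    exact Set.mem_iUnion.2 ⟨k, hk, hω, h⟩
  refine (measure_mono hsub).trans ((measure_iUnion_le _).trans ?_)
  unfold resonanceConst
  rw [← mul_assoc, ← ENNReal.tsum_mul_left, ← ENNReal.tsum_mul_right]
  refine ENNReal.tsum_le_tsum fun k => ?_
  by_cases hk : k = 0
  · simp [hk]
  · simp only [ne_eq, hk, not_false_eq_true, true_and, Set.ofPred_mem_eq]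
    refine (volume_resonance_le hO hβ hk _).trans_eq ?_
    rw [← ENNReal.ofReal_mul hγ]
    congr 2
    rw [div_eq_mul_inv]
    ring

/-! ### Measure of the frequencies lost in the iteration -/

namespace FourierAlg

variable {n : ℕ}

/-- The frequencies for which the Newton iteration converges and, moreover, the mean of the limit
is nonresonant. -/
def riccatiGood (x : (Fin n → ℝ) → RiccatiState n) (O : Set (Fin n → ℝ)) (γ : ℝ) (m : ℕ) :
    Set (Fin n → ℝ) :=
  {ω ∈ riccatiSetInf x O γ m | ∀ k : Fin n → ℤ,
    γ / (1 + ‖k‖) ^ m ≤ |kdot k ω + (riccatiSol x ω 0).im|}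

namespace RiccatiStart

variable {x : (Fin n → ℝ) → RiccatiState n} {F : FourierAlg n} {O : Set (Fin n → ℝ)} {γ s : ℝ}
  {m : ℕ} {σ₀ : ℂ} {r a : ℝ}

theorem abs_im_sub_le {t : ℝ} (ht : 0 ≤ t) {O : Set (Fin n → ℝ)} {z : (Fin n → ℝ) → FourierAlg n}
    (hz : FBound t O (fun ω => z ω - σ₀ • 1) r) {ω : Fin n → ℝ} (hω : ω ∈ O) :
    |(z ω 0).im - σ₀.im| ≤ r := by
  have h1 := hz.coeff_le ht hω 0
  have h2 := Complex.abs_im_le_norm (z ω 0 - σ₀)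
  rw [sub_apply, smul_apply, one_def', mul_one] at h1
  rw [Complex.sub_im] at h2
  exact h2.trans h1

theorem abs_im_lip {t : ℝ} (ht : 0 ≤ t) (hr : r ≤ 1 / 4) {O : Set (Fin n → ℝ)}
    {z : (Fin n → ℝ) → FourierAlg n}
    (hz : FBound t O (fun ω => z ω - σ₀ • 1) r) {ω ω' : Fin n → ℝ} (hω : ω ∈ O) (hω' : ω' ∈ O) :
    |(z ω 0).im - (z ω' 0).im| ≤ 1 / 4 * dist ω ω' := by
  have h1 := hz.coeff_lip ht hω hω' 0
  have h2 := Complex.abs_im_le_norm (z ω 0 - z ω' 0)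
  rw [sub_apply, sub_apply, sub_sub_sub_cancel_right] at h1
  rw [Complex.sub_im] at h2
  refine h2.trans (h1.trans ?_)
  gcongr

/-- A lost frequency is attributed to the first step at which it is resonant, so that it still lies
in the set on which that iterate is controlled. The constants `γ/2^j` sum to `2γ`, and the condition
on the limiting mean costs another `γ`. The index `k = 0` is never resonant, since the imaginary
part of the mean stays above `γ`. -/
theorem volume_sdiff_riccatiGood_le (h : RiccatiStart x F O γ s (2 * n) σ₀ r a)
    (hO : O ⊆ cell n) :
    volume (O \ riccatiGood x O γ (2 * n)) ≤ ENNReal.ofReal (3 * γ) * resonanceConst n := by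
  have hγ := h.γ_pos
  have hs := h.s_pos
  set A : ℕ → Set (Fin n → ℝ) := fun j => {ω ∈ riccatiSet x O γ (2 * n) j |
    ∃ k : Fin n → ℤ, k ≠ 0 ∧
      |kdot k ω + 2 * ((riccatiIter x j ω).σ 0).im| < γ / 2 ^ j / (1 + ‖k‖) ^ (2 * n)}
  set B : Set (Fin n → ℝ) := {ω ∈ riccatiSetInf x O γ (2 * n) | ∃ k : Fin n → ℤ, k ≠ 0 ∧
      |kdot k ω + (riccatiSol x ω 0).im| < γ / (1 + ‖k‖) ^ (2 * n)}
  have hσ : ∀ j, FBound (width s j) (riccatiSet x O γ (2 * n) j)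
      (fun ω => (riccatiIter x j ω).σ - σ₀ • 1) r := fun j =>
    (h.good j).bound_σ.le (by
      have : 0 ≤ r / 2 / 2 ^ j := by have := h.bound_σ.1; positivity
      linarith)
  have hA : ∀ j, volume (A j) ≤ ENNReal.ofReal (γ / 2 ^ j) * resonanceConst n := fun j => by
    refine volume_resonances_le ((riccatiSet_subset _ _ _ _ _).trans hO)
      (β := fun ω => 2 * ((riccatiIter x j ω).σ 0).im) (fun ω hω ω' hω' => ?_) (by positivity)
    have := abs_im_lip (h.width_nonneg j) h.r_le (hσ j) hω hω'
    rw [← mul_sub, abs_mul, abs_two]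
    linarith
  have hB : volume B ≤ ENNReal.ofReal γ * resonanceConst n := by
    refine volume_resonances_le
      ((Set.iInter_subset _ 0).trans ((riccatiSet_subset _ _ _ _ _).trans hO))
      (β := fun ω => (riccatiSol x ω 0).im) (fun ω hω ω' hω' => ?_) hγ.le
    have := abs_im_lip (by positivity) h.r_le h.bound_riccatiSol_sub hω hω'
    have := dist_nonneg (x := ω) (y := ω')
    linarith
  have hsub : O \ riccatiGood x O γ (2 * n) ⊆ (⋃ j, A j) ∪ B := by
    rintro ω ⟨hω, hn⟩
    by_cases hinf : ω ∈ riccatiSetInf x O γ (2 * n)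
    · right
      have h1 : ¬ ∀ k : Fin n → ℤ,
          γ / (1 + ‖k‖) ^ (2 * n) ≤ |kdot k ω + (riccatiSol x ω 0).im| := fun hk => hn ⟨hinf, hk⟩
      push Not at h1
      obtain ⟨k, hk⟩ := h1
      refine ⟨hinf, k, ?_, hk⟩
      rintro rfl
      have h2 := abs_im_sub_le (by positivity) h.bound_riccatiSol_sub hinf
      have h3 := h.im_pos
      rw [kdot_zero, zero_add, norm_zero, add_zero, one_pow, div_one] at hk
      have h4 := (abs_lt.1 hk).2
      have h5 := (abs_le.1 h2).1
      linarith
    · left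
      have h1 : ∃ j, ω ∉ riccatiSet x O γ (2 * n) j := by
        simpa [riccatiSetInf] using hinf
      classical
      have h2 := Nat.find_spec h1
      have h3 : ∀ i < Nat.find h1, ω ∈ riccatiSet x O γ (2 * n) i := fun i hi => by
        simpa using Nat.find_min h1 hi
      have h4 : ¬ ∀ i < Nat.find h1, ∀ k : Fin n → ℤ, γ / 2 ^ i / (1 + ‖k‖) ^ (2 * n) ≤
          |kdot k ω + 2 * ((riccatiIter x i ω).σ 0).im| := fun h5 => h2 ⟨hω, h5⟩
      push Not at h4
      obtain ⟨i, hi, k, hk⟩ := h4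
      refine Set.mem_iUnion.2 ⟨i, h3 i hi, k, ?_, hk⟩
      rintro rfl
      have h6 := abs_im_sub_le (h.width_nonneg i) (hσ i) (h3 i hi)
      have h7 := h.im_pos
      rw [kdot_zero, zero_add, norm_zero, add_zero, one_pow, div_one] at hk
      have h8 : γ / 2 ^ i ≤ γ := div_le_self hγ.le (one_le_pow₀ one_le_two)
      have h4 := (abs_lt.1 hk).2
      have h5 := (abs_le.1 h6).1
      linarith
  refine (measure_mono hsub).trans ((measure_union_le _ _).trans ?_)
  have h1 : volume (⋃ j, A j) ≤ ENNReal.ofReal (2 * γ) * resonanceConst n := by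
    refine (measure_iUnion_le _).trans ((ENNReal.tsum_le_tsum hA).trans ?_)
    rw [ENNReal.tsum_mul_right, ← ENNReal.ofReal_tsum_of_nonneg (fun j => by positivity)
      (summable_div_two_pow γ), tsum_div_two_pow]
  refine (add_le_add h1 hB).trans_eq ?_
  rw [← add_mul, ← ENNReal.ofReal_add (by positivity) hγ.le]
  congr 2
  ring

end RiccatiStart

end FourierAlg

open FourierAlg

/-! ### Fourier coefficients of real analytic functions on the torus -/

section Fourier

variable {n : ℕ}

/-- Periodicity with period `2π` in each variable. -/
def TorusPeriodic {E : Type*} (g : (Fin n → ℝ) → E) : Prop :=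
  ∀ (θ : Fin n → ℝ) (k : Fin n → ℤ), g (fun i => θ i + 2 * Real.pi * (k i : ℝ)) = g θ

theorem continuous_kdot (k : Fin n → ℤ) : Continuous (kdot k) := by
  unfold kdot; fun_prop

/-- The linear functional `θ ↦ k · θ`. -/
def kdotCLM (k : Fin n → ℤ) : (Fin n → ℝ) →L[ℝ] ℝ :=
  ∑ i, (k i : ℝ) • ContinuousLinearMap.proj i

theorem kdotCLM_apply (k : Fin n → ℤ) (θ : Fin n → ℝ) : kdotCLM k θ = kdot k θ := by
  simp [kdotCLM, kdot]

theorem kdot_single (k : Fin n → ℤ) (i : Fin n) : kdot k (Pi.single i 1) = k i := by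
  unfold kdot
  rw [Finset.sum_eq_single i]
  · simp
  · intro j _ hj
    simp [hj]
  · simp

theorem torusPeriodic_cexp (l : Fin n → ℤ) :
    TorusPeriodic (fun θ : Fin n → ℝ => Complex.exp (-(Complex.I * (kdot l θ : ℂ)))) := fun θ k => by
  have h : kdot l (fun i => θ i + 2 * Real.pi * (k i : ℝ)) =
      kdot l θ + ((∑ i, l i * k i : ℤ) : ℝ) * (2 * Real.pi) := by
    unfold kdot
    push_cast
    rw [Finset.sum_mul, ← Finset.sum_add_distrib]
    exact Finset.sum_congr rfl fun i _ => by ring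
  show Complex.exp (-(Complex.I * (kdot l (fun i => θ i + 2 * Real.pi * (k i : ℝ)) : ℂ))) = _
  rw [h, Complex.exp_eq_exp_iff_exists_int]
  refine ⟨-(∑ i, l i * k i), ?_⟩
  push_cast
  ring

theorem hasFDerivAt_cexp (l : Fin n → ℤ) (θ : Fin n → ℝ) :
    HasFDerivAt (fun θ : Fin n → ℝ => Complex.exp (-(Complex.I * (kdot l θ : ℂ))))
      (Complex.exp (-(Complex.I * (kdot l θ : ℂ))) •
        (-(Complex.I • (Complex.ofRealCLM.comp (kdotCLM l))))) θ := by
  have h1 : HasFDerivAt (fun θ : Fin n → ℝ => ((kdot l θ : ℝ) : ℂ))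
      (Complex.ofRealCLM.comp (kdotCLM l)) θ := by
    have := (Complex.ofRealCLM.comp (kdotCLM l)).hasFDerivAt (x := θ)
    refine this.congr_of_eventuallyEq (Eventually.of_forall fun θ => ?_)
    simp [kdotCLM_apply]
  exact ((h1.const_mul Complex.I).neg).cexp

/-- The divergence theorem for the vector field with the single component `g` in direction `i`; by
periodicity the fluxes through opposite faces cancel. -/
theorem integral_partial_eq_zero {g : (Fin n → ℝ) → ℂ} {g' : (Fin n → ℝ) → (Fin n → ℝ) →L[ℝ] ℂ}
    (hg : ∀ θ, HasFDerivAt g (g' θ) θ) (hper : TorusPeriodic g) (i : Fin n)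
    (hc : Continuous fun θ => g' θ (Pi.single i 1)) :
    ∫ θ in cell n, g' θ (Pi.single i 1) = 0 := by
  obtain ⟨n, rfl⟩ : ∃ n', n = n' + 1 := ⟨n - 1, by have := i.pos; omega⟩
  have hle : (fun _ : Fin (n + 1) => (0 : ℝ)) ≤ fun _ => 2 * Real.pi := fun _ => by positivity
  have hcg : Continuous g := continuous_iff_continuousAt.2 fun θ => (hg θ).continuousAt
  have hsum : ∀ θ, ∑ j, (Pi.single (M := fun _ : Fin (n + 1) =>
      (Fin (n + 1) → ℝ) → (Fin (n + 1) → ℝ) →L[ℝ] ℂ) i g') j θ (Pi.single j 1) =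
      g' θ (Pi.single i 1) := fun θ => by
    rw [Finset.sum_eq_single i]
    · simp
    · intro j _ hj
      simp [hj]
    · simp
  have h := integral_divergence_of_hasFDerivAt_off_countable' (fun _ : Fin (n + 1) => (0 : ℝ))
    (fun _ => 2 * Real.pi) hle (Pi.single i g) (Pi.single i g') ∅ Set.countable_empty
    (fun j => by
      by_cases hj : j = i
      · subst hj; simpa using hcg.continuousOn
      · rw [Pi.single_eq_of_ne hj]; exact continuousOn_const)
    (fun θ _ j => by
      by_cases hj : j = i
      · subst hj; simpa using hg θ
      · rw [Pi.single_eq_of_ne hj, Pi.single_eq_of_ne hj]; exact hasFDerivAt_const 0 θ)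
    (by
      simp only [hsum]
      exact hc.continuousOn.integrableOn_compact isCompact_Icc)
  simp only [hsum] at h
  unfold cell
  rw [h]
  refine Finset.sum_eq_zero fun j _ => ?_
  by_cases hj : j = i
  · subst hj
    rw [sub_eq_zero]
    refine integral_congr_ae (Eventually.of_forall fun y => ?_)
    simp only [Pi.single_eq_same]
    rw [← hper (j.insertNth 0 y) (Pi.single j 1)]
    congr 1
    funext a
    refine Fin.succAboveCases j ?_ (fun b => ?_) a
    · simp
    · simp
  · rw [Pi.single_eq_of_ne hj]
    simp

/-- For `k ≠ 0` the exponential is, up to a nonzero factor, a partial derivative of a periodic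
function. -/
theorem integral_cell_cexp (k : Fin n → ℤ) :
    ∫ θ in cell n, Complex.exp (Complex.I * (kdot k θ : ℂ)) =
      if k = 0 then (((2 * Real.pi) ^ n : ℝ) : ℂ) else 0 := by
  split_ifs with hk
  · subst hk
    simp only [kdot_zero, Complex.ofReal_zero, mul_zero, Complex.exp_zero]
    rw [setIntegral_const, measureReal_def, volume_cell, ENNReal.toReal_pow,
      ENNReal.toReal_ofReal (by positivity)]
    simp
  · obtain ⟨i, hi⟩ : ∃ i, k i ≠ 0 := Function.ne_iff.1 hk
    have h1 := integral_partial_eq_zero (hasFDerivAt_cexp (-k)) (torusPeriodic_cexp (-k)) i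
      (by
        have := continuous_kdot (-k)
        simp only [_root_.smul_apply]
        fun_prop)
    have h2 : ∀ θ : Fin n → ℝ, kdot (-k) θ = -kdot k θ := fun θ => by simp [kdot]
    simp only [_root_.smul_apply, _root_.neg_apply,
      ContinuousLinearMap.comp_apply, kdotCLM_apply, kdot_single, h2,
      Complex.ofRealCLM_apply, smul_eq_mul] at h1
    rw [integral_mul_const] at h1
    have h4 := (mul_eq_zero.1 h1).resolve_right fun h => hi (by simpa using h)
    simpa using h4

namespace FourierAlg

/-- The mean over the torus is the coefficient of index `0`. -/
theorem integral_cell_eval (c : FourierAlg n) :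
    ((((2 * Real.pi) ^ n)⁻¹ : ℝ) : ℂ) * ∫ θ in cell n, evalHom θ c = c 0 := by
  have hfin : volume (cell n) ≠ ∞ := by
    rw [volume_cell]
    exact ENNReal.pow_ne_top ENNReal.ofReal_ne_top
  have h1 : ∫ θ in cell n, evalHom θ c =
      ∑' k, ∫ θ in cell n, c k * Complex.exp (Complex.I * (kdot k θ : ℂ)) := by
    refine (integral_tsum (fun k => ?_) ?_)
    · have := continuous_kdot k
      exact (by fun_prop : Continuous fun θ : Fin n → ℝ =>
        c k * Complex.exp (Complex.I * (kdot k θ : ℂ))).aestronglyMeasurable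
    · have : ∀ k, ∫⁻ θ in cell n, ‖c k * Complex.exp (Complex.I * (kdot k θ : ℂ))‖ₑ =
          ‖c k‖ₑ * volume (cell n) := fun k => by
        have h : ∀ θ : Fin n → ℝ, ‖c k * Complex.exp (Complex.I * (kdot k θ : ℂ))‖ₑ = ‖c k‖ₑ :=
          fun θ => by
            rw [← ofReal_norm, norm_mul, norm_cexp_I_mul, mul_one, ofReal_norm]
        simp only [h]
        rw [setLIntegral_const]
      simp only [this]
      rw [ENNReal.tsum_mul_right]
      refine ENNReal.mul_ne_top ?_ hfin
      rw [← wsum_zero_eq]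
      exact c.wsum_zero_ne_top
  rw [h1, tsum_eq_single 0]
  · rw [integral_const_mul, integral_cell_cexp, if_pos rfl]
    have : ((2 * Real.pi) ^ n : ℝ) ≠ 0 := by positivity
    rw [mul_left_comm, ← Complex.ofReal_mul, inv_mul_cancel₀ this]
    simp
  · intro k hk
    rw [integral_const_mul, integral_cell_cexp, if_neg hk, mul_zero]

end FourierAlg

/-! #### Decay of the coefficients -/

theorem AnalyticOnNhd.iteratedFDeriv_apply {f : (Fin n → ℝ) → ℝ}
    (hf : AnalyticOnNhd ℝ f Set.univ) (m : ℕ) (e : Fin n → ℝ) :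
    AnalyticOnNhd ℝ (fun θ => iteratedFDeriv ℝ m f θ fun _ => e) Set.univ := by
  have h := hf.iteratedFDeriv m
  exact (ContinuousMultilinearMap.apply ℝ (fun _ : Fin m => Fin n → ℝ) ℝ
    fun _ => e).comp_analyticOnNhd h

theorem fderiv_iteratedFDeriv_apply {f : (Fin n → ℝ) → ℝ}
    (hf : AnalyticOnNhd ℝ f Set.univ) (m : ℕ) (e θ : Fin n → ℝ) :
    fderiv ℝ (fun θ => iteratedFDeriv ℝ m f θ fun _ => e) θ e =
      iteratedFDeriv ℝ (m + 1) f θ fun _ => e := by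
  have hd : DifferentiableAt ℝ (iteratedFDeriv ℝ m f) θ :=
    (hf.iteratedFDeriv m θ (Set.mem_univ θ)).differentiableAt
  rw [iteratedFDeriv_succ_apply_left]
  have h := ((ContinuousMultilinearMap.apply ℝ (fun _ : Fin m => Fin n → ℝ) ℝ
    fun _ => e).hasFDerivAt (x := iteratedFDeriv ℝ m f θ)).comp θ hd.hasFDerivAt
  exact congrArg (fun L : (Fin n → ℝ) →L[ℝ] ℝ => L e) h.fderiv

theorem TorusAnalytic.partial_iterate {f : (Fin n → ℝ) → ℝ} (hf : TorusAnalytic f) (m : ℕ)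
    (e : Fin n → ℝ) : TorusAnalytic (fun θ => iteratedFDeriv ℝ m f θ fun _ => e) := by
  refine ⟨hf.analytic.iteratedFDeriv_apply m e, fun θ k => ?_⟩
  have h1 : (fun θ => f (θ + fun i => 2 * Real.pi * (k i : ℝ))) = f :=
    funext fun θ => hf.periodic θ k
  have h2 := iteratedFDeriv_comp_add_right (𝕜 := ℝ) (f := f) m
    (fun i => 2 * Real.pi * (k i : ℝ)) θ
  rw [h1] at h2
  show iteratedFDeriv ℝ m f (θ + fun i => 2 * Real.pi * (k i : ℝ)) _ = _
  rw [h2]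

theorem fourierCoef_partial {f : (Fin n → ℝ) → ℝ} (hf : TorusAnalytic f) (i : Fin n)
    (k : Fin n → ℤ) : fourierCoef (fun θ => fderiv ℝ f θ (Pi.single i 1)) k =
      Complex.I * (k i : ℂ) * fourierCoef f k := by
  have hd : ∀ θ, HasFDerivAt (fun θ => (f θ : ℂ)) (Complex.ofRealCLM.comp (fderiv ℝ f θ)) θ :=
    fun θ => Complex.ofRealCLM.hasFDerivAt.comp θ
      (hf.analytic θ (Set.mem_univ θ)).differentiableAt.hasFDerivAt
  have hcf : Continuous f := continuous_iff_continuousAt.2 fun θ =>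
    (hf.analytic θ (Set.mem_univ θ)).continuousAt
  have hcd : Continuous fun θ => fderiv ℝ f θ (Pi.single i 1) := by
    have : Continuous (fderiv ℝ f) := continuous_iff_continuousAt.2 fun θ =>
      (hf.analytic.fderiv θ (Set.mem_univ θ)).continuousAt
    fun_prop
  have hck := continuous_kdot k
  have h := integral_partial_eq_zero (fun θ => (hd θ).mul (hasFDerivAt_cexp k θ))
    (fun θ l => by
      show ((f _ : ℝ) : ℂ) * _ = _
      rw [hf.periodic θ l]
      congr 1
      exact torusPeriodic_cexp k θ l) i (by
        simp only [_root_.add_apply, _root_.smul_apply,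
          _root_.neg_apply, ContinuousLinearMap.comp_apply, kdotCLM_apply,
          Complex.ofRealCLM_apply, smul_eq_mul]
        fun_prop)
  simp only [_root_.add_apply, _root_.smul_apply,
    _root_.neg_apply, ContinuousLinearMap.comp_apply, kdotCLM_apply, kdot_single,
    Complex.ofRealCLM_apply, smul_eq_mul] at h
  have hint : ∀ g : (Fin n → ℝ) → ℂ, Continuous g → Integrable g (volume.restrict (cell n)) :=
    fun g hg => hg.integrableOn_Icc
  rw [integral_add (hint _ (by fun_prop)) (hint _ (by fun_prop))] at h
  unfold fourierCoef
  have e1 : ∫ θ in cell n, (f θ : ℂ) * (Complex.exp (-(Complex.I * (kdot k θ : ℂ))) *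
      -(Complex.I * ((k i : ℝ) : ℂ))) = -(Complex.I * (k i : ℂ)) *
      ∫ θ in cell n, (f θ : ℂ) * Complex.exp (-(Complex.I * (kdot k θ : ℂ))) := by
    rw [← integral_const_mul]
    refine integral_congr_ae (Eventually.of_forall fun θ => ?_)
    push_cast
    ring
  rw [e1] at h
  have e2 : ∫ θ in cell n, ((fderiv ℝ f θ (Pi.single i 1) : ℝ) : ℂ) *
      Complex.exp (-(Complex.I * (kdot k θ : ℂ))) = Complex.I * (k i : ℂ) *
      ∫ θ in cell n, (f θ : ℂ) * Complex.exp (-(Complex.I * (kdot k θ : ℂ))) := by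
    have e3 : ∫ θ in cell n, ((fderiv ℝ f θ (Pi.single i 1) : ℝ) : ℂ) *
      Complex.exp (-(Complex.I * (kdot k θ : ℂ))) = ∫ θ in cell n,
      Complex.exp (-(Complex.I * (kdot k θ : ℂ))) * ((fderiv ℝ f θ (Pi.single i 1) : ℝ) : ℂ) := by
      simp only [mul_comm]
    rw [e3]
    linear_combination h
  rw [e2]
  ring

theorem norm_fourierCoef_le {f : (Fin n → ℝ) → ℝ} {M : ℝ} (hM : ∀ θ ∈ cell n, |f θ| ≤ M)
    (k : Fin n → ℤ) : ‖fourierCoef f k‖ ≤ M := by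
  unfold fourierCoef
  have hfin : volume (cell n) < ∞ := by
    rw [volume_cell]
    exact ENNReal.pow_lt_top ENNReal.ofReal_lt_top
  have h := norm_setIntegral_le_of_norm_le_const (μ := volume) (s := cell n) (C := M)
    (f := fun θ => (f θ : ℂ) * Complex.exp (-(Complex.I * (kdot k θ : ℂ)))) hfin
    fun θ hθ => by
      rw [norm_mul, ← mul_neg, ← Complex.ofReal_neg, norm_cexp_I_mul, mul_one, Complex.norm_real]
      exact hM θ hθ
  rw [measureReal_def, volume_cell, ENNReal.toReal_pow, ENNReal.toReal_ofReal (by positivity)] at h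
  rw [norm_mul, Complex.norm_real, Real.norm_of_nonneg (by positivity)]
  have hp : (0 : ℝ) < (2 * Real.pi) ^ n := by positivity
  calc _ ≤ ((2 * Real.pi) ^ n)⁻¹ * (M * (2 * Real.pi) ^ n) := by gcongr
    _ = M := by field_simp

theorem fourierCoef_iterate {f : (Fin n → ℝ) → ℝ} (hf : TorusAnalytic f) (i : Fin n) (m : ℕ)
    (k : Fin n → ℤ) :
    fourierCoef (fun θ => iteratedFDeriv ℝ m f θ fun _ => Pi.single i 1) k =
      (Complex.I * (k i : ℂ)) ^ m * fourierCoef f k := by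
  induction m with
  | zero => simp
  | succ m ih =>
    have h := fourierCoef_partial (hf.partial_iterate m (Pi.single i 1)) i k
    simp only [fderiv_iteratedFDeriv_apply hf.analytic] at h
    rw [h, ih]
    ring

/-- Locally uniform bounds for the derivatives of an analytic function. -/
theorem AnalyticAt.exists_iteratedFDeriv_bound {E : Type*} [NormedAddCommGroup E]
    [NormedSpace ℝ E] {f : E → ℝ} {x : E} (hf : AnalyticAt ℝ f x) :
    ∃ C R : ℝ, 0 ≤ C ∧ 0 < R ∧ ∀ᶠ y in 𝓝 x, ∀ (m : ℕ) (e : E), ‖e‖ ≤ 1 →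
      |iteratedFDeriv ℝ m f y fun _ => e| ≤ C * m ! * R ^ m := by
  obtain ⟨p, hp⟩ := hf
  obtain ⟨r, hr⟩ := hp
  -- One `ρ` allows the centre of the expansion to move, the other is the radius at which the
  -- recentred series is estimated.
  obtain ⟨ρ, hρ0, hρ⟩ : ∃ ρ : ℝ≥0, 0 < ρ ∧ (ρ : ℝ≥0∞) + ρ < r := by
    obtain ⟨a, ha0, ha⟩ := ENNReal.lt_iff_exists_nnreal_btwn.1 hr.r_pos
    refine ⟨a / 2, ?_, ?_⟩
    · have : 0 < a := by exact_mod_cast ha0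
      positivity
    · rw [← ENNReal.coe_add, add_halves]
      exact ha
  have hρr : (ρ : ℝ≥0∞) < r := lt_of_le_of_lt le_self_add hρ
  have hs := p.changeOriginSeries_summable_aux₁ (r := ρ) (r' := ρ) (hρ.trans_le hr.r_le)
  set M := ∑' s : Σ k l : ℕ, { s : Finset (Fin (k + l)) // s.card = l },
    ‖p (s.1 + s.2.1)‖₊ * ρ ^ s.2.1 * ρ ^ s.1 with hM
  refine ⟨M, (ρ : ℝ)⁻¹, M.2, by positivity, ?_⟩
  have hball : Metric.eball x ρ ∈ 𝓝 x := Metric.eball_mem_nhds x (by exact_mod_cast hρ0)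
  filter_upwards [hball] with y hy m e he
  have hyx : (‖y - x‖₊ : ℝ≥0∞) < ρ := by
    rw [Metric.mem_eball, edist_eq_enorm_sub] at hy
    exact hy
  have hco := hr.changeOrigin (y := y - x) (hyx.trans hρr)
  rw [add_sub_cancel] at hco
  have hfac := hco.factorial_smul e m
  -- A single convergent sum `M` majorises the coefficients of all orders of the series recentred at
  -- any point `y` of the ball, hence the uniformity in `y` and `m`.
  have hb : ‖p.changeOrigin (y - x) m‖₊ * ρ ^ m ≤ M := by
    have h1 := p.nnnorm_changeOrigin_le m (x := y - x) ((hyx.trans hρr).trans_le hr.r_le)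
    have hs2 := NNReal.summable_sigma.1 hs
    have hρle : ‖y - x‖₊ ≤ ρ := by exact_mod_cast hyx.le
    have h2 : (∑' s : Σ l : ℕ, { s : Finset (Fin (m + l)) // s.card = l },
        ‖p (m + s.1)‖₊ * ‖y - x‖₊ ^ s.1) ≤
        ∑' s : Σ l : ℕ, { s : Finset (Fin (m + l)) // s.card = l }, ‖p (m + s.1)‖₊ * ρ ^ s.1 := by
      refine Summable.tsum_le_tsum (fun s => by gcongr) ?_
        (p.changeOriginSeries_summable_aux₂ (hρr.trans_le hr.r_le) m)
      exact p.changeOriginSeries_summable_aux₂ ((hyx.trans hρr).trans_le hr.r_le) m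
    calc ‖p.changeOrigin (y - x) m‖₊ * ρ ^ m
        ≤ (∑' s : Σ l : ℕ, { s : Finset (Fin (m + l)) // s.card = l },
            ‖p (m + s.1)‖₊ * ρ ^ s.1) * ρ ^ m := by gcongr; exact h1.trans h2
      _ = ∑' s : Σ l : ℕ, { s : Finset (Fin (m + l)) // s.card = l },
            ‖p (m + s.1)‖₊ * ρ ^ s.1 * ρ ^ m := NNReal.tsum_mul_right _ _ |>.symm
      _ ≤ ∑' k, ∑' s : Σ l : ℕ, { s : Finset (Fin (k + l)) // s.card = l },
            ‖p (k + s.1)‖₊ * ρ ^ s.1 * ρ ^ k := by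
          exact hs2.2.le_tsum m (fun _ _ => zero_le)
      _ = M := by rw [hM, hs.tsum_sigma' fun k => hs2.1 k]
  have hb' : ‖p.changeOrigin (y - x) m‖ * (ρ : ℝ) ^ m ≤ M := by exact_mod_cast hb
  have hρ' : (0 : ℝ) < ρ := by exact_mod_cast hρ0
  rw [← hfac, nsmul_eq_mul, abs_mul, Nat.abs_cast]
  have h3 : |p.changeOrigin (y - x) m fun _ => e| ≤ ‖p.changeOrigin (y - x) m‖ := by
    have := (p.changeOrigin (y - x) m).le_opNorm fun _ => e
    rw [Real.norm_eq_abs] at this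
    refine this.trans ?_
    refine mul_le_of_le_one_right (norm_nonneg _) ?_
    exact Finset.prod_le_one (fun _ _ => norm_nonneg _) fun _ _ => he
  have h4 : ‖p.changeOrigin (y - x) m‖ ≤ M * (ρ : ℝ)⁻¹ ^ m := by
    rw [inv_pow, ← div_eq_mul_inv, le_div_iff₀ (by positivity)]
    exact hb'
  calc (m ! : ℝ) * |p.changeOrigin (y - x) m fun _ => e| ≤ m ! * (M * (ρ : ℝ)⁻¹ ^ m) := by
        gcongr; exact h3.trans h4
    _ = _ := by ring

theorem exists_iteratedFDeriv_bound_compact {f : (Fin n → ℝ) → ℝ}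
    (hf : AnalyticOnNhd ℝ f Set.univ) {K : Set (Fin n → ℝ)} (hK : IsCompact K) :
    ∃ C R : ℝ, 0 ≤ C ∧ 0 < R ∧ ∀ y ∈ K, ∀ (m : ℕ) (e : Fin n → ℝ), ‖e‖ ≤ 1 →
      |iteratedFDeriv ℝ m f y fun _ => e| ≤ C * m ! * R ^ m := by
  refine hK.induction_on (p := fun S => ∃ C R : ℝ, 0 ≤ C ∧ 0 < R ∧ ∀ y ∈ S, ∀ (m : ℕ)
    (e : Fin n → ℝ), ‖e‖ ≤ 1 → |iteratedFDeriv ℝ m f y fun _ => e| ≤ C * m ! * R ^ m)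
    ⟨0, 1, le_rfl, one_pos, by simp⟩ ?_ ?_ ?_
  · rintro S T hST ⟨C, R, hC, hR, h⟩
    exact ⟨C, R, hC, hR, fun y hy => h y (hST hy)⟩
  · rintro S T ⟨C, R, hC, hR, h⟩ ⟨C', R', hC', hR', h'⟩
    refine ⟨max C C', max R R', le_max_of_le_left hC, lt_max_of_lt_left hR, ?_⟩
    rintro y (hy | hy) m e he
    · exact (h y hy m e he).trans (by gcongr <;> apply le_max_left)
    · exact (h' y hy m e he).trans (by gcongr <;> apply le_max_right)
  · intro y _
    obtain ⟨C, R, hC, hR, h⟩ := (hf y (Set.mem_univ y)).exists_iteratedFDeriv_bound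
    exact ⟨_, mem_nhdsWithin_of_mem_nhds h, C, R, hC, hR, fun y hy => hy⟩

/-- The Fourier coefficients of an analytic function decay exponentially. -/
theorem TorusAnalytic.exists_decay {f : (Fin n → ℝ) → ℝ} (hf : TorusAnalytic f) :
    ∃ C ρ : ℝ, 0 ≤ C ∧ 0 < ρ ∧ ∀ k, ‖fourierCoef f k‖ ≤ C * Real.exp (-(ρ * ‖k‖)) := by
  obtain ⟨C, R, hC, hR, h⟩ := exists_iteratedFDeriv_bound_compact hf.analytic
    (isCompact_Icc : IsCompact (cell n))
  refine ⟨2 * C, (2 * R)⁻¹, by positivity, by positivity, fun k => ?_⟩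
  have hm : ∀ m : ℕ, ‖k‖ ^ m * ‖fourierCoef f k‖ ≤ C * m ! * R ^ m := by
    intro m
    rcases Nat.eq_zero_or_pos n with hn | hn
    · subst hn
      have h0 : ‖k‖ = 0 := by rw [Subsingleton.elim k 0, norm_zero]
      rcases Nat.eq_zero_or_pos m with rfl | hm
      · simp only [pow_zero, one_mul, Nat.factorial_zero, Nat.cast_one, mul_one]
        refine norm_fourierCoef_le (fun θ hθ => ?_) k
        have := h θ hθ 0 0 (norm_zero.trans_le zero_le_one)
        simpa using this
      · rw [h0, zero_pow hm.ne', zero_mul]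
        positivity
    -- In the direction of a largest component, `m` derivatives produce exactly the factor `‖k‖ ^
    -- m`.
    · obtain ⟨i, hi⟩ : ∃ i, ‖k‖ = ‖k i‖ := by
        have : Nonempty (Fin n) := ⟨⟨0, hn⟩⟩
        obtain ⟨i, hi⟩ := Finite.exists_max (fun i => ‖k i‖)
        exact ⟨i, le_antisymm ((pi_norm_le_iff_of_nonneg (norm_nonneg _)).2 hi)
          (norm_le_pi_norm k i)⟩
      have h1 := norm_fourierCoef_le (f := fun θ => iteratedFDeriv ℝ m f θ fun _ => Pi.single i 1)
        (fun θ hθ => h θ hθ m (Pi.single i 1) (by simp [Pi.norm_single])) k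
      rw [fourierCoef_iterate hf, norm_mul, norm_pow, norm_mul, Complex.norm_I, one_mul,
        Complex.norm_intCast, ← Int.norm_eq_abs, ← hi] at h1
      exact h1
  -- The bounds for all orders are weighted by `(2R)^(-m) / m!` and added: the left side sums to an
  -- exponential in `‖k‖`, the right side to a geometric series of ratio `1/2`.
  have hsum : HasSum (fun m : ℕ => ((2 * R)⁻¹ * ‖k‖) ^ m / m ! * ‖fourierCoef f k‖)
      (Real.exp ((2 * R)⁻¹ * ‖k‖) * ‖fourierCoef f k‖) := by
    have := (NormedSpace.expSeries_div_hasSum_exp ((2 * R)⁻¹ * ‖k‖)).mul_right ‖fourierCoef f k‖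
    rwa [← Real.exp_eq_exp_ℝ] at this
  have hle := hasSum_le (fun m => ?_) hsum (hasSum_geometric_two.mul_left C)
  · rw [Real.exp_neg, ← div_eq_mul_inv, le_div_iff₀ (Real.exp_pos _)]
    linarith
  · rw [mul_pow, div_mul_eq_mul_div, div_le_iff₀ (by positivity), mul_assoc]
    calc (2 * R)⁻¹ ^ m * (‖k‖ ^ m * ‖fourierCoef f k‖) ≤ (2 * R)⁻¹ ^ m * (C * m ! * R ^ m) := by
          exact mul_le_mul_of_nonneg_left (hm m) (by positivity)
      _ = C * (1 / 2) ^ m * m ! := by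
          rw [mul_inv, mul_pow, one_div, inv_pow R]
          field_simp

end Fourier

open FourierAlg

/-! ### The Fourier series of a real analytic function on the torus -/

section Inversion

open scoped Pointwise

variable {n : ℕ}

/-- The projection of `ℝⁿ` to the torus `(ℝ / ℤ)ⁿ`. -/
def torusProj (n : ℕ) : (Fin n → ℝ) → UnitAddTorus (Fin n) :=
  Pi.map fun _ => ((↑) : ℝ → UnitAddCircle)

theorem isOpenQuotientMap_torusProj (n : ℕ) : IsOpenQuotientMap (torusProj n) :=
  IsOpenQuotientMap.piMap fun _ => QuotientAddGroup.isOpenQuotientMap_mk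

theorem exists_of_torusProj_eq {x y : Fin n → ℝ} (h : torusProj n x = torusProj n y) :
    ∃ k : Fin n → ℤ, x = fun i => y i + (k i : ℝ) := by
  have h1 : ∀ i, ∃ k : ℤ, x i = y i + k := fun i => by
    have h2 : ((x i : ℝ) : UnitAddCircle) = ((y i : ℝ) : UnitAddCircle) := congrFun h i
    obtain ⟨k, hk⟩ := AddSubgroup.mem_zmultiples_iff.1 (QuotientAddGroup.eq.1 h2)
    refine ⟨-k, ?_⟩
    simp only [mul_one, zsmul_eq_mul] at hk
    push_cast
    linarith
  choose k hk using h1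
  exact ⟨k, funext hk⟩

theorem mFourier_torusProj (k : Fin n → ℤ) (x : Fin n → ℝ) :
    UnitAddTorus.mFourier k (torusProj n x) =
      Complex.exp (Complex.I * (kdot k ((2 * Real.pi) • x) : ℂ)) := by
  show ∏ i, fourier (k i) ((x i : ℝ) : UnitAddCircle) = _
  simp only [fourier_coe_apply]
  rw [← Complex.exp_sum]
  congr 1
  unfold kdot
  push_cast
  rw [Finset.mul_sum]
  refine Finset.sum_congr rfl fun i _ => ?_
  simp only [Pi.smul_apply, smul_eq_mul, Complex.ofReal_mul, Complex.ofReal_ofNat]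
  ring

theorem setIntegral_unit_cell (g : (Fin n → ℝ) → ℂ) :
    ∫ x in {x : Fin n → ℝ | ∀ i, x i ∈ Set.Ioc (0 : ℝ) (0 + 1)}, g ((2 * Real.pi) • x) =
      (((2 * Real.pi) ^ n)⁻¹ : ℝ) * ∫ θ in cell n, g θ := by
  have hpi : (0 : ℝ) < 2 * Real.pi := by positivity
  rw [Measure.setIntegral_comp_smul_of_pos volume g _ hpi, Module.finrank_fin_fun,
    Complex.real_smul]
  congr 1
  refine setIntegral_congr_set ?_
  have h1 : (2 * Real.pi) • {x : Fin n → ℝ | ∀ i, x i ∈ Set.Ioc (0 : ℝ) (0 + 1)} =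
      Set.univ.pi fun _ => Set.Ioc 0 (2 * Real.pi) := by
    ext θ
    rw [Set.mem_smul_set_iff_inv_smul_mem₀ hpi.ne']
    simp only [Set.mem_ofPred_eq, Pi.smul_apply, smul_eq_mul, Set.mem_Ioc, zero_add, Set.mem_pi,
      Set.mem_univ, true_imp_iff]
    refine forall_congr' fun i => ?_
    rw [inv_mul_le_iff₀ hpi, mul_one, mul_pos_iff_of_pos_left (inv_pos.2 hpi)]
  rw [h1]
  exact Measure.univ_pi_Ioc_ae_eq_Icc

theorem fourierCoef_neg (f : (Fin n → ℝ) → ℝ) (k : Fin n → ℤ) :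
    fourierCoef f (-k) = conj (fourierCoef f k) := by
  unfold fourierCoef
  rw [map_mul, Complex.conj_ofReal, ← integral_conj]
  congr 1
  refine integral_congr_ae (Eventually.of_forall fun θ => ?_)
  have : kdot (-k) θ = -kdot k θ := by simp [kdot]
  simp [this, ← Complex.exp_conj]

namespace TorusAnalytic

variable {f : (Fin n → ℝ) → ℝ}

theorem continuous (hf : TorusAnalytic f) : Continuous f :=
  continuous_iff_continuousAt.2 fun θ => (hf.analytic θ (Set.mem_univ θ)).continuousAt

theorem exists_wsum_ne_top (hf : TorusAnalytic f) :
    ∃ ρ : ℝ, 0 < ρ ∧ wsum ρ (fourierCoef f) ≠ ∞ := by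
  obtain ⟨C, ρ, hC, hρ, h⟩ := hf.exists_decay
  refine ⟨ρ / 2, by positivity, ?_⟩
  have hsum := (summable_one_add_norm_pow_inv n).mul_left
    (C * ((2 * n)! * Real.exp (ρ / 2) / (ρ / 2) ^ (2 * n)))
  refine ne_top_of_le_ne_top hsum.tsum_ofReal_ne_top (ENNReal.tsum_le_tsum fun k => ?_)
  rw [← ofReal_norm, ← ENNReal.ofReal_mul (Real.exp_pos _).le]
  refine ENNReal.ofReal_le_ofReal ?_
  -- Half of the decay pays for the weight, the other half for a summable power.
  have h1 := one_add_pow_le_exp (2 * n) (half_pos hρ) (norm_nonneg k)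
  have h2 : Real.exp (-(ρ * ‖k‖)) * Real.exp (ρ / 2 * ‖k‖) * Real.exp (ρ / 2 * ‖k‖) = 1 := by
    rw [← Real.exp_add, ← Real.exp_add, ← Real.exp_zero]
    congr 1
    ring
  rw [← div_eq_mul_inv, le_div_iff₀ (by positivity)]
  calc Real.exp (ρ / 2 * ‖k‖) * ‖fourierCoef f k‖ * (1 + ‖k‖) ^ (2 * n)
      ≤ Real.exp (ρ / 2 * ‖k‖) * (C * Real.exp (-(ρ * ‖k‖))) *
        ((2 * n)! * Real.exp (ρ / 2) / (ρ / 2) ^ (2 * n) * Real.exp (ρ / 2 * ‖k‖)) := by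
        gcongr
        exact h k
    _ = C * ((2 * n)! * Real.exp (ρ / 2) / (ρ / 2) ^ (2 * n)) *
        (Real.exp (-(ρ * ‖k‖)) * Real.exp (ρ / 2 * ‖k‖) * Real.exp (ρ / 2 * ‖k‖)) := by ring
    _ = _ := by rw [h2, mul_one]

/-- The Fourier coefficients as an element of the convolution algebra. -/
theorem summable_fourierCoef (hf : TorusAnalytic f) : Summable fun k => ‖fourierCoef f k‖ := by
  obtain ⟨ρ, hρ, h⟩ := hf.exists_wsum_ne_top
  exact summable_norm_iff_wsum.2 (ne_top_of_le_ne_top h (wsum_mono hρ.le _))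

/-- Fourier inversion. -/
theorem evalHom_fourierCoef (hf : TorusAnalytic f) (θ : Fin n → ℝ) :
    evalHom θ (ofFun (fourierCoef f)) = f θ := by
  have hpi : (2 * Real.pi : ℝ) ≠ 0 := by positivity
  -- After rescaling to period one the function descends to the unit torus. There the Fourier series
  -- of a continuous function with summable coefficients converges to it pointwise.
  set g : C(Fin n → ℝ, ℂ) := ⟨fun x => (f ((2 * Real.pi) • x) : ℂ), by
    have := hf.continuous
    fun_prop⟩ with hg
  have hq : IsQuotientMap (⟨torusProj n, (isOpenQuotientMap_torusProj n).continuous⟩ :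
      C(Fin n → ℝ, UnitAddTorus (Fin n))) := (isOpenQuotientMap_torusProj n).isQuotientMap
  have hfac : Function.FactorsThrough g (⟨torusProj n, (isOpenQuotientMap_torusProj n).continuous⟩ :
      C(Fin n → ℝ, UnitAddTorus (Fin n))) := fun x y hxy => by
    obtain ⟨k, rfl⟩ := exists_of_torusProj_eq hxy
    show ((f _ : ℝ) : ℂ) = ((f _ : ℝ) : ℂ)
    rw [← hf.periodic ((2 * Real.pi) • y) k]
    congr 2
    funext i
    simp [mul_add]
  set F : C(UnitAddTorus (Fin n), ℂ) := hq.lift g hfac with hF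
  have hFg : ∀ x, F (torusProj n x) = f ((2 * Real.pi) • x) := fun x =>
    DFunLike.congr_fun (hq.lift_comp g hfac) x
  have hco : ∀ k, UnitAddTorus.mFourierCoeff F k = fourierCoef f k := fun k => by
    rw [UnitAddTorus.mFourierCoeff_eq_integral F k (fun _ => 0)]
    unfold fourierCoef
    rw [← setIntegral_unit_cell]
    refine integral_congr_ae (Eventually.of_forall fun x => ?_)
    show UnitAddTorus.mFourier (-k) (torusProj n x) • F (torusProj n x) = _
    rw [mFourier_torusProj, hFg, smul_eq_mul, mul_comm]
    have : kdot (-k) ((2 * Real.pi) • x) = -kdot k ((2 * Real.pi) • x) := by simp [kdot]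
    rw [this]
    simp
  have hs : Summable (UnitAddTorus.mFourierCoeff F) := by
    have : UnitAddTorus.mFourierCoeff F = fourierCoef f := funext hco
    rw [this]
    exact hf.summable_fourierCoef.of_norm
  have h := (UnitAddTorus.hasSum_mFourier_series_apply_of_summable hs
    (torusProj n ((2 * Real.pi)⁻¹ • θ))).tsum_eq
  rw [hFg, smul_inv_smul₀ hpi] at h
  rw [← h, evalHom_apply]
  unfold eval
  refine tsum_congr fun k => ?_
  rw [hco, mFourier_torusProj, smul_inv_smul₀ hpi, smul_eq_mul,
    ofFun_apply hf.summable_fourierCoef]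

end TorusAnalytic

end Inversion

namespace FourierAlg

variable {n : ℕ}

/-! ### The approximate solution of second order -/

/-- The magnetic field as an element of the convolution algebra. -/
def magAlg (B₀ : ℝ) (f : FourierAlg n) (ε : ℝ) : FourierAlg n := (B₀ : ℂ) • 1 + (ε : ℂ) • f

/-- The coefficient of order one of the formal solution of the Riccati equation. -/
def lindstedtOne (B₀ : ℝ) (f : FourierAlg n) (ω : Fin n → ℝ) : FourierAlg n :=
  resolvent ω (4 * Complex.I * B₀) ((-(8 * B₀) : ℂ) • f)

/-- The coefficient of order two of the formal solution of the Riccati equation. -/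
def lindstedtTwo (B₀ : ℝ) (f : FourierAlg n) (ω : Fin n → ℝ) : FourierAlg n :=
  resolvent ω (4 * Complex.I * B₀) (-lindstedtOne B₀ f ω ^ 2 - (4 : ℂ) • f ^ 2)

/-- The truncation of the formal solution of the Riccati equation. -/
def lindstedtState (B₀ : ℝ) (f : FourierAlg n) (ε : ℝ) (ω : Fin n → ℝ) : RiccatiState n where
  σ := (2 * Complex.I * B₀) • 1 +
    ((ε : ℂ) • lindstedtOne B₀ f ω + (ε ^ 2 : ℂ) • lindstedtTwo B₀ f ω)
  S := resolvent ω 0 ((ε : ℂ) • lindstedtOne B₀ f ω + (ε ^ 2 : ℂ) • lindstedtTwo B₀ f ω)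
  E := (2 * ε ^ 3 : ℂ) • (lindstedtOne B₀ f ω * lindstedtTwo B₀ f ω) +
    (ε ^ 4 : ℂ) • lindstedtTwo B₀ f ω ^ 2

/-- The constant in the bounds for the truncation. -/
def lindstedtConst (B₀ A : ℝ) : ℝ := 1 + 16 * B₀ * A + 2 * ((16 * B₀ * A) ^ 2 + 4 * A ^ 2)

theorem one_le_lindstedtConst {B₀ A : ℝ} (hB : 0 < B₀) (hA : 0 ≤ A) : 1 ≤ lindstedtConst B₀ A := by
  unfold lindstedtConst
  have : 0 ≤ 16 * B₀ * A + 2 * ((16 * B₀ * A) ^ 2 + 4 * A ^ 2) := by positivity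
  linarith

section Bounds

variable {B₀ A s δ l ε : ℝ} {f : FourierAlg n} {O : Set (Fin n → ℝ)}

theorem bound_lindstedtOne' (hB : 0 < B₀) (hA : 0 ≤ A) (hs : 0 ≤ s)
    (hf : wsum (s + δ) f ≤ ENNReal.ofReal A)
    (h4 : ResBound O (fun _ => 4 * Complex.I * B₀) l δ) :
    FBound s O (lindstedtOne B₀ f) (16 * B₀ * A * l) := by
  have h := FBound.resolvent hs h4 ((FBound.const hf hA).smul (-(8 * B₀) : ℂ))
  refine h.le (le_of_eq ?_)
  have : ‖(-(8 * B₀) : ℂ)‖ = 8 * B₀ := by simp [abs_of_pos hB]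
  rw [this]
  ring

theorem bound_lindstedtOne (hB : 0 < B₀) (hA : 0 ≤ A) (hs : 0 ≤ s)
    (hf : wsum (s + δ) f ≤ ENNReal.ofReal A) (hl : 1 ≤ l)
    (h4 : ResBound O (fun _ => 4 * Complex.I * B₀) l δ) :
    FBound s O (lindstedtOne B₀ f) (lindstedtConst B₀ A * l) := by
  refine (bound_lindstedtOne' hB hA hs hf h4).le ?_
  unfold lindstedtConst
  gcongr
  have : 0 ≤ 2 * ((16 * B₀ * A) ^ 2 + 4 * A ^ 2) := by positivity
  linarith

theorem bound_lindstedtTwo (hB : 0 < B₀) (hA : 0 ≤ A) (hs : 0 ≤ s) (hδ : 0 ≤ δ)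
    (hf : wsum (s + δ + δ) f ≤ ENNReal.ofReal A) (hl : 1 ≤ l)
    (h4 : ResBound O (fun _ => 4 * Complex.I * B₀) l δ) :
    FBound s O (lindstedtTwo B₀ f) (lindstedtConst B₀ A * l ^ 3) := by
  have h1 := bound_lindstedtOne' hB hA (by positivity) hf h4
  have h2 : FBound (s + δ) O (fun _ : Fin n → ℝ => f) A :=
    (FBound.const hf hA).mono (by linarith) subset_rfl le_rfl
  have hsδ : 0 ≤ s + δ := by positivity
  have h3 := FBound.resolvent hs h4 ((h1.mul hsδ h1).neg.sub ((h2.mul hsδ h2).smul 4))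
  simp only [← pow_two] at h3
  refine h3.le ?_
  have e : ‖(4 : ℂ)‖ = 4 := by simp
  rw [e]
  have hl2 : A ^ 2 ≤ A ^ 2 * l ^ 2 := le_mul_of_one_le_right (by positivity) (one_le_pow₀ hl)
  calc 2 * l * ((16 * B₀ * A * l) ^ 2 + 4 * A ^ 2)
      ≤ 2 * l * ((16 * B₀ * A * l) ^ 2 + 4 * (A ^ 2 * l ^ 2)) := by gcongr
    _ = 2 * ((16 * B₀ * A) ^ 2 + 4 * A ^ 2) * l ^ 3 := by ring
    _ ≤ _ := by
        unfold lindstedtConst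
        gcongr
        have : 0 ≤ 16 * B₀ * A := by positivity
        linarith

theorem bound_lindstedt_sum (hB : 0 < B₀) (hA : 0 ≤ A) (hs : 0 ≤ s) (hδ : 0 ≤ δ)
    (hf : wsum (s + δ + δ) f ≤ ENNReal.ofReal A) (hl : 1 ≤ l) (hε : |ε| ≤ 1)
    (h4 : ResBound O (fun _ => 4 * Complex.I * B₀) l δ) :
    FBound s O (fun ω => (ε : ℂ) • lindstedtOne B₀ f ω + (ε ^ 2 : ℂ) • lindstedtTwo B₀ f ω)
      (2 * lindstedtConst B₀ A * l ^ 3 * |ε|) := by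
  have h1 := (bound_lindstedtOne hB hA hs (hf.trans' (wsum_mono (by linarith) _)) hl h4).smul ε
  have h2 := (bound_lindstedtTwo hB hA hs hδ hf hl h4).smul (ε ^ 2 : ℂ)
  refine (h1.add h2).le ?_
  have hQ := one_le_lindstedtConst hB hA
  rw [norm_pow, Complex.norm_real, Real.norm_eq_abs]
  have hl3 : l ≤ l ^ 3 := le_self_pow₀ hl (by norm_num)
  have e2 : |ε| ^ 2 ≤ |ε| := pow_le_of_le_one (abs_nonneg _) hε two_ne_zero
  calc |ε| * (lindstedtConst B₀ A * l) + |ε| ^ 2 * (lindstedtConst B₀ A * l ^ 3)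
      ≤ |ε| * (lindstedtConst B₀ A * l ^ 3) + |ε| * (lindstedtConst B₀ A * l ^ 3) := by gcongr
    _ = _ := by ring

theorem bound_lindstedtState_S (hB : 0 < B₀) (hA : 0 ≤ A) (hs : 0 ≤ s) (hδ : 0 ≤ δ)
    (hf : wsum (s + δ + δ + δ) f ≤ ENNReal.ofReal A) (hl : 1 ≤ l) (hε : |ε| ≤ 1)
    (h4 : ResBound O (fun _ => 4 * Complex.I * B₀) l δ) (h0 : ResBound O 0 l δ) :
    FBound s O (fun ω => (lindstedtState B₀ f ε ω).S)
      (4 * lindstedtConst B₀ A * l ^ 4 * |ε|) :=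
  (FBound.resolvent hs h0 (bound_lindstedt_sum hB hA (by positivity) hδ hf hl hε h4)).le
    (le_of_eq (by ring))

theorem bound_lindstedtState_E (hB : 0 < B₀) (hA : 0 ≤ A) (hs : 0 ≤ s) (hδ : 0 ≤ δ)
    (hf : wsum (s + δ + δ) f ≤ ENNReal.ofReal A) (hl : 1 ≤ l) (hε : |ε| ≤ 1)
    (h4 : ResBound O (fun _ => 4 * Complex.I * B₀) l δ) :
    FBound s O (fun ω => (lindstedtState B₀ f ε ω).E)
      (3 * lindstedtConst B₀ A ^ 2 * l ^ 6 * |ε| ^ 3) := by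
  have h1 := bound_lindstedtOne hB hA hs (hf.trans' (wsum_mono (by linarith) _)) hl h4
  have h2 := bound_lindstedtTwo hB hA hs hδ hf hl h4
  have h3 := ((h1.mul hs h2).smul (2 * ε ^ 3 : ℂ)).add ((h2.mul hs h2).smul (ε ^ 4 : ℂ))
  simp only [← pow_two] at h3
  refine h3.le ?_
  have hQ := one_le_lindstedtConst hB hA
  simp only [norm_mul, norm_pow, Complex.norm_real, Real.norm_eq_abs, Complex.norm_ofNat]
  have hl4 : l ^ 4 ≤ l ^ 6 := pow_le_pow_right₀ hl (by norm_num)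
  have e4 : |ε| ^ 4 ≤ |ε| ^ 3 := pow_le_pow_of_le_one (abs_nonneg _) hε (by norm_num)
  calc 2 * |ε| ^ 3 * (lindstedtConst B₀ A * l * (lindstedtConst B₀ A * l ^ 3)) +
        |ε| ^ 4 * (lindstedtConst B₀ A * l ^ 3) ^ 2
      = 2 * |ε| ^ 3 * (lindstedtConst B₀ A ^ 2 * l ^ 4) +
        |ε| ^ 4 * (lindstedtConst B₀ A ^ 2 * l ^ 6) := by ring
    _ ≤ 2 * |ε| ^ 3 * (lindstedtConst B₀ A ^ 2 * l ^ 6) +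
        |ε| ^ 3 * (lindstedtConst B₀ A ^ 2 * l ^ 6) := by gcongr
    _ = _ := by ring

end Bounds

/-- Collecting powers of `ε`: order zero cancels since `(2iB₀)² = -4B₀²`, orders one and two cancel
by the choice of the two coefficients, and orders three and four form `E`. An error of third order
is what later lets the Newton corrections be bounded by `ε²` without a divisor constant. -/
theorem isRiccati_lindstedtState {B₀ A s δ l : ℝ} (ε : ℝ) {f : FourierAlg n} {ω : Fin n → ℝ}
    (hB : 0 < B₀) (hA : 0 ≤ A) (hs : 0 ≤ s) (hδ : 0 ≤ δ)
    (hf : wsum (s + δ + δ + δ) f ≤ ENNReal.ofReal A)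
    (hl : 1 ≤ l) (hε : |ε| ≤ 1)
    (h4 : ResBound {ω} (fun _ => 4 * Complex.I * B₀) l δ) (h0 : ResBound {ω} 0 l δ)
    (hd4 : ∀ k, Complex.I * (kdot k ω : ℂ) + 4 * Complex.I * B₀ ≠ 0)
    (hd0 : ∀ k, k ≠ 0 → kdot k ω ≠ 0) :
    IsRiccati ω ((4 : ℂ) • magAlg B₀ f ε ^ 2) (lindstedtState B₀ f ε ω) := by
  have hω := Set.mem_singleton ω
  have b1 := bound_lindstedtOne (s := δ) hB hA hδ (hf.trans' (wsum_mono (by linarith) _)) hl h4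
  have bs := bound_lindstedt_sum (s := δ) hB hA hδ hδ (hf.trans' (wsum_mono (by linarith) _))
    hl hε h4
  have hfδ : FBound δ {ω} (fun _ => f) A :=
    FBound.const (hf.trans' (wsum_mono (by linarith) _)) hA
  have d1 : IsDeriv ω (lindstedtOne B₀ f ω) _ :=
    isDeriv_resolvent h4 hω ((hfδ.smul (-(8 * B₀) : ℂ)).wsum_ne_top hω) hd4
  have d2 : IsDeriv ω (lindstedtTwo B₀ f ω) _ :=
    isDeriv_resolvent h4 hω ((((b1.mul hδ b1).neg.sub ((hfδ.mul hδ hfδ).smul 4)).congr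
      (y := fun ω => -lindstedtOne B₀ f ω ^ 2 - (4 : ℂ) • f ^ 2)
      (fun ω _ => by simp only [pow_two])).wsum_ne_top hω) hd4
  rw [show resolvent ω _ _ = lindstedtOne B₀ f ω from rfl] at d1
  rw [show resolvent ω _ _ = lindstedtTwo B₀ f ω from rfl] at d2
  refine ⟨?_, ?_⟩
  · have h := isDeriv_resolvent_zero h0 hω (bs.wsum_ne_top hω) hd0
    show IsDeriv ω (lindstedtState B₀ f ε ω).S _
    convert h using 1
    · rfl
    show (2 * Complex.I * B₀) • 1 + ((ε : ℂ) • lindstedtOne B₀ f ω +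
      (ε ^ 2 : ℂ) • lindstedtTwo B₀ f ω) - ((2 * Complex.I * B₀) • (1 : FourierAlg n) +
      ((ε : ℂ) • lindstedtOne B₀ f ω + (ε ^ 2 : ℂ) • lindstedtTwo B₀ f ω)) 0 • 1 = _
    rw [add_apply ((2 * Complex.I * B₀) • (1 : FourierAlg n)), smul_apply, one_def', mul_one,
      add_smul]
    abel
  · have h := (IsDeriv.one.smul (2 * Complex.I * B₀)).add
      ((d1.smul (ε : ℂ)).add (d2.smul (ε ^ 2 : ℂ)))
    show IsDeriv ω ((2 * Complex.I * B₀) • 1 + _) _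
    convert h using 1
    simp only [lindstedtState, magAlg, Algebra.smul_def, map_mul, map_neg, map_pow, map_ofNat]
    have hI : (algebraMap ℂ (FourierAlg n) Complex.I) ^ 2 = -1 := by
      rw [← map_pow, Complex.I_sq, map_neg, map_one]
    linear_combination (-4 * algebraMap ℂ (FourierAlg n) B₀ ^ 2) * hI

end FourierAlg

namespace FourierAlg

variable {n : ℕ}

theorem IsDeriv.of_eq {ω : Fin n → ℝ} {x y z : FourierAlg n} (h : IsDeriv ω x y) (e : z = y) :
    IsDeriv ω x z := e ▸ h

/-! ### Green operators -/

/-- Solution of `g'' + 4 B₀² g = x`. -/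
def freeGreen (B₀ : ℝ) (ω : Fin n → ℝ) (x : FourierAlg n) : FourierAlg n :=
  resolvent ω (-(2 * Complex.I * B₀)) (resolvent ω (2 * Complex.I * B₀) x)

/-- The derivative of `freeGreen`. -/
def freeGreenDeriv (B₀ : ℝ) (ω : Fin n → ℝ) (x : FourierAlg n) : FourierAlg n :=
  resolvent ω (2 * Complex.I * B₀) x + (2 * Complex.I * B₀) • freeGreen B₀ ω x

/-- First factor of the Green operator: solution of `y' + σ y = r`. -/
def greenFactor (ω : Fin n → ℝ) (μ : ℂ) (S r : FourierAlg n) : FourierAlg n :=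
  NormedSpace.exp (-S) * resolvent ω μ (NormedSpace.exp S * r)

/-- Solution of `g'' + F g = r`, where `σ` solves the Riccati equation, `μ` is the mean of `σ` and
`S` a primitive of `σ - μ`. -/
def green (ω : Fin n → ℝ) (μ : ℂ) (S r : FourierAlg n) : FourierAlg n :=
  greenFactor ω (-μ) (-S) (greenFactor ω μ S r)

section Free

variable {B₀ s δ l a : ℝ} {ω : Fin n → ℝ} {x : FourierAlg n}

theorem bound_freeGreen (hs : 0 ≤ s) (hδ : 0 ≤ δ)
    (h2 : ResBound {ω} (fun _ => 2 * Complex.I * B₀) l δ)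
    (h2' : ResBound {ω} (fun _ => -(2 * Complex.I * B₀)) l δ)
    (hx : FBound (s + δ + δ) {ω} (fun _ => x) a) :
    FBound s {ω} (fun ω => freeGreen B₀ ω x) (4 * l ^ 2 * a) :=
  (FBound.resolvent hs h2' (FBound.resolvent (by positivity) h2 hx)).le (le_of_eq (by ring))

theorem bound_freeGreenDeriv (hB : 0 < B₀) (hs : 0 ≤ s) (hδ : 0 ≤ δ)
    (h2 : ResBound {ω} (fun _ => 2 * Complex.I * B₀) l δ)
    (h2' : ResBound {ω} (fun _ => -(2 * Complex.I * B₀)) l δ)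
    (hx : FBound (s + δ + δ) {ω} (fun _ => x) a) :
    FBound s {ω} (fun ω => freeGreenDeriv B₀ ω x) (2 * l * a + 8 * B₀ * l ^ 2 * a) := by
  have h := (FBound.resolvent (by positivity) h2 hx).mono (by linarith : s ≤ s + δ) subset_rfl le_rfl
  refine (h.add ((bound_freeGreen hs hδ h2 h2' hx).smul (2 * Complex.I * B₀))).le (le_of_eq ?_)
  have : ‖(2 * Complex.I * B₀ : ℂ)‖ = 2 * B₀ := by simp [abs_of_pos hB]
  rw [this]
  ring

/-- The factorisation `∂² + 4B₀² = (∂ + 2iB₀)(∂ - 2iB₀)`, inverted one factor at a time. -/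
theorem isDeriv_freeGreen (hδ : 0 ≤ δ)
    (h2 : ResBound {ω} (fun _ => 2 * Complex.I * B₀) l δ)
    (h2' : ResBound {ω} (fun _ => -(2 * Complex.I * B₀)) l δ)
    (hx : FBound (δ + δ) {ω} (fun _ => x) a)
    (hd : ∀ k, Complex.I * (kdot k ω : ℂ) + 2 * Complex.I * B₀ ≠ 0)
    (hd' : ∀ k, Complex.I * (kdot k ω : ℂ) + -(2 * Complex.I * B₀) ≠ 0) :
    IsDeriv ω (freeGreen B₀ ω x) (freeGreenDeriv B₀ ω x) ∧
      IsDeriv ω (freeGreenDeriv B₀ ω x) (x - (4 * B₀ ^ 2 : ℂ) • freeGreen B₀ ω x) := by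
  have hω := Set.mem_singleton ω
  have d1 := isDeriv_resolvent h2 hω (ne_top_of_le_ne_top (hx.wsum_ne_top hω)
    (wsum_mono (by linarith) _)) hd
  have d2 : IsDeriv ω (freeGreen B₀ ω x) _ :=
    isDeriv_resolvent h2' hω ((FBound.resolvent hδ h2 hx).wsum_ne_top hω) hd'
  have d3 : IsDeriv ω (freeGreen B₀ ω x) (freeGreenDeriv B₀ ω x) := by
    refine IsDeriv.of_eq d2 ?_
    rw [neg_smul, sub_neg_eq_add]
    rfl
  refine ⟨d3, ?_⟩
  have h := d1.add (d3.smul (2 * Complex.I * B₀))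
  refine IsDeriv.of_eq h ?_
  unfold freeGreenDeriv
  simp only [Algebra.smul_def, map_mul, map_pow, map_ofNat]
  have hI : (algebraMap ℂ (FourierAlg n) Complex.I) ^ 2 = -1 := by
    rw [← map_pow, Complex.I_sq, map_neg, map_one]
  linear_combination (-4 * algebraMap ℂ (FourierAlg n) B₀ ^ 2 * freeGreen B₀ ω x) * hI

end Free

section Perturbed

variable {s δ l a : ℝ} {ω : Fin n → ℝ} {μ : ℂ} {σ S r F : FourierAlg n}

theorem exp_neg_mul_exp' (S : FourierAlg n) : NormedSpace.exp (-S) * NormedSpace.exp S = 1 := by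
  rw [← NormedSpace.exp_add_of_commute (Commute.all _ _)]
  simp

theorem exp_two_le : Real.exp 1 * Real.exp 1 ≤ 8 := by
  have h := Real.exp_one_lt_d9
  have h0 := Real.exp_pos 1
  nlinarith

theorem bound_greenFactor (hs : 0 ≤ s) (hδ : 0 ≤ δ) (hR : ResBound {ω} (fun _ => μ) l δ)
    (hS : FBound (s + δ) {ω} (fun _ => S) 1) (hr : FBound (s + δ) {ω} (fun _ => r) a) :
    FBound s {ω} (fun ω => greenFactor ω μ S r) (16 * l * a) := by
  have h1 := FBound.resolvent hs hR ((hS.exp (by positivity)).mul (by positivity) hr)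
  have h2 := ((hS.mono (by linarith) subset_rfl le_rfl).neg.exp hs).mul hs h1
  refine h2.le ?_
  have := exp_two_le
  have := hR.1
  have := mul_nonneg hR.1.le hr.1
  nlinarith

/-- The integrating factor `exp S` reduces `∂ + σ` to `∂ + μ`, which `resolvent` inverts. -/
theorem isDeriv_greenFactor (hR : ResBound {ω} (fun _ => μ) l δ)
    (hS : FBound δ {ω} (fun _ => S) 1) (hr : FBound δ {ω} (fun _ => r) a) (hδ : 0 ≤ δ)
    (hd : ∀ k, Complex.I * (kdot k ω : ℂ) + μ ≠ 0) (hS' : IsDeriv ω S (σ - μ • 1)) :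
    IsDeriv ω (greenFactor ω μ S r) (r - σ * greenFactor ω μ S r) := by
  have hω := Set.mem_singleton ω
  have d1 := isDeriv_resolvent hR hω (((hS.exp hδ).mul hδ hr).wsum_ne_top hω) hd
  have d2 := hS'.neg.exp.mul d1
  refine IsDeriv.of_eq d2 ?_
  have := exp_neg_mul_exp' S
  unfold greenFactor
  set y := resolvent ω μ (NormedSpace.exp S * r)
  simp only [Algebra.smul_def, mul_one]
  linear_combination (-r) * this

theorem bound_green (hs : 0 ≤ s) (hδ : 0 ≤ δ) (hR : ResBound {ω} (fun _ => μ) l δ)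
    (hR' : ResBound {ω} (fun _ => -μ) l δ) (hS : FBound (s + δ + δ) {ω} (fun _ => S) 1)
    (hr : FBound (s + δ + δ) {ω} (fun _ => r) a) :
    FBound s {ω} (fun ω => green ω μ S r) (256 * l ^ 2 * a) := by
  have h1 := bound_greenFactor (by positivity) hδ hR hS hr
  have h2 := bound_greenFactor hs hδ hR' (S := -S) (r := greenFactor ω μ S r)
    (hS.mono (by linarith) subset_rfl le_rfl).neg
    (h1.congr fun ω' h => by rw [Set.mem_singleton_iff.1 h])
  refine (h2.le (le_of_eq (by ring))).congr fun ω' h => ?_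
  rw [Set.mem_singleton_iff.1 h]
  rfl

/-- The Riccati equation says that `(∂ + σ)(∂ - σ) = ∂² - σ' - σ² = ∂² + F`. The second factor is
handled as the first one with `-σ`, `-μ`, `-S`. -/
theorem isDeriv_green (hδ : 0 ≤ δ) (hR : ResBound {ω} (fun _ => μ) l δ)
    (hR' : ResBound {ω} (fun _ => -μ) l δ) (hS : FBound (δ + δ) {ω} (fun _ => S) 1)
    (hr : FBound (δ + δ) {ω} (fun _ => r) a)
    (hd : ∀ k, Complex.I * (kdot k ω : ℂ) + μ ≠ 0)
    (hd' : ∀ k, Complex.I * (kdot k ω : ℂ) + -μ ≠ 0) (hS' : IsDeriv ω S (σ - μ • 1))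
    (hσ : IsDeriv ω σ (-σ ^ 2 - F)) :
    IsDeriv ω (green ω μ S r) (σ * green ω μ S r + greenFactor ω μ S r) ∧
      IsDeriv ω (σ * green ω μ S r + greenFactor ω μ S r) (r - F * green ω μ S r) := by
  have hS1 : FBound δ {ω} (fun _ => S) 1 := hS.mono (by linarith) subset_rfl le_rfl
  have hr1 : FBound δ {ω} (fun _ => r) a := hr.mono (by linarith) subset_rfl le_rfl
  have d1 := isDeriv_greenFactor hR hS1 hr1 hδ hd hS'
  have h1 := bound_greenFactor hδ hδ hR hS hr
  have hS'' : IsDeriv ω (-S) (-σ - (-μ) • 1) := by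
    have := hS'.neg
    refine IsDeriv.of_eq this ?_
    rw [neg_smul]
    abel
  have d2 := isDeriv_greenFactor (r := greenFactor ω μ S r) hR' hS1.neg
    (h1.congr fun ω' h => by rw [Set.mem_singleton_iff.1 h]) hδ hd' hS''
  have d3 : IsDeriv ω (green ω μ S r) (σ * green ω μ S r + greenFactor ω μ S r) := by
    refine IsDeriv.of_eq d2 ?_
    unfold green
    ring
  refine ⟨d3, ?_⟩
  have h := (hσ.mul d3).add d1
  refine IsDeriv.of_eq h ?_
  ring

end Perturbed

end FourierAlg

namespace FourierAlg

variable {n : ℕ}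

/-! ### The response to a constant momentum -/

theorem FBound.freeze {s a : ℝ} {ω : Fin n → ℝ} {x : (Fin n → ℝ) → FourierAlg n}
    (h : FBound s {ω} x a) : FBound s {ω} (fun _ => x ω) a :=
  h.congr fun ω' hω' => by rw [Set.mem_singleton_iff.1 hω']

/-- Bounds for the resolvents at a fixed frequency that do not depend on the perturbation. -/
structure FreeResBound (B₀ : ℝ) (ω : Fin n → ℝ) (l δ : ℝ) : Prop where
  one_le : 1 ≤ l
  two : ResBound {ω} (fun _ => 2 * Complex.I * B₀) l δ
  neg_two : ResBound {ω} (fun _ => -(2 * Complex.I * B₀)) l δ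
  four : ResBound {ω} (fun _ => 4 * Complex.I * B₀) l δ
  zero : ResBound {ω} 0 l δ

/-- The term of order one of the response. -/
def respOne (B₀ : ℝ) (f : FourierAlg n) (ω : Fin n → ℝ) : FourierAlg n :=
  freeGreen B₀ ω (-(4 : ℂ) • f)

/-- The source of the term of order two of the response. -/
def respTwoSource (B₀ : ℝ) (f : FourierAlg n) (ω : Fin n → ℝ) : FourierAlg n :=
  (-(8 * B₀) : ℂ) • (f * respOne B₀ f ω) - (4 * (B₀ : ℂ)⁻¹) • (f * f)

/-- The term of order two of the response. -/
def respTwo (B₀ : ℝ) (f : FourierAlg n) (ω : Fin n → ℝ) : FourierAlg n :=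
  freeGreen B₀ ω (respTwoSource B₀ f ω)

/-- The source of the remainder of the response. -/
def respSource (B₀ : ℝ) (f : FourierAlg n) (ε : ℝ) (ω : Fin n → ℝ) : FourierAlg n :=
  (-ε ^ 3 : ℂ) • ((8 * B₀ : ℂ) • (f * respTwo B₀ f ω) + (4 : ℂ) • (f * f * respOne B₀ f ω)) -
    (4 * ε ^ 4 : ℂ) • (f * f * respTwo B₀ f ω)

/-- The remainder of the response. -/
def respRem (B₀ : ℝ) (f : FourierAlg n) (ε : ℝ) (ω : Fin n → ℝ) (μ : ℂ) (S : FourierAlg n) :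
    FourierAlg n := green ω μ S (respSource B₀ f ε ω)

/-- The derivative of the remainder of the response. -/
def respRemDeriv (B₀ : ℝ) (f : FourierAlg n) (ε : ℝ) (ω : Fin n → ℝ) (μ : ℂ)
    (σ S : FourierAlg n) : FourierAlg n :=
  σ * respRem B₀ f ε ω μ S + greenFactor ω μ S (respSource B₀ f ε ω)

/-- The response: the quasiperiodic solution of `q'' + 4 B² q = 4 B`. -/
def response (B₀ : ℝ) (f : FourierAlg n) (ε : ℝ) (ω : Fin n → ℝ) (μ : ℂ) (S : FourierAlg n) :
    FourierAlg n :=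
  (B₀ : ℂ)⁻¹ • 1 + ((ε : ℂ) • respOne B₀ f ω + (ε ^ 2 : ℂ) • respTwo B₀ f ω) +
    respRem B₀ f ε ω μ S

/-- The derivative of the response. -/
def responseDeriv (B₀ : ℝ) (f : FourierAlg n) (ε : ℝ) (ω : Fin n → ℝ) (μ : ℂ)
    (σ S : FourierAlg n) : FourierAlg n :=
  ((ε : ℂ) • freeGreenDeriv B₀ ω (-(4 : ℂ) • f) +
    (ε ^ 2 : ℂ) • freeGreenDeriv B₀ ω (respTwoSource B₀ f ω)) + respRemDeriv B₀ f ε ω μ σ S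

/-- Twice the defect `1 - B q`, the velocity of the guiding centre. -/
def drift (B₀ : ℝ) (f : FourierAlg n) (ε : ℝ) (ω : Fin n → ℝ) (μ : ℂ) (S : FourierAlg n) :
    FourierAlg n := (2 : ℂ) • (1 - magAlg B₀ f ε * response B₀ f ε ω μ S)

/-- Used to compare all monomials in `|ε|`, `Q` and `l` occurring in an estimate with a single
dominating one. -/
theorem pow_mul_pow_mul_le {e Q l : ℝ} (he0 : 0 ≤ e) (he : e ≤ 1) (hQ : 1 ≤ Q) (hl : 1 ≤ l)
    {a a' i i' j j' : ℕ} (ha : a' ≤ a) (hi : i ≤ i') (hj : j ≤ j') :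
    e ^ a * Q ^ i * l ^ j ≤ e ^ a' * Q ^ i' * l ^ j' := by
  have h1 := pow_le_pow_of_le_one he0 he ha
  have h2 := pow_le_pow_right₀ hQ hi
  have h3 := pow_le_pow_right₀ hl hj
  have : (0 : ℝ) ≤ Q := by linarith
  have : (0 : ℝ) ≤ l := by linarith
  gcongr

section Bounds

variable {B₀ Q s δ l L ε : ℝ} {ω : Fin n → ℝ} {f : FourierAlg n}

theorem bound_respOne (h : FreeResBound B₀ ω l δ) (hs : 0 ≤ s) (hδ : 0 ≤ δ)
    (hf : FBound (s + δ + δ) {ω} (fun _ => f) Q) :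
    FBound s {ω} (fun _ => respOne B₀ f ω) (16 * Q * l ^ 2) := by
  have := (bound_freeGreen hs hδ h.two h.neg_two (hf.smul (-(4 : ℂ)))).freeze
  refine this.le (le_of_eq ?_)
  have : ‖-(4 : ℂ)‖ = 4 := by simp
  rw [this]
  ring

theorem bound_respOneDeriv (h : FreeResBound B₀ ω l δ) (hs : 0 ≤ s) (hδ : 0 ≤ δ) (hB : 0 < B₀)
    (hBQ : B₀ ≤ Q) (hQ : 1 ≤ Q) (hf : FBound (s + δ + δ) {ω} (fun _ => f) Q) :
    FBound s {ω} (fun _ => freeGreenDeriv B₀ ω (-(4 : ℂ) • f)) (40 * Q ^ 2 * l ^ 2) := by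
  have h1 := (bound_freeGreenDeriv hB hs hδ h.two h.neg_two (hf.smul (-(4 : ℂ)))).freeze
  refine h1.le ?_
  have e : ‖-(4 : ℂ)‖ = 4 := by simp
  have hl := h.one_le
  have := pow_mul_pow_mul_le (e := 1) zero_le_one le_rfl hQ hl (le_refl 0)
    (by norm_num : 1 ≤ 2) (by norm_num : 1 ≤ 2)
  rw [e]
  calc 2 * l * (4 * Q) + 8 * B₀ * l ^ 2 * (4 * Q)
      ≤ 2 * l * (4 * Q) + 8 * Q * l ^ 2 * (4 * Q) := by gcongr
    _ ≤ _ := by linarith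

theorem bound_respTwoSource (h : FreeResBound B₀ ω l δ) (hs : 0 ≤ s) (hδ : 0 ≤ δ) (hB : 0 < B₀)
    (hBQ : B₀ ≤ Q) (hBQ' : B₀⁻¹ ≤ Q) (hQ : 1 ≤ Q)
    (hf : FBound (s + δ + δ) {ω} (fun _ => f) Q) :
    FBound s {ω} (fun _ => respTwoSource B₀ f ω) (132 * Q ^ 3 * l ^ 2) := by
  have h1 := bound_respOne h hs hδ hf
  have hf' : FBound s {ω} (fun _ => f) Q := hf.mono (by linarith) subset_rfl le_rfl
  refine (((hf'.mul hs h1).smul (-(8 * B₀) : ℂ)).sub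
    ((hf'.mul hs hf').smul (4 * (B₀ : ℂ)⁻¹))).le ?_
  have e1 : ‖(-(8 * B₀) : ℂ)‖ = 8 * B₀ := by simp [abs_of_pos hB]
  have e2 : ‖(4 * (B₀ : ℂ)⁻¹)‖ = 4 * B₀⁻¹ := by simp [abs_of_pos hB]
  have hl := h.one_le
  have := pow_mul_pow_mul_le (e := 1) zero_le_one le_rfl hQ hl (le_refl 0)
    (by norm_num : 3 ≤ 3) (by norm_num : 0 ≤ 2)
  rw [e1, e2]
  calc 8 * B₀ * (Q * (16 * Q * l ^ 2)) + 4 * B₀⁻¹ * (Q * Q)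
      ≤ 8 * Q * (Q * (16 * Q * l ^ 2)) + 4 * Q * (Q * Q) := by gcongr
    _ ≤ _ := by linarith

theorem bound_respTwo (h : FreeResBound B₀ ω l δ) (hs : 0 ≤ s) (hδ : 0 ≤ δ) (hB : 0 < B₀)
    (hBQ : B₀ ≤ Q) (hBQ' : B₀⁻¹ ≤ Q) (hQ : 1 ≤ Q)
    (hf : FBound (s + δ + δ + δ + δ) {ω} (fun _ => f) Q) :
    FBound s {ω} (fun _ => respTwo B₀ f ω) (528 * Q ^ 3 * l ^ 4) :=
  (bound_freeGreen hs hδ h.two h.neg_two (bound_respTwoSource h (by positivity) hδ hB hBQ hBQ' hQ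
    hf)).freeze.le (le_of_eq (by ring))

theorem bound_respTwoDeriv (h : FreeResBound B₀ ω l δ) (hs : 0 ≤ s) (hδ : 0 ≤ δ) (hB : 0 < B₀)
    (hBQ : B₀ ≤ Q) (hBQ' : B₀⁻¹ ≤ Q) (hQ : 1 ≤ Q)
    (hf : FBound (s + δ + δ + δ + δ) {ω} (fun _ => f) Q) :
    FBound s {ω} (fun _ => freeGreenDeriv B₀ ω (respTwoSource B₀ f ω))
      (1320 * Q ^ 4 * l ^ 4) := by
  refine (bound_freeGreenDeriv hB hs hδ h.two h.neg_two (bound_respTwoSource h (by positivity) hδ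
    hB hBQ hBQ' hQ hf)).freeze.le ?_
  have hl := h.one_le
  have := pow_mul_pow_mul_le (e := 1) zero_le_one le_rfl hQ hl (le_refl 0)
    (by norm_num : 3 ≤ 4) (by norm_num : 3 ≤ 4)
  calc 2 * l * (132 * Q ^ 3 * l ^ 2) + 8 * B₀ * l ^ 2 * (132 * Q ^ 3 * l ^ 2)
      ≤ 2 * l * (132 * Q ^ 3 * l ^ 2) + 8 * Q * l ^ 2 * (132 * Q ^ 3 * l ^ 2) := by gcongr
    _ ≤ _ := by linarith

theorem bound_respSource (h : FreeResBound B₀ ω l δ) (hs : 0 ≤ s) (hδ : 0 ≤ δ) (hB : 0 < B₀)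
    (hBQ : B₀ ≤ Q) (hBQ' : B₀⁻¹ ≤ Q) (hQ : 1 ≤ Q) (hε : |ε| ≤ 1)
    (hf : FBound (s + δ + δ + δ + δ) {ω} (fun _ => f) Q) :
    FBound s {ω} (fun _ => respSource B₀ f ε ω) (6400 * Q ^ 5 * l ^ 4 * |ε| ^ 3) := by
  have h1 := bound_respOne h hs hδ (hf.mono (by linarith) subset_rfl le_rfl)
  have h2 := bound_respTwo h hs hδ hB hBQ hBQ' hQ hf
  have hf' : FBound s {ω} (fun _ => f) Q := hf.mono (by linarith) subset_rfl le_rfl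
  have hff := hf'.mul hs hf'
  refine (((((hf'.mul hs h2).smul (8 * B₀ : ℂ)).add ((hff.mul hs h1).smul 4)).smul
    (-ε ^ 3 : ℂ)).sub ((hff.mul hs h2).smul (4 * ε ^ 4 : ℂ))).le ?_
  have hl := h.one_le
  simp only [norm_mul, norm_neg, norm_pow, Complex.norm_real, Real.norm_eq_abs, Complex.norm_ofNat,
    abs_of_pos hB]
  have hm := @pow_mul_pow_mul_le |ε| Q l (abs_nonneg _) hε hQ hl
  have m1 := hm (le_refl 3) (by norm_num : 3 ≤ 5) (by norm_num : 2 ≤ 4)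
  have m2 := hm (by norm_num : 3 ≤ 4) (le_refl 5) (le_refl 4)
  calc |ε| ^ 3 * (8 * B₀ * (Q * (528 * Q ^ 3 * l ^ 4)) + 4 * (Q * Q * (16 * Q * l ^ 2))) +
        4 * |ε| ^ 4 * (Q * Q * (528 * Q ^ 3 * l ^ 4))
      ≤ |ε| ^ 3 * (8 * Q * (Q * (528 * Q ^ 3 * l ^ 4)) + 4 * (Q * Q * (16 * Q * l ^ 2))) +
        4 * |ε| ^ 4 * (Q * Q * (528 * Q ^ 3 * l ^ 4)) := by gcongr
    _ ≤ _ := by linarith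

end Bounds

/-- The setting in which the response is estimated: a solution `σ` of the Riccati equation with
mean `μ` and bounds with constant `L`, the perturbation being small compared with `L`. -/
structure ResponseSetting (B₀ Q : ℝ) (f : FourierAlg n) (ε : ℝ) (ω : Fin n → ℝ) (L δ : ℝ)
    (μ : ℂ) (σ S : FourierAlg n) : Prop where
  B_pos : 0 < B₀
  B_le : B₀ ≤ Q
  B_inv_le : B₀⁻¹ ≤ Q
  one_le_Q : 1 ≤ Q
  abs_le : |ε| ≤ 1
  δ_pos : 0 < δ
  free : FreeResBound B₀ ω L δ
  ne_two : ∀ k, Complex.I * (kdot k ω : ℂ) + 2 * Complex.I * B₀ ≠ 0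
  ne_neg_two : ∀ k, Complex.I * (kdot k ω : ℂ) + -(2 * Complex.I * B₀) ≠ 0
  ne_zero : ∀ k, k ≠ 0 → kdot k ω ≠ 0
  res : ResBound {ω} (fun _ => μ) L δ
  res_neg : ResBound {ω} (fun _ => -μ) L δ
  ne_mean : ∀ k, Complex.I * (kdot k ω : ℂ) + μ ≠ 0
  ne_neg_mean : ∀ k, Complex.I * (kdot k ω : ℂ) + -μ ≠ 0
  f_zero : f 0 = 0
  bound_f : FBound (7 * δ) {ω} (fun _ => f) Q
  bound_S : FBound (3 * δ) {ω} (fun _ => S) 1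
  norm_σ_le : ‖σ‖ ≤ 3 * Q
  deriv_S : IsDeriv ω S (σ - μ • 1)
  deriv_σ : IsDeriv ω σ (-σ ^ 2 - (4 : ℂ) • magAlg B₀ f ε ^ 2)
  small : 1638400 * Q ^ 5 * L ^ 6 * |ε| ≤ 1

end FourierAlg

namespace FourierAlg

namespace ResponseSetting

variable {n : ℕ} {B₀ Q ε L δ l : ℝ} {f σ S : FourierAlg n} {ω : Fin n → ℝ} {μ : ℂ}

/-! #### Bounds for the response -/

theorem Q_pos (h : ResponseSetting B₀ Q f ε ω L δ μ σ S) : 0 < Q := one_pos.trans_le h.one_le_Q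

theorem bound_f_mono (h : ResponseSetting B₀ Q f ε ω L δ μ σ S) {t : ℝ} (ht : t ≤ 7 * δ) :
    FBound t {ω} (fun _ => f) Q := h.bound_f.mono ht subset_rfl le_rfl

theorem bound_source (h : ResponseSetting B₀ Q f ε ω L δ μ σ S) :
    FBound (3 * δ) {ω} (fun _ => respSource B₀ f ε ω) (6400 * Q ^ 5 * L ^ 4 * |ε| ^ 3) := by
  have := h.δ_pos
  exact bound_respSource h.free (by positivity) this.le h.B_pos h.B_le h.B_inv_le h.one_le_Q
    h.abs_le (h.bound_f_mono (by linarith))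

/-- The Green operator costs `256 * L ^ 2` and the source is of third order with constant `6400 * Q
^ 5 * L ^ 4`. The smallness condition spends one power of `|ε|` on the product of these constants,
so the remaining bound is free of divisors. -/
theorem bound_rem (h : ResponseSetting B₀ Q f ε ω L δ μ σ S) :
    FBound δ {ω} (fun _ => respRem B₀ f ε ω μ S) (|ε| ^ 2) := by
  have hδ := h.δ_pos
  refine (bound_green hδ.le hδ.le h.res h.res_neg (h.bound_S.mono (by linarith) subset_rfl le_rfl)
    (h.bound_source.mono (by linarith) subset_rfl le_rfl)).freeze.le ?_
  have := h.small
  calc 256 * L ^ 2 * (6400 * Q ^ 5 * L ^ 4 * |ε| ^ 3)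
      = (1638400 * Q ^ 5 * L ^ 6 * |ε|) * |ε| ^ 2 := by ring
    _ ≤ 1 * |ε| ^ 2 := by gcongr
    _ = _ := one_mul _

theorem norm_rem_le (h : ResponseSetting B₀ Q f ε ω L δ μ σ S) :
    ‖respRem B₀ f ε ω μ S‖ ≤ |ε| ^ 2 :=
  h.bound_rem.norm_le h.δ_pos.le (Set.mem_singleton ω)

theorem norm_remDeriv_le (h : ResponseSetting B₀ Q f ε ω L δ μ σ S) :
    ‖respRemDeriv B₀ f ε ω μ σ S‖ ≤ 4 * Q * |ε| ^ 2 := by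
  have hδ := h.δ_pos
  have hQ := h.one_le_Q
  have h1 := (bound_greenFactor hδ.le hδ.le h.res
    (h.bound_S.mono (by linarith) subset_rfl le_rfl)
    (h.bound_source.mono (by linarith) subset_rfl le_rfl)).norm_le hδ.le (Set.mem_singleton ω)
  have h2 : 16 * L * (6400 * Q ^ 5 * L ^ 4 * |ε| ^ 3) ≤ |ε| ^ 2 := by
    have hL := h.free.one_le
    have hQ' := h.Q_pos
    calc 16 * L * (6400 * Q ^ 5 * L ^ 4 * |ε| ^ 3)
        = (102400 * Q ^ 5 * L ^ 5 * |ε|) * |ε| ^ 2 := by ring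
      _ ≤ (1638400 * Q ^ 5 * L ^ 6 * |ε|) * |ε| ^ 2 := by
          gcongr
          · norm_num
          · norm_num
      _ ≤ 1 * |ε| ^ 2 := by gcongr; exact h.small
      _ = _ := one_mul _
  have h3 : ‖σ * respRem B₀ f ε ω μ S‖ ≤ 3 * Q * |ε| ^ 2 :=
    (norm_mul_le _ _).trans (mul_le_mul h.norm_σ_le h.norm_rem_le (norm_nonneg _)
      (by positivity [h.Q_pos]))
  have h4 : |ε| ^ 2 ≤ Q * |ε| ^ 2 := le_mul_of_one_le_left (by positivity) hQ
  refine (norm_add_le _ _).trans ?_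
  linarith

theorem isDeriv_rem (h : ResponseSetting B₀ Q f ε ω L δ μ σ S) :
    IsDeriv ω (respRem B₀ f ε ω μ S) (respRemDeriv B₀ f ε ω μ σ S) ∧
      IsDeriv ω (respRemDeriv B₀ f ε ω μ σ S)
        (respSource B₀ f ε ω - (4 : ℂ) • magAlg B₀ f ε ^ 2 * respRem B₀ f ε ω μ S) := by
  have hδ := h.δ_pos
  exact isDeriv_green hδ.le h.res h.res_neg (h.bound_S.mono (by linarith) subset_rfl le_rfl)
    (h.bound_source.mono (by linarith) subset_rfl le_rfl) h.ne_mean h.ne_neg_mean h.deriv_S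
    h.deriv_σ

theorem isDeriv_one (h : ResponseSetting B₀ Q f ε ω L δ μ σ S) :
    IsDeriv ω (respOne B₀ f ω) (freeGreenDeriv B₀ ω (-(4 : ℂ) • f)) ∧
      IsDeriv ω (freeGreenDeriv B₀ ω (-(4 : ℂ) • f))
        (-(4 : ℂ) • f - (4 * B₀ ^ 2 : ℂ) • respOne B₀ f ω) := by
  have hδ := h.δ_pos
  exact isDeriv_freeGreen hδ.le h.free.two h.free.neg_two
    ((h.bound_f_mono (by linarith)).smul (-(4 : ℂ))) h.ne_two h.ne_neg_two

theorem isDeriv_two (h : ResponseSetting B₀ Q f ε ω L δ μ σ S) :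
    IsDeriv ω (respTwo B₀ f ω) (freeGreenDeriv B₀ ω (respTwoSource B₀ f ω)) ∧
      IsDeriv ω (freeGreenDeriv B₀ ω (respTwoSource B₀ f ω))
        (respTwoSource B₀ f ω - (4 * B₀ ^ 2 : ℂ) • respTwo B₀ f ω) := by
  have hδ := h.δ_pos
  exact isDeriv_freeGreen hδ.le h.free.two h.free.neg_two
    (bound_respTwoSource h.free (by positivity) hδ.le h.B_pos h.B_le h.B_inv_le h.one_le_Q
      (h.bound_f_mono (by linarith))) h.ne_two h.ne_neg_two

theorem isDeriv_response (h : ResponseSetting B₀ Q f ε ω L δ μ σ S) :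
    IsDeriv ω (response B₀ f ε ω μ S) (responseDeriv B₀ f ε ω μ σ S) :=
  (((IsDeriv.one.smul _).add ((h.isDeriv_one.1.smul _).add (h.isDeriv_two.1.smul _))).add
    h.isDeriv_rem.1).of_eq (by rw [smul_zero, zero_add]; rfl)

theorem isDeriv_responseDeriv (h : ResponseSetting B₀ Q f ε ω L δ μ σ S) :
    IsDeriv ω (responseDeriv B₀ f ε ω μ σ S) ((4 : ℂ) • magAlg B₀ f ε -
      (4 : ℂ) • magAlg B₀ f ε ^ 2 * response B₀ f ε ω μ S) := by
  have hB : (B₀ : ℂ) ≠ 0 := Complex.ofReal_ne_zero.2 h.B_pos.ne'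
  refine (((h.isDeriv_one.2.smul (ε : ℂ)).add (h.isDeriv_two.2.smul (ε ^ 2 : ℂ))).add
    h.isDeriv_rem.2).of_eq ?_
  unfold respTwoSource respSource response magAlg
  simp only [Algebra.smul_def, map_mul, map_neg, map_pow, map_ofNat]
  have hI : algebraMap ℂ (FourierAlg n) B₀ * algebraMap ℂ (FourierAlg n) (B₀ : ℂ)⁻¹ = 1 := by
    rw [← map_mul, mul_inv_cancel₀ hB, map_one]
  linear_combination (-(4 * algebraMap ℂ (FourierAlg n) B₀ +
    8 * algebraMap ℂ (FourierAlg n) ε * f)) * hI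

theorem mean_one (h : ResponseSetting B₀ Q f ε ω L δ μ σ S) : respOne B₀ f ω 0 = 0 := by
  have hB : (B₀ : ℂ) ≠ 0 := Complex.ofReal_ne_zero.2 h.B_pos.ne'
  have h1 := h.isDeriv_one.2 0
  rw [kdot_zero, sub_apply, smul_apply, smul_apply, h.f_zero] at h1
  simpa [hB] using h1

theorem mean_two (h : ResponseSetting B₀ Q f ε ω L δ μ σ S) :
    4 * (B₀ : ℂ) ^ 2 * respTwo B₀ f ω 0 =
      -(8 * B₀) * (f * respOne B₀ f ω) 0 - 4 * (B₀ : ℂ)⁻¹ * (f * f) 0 := by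
  have h1 := h.isDeriv_two.2 0
  rw [kdot_zero, sub_apply, smul_apply] at h1
  unfold respTwoSource at h1
  rw [sub_apply, smul_apply, smul_apply] at h1
  simp only [Complex.ofReal_zero, mul_zero, zero_mul] at h1
  linear_combination h1

/-- A derivative has mean zero, so averaging the equation of the remainder leaves an identity. It
determines a mean of the remainder to a higher order than `bound_rem` does. -/
theorem mean_rem (h : ResponseSetting B₀ Q f ε ω L δ μ σ S) :
    4 * (magAlg B₀ f ε ^ 2 * respRem B₀ f ε ω μ S) 0 = respSource B₀ f ε ω 0 := by
  have h1 := h.isDeriv_rem.2 0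
  rw [kdot_zero, sub_apply, smul_mul_assoc, smul_apply] at h1
  simp only [Complex.ofReal_zero, mul_zero, zero_mul] at h1
  linear_combination h1

/-! ### Estimates with a second divisor constant, independent of the smallness condition -/

section Fine

variable (h : ResponseSetting B₀ Q f ε ω L δ μ σ S) (hl : FreeResBound B₀ ω l δ)
include h hl

theorem bound_one_fine : FBound δ {ω} (fun _ => respOne B₀ f ω) (16 * Q * l ^ 2) := by
  have hδ := h.δ_pos
  exact bound_respOne hl hδ.le hδ.le (h.bound_f_mono (by linarith))

theorem bound_two_fine : FBound δ {ω} (fun _ => respTwo B₀ f ω) (528 * Q ^ 3 * l ^ 4) := by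
  have hδ := h.δ_pos
  exact bound_respTwo hl hδ.le hδ.le h.B_pos h.B_le h.B_inv_le h.one_le_Q
    (h.bound_f_mono (by linarith))

theorem norm_response_sub_le :
    ‖response B₀ f ε ω μ S - (B₀ : ℂ)⁻¹ • 1‖ ≤ 545 * Q ^ 3 * l ^ 4 * |ε| := by
  have hδ := h.δ_pos
  have hω := Set.mem_singleton ω
  have h1 := (((h.bound_one_fine hl).smul (ε : ℂ)).add ((h.bound_two_fine hl).smul (ε ^ 2 : ℂ))).add
    h.bound_rem
  have h2 := h1.norm_le hδ.le hω
  have e : response B₀ f ε ω μ S - (B₀ : ℂ)⁻¹ • 1 = (ε : ℂ) • respOne B₀ f ω +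
    (ε ^ 2 : ℂ) • respTwo B₀ f ω + respRem B₀ f ε ω μ S := by unfold response; abel
  rw [e]
  refine h2.trans ?_
  simp only [norm_pow, Complex.norm_real, Real.norm_eq_abs]
  have hm := @pow_mul_pow_mul_le |ε| Q l (abs_nonneg _) h.abs_le h.one_le_Q hl.one_le
  linarith [hm (le_refl 1) (by norm_num : 1 ≤ 3) (by norm_num : 2 ≤ 4),
    hm (by norm_num : 1 ≤ 2) (le_refl 3) (le_refl 4),
    hm (by norm_num : 1 ≤ 2) (by norm_num : 0 ≤ 3) (by norm_num : 0 ≤ 4)]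

theorem norm_responseDeriv_le :
    ‖responseDeriv B₀ f ε ω μ σ S‖ ≤ 1364 * Q ^ 4 * l ^ 4 * |ε| := by
  have hδ := h.δ_pos
  have hω := Set.mem_singleton ω
  have b1 := bound_respOneDeriv hl hδ.le hδ.le h.B_pos h.B_le h.one_le_Q
    (h.bound_f_mono (by linarith))
  have b2 := bound_respTwoDeriv hl hδ.le hδ.le h.B_pos h.B_le h.B_inv_le h.one_le_Q
    (h.bound_f_mono (by linarith))
  have h2 := ((b1.smul (ε : ℂ)).add (b2.smul (ε ^ 2 : ℂ))).norm_le hδ.le hω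
  refine (norm_add_le _ _).trans ((add_le_add h2 h.norm_remDeriv_le).trans ?_)
  simp only [norm_pow, Complex.norm_real, Real.norm_eq_abs]
  have hm := @pow_mul_pow_mul_le |ε| Q l (abs_nonneg _) h.abs_le h.one_le_Q hl.one_le
  linarith [hm (le_refl 1) (by norm_num : 2 ≤ 4) (by norm_num : 2 ≤ 4),
    hm (by norm_num : 1 ≤ 2) (le_refl 4) (le_refl 4),
    hm (by norm_num : 1 ≤ 2) (by norm_num : 1 ≤ 4) (by norm_num : 0 ≤ 4)]

-- Multiplying out: order zero cancels because the unperturbed response is `B₀⁻¹`.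
omit hl in
theorem one_sub_magAlg_mul_response :
    1 - magAlg B₀ f ε * response B₀ f ε ω μ S =
      -((ε : ℂ) • ((B₀ : ℂ)⁻¹ • f + (B₀ : ℂ) • respOne B₀ f ω) +
        (ε ^ 2 : ℂ) • (f * respOne B₀ f ω + (B₀ : ℂ) • respTwo B₀ f ω) +
        (ε ^ 3 : ℂ) • (f * respTwo B₀ f ω) + magAlg B₀ f ε * respRem B₀ f ε ω μ S) := by
  have hB : (B₀ : ℂ) ≠ 0 := Complex.ofReal_ne_zero.2 h.B_pos.ne'
  have hI : algebraMap ℂ (FourierAlg n) B₀ * algebraMap ℂ (FourierAlg n) (B₀ : ℂ)⁻¹ = 1 := by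
    rw [← map_mul, mul_inv_cancel₀ hB, map_one]
  unfold response magAlg
  simp only [Algebra.smul_def, map_pow, mul_one]
  linear_combination -hI

omit hl in
theorem bound_magAlg : FBound δ {ω} (fun _ => magAlg B₀ f ε) (2 * Q) := by
  have hδ := h.δ_pos
  refine ((FBound.one.smul (B₀ : ℂ)).add ((h.bound_f_mono (by linarith)).smul (ε : ℂ))).le ?_
  have := h.abs_le
  have := h.Q_pos
  simp only [Complex.norm_real, Real.norm_eq_abs, abs_of_pos h.B_pos]
  nlinarith [h.B_le]

theorem bound_drift :
    FBound δ {ω} (fun _ => drift B₀ f ε ω μ S) (2182 * Q ^ 4 * l ^ 4 * |ε|) := by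
  have hδ := h.δ_pos
  have hf' := h.bound_f_mono (by linarith : δ ≤ 7 * δ)
  have b1 := h.bound_one_fine hl
  have b2 := h.bound_two_fine hl
  have b := ((((((hf'.smul (B₀ : ℂ)⁻¹).add (b1.smul (B₀ : ℂ))).smul (ε : ℂ)).add
    (((hf'.mul hδ.le b1).add (b2.smul (B₀ : ℂ))).smul (ε ^ 2 : ℂ))).add
    ((hf'.mul hδ.le b2).smul (ε ^ 3 : ℂ))).add (h.bound_magAlg.mul hδ.le h.bound_rem)).neg.smul 2
  unfold drift
  rw [h.one_sub_magAlg_mul_response]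
  refine b.le ?_
  have hQ := h.Q_pos
  have hl1 := hl.one_le
  have hBi := h.B_inv_le
  have hBp := h.B_le
  simp only [norm_pow, norm_inv, Complex.norm_real, Real.norm_eq_abs, abs_of_pos h.B_pos,
    Complex.norm_ofNat]
  have hm := @pow_mul_pow_mul_le |ε| Q l (abs_nonneg _) h.abs_le h.one_le_Q hl.one_le
  calc _ ≤ 2 * (|ε| * (Q * Q + Q * (16 * Q * l ^ 2)) + |ε| ^ 2 * (Q * (16 * Q * l ^ 2) +
        Q * (528 * Q ^ 3 * l ^ 4)) + |ε| ^ 3 * (Q * (528 * Q ^ 3 * l ^ 4)) + 2 * Q * |ε| ^ 2) := by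
        gcongr
    _ ≤ _ := by
        linarith [hm (le_refl 1) (by norm_num : 2 ≤ 4) (by norm_num : 0 ≤ 4),
          hm (le_refl 1) (by norm_num : 2 ≤ 4) (by norm_num : 2 ≤ 4),
          hm (by norm_num : 1 ≤ 2) (by norm_num : 2 ≤ 4) (by norm_num : 2 ≤ 4),
          hm (by norm_num : 1 ≤ 2) (le_refl 4) (le_refl 4),
          hm (by norm_num : 1 ≤ 3) (le_refl 4) (le_refl 4),
          hm (by norm_num : 1 ≤ 2) (by norm_num : 1 ≤ 4) (by norm_num : 0 ≤ 4)]

theorem norm_resolvent_drift_le :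
    ‖resolvent ω 0 (drift B₀ f ε ω μ S)‖ ≤ 4364 * Q ^ 4 * l ^ 5 * |ε| := by
  have hd := (h.bound_drift hl).mono (by linarith : 0 + δ ≤ δ) subset_rfl le_rfl
  refine ((FBound.resolvent le_rfl hl.zero hd).norm_le le_rfl (Set.mem_singleton ω)).trans
    (le_of_eq (by ring))

omit hl in
theorem isDeriv_resolvent_drift :
    IsDeriv ω (resolvent ω 0 (drift B₀ f ε ω μ S))
      (drift B₀ f ε ω μ S - drift B₀ f ε ω μ S 0 • 1) :=
  isDeriv_resolvent_zero h.free.zero (Set.mem_singleton ω)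
    ((h.bound_drift h.free).wsum_ne_top (Set.mem_singleton ω)) h.ne_zero

/-- The first order has mean zero because `f` and the first-order response do. The second order is
reduced by `mean_two` to quadratic expressions in `f` and `respOne`. The remainder is only `O(ε²)`,
but it enters through the mean of `magAlg * respRem`, which `mean_rem` shows to be `O(ε³)`. -/
theorem norm_drift_zero_sub_le :
    ‖drift B₀ f ε ω μ S 0 - 2 * ε ^ 2 * ((f * respOne B₀ f ω) 0 + ((B₀ : ℂ)⁻¹) ^ 2 * (f * f) 0)‖ ≤
      4260 * Q ^ 6 * l ^ 4 * |ε| ^ 3 := by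
  have hδ := h.δ_pos
  have hB : (B₀ : ℂ) ≠ 0 := Complex.ofReal_ne_zero.2 h.B_pos.ne'
  have hω := Set.mem_singleton ω
  have hQ := h.Q_pos
  have hl1 := hl.one_le
  set r := respRem B₀ f ε ω μ S
  set X := (magAlg B₀ f ε * r) 0 with hX
  -- One factor of the squared field in `mean_rem` is split into its constant and its oscillating
  -- part; the latter brings the missing power of `ε`.
  have h2 : (B₀ : ℂ) * X = respSource B₀ f ε ω 0 / 4 - ε * (f * (magAlg B₀ f ε * r)) 0 := by
    have h3 := h.mean_rem
    have h4 : magAlg B₀ f ε ^ 2 * r = (B₀ : ℂ) • (magAlg B₀ f ε * r) +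
        (ε : ℂ) • (f * (magAlg B₀ f ε * r)) := by
      simp only [magAlg, Algebra.smul_def, mul_one]
      ring
    rw [h4, add_apply, smul_apply, smul_apply, ← hX] at h3
    linear_combination h3 / 4
  have hdr : drift B₀ f ε ω μ S 0 - 2 * ε ^ 2 * ((f * respOne B₀ f ω) 0 +
      ((B₀ : ℂ)⁻¹) ^ 2 * (f * f) 0) = -(2 * (ε ^ 3 * (f * respTwo B₀ f ω) 0 + X)) := by
    have h4 : (B₀ : ℂ) * respTwo B₀ f ω 0 = -2 * (f * respOne B₀ f ω) 0 -
        ((B₀ : ℂ)⁻¹) ^ 2 * (f * f) 0 := by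
      have h5 := h.mean_two
      field_simp at h5 ⊢
      linear_combination h5 / 4
    unfold drift
    rw [h.one_sub_magAlg_mul_response]
    simp only [smul_apply, neg_apply, add_apply, h.mean_one, h.f_zero]
    linear_combination (-2 * (ε : ℂ) ^ 2) * h4
  have b2 := (h.bound_two_fine hl).norm_le hδ.le hω
  have bf := (h.bound_f_mono (by linarith : δ ≤ 7 * δ)).norm_le hδ.le hω
  have bs := (bound_respSource hl hδ.le hδ.le h.B_pos h.B_le h.B_inv_le h.one_le_Q h.abs_le
    (h.bound_f_mono (by linarith))).coeff_le hδ.le hω 0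
  have bB := h.bound_magAlg.norm_le hδ.le hω
  have c1 : ‖(f * respTwo B₀ f ω) 0‖ ≤ Q * (528 * Q ^ 3 * l ^ 4) :=
    (norm_apply_le _ _).trans ((norm_mul_le _ _).trans (by gcongr))
  have c2 : ‖(f * (magAlg B₀ f ε * r)) 0‖ ≤ Q * (2 * Q * |ε| ^ 2) := by
    refine (norm_apply_le _ _).trans ((norm_mul_le _ _).trans ?_)
    gcongr
    refine (norm_mul_le _ _).trans ?_
    gcongr
    exact h.norm_rem_le
  have c3 : ‖X‖ ≤ Q * (6400 * Q ^ 5 * l ^ 4 * |ε| ^ 3 / 4 + |ε| * (Q * (2 * Q * |ε| ^ 2))) := by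
    have e : X = (B₀ : ℂ)⁻¹ * (respSource B₀ f ε ω 0 / 4 - ε * (f * (magAlg B₀ f ε * r)) 0) := by
      rw [← h2, inv_mul_cancel_left₀ hB]
    rw [e, norm_mul, norm_inv, Complex.norm_real, Real.norm_of_nonneg h.B_pos.le]
    refine mul_le_mul h.B_inv_le ((norm_sub_le _ _).trans (add_le_add ?_ ?_)) (norm_nonneg _) hQ.le
    · rw [norm_div, Complex.norm_ofNat]
      gcongr
    · rw [norm_mul, Complex.norm_real, Real.norm_eq_abs]
      gcongr
  rw [hdr, norm_neg, norm_mul, Complex.norm_ofNat]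
  have c4 : ‖(ε : ℂ) ^ 3 * (f * respTwo B₀ f ω) 0 + X‖ ≤
      |ε| ^ 3 * (Q * (528 * Q ^ 3 * l ^ 4)) +
      Q * (6400 * Q ^ 5 * l ^ 4 * |ε| ^ 3 / 4 + |ε| * (Q * (2 * Q * |ε| ^ 2))) := by
    refine (norm_add_le _ _).trans (add_le_add ?_ c3)
    rw [norm_mul, norm_pow, Complex.norm_real, Real.norm_eq_abs]
    gcongr
  have hm := @pow_mul_pow_mul_le |ε| Q l (abs_nonneg _) h.abs_le h.one_le_Q hl.one_le
  linarith [hm (le_refl 3) (by norm_num : 4 ≤ 6) (le_refl 4),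
    hm (le_refl 3) (by norm_num : 3 ≤ 6) (by norm_num : 0 ≤ 4)]

end Fine

end ResponseSetting

end FourierAlg

namespace FourierAlg

variable {n : ℕ}

/-! ### The constant of the drift -/

theorem kdot_neg_left (k : Fin n → ℤ) (θ : Fin n → ℝ) : kdot (-k) θ = -kdot k θ := by
  simp [kdot]

/-- The function `g_ω` as an element of the convolution algebra. -/
def gAlg (B₀ : ℝ) (f : FourierAlg n) (ω : Fin n → ℝ) : FourierAlg n :=
  (-((1 / Real.sqrt (2 * B₀) : ℝ) : ℂ)) •
    (f - (2 * B₀ * Complex.I : ℂ) • resolvent ω (2 * Complex.I * B₀) f)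

section

variable {B₀ δ l : ℝ} {ω : Fin n → ℝ} {f : FourierAlg n}

theorem add_two_ne_zero (hd : ∀ k, Complex.I * (kdot k ω : ℂ) + 2 * Complex.I * B₀ ≠ 0)
    (k : Fin n → ℤ) : kdot k ω + 2 * B₀ ≠ 0 := fun h => hd k (by
  have : ((kdot k ω + 2 * B₀ : ℝ) : ℂ) = 0 := by rw [h, Complex.ofReal_zero]
  push_cast at this
  linear_combination Complex.I * this)

/-- Partial fractions: `x/(x + 2B₀) = 1 - 2B₀/(x + 2B₀)`, the last term being a resolvent of `f`. -/
theorem gAlg_apply (h2 : ResBound {ω} (fun _ => 2 * Complex.I * B₀) l δ) (hf : wsum δ f ≠ ∞)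
    (hd : ∀ k, Complex.I * (kdot k ω : ℂ) + 2 * Complex.I * B₀ ≠ 0) (k : Fin n → ℤ) :
    gAlg B₀ f ω k = -((1 / Real.sqrt (2 * B₀) : ℝ) : ℂ) *
      (((kdot k ω / (kdot k ω + 2 * B₀) : ℝ) : ℂ) * f k) := by
  unfold gAlg
  rw [smul_apply, sub_apply, smul_apply, resolvent_apply h2 (Set.mem_singleton ω) hf]
  congr 1
  have h1 : ((kdot k ω : ℝ) + 2 * B₀ : ℂ) ≠ 0 := by
    exact_mod_cast add_two_ne_zero hd k
  have h3 : Complex.I * (kdot k ω : ℂ) + 2 * Complex.I * B₀ =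
      Complex.I * ((kdot k ω : ℝ) + 2 * B₀ : ℂ) := by ring
  rw [h3, mul_inv]
  push_cast
  field_simp
  ring

theorem respOne_apply (h : FreeResBound B₀ ω l δ) (hδ : 0 ≤ δ) (hf : wsum (δ + δ) f ≠ ∞)
    (hd : ∀ k, Complex.I * (kdot k ω : ℂ) + 2 * Complex.I * B₀ ≠ 0) (k : Fin n → ℤ) :
    respOne B₀ f ω k = 4 * ((kdot k ω + 2 * B₀ : ℝ) : ℂ)⁻¹ * ((kdot k ω - 2 * B₀ : ℝ) : ℂ)⁻¹ *
      f k := by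
  have hω := Set.mem_singleton ω
  have hf' : FBound (δ + δ) {ω} (fun _ => -(4 : ℂ) • f) (‖-(4 : ℂ)‖ * (wsum (δ + δ) f).toReal) :=
    (FBound.const (by rw [ENNReal.ofReal_toReal hf]) ENNReal.toReal_nonneg).smul _
  unfold respOne freeGreen
  rw [resolvent_apply h.neg_two hω ((FBound.resolvent hδ h.two hf').wsum_ne_top hω),
    resolvent_apply h.two hω (ne_top_of_le_ne_top (hf'.wsum_ne_top hω) (wsum_mono (by linarith) _)),
    smul_apply]
  have h1 := add_two_ne_zero hd k
  have h2 := add_two_ne_zero hd (-k)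
  rw [kdot_neg_left] at h2
  have h1' : ((kdot k ω : ℝ) + 2 * B₀ : ℂ) ≠ 0 := by exact_mod_cast h1
  have h2' : ((kdot k ω : ℝ) - 2 * B₀ : ℂ) ≠ 0 := by
    have : kdot k ω - 2 * B₀ ≠ 0 := fun h => h2 (by linarith)
    exact_mod_cast this
  have e1 : Complex.I * (kdot k ω : ℂ) + 2 * Complex.I * B₀ =
      Complex.I * ((kdot k ω : ℝ) + 2 * B₀ : ℂ) := by ring
  have e2 : Complex.I * (kdot k ω : ℂ) + -(2 * Complex.I * B₀) =
      Complex.I * ((kdot k ω : ℝ) - 2 * B₀ : ℂ) := by ring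
  rw [e1, e2, mul_inv, mul_inv, Complex.inv_I]
  push_cast
  linear_combination (4 * ((kdot k ω : ℝ) + 2 * B₀ : ℂ)⁻¹ * ((kdot k ω : ℝ) - 2 * B₀ : ℂ)⁻¹ * f k) *
    -Complex.I_sq

/-- The three means are sums over the pairs `k, -k`. With `x = k·ω`, the terms agree by `4/(x² -
4B₀²) + 1/B₀² = x²/(B₀²(x² - 4B₀²))`, the right side being the product of the multipliers of `g_ω`
at `k` and `-k`, up to the normalisation. -/
theorem mean_identity (hB : 0 < B₀) (h : FreeResBound B₀ ω l δ) (hδ : 0 ≤ δ)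
    (hf : wsum (δ + δ) f ≠ ∞)
    (hd : ∀ k, Complex.I * (kdot k ω : ℂ) + 2 * Complex.I * B₀ ≠ 0) :
    (f * respOne B₀ f ω) 0 + ((B₀ : ℂ)⁻¹) ^ 2 * (f * f) 0 =
      2 * (B₀ : ℂ)⁻¹ * (gAlg B₀ f ω * gAlg B₀ f ω) 0 := by
  have hB' : (B₀ : ℂ) ≠ 0 := Complex.ofReal_ne_zero.2 hB.ne'
  have hfδ : wsum δ f ≠ ∞ := ne_top_of_le_ne_top hf (wsum_mono (by linarith) _)
  rw [mul_apply, mul_apply, mul_apply, ← tsum_mul_left, ← tsum_mul_left,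
    ← (summable_conv f _ 0).of_norm.tsum_add ((summable_conv f f 0).of_norm.mul_left _)]
  refine tsum_congr fun k => ?_
  rw [gAlg_apply h.two hfδ hd, gAlg_apply h.two hfδ hd, respOne_apply h hδ hf hd, zero_sub,
    kdot_neg_left]
  have h1 := add_two_ne_zero hd k
  have h2 := add_two_ne_zero hd (-k)
  rw [kdot_neg_left] at h2
  have hs : ((1 / Real.sqrt (2 * B₀) : ℝ) : ℂ) ^ 2 = (2 * (B₀ : ℂ))⁻¹ := by
    rw [← Complex.ofReal_pow, div_pow, Real.sq_sqrt (by positivity)]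
    push_cast
    simp
  have e1 : ((-kdot k ω - 2 * B₀ : ℝ) : ℂ) = -((kdot k ω : ℝ) + 2 * B₀ : ℂ) := by push_cast; ring
  have h1' : ((kdot k ω : ℝ) + 2 * B₀ : ℂ) ≠ 0 := by exact_mod_cast h1
  have h2' : (-(kdot k ω : ℝ) + 2 * B₀ : ℂ) ≠ 0 := by exact_mod_cast h2
  rw [e1]
  have key : f k * (4 * ((-kdot k ω + 2 * B₀ : ℝ) : ℂ)⁻¹ * (-((kdot k ω : ℝ) + 2 * B₀ : ℂ))⁻¹ *
      f (-k)) + (B₀ : ℂ)⁻¹ ^ 2 * (f k * f (-k)) = 2 * (B₀ : ℂ)⁻¹ *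
      ((2 * (B₀ : ℂ))⁻¹ * ((((kdot k ω / (kdot k ω + 2 * B₀) : ℝ) : ℂ) * f k) *
        (((-kdot k ω / (-kdot k ω + 2 * B₀) : ℝ) : ℂ) * f (-k)))) := by
    push_cast
    field_simp
    ring
  rw [key, ← hs]
  ring

end

theorem cOmega_eq {B₀ δ l : ℝ} {ω : Fin n → ℝ} {f : (Fin n → ℝ) → ℝ} (hf : TorusAnalytic f)
    (h2 : ResBound {ω} (fun _ => 2 * Complex.I * B₀) l δ)
    (hw : wsum δ (ofFun (fourierCoef f)) ≠ ∞)
    (hd : ∀ k, Complex.I * (kdot k ω : ℂ) + 2 * Complex.I * B₀ ≠ 0) :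
    cOmega B₀ f ω = -(gAlg B₀ (ofFun (fourierCoef f)) ω * gAlg B₀ (ofFun (fourierCoef f)) ω) 0 := by
  unfold cOmega
  rw [← integral_cell_eval]
  congr 3
  funext θ
  rw [map_mul, ← pow_two]
  congr 1
  rw [evalHom_apply]
  unfold eval gOmega
  rw [← tsum_mul_left]
  refine tsum_congr fun k => ?_
  rw [gAlg_apply h2 hw hd, ofFun_apply hf.summable_fourierCoef]
  ring

/-- Although `g_ω` is complex, the multipliers are real and conjugation exchanges `f̂(k)` and
`f̂(-k)`, so each term of the sum for the mean of `g_ω²` is real. -/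
theorem cOmega_im {B₀ δ l : ℝ} {ω : Fin n → ℝ} {f : (Fin n → ℝ) → ℝ} (hf : TorusAnalytic f)
    (h2 : ResBound {ω} (fun _ => 2 * Complex.I * B₀) l δ)
    (hw : wsum δ (ofFun (fourierCoef f)) ≠ ∞)
    (hd : ∀ k, Complex.I * (kdot k ω : ℂ) + 2 * Complex.I * B₀ ≠ 0) :
    (cOmega B₀ f ω).im = 0 := by
  rw [← Complex.conj_eq_iff_im, cOmega_eq hf h2 hw hd, map_neg, mul_apply, Complex.conj_tsum]
  congr 1
  refine tsum_congr fun k => ?_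
  have hc : ∀ k, conj (ofFun (fourierCoef f) k) = ofFun (fourierCoef f) (-k) := fun k => by
    rw [ofFun_apply hf.summable_fourierCoef, ofFun_apply hf.summable_fourierCoef, fourierCoef_neg]
  rw [gAlg_apply h2 hw hd, gAlg_apply h2 hw hd, zero_sub]
  simp only [map_mul, map_neg, Complex.conj_ofReal, hc, neg_neg]
  ring

end FourierAlg

namespace FourierAlg

variable {n : ℕ}

/-! ### Riccati solutions along the flow -/

theorem IsDeriv.hasDerivAt_re {ω : Fin n → ℝ} {x y : FourierAlg n} (h : IsDeriv ω x y) (t : ℝ) :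
    HasDerivAt (fun t : ℝ => (evalHom (t • ω) x).re) (evalHom (t • ω) y).re t :=
  Complex.reCLM.hasFDerivAt.comp_hasDerivAt t (h.hasDerivAt t)

theorem IsDeriv.hasDerivAt_im {ω : Fin n → ℝ} {x y : FourierAlg n} (h : IsDeriv ω x y) (t : ℝ) :
    HasDerivAt (fun t : ℝ => (evalHom (t • ω) x).im) (evalHom (t • ω) y).im t :=
  Complex.imCLM.hasFDerivAt.comp_hasDerivAt t (h.hasDerivAt t)

theorem evalHom_smul_one (θ : Fin n → ℝ) (a : ℂ) : evalHom θ (a • (1 : FourierAlg n)) = a := by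
  rw [map_smul, map_one, smul_eq_mul, mul_one]

theorem abs_im_evalHom_sub_le {σ : FourierAlg n} {z : ℂ} {r : ℝ} (h : ‖σ - z • 1‖ ≤ r)
    (θ : Fin n → ℝ) : |(evalHom θ σ).im - z.im| ≤ r := by
  have h1 := (norm_evalHom_le θ (σ - z • 1)).trans h
  rw [map_sub, evalHom_smul_one] at h1
  rw [← Complex.sub_im]
  exact (Complex.abs_im_le_norm _).trans h1

theorem abs_re_evalHom_le (x : FourierAlg n) (θ : Fin n → ℝ) : |(evalHom θ x).re| ≤ ‖x‖ :=
  (Complex.abs_re_le_norm _).trans (norm_evalHom_le θ x)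

/-- A solution of a real Riccati equation with positive imaginary part has purely imaginary mean,
and its imaginary part is given by a primitive of its real part. -/
theorem riccati_mean_re_and_invariant {ω : Fin n → ℝ} {σ S F : FourierAlg n} {a b : ℝ}
    (hS : IsDeriv ω S (σ - σ 0 • 1)) (hσ : IsDeriv ω σ (-σ ^ 2 - F))
    (hF : ∀ θ, (evalHom θ F).im = 0) (ha : 0 < a)
    (hν : ∀ θ, a ≤ (evalHom θ σ).im) (hνb : ∀ θ, (evalHom θ σ).im ≤ b) :
    (σ 0).re = 0 ∧ ∀ t : ℝ, (evalHom (t • ω) σ).im * Real.exp (2 * (evalHom (t • ω) S).re) =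
      (evalHom 0 σ).im * Real.exp (2 * (evalHom 0 S).re) := by
  set m := (σ 0).re
  set N : ℝ → ℝ := fun t => (evalHom (t • ω) σ).im *
    Real.exp (2 * (evalHom (t • ω) S).re) with hN
  -- With `y = exp(∫σ)`, this product is a multiple of the Wronskian of `y` and its conjugate; the
  -- factor `exp(2mt)` restores the mean that was removed from the primitive `S`.
  have hder : ∀ t, HasDerivAt (fun t => N t * Real.exp (2 * m * t)) 0 t := fun t => by
    have h1 := hσ.hasDerivAt_im t
    have h2 := ((hS.hasDerivAt_re t).const_mul 2).exp
    have h3 := ((hasDerivAt_id t).const_mul (2 * m)).exp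
    refine ((h1.mul h2).mul h3).congr_deriv ?_
    rw [map_sub, map_neg, map_pow, map_sub, evalHom_smul_one, Complex.sub_im, Complex.neg_im, hF,
      Complex.sub_re, pow_two, Complex.mul_im]
    simp only [id_eq, Pi.mul_apply]
    ring
  have hconst : ∀ t, N t * Real.exp (2 * m * t) = N 0 := fun t => by
    have := is_const_of_deriv_eq_zero (fun t => (hder t).differentiableAt) (fun t => (hder t).deriv)
      t 0
    simpa using this
  have hlow : ∀ t, a * Real.exp (-(2 * ‖S‖)) ≤ N t := fun t => by
    have := (abs_le.1 (abs_re_evalHom_le S (t • ω))).1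
    exact mul_le_mul (hν _) (Real.exp_le_exp.2 (by linarith)) (Real.exp_pos _).le
      (ha.le.trans (hν _))
  have hup : ∀ t, N t ≤ b * Real.exp (2 * ‖S‖) := fun t => by
    have := (abs_le.1 (abs_re_evalHom_le S (t • ω))).2
    exact mul_le_mul (hνb _) (Real.exp_le_exp.2 (by linarith)) (Real.exp_pos _).le
      (ha.le.trans ((hν 0).trans (hνb 0)))
  set A := a * Real.exp (-(2 * ‖S‖)) with hA
  set D := b * Real.exp (2 * ‖S‖) with hD
  have hA0 : 0 < A := by positivity
  have hexp : ∀ t, Real.exp (2 * m * t) ≤ D / A := fun t => by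
    rw [le_div_iff₀ hA0]
    calc Real.exp (2 * m * t) * A ≤ Real.exp (2 * m * t) * N t := by gcongr; exact hlow t
      _ = N 0 := by rw [mul_comm, hconst]
      _ ≤ D := hup 0
  -- Otherwise, at the time `(D/A)/(2m)`, the bound would read `exp(D/A) ≤ D/A`.
  have hm : m = 0 := by
    by_contra hm
    have h1 := hexp ((D / A) / (2 * m))
    rw [mul_div_cancel₀ _ (by positivity : 2 * m ≠ 0)] at h1
    have := Real.add_one_le_exp (D / A)
    linarith
  refine ⟨hm, fun t => ?_⟩
  have := hconst t
  rw [hm] at this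
  simpa [hN] using this

/-! ### The nonresonant frequencies -/

/-- The frequencies in the cell that are nonresonant with constant `γ` for the unperturbed
problem. -/
def freeSet (B₀ : ℝ) (n : ℕ) (γ : ℝ) : Set (Fin n → ℝ) :=
  {ω ∈ cell n | ∀ k : Fin n → ℤ, k ≠ 0 → γ / (1 + ‖k‖) ^ (2 * n) ≤ |kdot k ω| ∧
    γ / (1 + ‖k‖) ^ (2 * n) ≤ |kdot k ω + 2 * B₀| ∧
    γ / (1 + ‖k‖) ^ (2 * n) ≤ |kdot k ω + 4 * B₀|}

theorem volume_sdiff_freeSet_le (B₀ : ℝ) (n : ℕ) {γ : ℝ} (hγ : 0 ≤ γ) :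
    volume (cell n \ freeSet B₀ n γ) ≤ ENNReal.ofReal (3 * γ) * resonanceConst n := by
  have h : ∀ β : ℝ, volume {ω ∈ cell n | ∃ k : Fin n → ℤ, k ≠ 0 ∧
      |kdot k ω + β| < γ / (1 + ‖k‖) ^ (2 * n)} ≤ ENNReal.ofReal γ * resonanceConst n := fun β =>
    volume_resonances_le subset_rfl (β := fun _ => β)
      (fun ω _ ω' _ => by simp only [sub_self, abs_zero]; positivity) hγ
  refine (measure_mono (t := ({ω ∈ cell n | ∃ k : Fin n → ℤ, k ≠ 0 ∧
      |kdot k ω + 0| < γ / (1 + ‖k‖) ^ (2 * n)} ∪ {ω ∈ cell n | ∃ k : Fin n → ℤ, k ≠ 0 ∧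
      |kdot k ω + 2 * B₀| < γ / (1 + ‖k‖) ^ (2 * n)}) ∪ {ω ∈ cell n | ∃ k : Fin n → ℤ, k ≠ 0 ∧
      |kdot k ω + 4 * B₀| < γ / (1 + ‖k‖) ^ (2 * n)}) ?_).trans ?_
  · rintro ω ⟨hω, hn⟩
    by_contra hcon
    refine hn ⟨hω, fun k hk => ⟨?_, ?_, ?_⟩⟩
    · by_contra hlt
      exact hcon (Or.inl (Or.inl ⟨hω, k, hk, by rw [add_zero]; exact not_le.1 hlt⟩))
    · by_contra hlt
      exact hcon (Or.inl (Or.inr ⟨hω, k, hk, not_le.1 hlt⟩))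
    · by_contra hlt
      exact hcon (Or.inr ⟨hω, k, hk, not_le.1 hlt⟩)
  · refine (measure_union_le _ _).trans ((add_le_add ((measure_union_le _ _).trans
      (add_le_add (h _) (h _))) (h _)).trans_eq ?_)
    rw [← add_mul, ← add_mul, ← ENNReal.ofReal_add hγ hγ, ← ENNReal.ofReal_add (by positivity) hγ]
    congr 2
    ring

section

variable {B₀ γ δ : ℝ}

/-- The bound with `-2B₀` is the one with `2B₀` at `-k`; at `k = 0` the condition `γ ≤ B₀` suffices.
-/
theorem lower_of_mem_freeSet (hB : 0 < B₀) (hγB : γ ≤ B₀) {ω : Fin n → ℝ} (hω : ω ∈ freeSet B₀ n γ) (k : Fin n → ℤ) :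
    γ / (1 + ‖k‖) ^ (2 * n) ≤ |kdot k ω + 2 * B₀| ∧
      γ / (1 + ‖k‖) ^ (2 * n) ≤ |kdot k ω - 2 * B₀| ∧
      γ / (1 + ‖k‖) ^ (2 * n) ≤ |kdot k ω + 4 * B₀| := by
  by_cases hk : k = 0
  · subst hk
    simp only [norm_zero, add_zero, one_pow, div_one, kdot_zero, zero_add, zero_sub, abs_neg]
    rw [abs_of_pos (by positivity), abs_of_pos (by positivity)]
    exact ⟨by linarith, by linarith, by linarith⟩
  · have h1 := hω.2 k hk
    have h2 := (hω.2 (-k) (neg_ne_zero.2 hk)).2.1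
    rw [kdot_neg_left, norm_neg] at h2
    refine ⟨h1.2.1, ?_, h1.2.2⟩
    rw [← abs_neg]
    convert h2 using 2
    ring

theorem norm_I_mul_add_I_mul (x y : ℝ) : ‖Complex.I * (x : ℂ) + Complex.I * (y : ℂ)‖ = |x + y| := by
  rw [← mul_add, norm_mul, Complex.norm_I, one_mul, ← Complex.ofReal_add, Complex.norm_real,
    Real.norm_eq_abs]

theorem resBound_const (hγ : 0 < γ) (hγ1 : γ ≤ 1) (hδ : 0 < δ) {O : Set (Fin n → ℝ)} {y : ℝ} {m : ℕ}
    (h : ∀ ω ∈ O, ∀ k : Fin n → ℤ, γ / (1 + ‖k‖) ^ m ≤ |kdot k ω + y|) :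
    ResBound O (fun _ => Complex.I * (y : ℂ)) (divConst n m γ δ) δ :=
  resBound_of_lower hγ hγ1 hδ (fun k => Or.inr fun ω hω => by
    rw [norm_I_mul_add_I_mul]; exact h ω hω k) (by simp)

theorem resBound_zero_of_lower (hγ : 0 < γ) (hγ1 : γ ≤ 1) (hδ : 0 < δ) {O : Set (Fin n → ℝ)} {m : ℕ}
    (h : ∀ ω ∈ O, ∀ k : Fin n → ℤ, k ≠ 0 → γ / (1 + ‖k‖) ^ m ≤ |kdot k ω|) :
    ResBound O 0 (divConst n m γ δ) δ :=
  resBound_of_lower hγ hγ1 hδ (fun k => by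
    by_cases hk : k = 0
    · left
      intro ω _
      simp [hk, kdot_zero]
    · right
      intro ω hω
      simpa using h ω hω k hk) (by simp)

theorem freeResBound_of_lower (hγ : 0 < γ) (hγ1 : γ ≤ 1) (hδ : 0 < δ) {m : ℕ} {ω : Fin n → ℝ}
    (h2 : ∀ k : Fin n → ℤ, γ / (1 + ‖k‖) ^ m ≤ |kdot k ω + 2 * B₀|)
    (h4 : ∀ k : Fin n → ℤ, γ / (1 + ‖k‖) ^ m ≤ |kdot k ω + 4 * B₀|)
    (h0 : ∀ k : Fin n → ℤ, k ≠ 0 → γ / (1 + ‖k‖) ^ m ≤ |kdot k ω|) :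
    FreeResBound B₀ ω (divConst n m γ δ) δ := by
  refine ⟨one_le_divConst n _ hγ hγ1 hδ, ?_, ?_, ?_, ?_⟩
  · have := resBound_const (O := {ω}) (y := 2 * B₀) hγ hγ1 hδ (fun ω' h k => by
      rw [Set.mem_singleton_iff.1 h]; exact h2 k)
    convert this using 2
    push_cast; ring
  · have := resBound_const (O := {ω}) (y := -(2 * B₀)) hγ hγ1 hδ (fun ω' h k => by
      have := h2 (-k)
      rw [norm_neg, kdot_neg_left] at this
      rw [Set.mem_singleton_iff.1 h, ← abs_neg]
      convert this using 2
      ring)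
    convert this using 2
    push_cast; ring
  · have := resBound_const (O := {ω}) (y := 4 * B₀) hγ hγ1 hδ (fun ω' h k => by
      rw [Set.mem_singleton_iff.1 h]; exact h4 k)
    convert this using 2
    push_cast; ring
  · exact resBound_zero_of_lower hγ hγ1 hδ (fun ω' h k hk => by
      rw [Set.mem_singleton_iff.1 h]; exact h0 k hk)

theorem freeResBound_of_mem_freeSet (hB : 0 < B₀) (hγ : 0 < γ) (hγ1 : γ ≤ 1) (hγB : γ ≤ B₀)
    (hδ : 0 < δ) {ω : Fin n → ℝ} (hω : ω ∈ freeSet B₀ n γ) :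
    FreeResBound B₀ ω (divConst n (2 * n) γ δ) δ :=
  freeResBound_of_lower hγ hγ1 hδ (fun k => (lower_of_mem_freeSet hB hγB hω k).1)
    (fun k => (lower_of_mem_freeSet hB hγB hω k).2.2) fun k hk => (hω.2 k hk).1

/-- Since `1 + |k|^τ ≤ 2(1 + |k|)^⌈τ⌉`, half of `γ` suffices; the minimum with 1 meets the
normalisation of the divisor constants. The resulting constant does not depend on `ε`, and this is
the source of the uniformity without loss. -/
theorem freeResBound_of_mem_diophantine {τ : ℝ} (hγ : 0 < γ) (hτ : 0 ≤ τ) (hδ : 0 < δ)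
    {ω : Fin n → ℝ} (hω : ω ∈ diophantine B₀ n γ τ) :
    FreeResBound B₀ ω (divConst n ⌈τ⌉₊ (min γ 1 / 2) δ) δ := by
  have hx : ∀ k : Fin n → ℤ, ‖k‖ ^ τ ≤ (1 + ‖k‖) ^ ⌈τ⌉₊ := fun k => by
    rw [← Real.rpow_natCast]
    exact (Real.rpow_le_rpow (norm_nonneg k) (by linarith) hτ).trans
      (Real.rpow_le_rpow_of_exponent_le (by linarith [norm_nonneg k]) (Nat.le_ceil τ))
  have h1 : ∀ k : Fin n → ℤ, (1 : ℝ) ≤ (1 + ‖k‖) ^ ⌈τ⌉₊ := fun k =>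
    one_le_pow₀ (by linarith [norm_nonneg k])
  have hm : min γ 1 ≤ γ := min_le_left _ _
  have hm0 : 0 < min γ 1 := lt_min hγ one_pos
  have hle : ∀ k : Fin n → ℤ, min γ 1 / 2 / (1 + ‖k‖) ^ ⌈τ⌉₊ ≤ γ / (1 + ‖k‖ ^ τ) := fun k => by
    rw [div_div]
    have : 0 ≤ ‖k‖ ^ τ := by positivity
    exact div_le_div₀ hγ.le hm (by positivity) (by linarith [hx k, h1 k])
  refine freeResBound_of_lower (by positivity) (by linarith [min_le_right γ 1]) hδ
    (fun k => (hle k).trans (hω.2.1 k)) (fun k => (hle k).trans (hω.2.2.1 k))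
    fun k hk => le_trans ?_ (hω.2.2.2 k hk)
  have : 0 < ‖k‖ := norm_pos_iff.2 hk
  exact div_le_div₀ hγ.le (by linarith) (by positivity) (hx k)

theorem mem_nonresonant_of_mem_freeSet (hB : 0 < B₀) (hγ : 0 < γ) (hγB : γ ≤ B₀)
    {ω : Fin n → ℝ} (hω : ω ∈ freeSet B₀ n γ) : ω ∈ nonresonant B₀ n := by
  have h1 : ∀ k : Fin n → ℤ, (1 + ‖k‖) ^ (2 * n) ≤ (1 + ‖k‖) ^ (2 * n + 1) := fun k =>
    pow_le_pow_right₀ (by linarith [norm_nonneg k]) (by omega)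
  -- The exponent `2n + 1` is positive also for `n = 0`. The power of two comes from comparing `(1 +
  -- |k|)^p` with `1 + |k|^p`, and with `|k|^p` when `|k| ≥ 1`.
  refine ⟨hω.1, γ / 2 ^ (2 * n + 1), ((2 * n + 1 : ℕ) : ℝ), by positivity, by positivity,
    fun k => le_trans ?_ (lower_of_mem_freeSet hB hγB hω k).1, fun k hk => le_trans ?_ (hω.2 k hk).1⟩
  · rw [Real.rpow_natCast, div_div]
    refine div_le_div_of_nonneg_left hγ.le (by positivity) ((h1 k).trans
      ((add_pow_le zero_le_one (norm_nonneg k) _).trans ?_))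
    rw [one_pow]
    gcongr <;> simp
  · rw [Real.rpow_natCast, div_div, ← mul_pow]
    have hk1 : 1 ≤ ‖k‖ := by
      obtain ⟨i, hi⟩ : ∃ i, k i ≠ 0 := Function.ne_iff.1 hk
      refine le_trans ?_ (norm_le_pi_norm k i)
      rw [Int.norm_eq_abs]
      exact_mod_cast Int.one_le_abs hi
    exact div_le_div_of_nonneg_left hγ.le (by positivity) ((h1 k).trans
      (pow_le_pow_left₀ (by positivity) (by linarith) _))

end

end FourierAlg

namespace FourierAlg

variable {n : ℕ}

/-! ### The Riccati solution near the unperturbed one -/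

/-- The size of the neighbourhood of the unperturbed solution. -/
def kamRadius (B₀ : ℝ) : ℝ := min (1 / 4) B₀

/-- The constant in the smallness condition. -/
def kamConst (B₀ Q : ℝ) (n : ℕ) : ℝ :=
  86400 * lindstedtConst B₀ Q ^ 2 * (2 ^ (2 * (2 * n) + 3)) ^ 2 * (kamRadius B₀)⁻¹ +
    1638400 * Q ^ 5

/-- The perturbation is small compared with the bounds for the divisors. -/
structure KamSetting (B₀ Q : ℝ) (f : FourierAlg n) (ε γ δ : ℝ) : Prop where
  B_pos : 0 < B₀
  B_le : B₀ ≤ Q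
  B_inv_le : B₀⁻¹ ≤ Q
  one_le_Q : 1 ≤ Q
  abs_le_one : |ε| ≤ 1
  δ_pos : 0 < δ
  γ_pos : 0 < γ
  γ_le_one : γ ≤ 1
  γ_le : γ ≤ B₀
  wsum_f_le : wsum (9 * δ) f ≤ ENNReal.ofReal Q
  f_zero : f 0 = 0
  real_f : ∀ θ, (evalHom θ f).im = 0
  small : kamConst B₀ Q n * (divConst n (2 * n) γ δ + divConst n (2 * n) γ (6 * δ / 8)) ^ 8 *
    |ε| ≤ 1

namespace KamSetting

variable {B₀ Q ε γ δ l : ℝ} {f : FourierAlg n} {ω : Fin n → ℝ}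

theorem radius_pos (h : KamSetting B₀ Q f ε γ δ) : 0 < kamRadius B₀ :=
  lt_min (by norm_num) h.B_pos

theorem one_le_lindstedt (h : KamSetting B₀ Q f ε γ δ) : 1 ≤ lindstedtConst B₀ Q :=
  one_le_lindstedtConst h.B_pos (zero_le_one.trans h.one_le_Q)

theorem one_le_div (h : KamSetting B₀ Q f ε γ δ) : 1 ≤ divConst n (2 * n) γ δ :=
  one_le_divConst n _ h.γ_pos h.γ_le_one h.δ_pos

theorem one_le_div' (h : KamSetting B₀ Q f ε γ δ) : 1 ≤ divConst n (2 * n) γ (6 * δ / 8) :=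
  one_le_divConst n _ h.γ_pos h.γ_le_one (by have := h.δ_pos; positivity)

/-- The consequences of the smallness condition, in terms of monomials. -/
theorem monomial_le (h : KamSetting B₀ Q f ε γ δ) {i a b c : ℕ} (hi : i ≤ 2) (hab : a + b ≤ 8)
    (hc : 1 ≤ c) :
    86400 * (2 ^ (2 * (2 * n) + 3)) ^ 2 * (lindstedtConst B₀ Q ^ i * divConst n (2 * n) γ δ ^ a *
      divConst n (2 * n) γ (6 * δ / 8) ^ b * |ε| ^ c) ≤ kamRadius B₀ := by
  have hP := h.one_le_lindstedt
  have h1 := h.one_le_div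
  have h2 := h.one_le_div'
  have hr := h.radius_pos
  have hs := h.small
  have hQ := h.one_le_Q
  set P := lindstedtConst B₀ Q
  set x := divConst n (2 * n) γ δ
  set y := divConst n (2 * n) γ (6 * δ / 8)
  have hm : P ^ i * x ^ a * y ^ b * |ε| ^ c ≤ P ^ 2 * (x + y) ^ 8 * |ε| := by
    calc P ^ i * x ^ a * y ^ b * |ε| ^ c ≤ P ^ 2 * (x + y) ^ a * (x + y) ^ b * |ε| := by
          have : |ε| ^ c ≤ |ε| := pow_le_of_le_one (abs_nonneg _) h.abs_le_one (by omega)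
          gcongr
          · linarith
          · linarith
      _ = P ^ 2 * (x + y) ^ (a + b) * |ε| := by ring
      _ ≤ _ := by
          gcongr
          linarith
  have h3 : 86400 * P ^ 2 * (2 ^ (2 * (2 * n) + 3)) ^ 2 * (kamRadius B₀)⁻¹ * (x + y) ^ 8 * |ε| ≤ 1 := by
    refine le_trans ?_ hs
    unfold kamConst
    gcongr
    have : 0 ≤ 1638400 * Q ^ 5 := by positivity
    linarith
  calc _ ≤ 86400 * (2 ^ (2 * (2 * n) + 3)) ^ 2 * (P ^ 2 * (x + y) ^ 8 * |ε|) := by gcongr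
    _ = (86400 * P ^ 2 * (2 ^ (2 * (2 * n) + 3)) ^ 2 * (kamRadius B₀)⁻¹ * (x + y) ^ 8 * |ε|) *
        kamRadius B₀ := by field_simp
    _ ≤ 1 * kamRadius B₀ := by gcongr
    _ = _ := one_mul _

theorem monomial_le' (h : KamSetting B₀ Q f ε γ δ) {i a b c : ℕ} (hi : i ≤ 2) (hab : a + b ≤ 8)
    (hc : 1 ≤ c) :
    86400 * (lindstedtConst B₀ Q ^ i * divConst n (2 * n) γ δ ^ a *
      divConst n (2 * n) γ (6 * δ / 8) ^ b * |ε| ^ c) ≤ kamRadius B₀ := by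
  refine le_trans ?_ (h.monomial_le hi hab hc)
  have hP := h.one_le_lindstedt
  have h1 := h.one_le_div
  have h2 := h.one_le_div'
  gcongr
  have : (1 : ℝ) ≤ (2 ^ (2 * (2 * n) + 3)) ^ 2 := one_le_pow₀ (one_le_pow₀ one_le_two)
  linarith

theorem radius_le (B₀ : ℝ) : kamRadius B₀ ≤ 1 / 4 := min_le_left _ _

theorem bound_f (h : KamSetting B₀ Q f ε γ δ) {t : ℝ} (ht : t ≤ 9 * δ) :
    wsum t f ≤ ENNReal.ofReal Q := (wsum_mono ht _).trans h.wsum_f_le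

theorem ne_of_lower {m : ℕ} {γ y : ℝ} (hγ : 0 < γ) {k : Fin n → ℤ}
    (h : γ / (1 + ‖k‖) ^ m ≤ |kdot k ω + y|) :
    Complex.I * (kdot k ω : ℂ) + Complex.I * (y : ℂ) ≠ 0 := by
  rw [← norm_pos_iff, norm_I_mul_add_I_mul]
  exact lt_of_lt_of_le (by positivity) h

theorem freeResBound (h : KamSetting B₀ Q f ε γ δ) (hω : ω ∈ freeSet B₀ n γ) :
    FreeResBound B₀ ω (divConst n (2 * n) γ δ) δ :=
  freeResBound_of_mem_freeSet h.B_pos h.γ_pos h.γ_le_one h.γ_le h.δ_pos hω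

theorem ne_zero (h : KamSetting B₀ Q f ε γ δ) (hω : ω ∈ freeSet B₀ n γ) {k : Fin n → ℤ}
    (hk : k ≠ 0) : kdot k ω ≠ 0 := by
  have := (hω.2 k hk).1
  have hγ := h.γ_pos
  exact abs_pos.1 (lt_of_lt_of_le (by positivity) this)

/-- The truncated series starts the iteration: its primitive needs three losses of `δ`, from `9δ` to
`6δ`, and its error is of third order. Each smallness requirement is an instance of `monomial_le` or
`monomial_le'`. -/
theorem riccatiStart (h : KamSetting B₀ Q f ε γ δ) :
    RiccatiStart (lindstedtState B₀ f ε) ((4 : ℂ) • magAlg B₀ f ε ^ 2) (freeSet B₀ n γ) γ (6 * δ)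
      (2 * n) (2 * Complex.I * B₀) (kamRadius B₀)
      (3 * lindstedtConst B₀ Q ^ 2 * divConst n (2 * n) γ δ ^ 6 * |ε| ^ 3) := by
  have hδ := h.δ_pos
  have hB := h.B_pos
  have hQ := h.one_le_Q
  have hQ0 : 0 ≤ Q := zero_le_one.trans hQ
  have hr := radius_le B₀
  have hl := h.one_le_div
  have hlow := fun ω (hω : ω ∈ freeSet B₀ n γ) => lower_of_mem_freeSet hB h.γ_le hω
  have h4 : ResBound (freeSet B₀ n γ) (fun _ => 4 * Complex.I * B₀) (divConst n (2 * n) γ δ) δ := by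
    have := resBound_const (O := freeSet B₀ n γ) (y := 4 * B₀) h.γ_pos h.γ_le_one hδ
      (fun ω hω k => (hlow ω hω k).2.2)
    convert this using 2
    push_cast; ring
  have h0 : ResBound (freeSet B₀ n γ) 0 (divConst n (2 * n) γ δ) δ :=
    resBound_zero_of_lower h.γ_pos h.γ_le_one hδ (fun ω hω k hk => (hω.2 k hk).1)
  refine ⟨h.γ_pos, h.γ_le_one, by positivity, fun ω hω k hk => (hω.2 k hk).1, hr, ?_,
    fun ω hω => ?_, ?_, ?_, ?_, ?_, ?_⟩
  · have := min_le_right (1 / 4) B₀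
    have := h.γ_le
    have e : (2 * Complex.I * B₀ : ℂ).im = 2 * B₀ := by simp
    rw [e]
    unfold kamRadius
    linarith
  · have hf := h.freeResBound hω
    refine isRiccati_lindstedtState ε hB hQ0 le_rfl hδ.le (h.bound_f (by linarith)) hl h.abs_le_one
      hf.four hf.zero (fun k => ?_) fun k hk => h.ne_zero hω hk
    have := ne_of_lower h.γ_pos (hlow ω hω k).2.2
    convert this using 2
    push_cast; ring
  · refine (bound_lindstedtState_S hB hQ0 (by positivity) hδ.le (h.bound_f (by linarith)) hl
      h.abs_le_one h4 h0).le ?_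
    have := h.monomial_le' (i := 1) (a := 4) (b := 0) (c := 1) (by norm_num) (by norm_num) le_rfl
    simp only [pow_one, pow_zero, mul_one] at this
    linarith
  · have hb := bound_lindstedt_sum (s := 6 * δ) hB hQ0 (by positivity) hδ.le
      (h.bound_f (by linarith)) hl h.abs_le_one h4
    have := h.monomial_le' (i := 1) (a := 3) (b := 0) (c := 1) (by norm_num) (by norm_num) le_rfl
    simp only [pow_one, pow_zero, mul_one] at this
    refine (hb.le (by have := hb.1; linarith)).congr fun ω _ => ?_
    simp only [lindstedtState]
    abel
  · exact bound_lindstedtState_E hB hQ0 (by positivity) hδ.le (h.bound_f (by linarith)) hl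
      h.abs_le_one h4
  · have := h.monomial_le' (i := 2) (a := 6) (b := 1) (c := 3) le_rfl (by norm_num) (by norm_num)
    simp only [pow_one] at this
    have := h.radius_pos
    linarith
  · have := h.monomial_le (i := 2) (a := 6) (b := 2) (c := 3) le_rfl (by norm_num) (by norm_num)
    linarith

theorem norm_sub_le (h : KamSetting B₀ Q f ε γ δ)
    (hω : ω ∈ riccatiGood (lindstedtState B₀ f ε) (freeSet B₀ n γ) γ (2 * n)) :
    ‖riccatiSol (lindstedtState B₀ f ε) ω - (2 * Complex.I * B₀) • 1‖ ≤ kamRadius B₀ :=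
  h.riccatiStart.bound_riccatiSol_sub.norm_le (by have := h.δ_pos; positivity) hω.1

theorem mem_freeSet
    (hω : ω ∈ riccatiGood (lindstedtState B₀ f ε) (freeSet B₀ n γ) γ (2 * n)) :
    ω ∈ freeSet B₀ n γ := (Set.mem_iInter.1 hω.1 0).1

theorem im_bounds (h : KamSetting B₀ Q f ε γ δ)
    (hω : ω ∈ riccatiGood (lindstedtState B₀ f ε) (freeSet B₀ n γ) γ (2 * n)) (θ : Fin n → ℝ) :
    B₀ ≤ (evalHom θ (riccatiSol (lindstedtState B₀ f ε) ω)).im ∧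
      (evalHom θ (riccatiSol (lindstedtState B₀ f ε) ω)).im ≤ 3 * B₀ := by
  have h1 := abs_le.1 (abs_im_evalHom_sub_le (h.norm_sub_le hω) θ)
  have e : (2 * Complex.I * B₀ : ℂ).im = 2 * B₀ := by simp
  rw [e] at h1
  have : kamRadius B₀ ≤ B₀ := min_le_right _ _
  constructor <;> linarith

theorem im_field_eq_zero (h : KamSetting B₀ Q f ε γ δ) (θ : Fin n → ℝ) :
    (evalHom θ ((4 : ℂ) • magAlg B₀ f ε ^ 2)).im = 0 := by
  have h1 : evalHom θ (magAlg B₀ f ε) = ((B₀ + ε * (evalHom θ f).re : ℝ) : ℂ) := by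
    unfold magAlg
    rw [map_add, evalHom_smul_one, map_smul, smul_eq_mul]
    have := h.real_f θ
    apply Complex.ext <;> simp [this]
  rw [map_smul, map_pow, h1, smul_eq_mul, ← Complex.ofReal_pow]
  rw [show (4 : ℂ) = ((4 : ℝ) : ℂ) by norm_num, ← Complex.ofReal_mul, Complex.ofReal_im]

theorem mean_re_and_invariant (h : KamSetting B₀ Q f ε γ δ)
    (hω : ω ∈ riccatiGood (lindstedtState B₀ f ε) (freeSet B₀ n γ) γ (2 * n)) :
    (riccatiSol (lindstedtState B₀ f ε) ω 0).re = 0 ∧ ∀ t : ℝ,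
      (evalHom (t • ω) (riccatiSol (lindstedtState B₀ f ε) ω)).im *
        Real.exp (2 * (evalHom (t • ω) (riccatiPrim (lindstedtState B₀ f ε) ω)).re) =
      (evalHom 0 (riccatiSol (lindstedtState B₀ f ε) ω)).im *
        Real.exp (2 * (evalHom 0 (riccatiPrim (lindstedtState B₀ f ε) ω)).re) :=
  riccati_mean_re_and_invariant (h.riccatiStart.isDeriv_riccatiPrim hω.1)
    (h.riccatiStart.isDeriv_riccatiSol hω.1) h.im_field_eq_zero h.B_pos
    (fun θ => (h.im_bounds hω θ).1) fun θ => (h.im_bounds hω θ).2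

theorem mean_eq (h : KamSetting B₀ Q f ε γ δ)
    (hω : ω ∈ riccatiGood (lindstedtState B₀ f ε) (freeSet B₀ n γ) γ (2 * n)) :
    riccatiSol (lindstedtState B₀ f ε) ω 0 =
      Complex.I * ((riccatiSol (lindstedtState B₀ f ε) ω 0).im : ℂ) := by
  have := (h.mean_re_and_invariant hω).1
  apply Complex.ext <;> simp [this]

theorem bound_prim (h : KamSetting B₀ Q f ε γ δ)
    (hω : ω ∈ riccatiGood (lindstedtState B₀ f ε) (freeSet B₀ n γ) γ (2 * n)) :
    FBound (3 * δ) {ω} (fun _ => riccatiPrim (lindstedtState B₀ f ε) ω) 1 := by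
  have hδ := h.δ_pos
  have h1 := h.riccatiStart.bound_riccatiPrim.add
    (h.riccatiStart.bound_S.mono (by linarith : 6 * δ / 2 ≤ 6 * δ)
      (fun ω hω => (Set.mem_iInter.1 hω 0).1) le_rfl)
  have h2 := (h1.singleton hω.1).freeze
  have h3 := h.monomial_le' (i := 2) (a := 6) (b := 2) (c := 3) le_rfl (by norm_num) (by norm_num)
  have := radius_le B₀
  refine (h2.mono (by linarith) subset_rfl (by linarith)).congr fun ω _ => ?_
  abel

theorem norm_one_le : ‖(1 : FourierAlg n)‖ ≤ 1 :=
  (FBound.one (s := 0) (O := {(0 : Fin n → ℝ)})).norm_le le_rfl (Set.mem_singleton _)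

theorem responseSetting (h : KamSetting B₀ Q f ε γ δ)
    (hω : ω ∈ riccatiGood (lindstedtState B₀ f ε) (freeSet B₀ n γ) γ (2 * n)) :
    ResponseSetting B₀ Q f ε ω (divConst n (2 * n) γ δ) δ
      (riccatiSol (lindstedtState B₀ f ε) ω 0) (riccatiSol (lindstedtState B₀ f ε) ω)
      (riccatiPrim (lindstedtState B₀ f ε) ω) := by
  have hδ := h.δ_pos
  have hB := h.B_pos
  have hQ := h.one_le_Q
  have hQ0 : 0 ≤ Q := zero_le_one.trans hQ
  have hO := mem_freeSet hω
  have hlow := lower_of_mem_freeSet hB h.γ_le hO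
  have hmean := h.mean_eq hω
  set σ := riccatiSol (lindstedtState B₀ f ε) ω with hσ
  have hlow' : ∀ k : Fin n → ℤ, γ / (1 + ‖k‖) ^ (2 * n) ≤ |kdot k ω + -(σ 0).im| := fun k => by
    have := hω.2 (-k)
    rw [norm_neg, kdot_neg_left] at this
    rw [← abs_neg]
    convert this using 2
    ring
  have hneg : -σ 0 = Complex.I * ((-(σ 0).im : ℝ) : ℂ) := by
    conv_lhs => rw [hmean]
    push_cast; ring
  refine ⟨hB, h.B_le, h.B_inv_le, hQ, h.abs_le_one, hδ, h.freeResBound hO, fun k => ?_, fun k => ?_,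
    fun k hk => h.ne_zero hO hk, ?_, ?_, fun k => ?_, fun k => ?_, h.f_zero,
    FBound.const (h.bound_f (by linarith)) hQ0, h.bound_prim hω, ?_,
    h.riccatiStart.isDeriv_riccatiPrim hω.1, h.riccatiStart.isDeriv_riccatiSol hω.1, ?_⟩
  · have := ne_of_lower h.γ_pos (hlow k).1
    convert this using 2
    push_cast; ring
  · have h1 := (hlow k).2.1
    rw [sub_eq_add_neg] at h1
    have := ne_of_lower h.γ_pos h1
    convert this using 2
    push_cast; ring
  · rw [hmean]
    exact resBound_const h.γ_pos h.γ_le_one hδ fun ω' h' k => by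
      rw [Set.mem_singleton_iff.1 h']; exact hω.2 k
  · rw [hneg]
    exact resBound_const h.γ_pos h.γ_le_one hδ fun ω' h' k => by
      rw [Set.mem_singleton_iff.1 h']; exact hlow' k
  · rw [hmean]
    exact ne_of_lower h.γ_pos (hω.2 k)
  · rw [hneg]
    exact ne_of_lower h.γ_pos (hlow' k)
  · have h1 := h.norm_sub_le hω
    have h2 : ‖(2 * Complex.I * B₀ : ℂ) • (1 : FourierAlg n)‖ ≤ 2 * B₀ := by
      rw [norm_smul]
      have e : ‖(2 * Complex.I * B₀ : ℂ)‖ = 2 * B₀ := by simp [abs_of_pos hB]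
      rw [e]
      exact mul_le_of_le_one_right (by positivity) norm_one_le
    have h3 := norm_le_norm_sub_add σ ((2 * Complex.I * B₀ : ℂ) • (1 : FourierAlg n))
    have : kamRadius B₀ ≤ B₀ := min_le_right _ _
    linarith [h.B_le]
  · refine le_trans ?_ h.small
    have h1 := h.one_le_div
    have h2 := h.one_le_div'
    have hr := h.radius_pos
    have h3 : divConst n (2 * n) γ δ ^ 6 ≤
        (divConst n (2 * n) γ δ + divConst n (2 * n) γ (6 * δ / 8)) ^ 8 :=
      (pow_le_pow_left₀ (by linarith) (by linarith) 6).trans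
        (pow_le_pow_right₀ (by linarith) (by norm_num))
    have hP := h.one_le_lindstedt
    unfold kamConst
    gcongr
    have : 0 ≤ 86400 * lindstedtConst B₀ Q ^ 2 * (2 ^ (2 * (2 * n) + 3)) ^ 2 *
      (kamRadius B₀)⁻¹ := by positivity
    linarith

section Fine

variable (h : KamSetting B₀ Q f ε γ δ)
  (hω : ω ∈ riccatiGood (lindstedtState B₀ f ε) (freeSet B₀ n γ) γ (2 * n))
  (hl : FreeResBound B₀ ω l δ)
include h hω

/-- The total correction is at most a power of the divisor constants times `|ε|³`; one factor `|ε|`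
absorbs the constants, so no trace of the small divisors of the iteration remains. -/
theorem norm_sol_sub_le :
    ‖riccatiSol (lindstedtState B₀ f ε) ω - (lindstedtState B₀ f ε ω).σ‖ ≤ |ε| ^ 2 := by
  have hδ := h.δ_pos
  refine (h.riccatiStart.bound_riccatiSol.norm_le (by positivity) hω.1).trans ?_
  have h3 := h.monomial_le' (i := 2) (a := 6) (b := 1) (c := 1) le_rfl (by norm_num) (by norm_num)
  have := radius_le B₀
  rw [pow_one, pow_one] at h3
  calc _ = 720 * (lindstedtConst B₀ Q ^ 2 * divConst n (2 * n) γ δ ^ 6 *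
        divConst n (2 * n) γ (6 * δ / 8) * |ε|) * |ε| ^ 2 := by ring
    _ ≤ 1 * |ε| ^ 2 := by gcongr; linarith
    _ = _ := one_mul _

theorem norm_prim_sub_le :
    ‖riccatiPrim (lindstedtState B₀ f ε) ω - (lindstedtState B₀ f ε ω).S‖ ≤ |ε| ^ 2 := by
  have hδ := h.δ_pos
  refine (h.riccatiStart.bound_riccatiPrim.norm_le (by positivity) hω.1).trans ?_
  have h3 := h.monomial_le' (i := 2) (a := 6) (b := 2) (c := 1) le_rfl (by norm_num) (by norm_num)
  have := radius_le B₀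
  rw [pow_one] at h3
  calc _ = 1440 * (lindstedtConst B₀ Q ^ 2 * divConst n (2 * n) γ δ ^ 6 *
        divConst n (2 * n) γ (6 * δ / 8) ^ 2 * |ε|) * |ε| ^ 2 := by ring
    _ ≤ 1 * |ε| ^ 2 := by gcongr; linarith
    _ = _ := one_mul _

include hl

theorem norm_sol_sub_const_le :
    ‖riccatiSol (lindstedtState B₀ f ε) ω - (2 * Complex.I * B₀) • 1‖ ≤
      3 * lindstedtConst B₀ Q * l ^ 3 * |ε| := by
  have hδ := h.δ_pos
  have hQ0 : 0 ≤ Q := zero_le_one.trans h.one_le_Q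
  have h1 := h.norm_sol_sub_le hω
  have h2 := (bound_lindstedt_sum (s := 0) h.B_pos hQ0 le_rfl hδ.le (h.bound_f (by linarith))
    hl.one_le h.abs_le_one hl.four).norm_le le_rfl (Set.mem_singleton ω)
  have e : riccatiSol (lindstedtState B₀ f ε) ω - (2 * Complex.I * B₀) • 1 =
      (riccatiSol (lindstedtState B₀ f ε) ω - (lindstedtState B₀ f ε ω).σ) +
      ((ε : ℂ) • lindstedtOne B₀ f ω + (ε ^ 2 : ℂ) • lindstedtTwo B₀ f ω) := by
    simp only [lindstedtState]
    abel
  rw [e]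
  refine (norm_add_le _ _).trans ((add_le_add h1 h2).trans ?_)
  have hm := @pow_mul_pow_mul_le |ε| (lindstedtConst B₀ Q) l (abs_nonneg _) h.abs_le_one
    h.one_le_lindstedt hl.one_le 2 1 0 1 0 3 (by norm_num) (by norm_num) (by norm_num)
  linarith

theorem norm_prim_le :
    ‖riccatiPrim (lindstedtState B₀ f ε) ω‖ ≤ 5 * lindstedtConst B₀ Q * l ^ 4 * |ε| := by
  have hδ := h.δ_pos
  have hQ0 : 0 ≤ Q := zero_le_one.trans h.one_le_Q
  have h1 := h.norm_prim_sub_le hω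
  have h2 := (bound_lindstedtState_S (s := 0) h.B_pos hQ0 le_rfl hδ.le (h.bound_f (by linarith))
    hl.one_le h.abs_le_one hl.four hl.zero).norm_le le_rfl (Set.mem_singleton ω)
  have h3 := norm_le_norm_sub_add (riccatiPrim (lindstedtState B₀ f ε) ω)
    (lindstedtState B₀ f ε ω).S
  have hm := @pow_mul_pow_mul_le |ε| (lindstedtConst B₀ Q) l (abs_nonneg _) h.abs_le_one
    h.one_le_lindstedt hl.one_le 2 1 0 1 0 4 (by norm_num) (by norm_num) (by norm_num)
  linarith

/-- The frequency shift is quadratic because the first-order coefficient has mean zero, `f` having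
mean zero. -/
theorem abs_mean_sub_le :
    |(riccatiSol (lindstedtState B₀ f ε) ω 0).im - 2 * B₀| ≤
      2 * lindstedtConst B₀ Q * l ^ 3 * |ε| ^ 2 := by
  have hδ := h.δ_pos
  have hQ0 : 0 ≤ Q := zero_le_one.trans h.one_le_Q
  have h1 := (norm_apply_le _ 0).trans (h.norm_sol_sub_le hω)
  have h2 := (bound_lindstedtTwo (s := 0) h.B_pos hQ0 le_rfl hδ.le (h.bound_f (by linarith))
    hl.one_le hl.four).coeff_le le_rfl (Set.mem_singleton ω) 0
  have h3 : lindstedtOne B₀ f ω 0 = 0 := by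
    unfold lindstedtOne
    have := resolvent_apply hl.four (Set.mem_singleton ω) (c := (-(8 * B₀) : ℂ) • f)
      (((FBound.const (s := δ) (O := {ω}) (h.bound_f (by linarith)) hQ0).smul _).wsum_ne_top
        (Set.mem_singleton ω)) 0
    rw [this, smul_apply, h.f_zero, mul_zero, mul_zero]
  have h4 : riccatiSol (lindstedtState B₀ f ε) ω 0 - 2 * Complex.I * B₀ =
      (riccatiSol (lindstedtState B₀ f ε) ω - (lindstedtState B₀ f ε ω).σ) 0 +
      ε ^ 2 * lindstedtTwo B₀ f ω 0 := by
    simp only [lindstedtState, sub_apply, add_apply, smul_apply, h3, one_def']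
    ring
  have h5 : (riccatiSol (lindstedtState B₀ f ε) ω 0).im - 2 * B₀ =
      (riccatiSol (lindstedtState B₀ f ε) ω 0 - 2 * Complex.I * B₀).im := by simp
  rw [h5]
  refine (Complex.abs_im_le_norm _).trans ?_
  rw [h4]
  have h6 : ‖(ε : ℂ) ^ 2 * lindstedtTwo B₀ f ω 0‖ ≤ |ε| ^ 2 * (lindstedtConst B₀ Q * l ^ 3) := by
    rw [norm_mul, norm_pow, Complex.norm_real, Real.norm_eq_abs]
    gcongr
  refine (norm_add_le _ _).trans ((add_le_add h1 h6).trans ?_)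
  have hm := @pow_mul_pow_mul_le |ε| (lindstedtConst B₀ Q) l (abs_nonneg _) h.abs_le_one
    h.one_le_lindstedt hl.one_le 2 2 0 1 0 3 (by norm_num) (by norm_num) (by norm_num)
  linarith

end Fine

end KamSetting

end FourierAlg

/-! ### Floquet data -/

/-- The coefficients of the transformation to normal form: the fundamental matrix of the
homogeneous equation, the response to a constant momentum with its derivative, and the oscillating
part of the drift. -/
structure FloquetData where
  (A β C Δ q r s : ℝ → ℝ)

namespace FloquetData

/-- The differential equations of the coefficients. -/
structure IsSolution (d : FloquetData) (B₀ b D : ℝ) (B : ℝ → ℝ) : Prop where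
  deriv_A : ∀ t, HasDerivAt d.A (2 * d.C t + b * B₀ * d.β t) t
  deriv_β : ∀ t, HasDerivAt d.β (2 * d.Δ t - b / B₀ * d.A t) t
  deriv_C : ∀ t, HasDerivAt d.C (-2 * B t ^ 2 * d.A t + b * B₀ * d.Δ t) t
  deriv_Δ : ∀ t, HasDerivAt d.Δ (-2 * B t ^ 2 * d.β t - b / B₀ * d.C t) t
  deriv_q : ∀ t, HasDerivAt d.q (d.r t) t
  deriv_r : ∀ t, HasDerivAt d.r (4 * B t - 4 * B t ^ 2 * d.q t) t
  deriv_s : ∀ t, HasDerivAt d.s (2 * (1 - B t * d.q t) - D) t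
  det : ∀ t, d.A t * d.Δ t - d.β t * d.C t = 1

/-- The coefficients are `δ`-close to those of the unperturbed problem. -/
structure IsSmall (d : FloquetData) (B₀ : ℝ) (B : ℝ → ℝ) (δ : ℝ) : Prop where
  A : ∀ t, |d.A t - 1| ≤ δ
  β : ∀ t, |d.β t| ≤ δ
  C : ∀ t, |d.C t| ≤ δ
  Δ : ∀ t, |d.Δ t - 1| ≤ δ
  q : ∀ t, |d.q t - B₀⁻¹| ≤ δ
  r : ∀ t, |d.r t| ≤ δ
  s : ∀ t, |d.s t| ≤ δ
  field : ∀ t, |(B t)⁻¹ - B₀⁻¹| ≤ δ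
  field_sq : ∀ t, |B₀ ^ 2 / B t ^ 2 - 1| ≤ δ

theorem IsSmall.mono {d : FloquetData} {B₀ : ℝ} {B : ℝ → ℝ} {δ δ' : ℝ} (h : d.IsSmall B₀ B δ)
    (hδ : δ ≤ δ') : d.IsSmall B₀ B δ' :=
  ⟨fun t => (h.A t).trans hδ, fun t => (h.β t).trans hδ, fun t => (h.C t).trans hδ,
    fun t => (h.Δ t).trans hδ, fun t => (h.q t).trans hδ, fun t => (h.r t).trans hδ,
    fun t => (h.s t).trans hδ, fun t => (h.field t).trans hδ, fun t => (h.field_sq t).trans hδ⟩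

end FloquetData

namespace FourierAlg

variable {n : ℕ}

/-- The amplitude of the normalized fundamental solution. -/
def floquetAmp (B₀ : ℝ) (σ S : FourierAlg n) : ℝ :=
  Real.sqrt (2 * B₀ / ((evalHom 0 σ).im * Real.exp (2 * (evalHom 0 S).re)))

/-- The Floquet data along the orbit with frequency `ω`, given by a solution `σ` of the Riccati
equation, the primitive `S` of its oscillating part, the response `q`, its derivative `r` and the
oscillating part `s` of the drift. -/
def floquet (B₀ : ℝ) (ω : Fin n → ℝ) (σ S q r s : FourierAlg n) : FloquetData where
  A t := floquetAmp B₀ σ S * (evalHom (t • ω) (NormedSpace.exp S)).re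
  β t := floquetAmp B₀ σ S / B₀ * (evalHom (t • ω) (NormedSpace.exp S)).im
  C t := floquetAmp B₀ σ S / 2 * (evalHom (t • ω) (σ * NormedSpace.exp S)).re
  Δ t := floquetAmp B₀ σ S / (2 * B₀) * (evalHom (t • ω) (σ * NormedSpace.exp S)).im
  q t := (evalHom (t • ω) q).re
  r t := (evalHom (t • ω) r).re
  s t := (evalHom (t • ω) s).re

/-- By the Riccati equation `exp(S + ibt)` solves the homogeneous equation. The data are `A + iB₀β =
N exp S` and `C + iB₀Δ = (N/2) σ exp S`, that is, the solution and half its derivative with the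
rotation removed. The determinant is `N²/(2B₀) · Im σ · |exp S|²`, a constant by the conserved
Wronskian, and the amplitude `N` normalises it to one. -/
theorem isSolution_floquet {B₀ b : ℝ} {B : ℝ → ℝ} {ω : Fin n → ℝ} {M σ S q r s v : FourierAlg n}
    (hB : 0 < B₀) (hM : ∀ t, evalHom (t • ω) M = (B t : ℂ))
    (hS : IsDeriv ω S (σ - (Complex.I * b) • 1)) (hσ : IsDeriv ω σ (-σ ^ 2 - (4 : ℂ) • M ^ 2))
    (hq : IsDeriv ω q r) (hr : IsDeriv ω r ((4 : ℂ) • M - (4 : ℂ) • M ^ 2 * q))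
    (hs : IsDeriv ω s (v - v 0 • 1)) (hv : v = (2 : ℂ) • (1 - M * q))
    (hν : 0 < (evalHom 0 σ).im)
    (hinv : ∀ t : ℝ, (evalHom (t • ω) σ).im * Real.exp (2 * (evalHom (t • ω) S).re) =
      (evalHom 0 σ).im * Real.exp (2 * (evalHom 0 S).re)) :
    (floquet B₀ ω σ S q r s).IsSolution B₀ b (v 0).re B := by
  have he := hS.exp
  have hg : IsDeriv ω (σ * NormedSpace.exp S) (-(4 : ℂ) • M ^ 2 * NormedSpace.exp S -
      (Complex.I * b) • (σ * NormedSpace.exp S)) := by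
    refine (hσ.mul he).of_eq ?_
    simp only [Algebra.smul_def, mul_one, map_neg]
    ring
  set N := floquetAmp B₀ σ S with hN
  refine ⟨fun t => ?_, fun t => ?_, fun t => ?_, fun t => ?_, fun t => ?_, fun t => ?_, fun t => ?_,
    fun t => ?_⟩
  · refine ((he.hasDerivAt_re t).const_mul N).congr_deriv ?_
    simp only [floquet, ← hN]
    rw [sub_mul, smul_one_mul, map_sub, map_smul, smul_eq_mul, Complex.sub_re]
    simp only [Complex.mul_re, Complex.mul_im, Complex.I_re, Complex.I_im, Complex.ofReal_re,
      Complex.ofReal_im]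
    field_simp
    ring
  · refine ((he.hasDerivAt_im t).const_mul (N / B₀)).congr_deriv ?_
    simp only [floquet, ← hN]
    rw [sub_mul, smul_one_mul, map_sub, map_smul, smul_eq_mul, Complex.sub_im]
    simp only [Complex.mul_re, Complex.mul_im, Complex.I_re, Complex.I_im, Complex.ofReal_re,
      Complex.ofReal_im]
    field_simp
    ring
  · refine ((hg.hasDerivAt_re t).const_mul (N / 2)).congr_deriv ?_
    simp only [floquet, ← hN]
    rw [map_sub, map_smul, smul_mul_assoc, map_smul, map_mul _ (M ^ 2), map_pow, hM, smul_eq_mul,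
      smul_eq_mul, Complex.sub_re, ← Complex.ofReal_pow]
    simp only [Complex.mul_re, Complex.mul_im, Complex.I_re, Complex.I_im, Complex.ofReal_re,
      Complex.ofReal_im, Complex.neg_re, Complex.neg_im, Complex.re_ofNat, Complex.im_ofNat]
    field_simp
    ring
  · refine ((hg.hasDerivAt_im t).const_mul (N / (2 * B₀))).congr_deriv ?_
    simp only [floquet, ← hN]
    rw [map_sub, map_smul, smul_mul_assoc, map_smul, map_mul _ (M ^ 2), map_pow, hM, smul_eq_mul,
      smul_eq_mul, Complex.sub_im, ← Complex.ofReal_pow]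
    simp only [Complex.mul_re, Complex.mul_im, Complex.I_re, Complex.I_im, Complex.ofReal_re,
      Complex.ofReal_im, Complex.neg_re, Complex.neg_im, Complex.re_ofNat, Complex.im_ofNat]
    field_simp
    ring
  · exact hq.hasDerivAt_re t
  · refine (hr.hasDerivAt_re t).congr_deriv ?_
    simp only [floquet]
    rw [map_sub, map_smul, map_mul, map_smul, map_pow, hM, smul_eq_mul,
      smul_eq_mul, Complex.sub_re]
    simp [pow_two]
  · refine (hs.hasDerivAt_re t).congr_deriv ?_
    simp only [floquet]
    rw [map_sub, evalHom_smul_one, Complex.sub_re, hv, map_smul, map_sub, map_one, map_mul, hM]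
    simp
  · simp only [floquet, ← hN]
    have h1 := hinv t
    have hexp : (evalHom (t • ω) (NormedSpace.exp S)).re ^ 2 +
        (evalHom (t • ω) (NormedSpace.exp S)).im ^ 2 =
        Real.exp (2 * (evalHom (t • ω) S).re) := by
      rw [evalHom_exp, pow_two, pow_two, ← Complex.normSq_apply, ← Complex.sq_norm,
        Complex.norm_exp, ← Real.exp_nat_mul]
      norm_num
    have hN2 : N ^ 2 * ((evalHom (t • ω) σ).im * Real.exp (2 * (evalHom (t • ω) S).re)) =
        2 * B₀ := by
      rw [h1, hN, floquetAmp, Real.sq_sqrt (by positivity)]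
      field_simp
    rw [← hexp] at hN2
    rw [map_mul, Complex.mul_re, Complex.mul_im]
    field_simp
    linear_combination hN2

end FourierAlg

/-! ### Distance of the Floquet data from the unperturbed ones -/

namespace FourierAlg

variable {n : ℕ}

theorem abs_floquetAmp_sub_one_le {B₀ Q d : ℝ} {σ S : FourierAlg n} (hB : 0 < B₀)
    (hBi : B₀⁻¹ ≤ Q) (hQ : 1 ≤ Q) (hS : ‖S‖ ≤ d)
    (hσ : ‖σ - (2 * Complex.I * B₀) • 1‖ ≤ d) (hd : 208 * Q * d ≤ 1) :
    |floquetAmp B₀ σ S - 1| ≤ 11 * Q * d := by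
  have hd0 : 0 ≤ d := (norm_nonneg _).trans hS
  have hd1 : d ≤ 1 / 208 := by nlinarith
  have hBQ : 1 ≤ B₀ * Q := by rwa [inv_le_iff_one_le_mul₀' hB] at hBi
  have hdB : 208 * d ≤ B₀ := by nlinarith
  have h1 := abs_le.1 (abs_im_evalHom_sub_le hσ 0)
  rw [show (2 * Complex.I * B₀ : ℂ).im = 2 * B₀ by simp] at h1
  have h2 := (abs_re_evalHom_le S 0).trans hS
  have h3 : |Real.exp (2 * (evalHom 0 S).re) - 1| ≤ 4 * d := by
    have h4 : |2 * (evalHom 0 S).re| ≤ 2 * d := by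
      rw [abs_mul, abs_two]; linarith
    exact (Real.abs_exp_sub_one_le (by linarith)).trans (by linarith)
  set ν := (evalHom 0 σ).im
  set E := Real.exp (2 * (evalHom 0 S).re)
  have h5 := abs_le.1 h3
  have hνE : B₀ ≤ ν * E := by nlinarith
  have hνE0 : 0 < ν * E := hB.trans_le hνE
  have h6 : |2 * B₀ / (ν * E) - 1| ≤ 11 * Q * d := by
    rw [div_sub_one hνE0.ne', abs_div, abs_of_pos hνE0, div_le_iff₀ hνE0]
    have h7 : |2 * B₀ - ν * E| ≤ 3 * d + 8 * B₀ * d := by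
      rw [abs_le]
      constructor <;> nlinarith
    refine h7.trans ?_
    calc 3 * d + 8 * B₀ * d ≤ 3 * (B₀ * Q) * d + 8 * (B₀ * Q) * d := by
          have : B₀ ≤ B₀ * Q := le_mul_of_one_le_right hB.le hQ
          nlinarith
      _ = 11 * Q * d * B₀ := by ring
      _ ≤ 11 * Q * d * (ν * E) := by gcongr
  have h8 : floquetAmp B₀ σ S ^ 2 = 2 * B₀ / (ν * E) := Real.sq_sqrt (by positivity)
  have h9 : 0 ≤ floquetAmp B₀ σ S := Real.sqrt_nonneg _
  rw [← h8] at h6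
  refine le_trans ?_ h6
  -- The amplitude is nonnegative, so its distance to 1 is at most that of its square.
  have h10 : floquetAmp B₀ σ S ^ 2 - 1 =
      (floquetAmp B₀ σ S - 1) * (floquetAmp B₀ σ S + 1) := by ring
  rw [h10, abs_mul, abs_of_nonneg (by linarith : 0 ≤ floquetAmp B₀ σ S + 1)]
  exact le_mul_of_one_le_right (abs_nonneg _) (by linarith)

theorem isSmall_floquet {B₀ Q d : ℝ} {B : ℝ → ℝ} {ω : Fin n → ℝ} {σ S q r s : FourierAlg n}
    (hB : 0 < B₀) (hBQ : B₀ ≤ Q) (hBi : B₀⁻¹ ≤ Q) (hQ : 1 ≤ Q) (hS : ‖S‖ ≤ d)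
    (hσ : ‖σ - (2 * Complex.I * B₀) • 1‖ ≤ d) (hq : ‖q - (B₀ : ℂ)⁻¹ • 1‖ ≤ d) (hr : ‖r‖ ≤ d)
    (hs : ‖s‖ ≤ d) (hBt : ∀ t, |B t - B₀| ≤ d) (hd : 208 * Q * d ≤ 1) :
    (floquet B₀ ω σ S q r s).IsSmall B₀ B (24 * Q ^ 2 * d) := by
  have hN := abs_floquetAmp_sub_one_le hB hBi hQ hS hσ hd
  have hd0 : 0 ≤ d := (norm_nonneg _).trans hS
  have hQ0 : 0 < Q := by linarith
  have hQd : d ≤ Q * d := le_mul_of_one_le_left hd0 hQ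
  have hQQd : Q * d ≤ Q ^ 2 * d := by nlinarith
  have hBQ1 : 1 ≤ B₀ * Q := by rwa [inv_le_iff_one_le_mul₀' hB] at hBi
  have hdB : 208 * d ≤ B₀ := by nlinarith
  have he : ∀ t : ℝ, ‖evalHom (t • ω) (NormedSpace.exp S) - 1‖ ≤ 2 * d := fun t => by
    have h1 := (norm_evalHom_le (t • ω) S).trans hS
    rw [evalHom_exp]
    exact (Complex.norm_exp_sub_one_le (by linarith)).trans (by linarith)
  have he1 : ∀ t : ℝ, ‖evalHom (t • ω) (NormedSpace.exp S)‖ ≤ 2 := fun t => by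
    have := norm_le_norm_sub_add (evalHom (t • ω) (NormedSpace.exp S)) 1
    rw [norm_one] at this
    linarith [he t]
  have hg : ∀ t : ℝ, ‖evalHom (t • ω) (σ * NormedSpace.exp S) - 2 * Complex.I * B₀‖ ≤
      6 * Q * d := fun t => by
    have h1 := (norm_evalHom_le (t • ω) _).trans hσ
    rw [map_sub, evalHom_smul_one] at h1
    have e : evalHom (t • ω) (σ * NormedSpace.exp S) - 2 * Complex.I * B₀ =
        (evalHom (t • ω) σ - 2 * Complex.I * B₀) * evalHom (t • ω) (NormedSpace.exp S) +
        2 * Complex.I * B₀ * (evalHom (t • ω) (NormedSpace.exp S) - 1) := by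
      rw [map_mul]; ring
    have e2 : ‖(2 * Complex.I * B₀ : ℂ)‖ = 2 * B₀ := by simp [abs_of_pos hB]
    rw [e]
    calc _ ≤ d * 2 + 2 * B₀ * (2 * d) := by
          refine (norm_add_le _ _).trans (add_le_add ?_ ?_)
          · rw [norm_mul]; exact mul_le_mul h1 (he1 t) (norm_nonneg _) hd0
          · rw [norm_mul, e2]; gcongr; exact he t
      _ ≤ _ := by nlinarith
  set N := floquetAmp B₀ σ S with hNdef
  have hN0 : 0 ≤ N := Real.sqrt_nonneg _
  have hN2 : N ≤ 2 := by linarith [(abs_le.1 hN).2]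
  have hBlow : ∀ t, B₀ / 2 ≤ B t := fun t => by linarith [(abs_le.1 (hBt t)).1]
  have hB2 : (B₀ / 2)⁻¹ ≤ 2 * Q := by rw [inv_div, div_eq_mul_inv]; linarith
  refine ⟨fun t => ?_, fun t => ?_, fun t => ?_, fun t => ?_, fun t => ?_, fun t => ?_, fun t => ?_,
    fun t => ?_, fun t => ?_⟩
  · have h1 := Complex.abs_re_le_norm (evalHom (t • ω) (NormedSpace.exp S) - 1)
    have h2 := (Complex.abs_re_le_norm (evalHom (t • ω) (NormedSpace.exp S))).trans (he1 t)
    rw [Complex.sub_re, Complex.one_re] at h1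
    show |N * (evalHom (t • ω) (NormedSpace.exp S)).re - 1| ≤ _
    set x := (evalHom (t • ω) (NormedSpace.exp S)).re
    have e : N * x - 1 = (N - 1) * x + (x - 1) := by ring
    rw [e]
    refine (abs_add_le _ _).trans ?_
    rw [abs_mul]
    have h3 : |N - 1| * |x| ≤ 11 * Q * d * 2 := mul_le_mul hN h2 (abs_nonneg _) (by positivity)
    linarith [he t]
  · have h1 := Complex.abs_im_le_norm (evalHom (t • ω) (NormedSpace.exp S) - 1)
    rw [Complex.sub_im, Complex.one_im, sub_zero] at h1
    show |N / B₀ * (evalHom (t • ω) (NormedSpace.exp S)).im| ≤ _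
    rw [abs_mul, abs_of_nonneg (by positivity), div_eq_mul_inv]
    have h3 : N * B₀⁻¹ * |(evalHom (t • ω) (NormedSpace.exp S)).im| ≤ 2 * Q * (2 * d) := by
      gcongr
      exact h1.trans (he t)
    linarith
  · have h1 := Complex.abs_re_le_norm
      (evalHom (t • ω) (σ * NormedSpace.exp S) - 2 * Complex.I * B₀)
    rw [Complex.sub_re, show (2 * Complex.I * B₀ : ℂ).re = 0 by simp, sub_zero] at h1
    show |N / 2 * (evalHom (t • ω) (σ * NormedSpace.exp S)).re| ≤ _
    rw [abs_mul, abs_of_nonneg (by positivity)]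
    have h3 : N / 2 * |(evalHom (t • ω) (σ * NormedSpace.exp S)).re| ≤ 2 / 2 * (6 * Q * d) := by
      gcongr
      exact h1.trans (hg t)
    linarith
  · have h1 := Complex.abs_im_le_norm
      (evalHom (t • ω) (σ * NormedSpace.exp S) - 2 * Complex.I * B₀)
    rw [Complex.sub_im, show (2 * Complex.I * B₀ : ℂ).im = 2 * B₀ by simp] at h1
    show |N / (2 * B₀) * (evalHom (t • ω) (σ * NormedSpace.exp S)).im - 1| ≤ _
    set x := (evalHom (t • ω) (σ * NormedSpace.exp S)).im
    have e : N / (2 * B₀) * x - 1 = N * B₀⁻¹ / 2 * (x - 2 * B₀) + (N - 1) := by field_simp; ring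
    rw [e]
    refine (abs_add_le _ _).trans ?_
    rw [abs_mul, abs_of_nonneg (by positivity)]
    have h3 : N * B₀⁻¹ / 2 * |x - 2 * B₀| ≤ 2 * Q / 2 * (6 * Q * d) := by
      gcongr
      exact h1.trans (hg t)
    linarith
  · have h1 := (abs_re_evalHom_le (q - (B₀ : ℂ)⁻¹ • 1) (t • ω)).trans hq
    rw [map_sub, evalHom_smul_one, Complex.sub_re, ← Complex.ofReal_inv, Complex.ofReal_re] at h1
    exact h1.trans (by linarith)
  · exact ((abs_re_evalHom_le r (t • ω)).trans hr).trans (by linarith)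
  · exact ((abs_re_evalHom_le s (t • ω)).trans hs).trans (by linarith)
  · have h1 := hBlow t
    have h2 : 0 < B t := by linarith
    have h3 : (B t)⁻¹ ≤ 2 * Q := (inv_anti₀ (by positivity) h1).trans hB2
    rw [inv_sub_inv h2.ne' hB.ne', abs_div, abs_sub_comm, abs_of_pos (by positivity : 0 < B t * B₀),
      div_eq_mul_inv, mul_inv]
    calc |B t - B₀| * ((B t)⁻¹ * B₀⁻¹) ≤ d * (2 * Q * Q) := by
          gcongr
          exact hBt t
      _ ≤ _ := by nlinarith
  · have h1 := hBlow t
    have h2 : 0 < B t := by linarith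
    have h3 : (B t)⁻¹ ≤ 2 * Q := (inv_anti₀ (by positivity) h1).trans hB2
    have e : B₀ ^ 2 / B t ^ 2 - 1 = -((B t - B₀) * (B t)⁻¹ * (B₀ * (B t)⁻¹ + 1)) := by
      field_simp; ring
    rw [e, abs_neg, abs_mul, abs_mul, abs_of_pos (inv_pos.2 h2)]
    have h4 : B₀ * (B t)⁻¹ ≤ 2 := by
      rw [← div_eq_mul_inv, div_le_iff₀ h2]; linarith
    have h5 : 0 ≤ B₀ * (B t)⁻¹ := by positivity
    rw [abs_of_nonneg (by linarith : 0 ≤ B₀ * (B t)⁻¹ + 1)]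
    calc |B t - B₀| * (B t)⁻¹ * (B₀ * (B t)⁻¹ + 1) ≤ d * (2 * Q) * (2 + 1) := by
          gcongr
          exact hBt t
      _ ≤ _ := by linarith

end FourierAlg

/-! ### Logarithmic losses -/

/-- A factor that grows logarithmically as `ε` tends to zero. -/
def logFac (ε : ℝ) : ℝ := 1 + Real.log (1 + 1 / |ε|)

theorem one_le_logFac (ε : ℝ) : 1 ≤ logFac ε := by
  have : 0 ≤ Real.log (1 + 1 / |ε|) :=
    Real.log_nonneg (by have : 0 ≤ 1 / |ε| := by positivity
                        linarith)
  unfold logFac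
  linarith

theorem tendsto_logFac : Tendsto logFac (𝓝[≠] 0) atTop := by
  have h1 : Tendsto (fun ε : ℝ => |ε|) (𝓝[≠] 0) (𝓝[>] 0) := by
    refine tendsto_nhdsWithin_iff.2 ⟨?_, ?_⟩
    · have := (continuous_abs (G := ℝ)).tendsto 0
      rw [abs_zero] at this
      exact this.mono_left nhdsWithin_le_nhds
    · filter_upwards [self_mem_nhdsWithin] with ε hε using abs_pos.2 hε
  have h2 : Tendsto (fun ε : ℝ => 1 + 1 / |ε|) (𝓝[≠] 0) atTop := by
    simp only [one_div]
    exact tendsto_atTop_add_const_left _ _ (tendsto_inv_nhdsGT_zero.comp h1)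
  exact tendsto_atTop_add_const_left _ _ (Real.tendsto_log_atTop.comp h2)

/-- A logarithm is bounded by any negative power of `|ε|`; the exponent `η/(M + 1)` makes `M`
factors cost less than `η`. The value `ε = 0` is admitted because `j ≠ 0`. -/
theorem exists_logFac_pow_mul_le (M : ℕ) {η : ℝ} (hη : 0 < η) :
    ∃ K : ℝ, 0 < K ∧ ∀ ε : ℝ, |ε| ≤ 1 → ∀ j : ℕ, j ≠ 0 →
      logFac ε ^ M * |ε| ^ j ≤ K * |ε| ^ ((j : ℝ) - η) := by
  set a : ℝ := η / (M + 1) with ha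
  have ha0 : 0 < a := by positivity
  refine ⟨(1 + 2 ^ a / a) ^ M, by positivity, fun ε hε j hj => ?_⟩
  rcases eq_or_ne ε 0 with rfl | h0
  · rw [abs_zero, zero_pow hj, mul_zero]
    positivity
  have he : 0 < |ε| := abs_pos.2 h0
  have hlog : logFac ε ≤ (1 + 2 ^ a / a) * |ε| ^ (-a) := by
    have h1 : 1 + 1 / |ε| ≤ 2 / |ε| := by
      rw [← sub_nonneg]
      have : 2 / |ε| - (1 + 1 / |ε|) = 1 / |ε| - 1 := by ring
      rw [this, sub_nonneg]
      exact one_le_one_div he hε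
    have h2 : Real.log (1 + 1 / |ε|) ≤ (2 / |ε|) ^ a / a :=
      (Real.log_le_log (by positivity) h1).trans (Real.log_le_rpow_div (by positivity) ha0)
    rw [Real.div_rpow zero_le_two he.le, div_eq_mul_inv (2 ^ a), ← Real.rpow_neg he.le] at h2
    have h3 : 1 ≤ |ε| ^ (-a) := Real.one_le_rpow_of_pos_of_le_one_of_nonpos he hε (by linarith)
    unfold logFac
    calc _ ≤ |ε| ^ (-a) + 2 ^ a * |ε| ^ (-a) / a := add_le_add h3 h2
      _ = _ := by ring
  calc logFac ε ^ M * |ε| ^ j ≤ ((1 + 2 ^ a / a) * |ε| ^ (-a)) ^ M * |ε| ^ j := by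
        have := one_le_logFac ε
        gcongr
    _ = (1 + 2 ^ a / a) ^ M * |ε| ^ ((j : ℝ) - a * M) := by
        rw [mul_pow, mul_assoc, ← Real.rpow_natCast (|ε| ^ (-a)), ← Real.rpow_mul he.le,
          ← Real.rpow_natCast |ε| j, ← Real.rpow_add he]
        congr 2
        ring
    _ ≤ _ := by
        refine mul_le_mul_of_nonneg_left (Real.rpow_le_rpow_of_exponent_ge he hε ?_) (by positivity)
        have : a * (M + 1) = η := by rw [ha]; field_simp
        linarith

theorem exists_logFac_pow_mul_le_one (W : ℝ) (M : ℕ) :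
    ∃ ε₀ : ℝ, 0 < ε₀ ∧ ∀ ε : ℝ, |ε| < ε₀ → W * (logFac ε ^ M * |ε|) ≤ 1 := by
  obtain ⟨K, hK, h⟩ := exists_logFac_pow_mul_le M (half_pos one_pos)
  set V := (|W| + 1) * K with hV
  have hV0 : 0 < V := by positivity
  refine ⟨min 1 (V ^ 2)⁻¹, by positivity, fun ε hε => ?_⟩
  have h1 := h ε (hε.le.trans (min_le_left _ _)) 1 one_ne_zero
  have h2 : |ε| ≤ (V ^ 2)⁻¹ := hε.le.trans (min_le_right _ _)
  have e : ((1 : ℕ) : ℝ) - 1 / 2 = 1 / 2 := by norm_num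
  rw [pow_one, e, ← Real.sqrt_eq_rpow] at h1
  have h3 : Real.sqrt |ε| ≤ V⁻¹ := by
    rw [← inv_pow] at h2
    exact Real.sqrt_le_left (by positivity) |>.2 h2
  have h0 : 0 ≤ logFac ε ^ M * |ε| := by have := one_le_logFac ε; positivity
  calc W * (logFac ε ^ M * |ε|) ≤ (|W| + 1) * (logFac ε ^ M * |ε|) :=
        mul_le_mul_of_nonneg_right (by linarith [le_abs_self W]) h0
    _ ≤ (|W| + 1) * (K * V⁻¹) := by
        refine mul_le_mul_of_nonneg_left (h1.trans ?_) (by positivity)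
        gcongr
    _ = V * V⁻¹ := by rw [hV]; ring
    _ = 1 := mul_inv_cancel₀ hV0.ne'

/-! ### Floquet data and mean drift of the Landau flow -/

namespace FourierAlg

variable {n : ℕ}

/-- Only `γ⁻²` enters, so dividing `γ` by the logarithmic factor multiplies the divisor constant by
the square of that factor. -/
theorem divConst_div (n m : ℕ) (g a δ : ℝ) :
    divConst n m (g / a) δ = divConst n m g δ * a ^ 2 := by
  unfold divConst
  rw [inv_div, div_eq_mul_inv a g]
  ring

namespace KamSetting

variable {B₀ Q ε γ δ l : ℝ} {f : (Fin n → ℝ) → ℝ} {ω : Fin n → ℝ}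

/-- The Floquet data given by the solution of the Riccati equation. -/
def data (B₀ : ℝ) (f : FourierAlg n) (ε : ℝ) (ω : Fin n → ℝ) : FloquetData :=
  floquet B₀ ω (riccatiSol (lindstedtState B₀ f ε) ω) (riccatiPrim (lindstedtState B₀ f ε) ω)
    (response B₀ f ε ω (riccatiSol (lindstedtState B₀ f ε) ω 0)
      (riccatiPrim (lindstedtState B₀ f ε) ω))
    (responseDeriv B₀ f ε ω (riccatiSol (lindstedtState B₀ f ε) ω 0)
      (riccatiSol (lindstedtState B₀ f ε) ω) (riccatiPrim (lindstedtState B₀ f ε) ω))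
    (resolvent ω 0 (drift B₀ f ε ω (riccatiSol (lindstedtState B₀ f ε) ω 0)
      (riccatiPrim (lindstedtState B₀ f ε) ω)))

/-- The rotation frequency. -/
def freq (B₀ : ℝ) (f : FourierAlg n) (ε : ℝ) (ω : Fin n → ℝ) : ℝ :=
  (riccatiSol (lindstedtState B₀ f ε) ω 0).im

/-- The normalized mean drift. -/
def meanDrift (B₀ : ℝ) (f : FourierAlg n) (ε : ℝ) (ω : Fin n → ℝ) : ℝ :=
  -(B₀ / 4) * (drift B₀ f ε ω (riccatiSol (lindstedtState B₀ f ε) ω 0)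
      (riccatiPrim (lindstedtState B₀ f ε) ω) 0).re

/-- The constant in the bounds for the Floquet data. -/
def dataConst (B₀ Q : ℝ) : ℝ := 8 * lindstedtConst B₀ Q + 6274 * Q ^ 4

local notation "F" => ofFun (fourierCoef f)

theorem evalHom_magAlg (hf : TorusAnalytic f) (B₀ ε t : ℝ) (ω : Fin n → ℝ) :
    evalHom (t • ω) (magAlg B₀ F ε) = (magB B₀ f ε ω t : ℂ) := by
  unfold magAlg magB
  rw [map_add, evalHom_smul_one, map_smul, smul_eq_mul, hf.evalHom_fourierCoef]
  push_cast
  ring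

theorem abs_magB_sub_le (hf : TorusAnalytic f) {Q : ℝ} (hQ : ‖F‖ ≤ Q) (B₀ ε t : ℝ)
    (ω : Fin n → ℝ) : |magB B₀ f ε ω t - B₀| ≤ Q * |ε| := by
  have h1 := (norm_evalHom_le (t • ω) F).trans hQ
  rw [hf.evalHom_fourierCoef, Complex.norm_real, Real.norm_eq_abs] at h1
  unfold magB
  rw [add_sub_cancel_left, abs_mul, mul_comm]
  gcongr

theorem isSolution (h : KamSetting B₀ Q F ε γ δ) (hf : TorusAnalytic f)
    (hω : ω ∈ riccatiGood (lindstedtState B₀ F ε) (freeSet B₀ n γ) γ (2 * n)) :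
    (data B₀ F ε ω).IsSolution B₀ (freq B₀ F ε ω) (-4 / B₀ * meanDrift B₀ F ε ω)
      (magB B₀ f ε ω) := by
  have hr := h.responseSetting hω
  have hB := h.B_pos
  have e : -4 / B₀ * meanDrift B₀ F ε ω =
      (drift B₀ F ε ω (riccatiSol (lindstedtState B₀ F ε) ω 0)
        (riccatiPrim (lindstedtState B₀ F ε) ω) 0).re := by
    unfold meanDrift
    field_simp
  rw [e]
  refine isSolution_floquet hB (fun t => evalHom_magAlg hf B₀ ε t ω) ?_ hr.deriv_σ
    hr.isDeriv_response hr.isDeriv_responseDeriv hr.isDeriv_resolvent_drift rfl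
    (hB.trans_le (h.im_bounds hω 0).1) (h.mean_re_and_invariant hω).2
  have := hr.deriv_S
  rw [h.mean_eq hω] at this
  exact this

theorem isSmall (h : KamSetting B₀ Q F ε γ δ) (hf : TorusAnalytic f)
    (hω : ω ∈ riccatiGood (lindstedtState B₀ F ε) (freeSet B₀ n γ) γ (2 * n))
    (hl : FreeResBound B₀ ω l δ)
    (hs : 208 * Q * (dataConst B₀ Q * divConst n (2 * n) γ δ ^ 5 * |ε|) ≤ 1) :
    (data B₀ F ε ω).IsSmall B₀ (magB B₀ f ε ω) (24 * Q ^ 2 * (dataConst B₀ Q * l ^ 5 * |ε|)) := by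
  have hr := h.responseSetting hω
  have hQ := h.one_le_Q
  have hP := h.one_le_lindstedt
  have hF : ‖F‖ ≤ Q := 
    (FBound.const (s := 0) (O := {ω}) (h.bound_f (by linarith [h.δ_pos]))
      (by linarith)).norm_le le_rfl (Set.mem_singleton ω)
  have key : ∀ l', FreeResBound B₀ ω l' δ →
      ‖riccatiPrim (lindstedtState B₀ F ε) ω‖ ≤ dataConst B₀ Q * l' ^ 5 * |ε| ∧
      ‖riccatiSol (lindstedtState B₀ F ε) ω - (2 * Complex.I * B₀) • 1‖ ≤
        dataConst B₀ Q * l' ^ 5 * |ε| ∧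
      ‖response B₀ F ε ω (riccatiSol (lindstedtState B₀ F ε) ω 0)
        (riccatiPrim (lindstedtState B₀ F ε) ω) - (B₀ : ℂ)⁻¹ • 1‖ ≤
        dataConst B₀ Q * l' ^ 5 * |ε| ∧
      ‖responseDeriv B₀ F ε ω (riccatiSol (lindstedtState B₀ F ε) ω 0)
        (riccatiSol (lindstedtState B₀ F ε) ω) (riccatiPrim (lindstedtState B₀ F ε) ω)‖ ≤
        dataConst B₀ Q * l' ^ 5 * |ε| ∧
      ‖resolvent ω 0 (drift B₀ F ε ω (riccatiSol (lindstedtState B₀ F ε) ω 0)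
        (riccatiPrim (lindstedtState B₀ F ε) ω))‖ ≤ dataConst B₀ Q * l' ^ 5 * |ε| ∧
      Q * |ε| ≤ dataConst B₀ Q * l' ^ 5 * |ε| := fun l' hl' => by
    have h1 := hl'.one_le
    have hQ4 : Q ^ 3 ≤ Q ^ 4 := pow_le_pow_right₀ hQ (by norm_num)
    have hQ1 : Q ≤ Q ^ 4 := le_self_pow₀ hQ (by norm_num)
    have hl3 : l' ^ 3 ≤ l' ^ 5 := pow_le_pow_right₀ h1 (by norm_num)
    have hl4 : l' ^ 4 ≤ l' ^ 5 := pow_le_pow_right₀ h1 (by norm_num)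
    have hl0 : 1 ≤ l' ^ 5 := one_le_pow₀ h1
    have hQ0 : 0 ≤ Q := by linarith
    have hQ40 : 0 ≤ Q ^ 4 := by positivity
    have hl00 : 0 ≤ l' := by linarith
    unfold dataConst
    refine ⟨(h.norm_prim_le hω hl').trans ?_, (h.norm_sol_sub_const_le hω hl').trans ?_,
      (hr.norm_response_sub_le hl').trans ?_, (hr.norm_responseDeriv_le hl').trans ?_,
      (hr.norm_resolvent_drift_le hl').trans ?_, ?_⟩
    · gcongr; linarith
    · gcongr; linarith
    · gcongr; linarith
    · gcongr; linarith
    · gcongr; linarith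
    · gcongr
      refine le_trans ?_ (le_mul_of_one_le_right (by linarith) hl0)
      linarith
  obtain ⟨a1, a2, a3, a4, a5, a6⟩ := key l hl
  obtain ⟨b1, b2, b3, b4, b5, b6⟩ := key _ hr.free
  -- The smallness required here is known only for the constant of the iteration, while the bound is
  -- wanted for `l`. The minimum of the two bounds serves both purposes.
  refine (isSmall_floquet h.B_pos h.B_le h.B_inv_le hQ (le_min a1 b1) (le_min a2 b2)
    (le_min a3 b3) (le_min a4 b4) (le_min a5 b5)
    (fun t => (abs_magB_sub_le hf hF B₀ ε t ω).trans (le_min a6 b6)) (le_trans ?_ hs)).mono ?_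
  · gcongr
    exact min_le_right _ _
  · gcongr
    exact min_le_left _ _

/-- The factor `-B₀/4` converts the mean drift velocity, `2ε²` times the two sides of
`mean_identity` up to third order, into `c_ω ε²`. -/
theorem norm_meanDrift_sub_le (h : KamSetting B₀ Q F ε γ δ) (hf : TorusAnalytic f)
    (hω : ω ∈ riccatiGood (lindstedtState B₀ F ε) (freeSet B₀ n γ) γ (2 * n))
    (hl : FreeResBound B₀ ω l δ) :
    ‖(meanDrift B₀ F ε ω : ℂ) - cOmega B₀ f ω * (ε : ℂ) ^ 2‖ ≤ 1065 * Q ^ 7 * l ^ 4 * |ε| ^ 3 := by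
  have hr := h.responseSetting hω
  have hδ := h.δ_pos
  have hB := h.B_pos
  have hB' : (B₀ : ℂ) ≠ 0 := Complex.ofReal_ne_zero.2 hB.ne'
  have hw : ∀ s ≤ 9 * δ, wsum s F ≠ ∞ := fun s hs =>
    ne_top_of_le_ne_top ENNReal.ofReal_ne_top (h.bound_f hs)
  have h1 := hr.norm_drift_zero_sub_le hl
  rw [mean_identity hB hr.free hδ.le (hw _ (by linarith)) hr.ne_two] at h1
  have hc := cOmega_eq hf hr.free.two (hw _ (by linarith)) hr.ne_two
  have hci := cOmega_im hf hr.free.two (hw _ (by linarith)) hr.ne_two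
  set v := drift B₀ F ε ω (riccatiSol (lindstedtState B₀ F ε) ω 0)
    (riccatiPrim (lindstedtState B₀ F ε) ω) 0 with hv
  set g := (gAlg B₀ F ω * gAlg B₀ F ω) 0 with hg
  have hgr : g = ((-(cOmega B₀ f ω).re : ℝ) : ℂ) := by
    apply Complex.ext
    · rw [hc]; simp
    · rw [Complex.ofReal_im, ← neg_eq_zero, ← Complex.neg_im, ← hc, hci]
  have hcr : cOmega B₀ f ω = (((cOmega B₀ f ω).re : ℝ) : ℂ) := by
    apply Complex.ext <;> simp [hci]
  set y := (cOmega B₀ f ω).re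
  rw [hcr, ← Complex.ofReal_pow, ← Complex.ofReal_mul, ← Complex.ofReal_sub, Complex.norm_real,
    Real.norm_eq_abs]
  have e : meanDrift B₀ F ε ω - y * ε ^ 2 =
      -(B₀ / 4) * (v - 2 * ε ^ 2 * (2 * (B₀ : ℂ)⁻¹ * g)).re := by
    have e2 : v - 2 * ε ^ 2 * (2 * (B₀ : ℂ)⁻¹ * g) = v + ((4 * ε ^ 2 * B₀⁻¹ * y : ℝ) : ℂ) := by
      rw [hgr]; push_cast; ring
    rw [e2, Complex.add_re, Complex.ofReal_re]
    unfold meanDrift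
    rw [← hv]
    field_simp
    ring
  rw [e, abs_mul, abs_neg, abs_of_pos (by positivity)]
  have hQ := h.one_le_Q
  have hl1 := hl.one_le
  calc _ ≤ Q / 4 * (4260 * Q ^ 6 * l ^ 4 * |ε| ^ 3) := by
        gcongr
        · exact h.B_le
        · exact (Complex.abs_re_le_norm _).trans h1
    _ = _ := by ring

end KamSetting

end FourierAlg

namespace FourierAlg

variable {n : ℕ}

/-! ### The set of good frequencies -/

/-- A measurable subset of the frequencies for which the iteration converges, of the same
measure. -/
def goodFreq (B₀ : ℝ) (f : FourierAlg n) (ε γ : ℝ) : Set (Fin n → ℝ) :=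
  cell n \ toMeasurable volume
    (cell n \ riccatiGood (lindstedtState B₀ f ε) (freeSet B₀ n γ) γ (2 * n))

theorem measurableSet_goodFreq (B₀ : ℝ) (f : FourierAlg n) (ε γ : ℝ) :
    MeasurableSet (goodFreq B₀ f ε γ) :=
  measurableSet_Icc.diff (measurableSet_toMeasurable _ _)

theorem goodFreq_subset (B₀ : ℝ) (f : FourierAlg n) (ε γ : ℝ) :
    goodFreq B₀ f ε γ ⊆ riccatiGood (lindstedtState B₀ f ε) (freeSet B₀ n γ) γ (2 * n) := by
  rintro ω ⟨h1, h2⟩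
  by_contra hn
  exact h2 (subset_toMeasurable _ _ ⟨h1, hn⟩)

theorem KamSetting.volume_sdiff_goodFreq_le {B₀ Q ε γ δ : ℝ} {f : FourierAlg n}
    (h : KamSetting B₀ Q f ε γ δ) :
    volume (cell n \ goodFreq B₀ f ε γ) ≤ ENNReal.ofReal (6 * γ) * resonanceConst n := by
  have hγ := h.γ_pos.le
  set G := riccatiGood (lindstedtState B₀ f ε) (freeSet B₀ n γ) γ (2 * n) with hG
  calc volume (cell n \ goodFreq B₀ f ε γ) ≤ volume (toMeasurable volume (cell n \ G)) := by
        refine measure_mono ?_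
        rintro ω ⟨h1, h2⟩
        by_contra hn
        exact h2 ⟨h1, hn⟩
    _ = volume (cell n \ G) := measure_toMeasurable _
    _ ≤ volume ((cell n \ freeSet B₀ n γ) ∪ (freeSet B₀ n γ \ G)) := by
        refine measure_mono ?_
        rintro ω ⟨h1, h2⟩
        by_cases h3 : ω ∈ freeSet B₀ n γ
        · exact Or.inr ⟨h3, h2⟩
        · exact Or.inl ⟨h1, h3⟩
    _ ≤ _ := (measure_union_le _ _).trans (add_le_add (volume_sdiff_freeSet_le B₀ n hγ)
        (h.riccatiStart.volume_sdiff_riccatiGood_le fun ω hω => hω.1))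
    _ = _ := by
        rw [← add_mul, ← ENNReal.ofReal_add (by positivity) (by positivity)]
        congr 2
        ring

/-- The nonresonance constant for the perturbation of size `ε`. -/
def resParam (B₀ ε : ℝ) : ℝ := min 1 B₀ / logFac ε

theorem resParam_pos {B₀ : ℝ} (hB : 0 < B₀) (ε : ℝ) : 0 < resParam B₀ ε :=
  div_pos (lt_min one_pos hB) (one_pos.trans_le (one_le_logFac ε))

theorem resParam_le {B₀ : ℝ} (hB : 0 < B₀) (ε : ℝ) : resParam B₀ ε ≤ min 1 B₀ :=
  div_le_self (lt_min one_pos hB).le (one_le_logFac ε)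

theorem tendsto_resParam (B₀ : ℝ) : Tendsto (resParam B₀) (𝓝[≠] 0) (𝓝 0) :=
  tendsto_logFac.const_div_atTop _

/-- Reduction of the Landau flow: for most frequencies there are Floquet data with the asserted
asymptotics. -/
theorem exists_floquetData {B₀ : ℝ} (hB : 0 < B₀) {f : (Fin n → ℝ) → ℝ} (hf : TorusAnalytic f)
    (h0 : fourierCoef f 0 = 0) :
    ∃ (ε₀ δ P L : ℝ) (C : ℝ → Set (Fin n → ℝ)) (b c : ℝ → (Fin n → ℝ) → ℝ)
      (d : ℝ → (Fin n → ℝ) → FloquetData),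
      0 < ε₀ ∧ ε₀ ≤ 1 ∧ 0 < δ ∧ 0 < P ∧
      (∀ ε : ℝ, |ε| < ε₀ → ∀ (ω : Fin n → ℝ) (t : ℝ), |magB B₀ f ε ω t - B₀| ≤ B₀ / 2) ∧
      (∀ ε : ℝ, |ε| < ε₀ → MeasurableSet (C ε) ∧ C ε ⊆ nonresonant B₀ n) ∧
      Tendsto (fun ε => volume (nonresonant B₀ n \ C ε)) (𝓝[≠] 0) (𝓝 0) ∧
      ∀ ε : ℝ, |ε| < ε₀ → ∀ ω ∈ C ε, FreeResBound B₀ ω (L * logFac ε ^ 2) δ ∧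
        (d ε ω).IsSolution B₀ (b ε ω) (-4 / B₀ * c ε ω) (magB B₀ f ε ω) ∧
        (d ε ω).IsSmall B₀ (magB B₀ f ε ω) 1 ∧
        ∀ l, FreeResBound B₀ ω l δ →
          (d ε ω).IsSmall B₀ (magB B₀ f ε ω) (P * l ^ 5 * |ε|) ∧
          |b ε ω - 2 * B₀| ≤ P * l ^ 3 * |ε| ^ 2 ∧
          ‖(c ε ω : ℂ) - cOmega B₀ f ω * (ε : ℂ) ^ 2‖ ≤ P * l ^ 4 * |ε| ^ 3 := by
  obtain ⟨ρ, hρ, hw⟩ := hf.exists_wsum_ne_top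
  set F : FourierAlg n := ofFun (fourierCoef f) with hF
  -- Nine units of width: three for the truncated series and three for the iteration, which halves
  -- `6δ`; the sources of the response are then estimated at width `3δ` and the Green operator
  -- leaves `δ` for the primitive of the drift.
  set δ := ρ / 9 with hδ
  have hδ0 : 0 < δ := by positivity
  set Q := 1 + B₀ + B₀⁻¹ + (wsum (9 * δ) F).toReal with hQdef
  have hBi : 0 < B₀⁻¹ := inv_pos.2 hB
  have hw0 : 0 ≤ (wsum (9 * δ) F).toReal := ENNReal.toReal_nonneg
  have hQ1 : 1 ≤ Q := by linarith
  have hwF : wsum (9 * δ) F ≤ ENNReal.ofReal Q := by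
    have : wsum (9 * δ) F ≠ ∞ :=
      ne_top_of_le_ne_top hw ((wsum_ofFun_le _ _).trans (wsum_mono (by rw [hδ]; linarith) _))
    rw [← ENNReal.ofReal_toReal this]
    exact ENNReal.ofReal_le_ofReal (by linarith)
  have hFQ : ‖F‖ ≤ Q :=
    (FBound.const (s := 0) (O := {(0 : Fin n → ℝ)}) ((wsum_mono (by positivity) _).trans hwF)
      (by linarith)).norm_le le_rfl (Set.mem_singleton _)
  set g := min 1 B₀ with hg
  have hg0 : 0 < g := lt_min one_pos hB
  set L := divConst n (2 * n) g δ with hL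
  set L' := divConst n (2 * n) g (6 * δ / 8) with hL'
  have hL0 : 0 < L := divConst_pos n _ hg0 hδ0
  have hL0' : 0 < L' := divConst_pos n _ hg0 (by positivity)
  have hdiv : ∀ ε δ', divConst n (2 * n) (resParam B₀ ε) δ' =
      divConst n (2 * n) g δ' * logFac ε ^ 2 := fun ε δ' => divConst_div n _ _ _ _
  have hP1 := one_le_lindstedtConst hB (by linarith : (0 : ℝ) ≤ Q)
  have hD : 0 < KamSetting.dataConst B₀ Q := by unfold KamSetting.dataConst; positivity
  -- The smallness conditions contain the eighth and the fifth power of divisor constants, each of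
  -- which carries a squared logarithm.
  obtain ⟨e1, he1, hs1⟩ := exists_logFac_pow_mul_le_one (kamConst B₀ Q n * (L + L') ^ 8) 16
  obtain ⟨e2, he2, hs2⟩ := exists_logFac_pow_mul_le_one (208 * Q ^ 2 * KamSetting.dataConst B₀ Q * L ^ 5) 10
  set ε₀ := min (min e1 e2) (min 1 (B₀ / (2 * Q))) with hε₀
  have hset : ∀ ε : ℝ, |ε| < ε₀ → KamSetting B₀ Q F ε (resParam B₀ ε) δ := fun ε hε => by
    have hg' := resParam_le hB ε
    refine ⟨hB, by linarith, by linarith, hQ1,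
      (hε.trans_le ((min_le_right _ _).trans (min_le_left _ _))).le, hδ0, resParam_pos hB ε,
      hg'.trans (min_le_left _ _), hg'.trans (min_le_right _ _), hwF, ?_, fun θ => ?_, ?_⟩
    · rw [hF, ofFun_apply hf.summable_fourierCoef, h0]
    · rw [hF, hf.evalHom_fourierCoef, Complex.ofReal_im]
    · refine le_trans (le_of_eq ?_) (hs1 ε (hε.trans_le ((min_le_left _ _).trans (min_le_left _ _))))
      rw [hdiv, hdiv]
      ring
  set P := max (24 * Q ^ 2 * KamSetting.dataConst B₀ Q) (max (2 * lindstedtConst B₀ Q) (1065 * Q ^ 7)) with hP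
  refine ⟨ε₀, δ, P, L, fun ε => goodFreq B₀ F ε (resParam B₀ ε), KamSetting.freq B₀ F,
    KamSetting.meanDrift B₀ F, KamSetting.data B₀ F, by positivity,
    (min_le_right _ _).trans (min_le_left _ _), hδ0,
    lt_max_of_lt_right (lt_max_of_lt_right (by positivity)), fun ε hε ω t => ?_, fun ε hε => ?_,
    ?_, fun ε hε ω hω => ?_⟩
  · refine (KamSetting.abs_magB_sub_le hf hFQ B₀ ε t ω).trans ?_
    have h3 : |ε| ≤ B₀ / (2 * Q) :=
      (hε.trans_le ((min_le_right _ _).trans (min_le_right _ _))).le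
    calc Q * |ε| ≤ Q * (B₀ / (2 * Q)) := by gcongr
      _ = B₀ / 2 := by field_simp
  · refine ⟨measurableSet_goodFreq _ _ _ _, fun ω hω => ?_⟩
    have hg' := resParam_le hB ε
    exact mem_nonresonant_of_mem_freeSet hB (resParam_pos hB ε) (hg'.trans (min_le_right _ _))
      (KamSetting.mem_freeSet (goodFreq_subset _ _ _ _ hω))
  -- The excluded measure is proportional to the nonresonance constant, which tends to zero like an
  -- inverse logarithm.
  · have h1 : Tendsto (fun ε => ENNReal.ofReal (6 * resParam B₀ ε) * resonanceConst n) (𝓝[≠] 0)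
        (𝓝 0) := by
      have h2 := (tendsto_resParam B₀).const_mul 6
      rw [mul_zero] at h2
      have h3 := ENNReal.Tendsto.mul_const (ENNReal.tendsto_ofReal h2)
        (Or.inr (resonanceConst_ne_top n))
      rwa [ENNReal.ofReal_zero, zero_mul] at h3
    refine tendsto_of_tendsto_of_tendsto_of_le_of_le' tendsto_const_nhds h1
      (Eventually.of_forall fun _ => zero_le) ?_
    have hev : ∀ᶠ ε : ℝ in 𝓝[≠] 0, |ε| < ε₀ := by
      refine nhdsWithin_le_nhds ?_
      have hpos : 0 < ε₀ := by positivity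
      filter_upwards [Metric.ball_mem_nhds (0 : ℝ) hpos] with ε hε
      simpa using hε
    filter_upwards [hev] with ε hε
    refine (measure_mono ?_).trans (hset ε hε).volume_sdiff_goodFreq_le
    exact Set.sdiff_subset_sdiff_left fun ω hω => hω.1
  · have h := hset ε hε
    have hω' := goodFreq_subset _ _ _ _ hω
    have hs := hs2 ε (hε.trans_le ((min_le_left _ _).trans (min_le_right _ _)))
    have hfree := h.freeResBound (KamSetting.mem_freeSet hω')
    have hsQ : 208 * Q ^ 2 * (KamSetting.dataConst B₀ Q * divConst n (2 * n) (resParam B₀ ε) δ ^ 5 * |ε|) ≤ 1 := by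
      refine le_trans (le_of_eq ?_) hs
      rw [hdiv]
      ring
    have hx : 0 ≤ KamSetting.dataConst B₀ Q * divConst n (2 * n) (resParam B₀ ε) δ ^ 5 * |ε| := by
      rw [hdiv]; positivity
    have hs' : 208 * Q * (KamSetting.dataConst B₀ Q * divConst n (2 * n) (resParam B₀ ε) δ ^ 5 * |ε|) ≤ 1 := by
      refine le_trans ?_ hsQ
      gcongr
      exact le_self_pow₀ hQ1 (by norm_num)
    refine ⟨?_, h.isSolution hf hω', ?_, fun l hl => ⟨?_, ?_, ?_⟩⟩
    · rw [hdiv] at hfree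
      exact hfree
    · refine (h.isSmall hf hω' hfree hs').mono (le_trans ?_ hsQ)
      gcongr
      norm_num
    · refine (h.isSmall hf hω' hl hs').mono ?_
      have hl1 := hl.one_le
      calc _ = 24 * Q ^ 2 * KamSetting.dataConst B₀ Q * (l ^ 5 * |ε|) := by ring
        _ ≤ P * (l ^ 5 * |ε|) := by gcongr; exact le_max_left _ _
        _ = _ := by ring
    · refine (h.abs_mean_sub_le hω' hl).trans ?_
      have hl1 := hl.one_le
      gcongr
      exact (le_max_left _ _).trans (le_max_right _ _)
    · refine (h.norm_meanDrift_sub_le hf hω' hl).trans ?_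
      have hl1 := hl.one_le
      gcongr
      exact (le_max_right _ _).trans (le_max_right _ _)

end FourierAlg

/-! ### Linear differential equations with bounded coefficients -/

section LinearODE

variable {E : Type*} [NormedAddCommGroup E] [NormedSpace ℝ E]

theorem norm_integral_le_exp_of_nonneg {g : ℝ → E} {M l : ℝ} (hM : 0 ≤ M) (hl : 0 < l)
    (h : ∀ s, ‖g s‖ ≤ M * Real.exp (l * |s|)) {t : ℝ} (ht : 0 ≤ t) :
    ‖∫ s in (0 : ℝ)..t, g s‖ ≤ M / l * Real.exp (l * |t|) := by
  have hd : ∀ s, HasDerivAt (fun s => M / l * Real.exp (l * s)) (M * Real.exp (l * s)) s := fun s => by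
    refine ((((hasDerivAt_id s).const_mul l).exp).const_mul (M / l)).congr_deriv ?_
    simp only [id]
    field_simp
  have hc : Continuous fun s : ℝ => M * Real.exp (l * s) := by fun_prop
  have h1 := intervalIntegral.norm_integral_le_of_norm_le (f := g) (μ := volume)
    (g := fun s => M * Real.exp (l * s)) ht
    (Eventually.of_forall fun s hs => by have := h s; rwa [abs_of_pos hs.1] at this)
    (hc.intervalIntegrable _ _)
  rw [intervalIntegral.integral_eq_sub_of_hasDerivAt (fun s _ => hd s)
    (hc.intervalIntegrable _ _)] at h1
  rw [abs_of_nonneg ht]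
  have : 0 ≤ M / l * Real.exp (l * 0) := by positivity
  linarith

theorem norm_integral_le_exp {g : ℝ → E} {M l : ℝ} (hM : 0 ≤ M) (hl : 0 < l)
    (h : ∀ s, ‖g s‖ ≤ M * Real.exp (l * |s|)) (t : ℝ) :
    ‖∫ s in (0 : ℝ)..t, g s‖ ≤ M / l * Real.exp (l * |t|) := by
  rcases le_total 0 t with ht | ht
  · exact norm_integral_le_exp_of_nonneg hM hl h ht
  · have h1 := norm_integral_le_exp_of_nonneg (g := fun s => g (-s)) hM hl
      (fun s => by have := h (-s); rwa [abs_neg] at this) (neg_nonneg.2 ht)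
    rw [intervalIntegral.integral_comp_neg, neg_neg, neg_zero, intervalIntegral.integral_symm,
      norm_neg, abs_neg] at h1
    exact h1

/-- The weighted Picard operator. -/
def picardFun (A : ℝ → E →L[ℝ] E) (l : ℝ) (v₀ : E) (u : ℝ → E) (t : ℝ) : E :=
  Real.exp (-(l * |t|)) • (v₀ + ∫ s in (0 : ℝ)..t, Real.exp (l * |s|) • A s (u s))

theorem continuous_picard_integrand {A : ℝ → E →L[ℝ] E} (hA : Continuous A) (l : ℝ) {u : ℝ → E}
    (hu : Continuous u) : Continuous fun s => Real.exp (l * |s|) • A s (u s) := by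
  have : Continuous fun s : ℝ => Real.exp (l * |s|) := by fun_prop
  exact this.smul (hA.clm_apply hu)

/-- In the supremum norm weighted by `exp(-2K|t|)`, integration gains `1/(2K)` and the field costs
`K`. The Picard map is therefore a contraction by `1/2` on the whole line. -/
theorem norm_exp_smul_integral_le {A : ℝ → E →L[ℝ] E} {K : ℝ} (hK0 : 0 < K)
    (hK : ∀ t, ‖A t‖ ≤ K) {u : ℝ → E} {M : ℝ} (hu : ∀ t, ‖u t‖ ≤ M) (t : ℝ) :
    ‖Real.exp (-(2 * K * |t|)) • ∫ s in (0 : ℝ)..t, Real.exp (2 * K * |s|) • A s (u s)‖ ≤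
      1 / 2 * M := by
  have hM : 0 ≤ M := (norm_nonneg _).trans (hu 0)
  have h1 := norm_integral_le_exp (g := fun s => Real.exp (2 * K * |s|) • A s (u s))
    (M := K * M) (l := 2 * K) (by positivity) (by positivity) (fun s => by
      rw [norm_smul, Real.norm_eq_abs, Real.abs_exp, mul_comm]
      gcongr
      exact (A s).le_of_opNorm_le_of_le (hK s) (hu s)) t
  rw [norm_smul, Real.norm_eq_abs, Real.abs_exp]
  calc _ ≤ Real.exp (-(2 * K * |t|)) * (K * M / (2 * K) * Real.exp (2 * K * |t|)) := by gcongr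
    _ = K * M / (2 * K) * (Real.exp (-(2 * K * |t|)) * Real.exp (2 * K * |t|)) := by ring
    _ = 1 / 2 * M := by
        rw [← Real.exp_add, neg_add_cancel, Real.exp_zero, mul_one]
        field_simp

open scoped BoundedContinuousFunction in
-- The fixed point `u` is the solution divided by `exp(2K|t|)`. Working on all of `ℝ` at once avoids
-- any continuation of local solutions.
theorem exists_solution_of_bounded [CompleteSpace E] {A : ℝ → E →L[ℝ] E} (hA : Continuous A) {K : ℝ} (hK0 : 0 < K)
    (hK : ∀ t, ‖A t‖ ≤ K) (v₀ : E) :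
    ∃ v : ℝ → E, v 0 = v₀ ∧ ∀ t, HasDerivAt v (A t (v t)) t := by
  have hcont : ∀ u : ℝ → E, Continuous u → Continuous (picardFun A (2 * K) v₀ u) := fun u hu => by
    have h1 := continuous_picard_integrand hA (2 * K) hu
    have h2 : Continuous fun t : ℝ => Real.exp (-(2 * K * |t|)) := by fun_prop
    have h3 : Continuous fun t : ℝ => ∫ s in (0 : ℝ)..t, Real.exp (2 * K * |s|) • A s (u s) :=
      continuous_iff_continuousAt.2 fun t => (h1.integral_hasStrictDerivAt 0 t).hasDerivAt.continuousAt
    exact h2.smul (continuous_const.add h3)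
  have hbd : ∀ u : ℝ →ᵇ E, ∀ t, ‖picardFun A (2 * K) v₀ u t‖ ≤ ‖v₀‖ + 1 / 2 * ‖u‖ := fun u t => by
    unfold picardFun
    rw [smul_add]
    refine (norm_add_le _ _).trans (add_le_add ?_
      (norm_exp_smul_integral_le hK0 hK u.norm_coe_le_norm t))
    rw [norm_smul, Real.norm_eq_abs, Real.abs_exp]
    refine mul_le_of_le_one_left (norm_nonneg _) (Real.exp_le_one_iff.2 ?_)
    have : 0 ≤ 2 * K * |t| := by positivity
    linarith
  let Φ : (ℝ →ᵇ E) → (ℝ →ᵇ E) := fun u =>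
    BoundedContinuousFunction.ofNormedAddCommGroup (picardFun A (2 * K) v₀ u) (hcont u u.continuous)
      (‖v₀‖ + 1 / 2 * ‖u‖) (hbd u)
  have hΦ : ContractingWith (1 / 2) Φ := by
    refine ⟨by rw [← NNReal.coe_lt_coe]; norm_num, LipschitzWith.of_dist_le_mul fun u w => ?_⟩
    rw [BoundedContinuousFunction.dist_le (by positivity)]
    intro t
    have e : picardFun A (2 * K) v₀ u t - picardFun A (2 * K) v₀ w t =
        Real.exp (-(2 * K * |t|)) • ∫ s in (0 : ℝ)..t, Real.exp (2 * K * |s|) • A s ((u - w) s) := by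
      unfold picardFun
      rw [← smul_sub, add_sub_add_left_eq_sub, ← intervalIntegral.integral_sub
        ((continuous_picard_integrand hA _ u.continuous).intervalIntegrable _ _)
        ((continuous_picard_integrand hA _ w.continuous).intervalIntegrable _ _)]
      simp only [BoundedContinuousFunction.coe_sub, Pi.sub_apply, map_sub, smul_sub]
    have := norm_exp_smul_integral_le hK0 hK (u - w).norm_coe_le_norm t
    rw [← e] at this
    rw [dist_eq_norm, dist_eq_norm]
    simpa [Φ] using this
  obtain ⟨u, hu⟩ : ∃ u, Φ u = u := ⟨_, hΦ.fixedPoint_isFixedPt⟩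
  have hu' : ∀ t, Real.exp (2 * K * |t|) • u t =
      v₀ + ∫ s in (0 : ℝ)..t, Real.exp (2 * K * |s|) • A s (u s) := fun t => by
    have h1 : u t = picardFun A (2 * K) v₀ u t := by
      conv_lhs => rw [← hu]
      rfl
    rw [h1, picardFun, smul_smul, ← Real.exp_add, add_neg_cancel, Real.exp_zero, one_smul]
  refine ⟨fun t => Real.exp (2 * K * |t|) • u t, (hu' 0).trans (by simp), fun t => ?_⟩
  have h1 := continuous_picard_integrand hA (2 * K) u.continuous
  have h2 := ((h1.integral_hasStrictDerivAt 0 t).hasDerivAt).const_add v₀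
  simp only [map_smul]
  exact h2.congr_of_eventuallyEq (Eventually.of_forall hu')

end LinearODE

/-! ### Hamilton's equations -/

section Hamilton

variable {n : ℕ}

/-- The coordinate `xᵢ` of the phase space. -/
def posCLM (i : Fin 2) : Phase →L[ℝ] ℝ :=
  (ContinuousLinearMap.proj i).comp (ContinuousLinearMap.fst ℝ (Fin 2 → ℝ) (Fin 2 → ℝ))

/-- The coordinate `pᵢ` of the phase space. -/
def momCLM (i : Fin 2) : Phase →L[ℝ] ℝ :=
  (ContinuousLinearMap.proj i).comp (ContinuousLinearMap.snd ℝ (Fin 2 → ℝ) (Fin 2 → ℝ))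

@[simp] theorem posCLM_apply (i : Fin 2) (v : Phase) : posCLM i v = v.1 i := rfl

@[simp] theorem momCLM_apply (i : Fin 2) (v : Phase) : momCLM i v = v.2 i := rfl

theorem fderiv_hLandau (B₀ : ℝ) (f : (Fin n → ℝ) → ℝ) (ε : ℝ) (ω : Fin n → ℝ) (t : ℝ) (v : Phase) :
    fderiv ℝ (hLandau B₀ f ε ω t) v =
      (2 * (v.2 0 - magB B₀ f ε ω t * v.1 1)) • (momCLM 0 - magB B₀ f ε ω t • posCLM 1) +
        (2 * v.2 1) • momCLM 1 := by
  refine HasFDerivAt.fderiv ?_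
  have h0 := (momCLM 0 - magB B₀ f ε ω t • posCLM 1).hasFDerivAt (x := v)
  have h1 := (momCLM 1).hasFDerivAt (x := v)
  refine ((h0.pow 2).add (h1.pow 2)).congr_fderiv ?_
  simp

theorem isHamiltonSol_hLandau_iff {B₀ : ℝ} {f : (Fin n → ℝ) → ℝ} {ε : ℝ} {ω : Fin n → ℝ}
    {v : ℝ → Phase} :
    IsHamiltonSol (hLandau B₀ f ε ω) v ↔ ∀ t,
      HasDerivAt (fun s => (v s).1 0) (2 * ((v t).2 0 - magB B₀ f ε ω t * (v t).1 1)) t ∧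
      HasDerivAt (fun s => (v s).1 1) (2 * (v t).2 1) t ∧
      HasDerivAt (fun s => (v s).2 0) 0 t ∧
      HasDerivAt (fun s => (v s).2 1)
        (2 * magB B₀ f ε ω t * ((v t).2 0 - magB B₀ f ε ω t * (v t).1 1)) t := by
  unfold IsHamiltonSol
  simp only [Fin.forall_fin_two, fderiv_hLandau]
  refine forall_congr' fun t => ?_
  have e : ∀ x y : ℝ, 2 * (x - magB B₀ f ε ω t * y) * magB B₀ f ε ω t =
    2 * magB B₀ f ε ω t * (x - magB B₀ f ε ω t * y) := fun x y => by ring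
  simp [e]
  tauto

theorem hNormal_eq {B₀ : ℝ} (hB : 0 < B₀) (b c : ℝ) (v : Phase) : hNormal B₀ b c v =
    b / (2 * B₀) * ((B₀ * v.1 1 - v.2 0) ^ 2 + v.2 1 ^ 2) - 2 * c / B₀ * v.2 0 ^ 2 := by
  have hs : Real.sqrt (2 * B₀) ^ 2 = 2 * B₀ := Real.sq_sqrt (by positivity)
  have hs0 : Real.sqrt (2 * B₀) ≠ 0 := (Real.sqrt_pos.2 (by positivity)).ne'
  have h1 : ‖zOne B₀ v‖ ^ 2 = ((B₀ * v.1 1 - v.2 0) ^ 2 + v.2 1 ^ 2) / (2 * B₀) := by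
    unfold zOne
    rw [mul_comm Complex.I, ← Complex.normSq_eq_norm_sq, Complex.normSq_add_mul_I,
      show ((B₀ * v.1 1 - v.2 0) ^ 2 + v.2 1 ^ 2) / (2 * B₀) =
        ((B₀ * v.1 1 - v.2 0) ^ 2 + v.2 1 ^ 2) / Real.sqrt (2 * B₀) ^ 2 by rw [hs]]
    generalize Real.sqrt (2 * B₀) = s at hs0
    field_simp
  have h2 : zTwo B₀ v - conj (zTwo B₀ v) = ((2 * (v.2 0 / Real.sqrt (2 * B₀)) : ℝ) : ℂ) * Complex.I := by
    rw [Complex.sub_conj]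
    unfold zTwo
    rw [Complex.add_im, Complex.ofReal_im, Complex.I_mul_im, Complex.ofReal_re, zero_add]
  unfold hNormal
  rw [h1, h2, mul_pow, Complex.I_sq, ← Complex.ofReal_pow, mul_neg_one, Complex.neg_re,
    Complex.ofReal_re, mul_pow, div_pow, hs]
  field_simp
  ring

theorem fderiv_hNormal {B₀ : ℝ} (hB : 0 < B₀) (b c : ℝ) (v : Phase) :
    fderiv ℝ (hNormal B₀ b c) v =
      (b / B₀ * (B₀ * v.1 1 - v.2 0)) • (B₀ • posCLM 1 - momCLM 0) +
        (b / B₀ * v.2 1) • momCLM 1 - (4 * c / B₀ * v.2 0) • momCLM 0 := by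
  refine HasFDerivAt.fderiv ?_
  have h0 := (B₀ • posCLM 1 - momCLM 0).hasFDerivAt (x := v)
  have h1 := (momCLM 1).hasFDerivAt (x := v)
  have h2 := (momCLM 0).hasFDerivAt (x := v)
  have h := ((((h0.pow 2).add (h1.pow 2)).const_mul (b / (2 * B₀))).sub
    ((h2.pow 2).const_mul (2 * c / B₀)))
  refine (h.congr_fderiv ?_).congr_of_eventuallyEq
    (Eventually.of_forall fun w => by rw [hNormal_eq hB]; simp)
  ext w <;> simp <;> field_simp
  ring

theorem isHamiltonSol_hNormal_iff {B₀ : ℝ} (hB : 0 < B₀) {b c : ℝ} {v : ℝ → Phase} :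
    IsHamiltonSol (fun _ => hNormal B₀ b c) v ↔ ∀ t,
      HasDerivAt (fun s => (v s).1 0)
        (-(b / B₀ * (B₀ * (v t).1 1 - (v t).2 0)) - 4 * c / B₀ * (v t).2 0) t ∧
      HasDerivAt (fun s => (v s).1 1) (b / B₀ * (v t).2 1) t ∧
      HasDerivAt (fun s => (v s).2 0) 0 t ∧
      HasDerivAt (fun s => (v s).2 1) (-(b * (B₀ * (v t).1 1 - (v t).2 0))) t := by
  unfold IsHamiltonSol
  simp only [Fin.forall_fin_two, fderiv_hNormal hB]
  refine forall_congr' fun t => ?_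
  have e : ∀ x y : ℝ, b / B₀ * (B₀ * x - y) * B₀ = b * (B₀ * x - y) := fun x y => by field_simp
  simp [e]
  tauto

/-- The vector field of Hamilton's equations in the field `B`. -/
def landauField (B : ℝ) : Phase →L[ℝ] Phase :=
  ((ContinuousLinearMap.pi ![(2 : ℝ) • (momCLM 0 - B • posCLM 1), (2 : ℝ) • momCLM 1]).prod
    (ContinuousLinearMap.pi ![0, (2 * B) • (momCLM 0 - B • posCLM 1)]))

theorem continuous_landauField : Continuous landauField := by
  -- The field is a quadratic polynomial in `B`, recovered by interpolation at `-1`, `0` and `1`.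
  have h : landauField = fun B => landauField 0 +
      (B / 2) • (landauField 1 - landauField (-1)) +
      B ^ 2 • ((1 / 2 : ℝ) • (landauField 1 + landauField (-1)) - landauField 0) := by
    funext B
    ext v i <;> fin_cases i <;> simp [landauField] <;> ring_nf <;> simp
  rw [h]
  fun_prop

theorem isHamiltonSol_hLandau_iff_landauField {B₀ : ℝ} {f : (Fin n → ℝ) → ℝ} {ε : ℝ}
    {ω : Fin n → ℝ} {v : ℝ → Phase} :
    IsHamiltonSol (hLandau B₀ f ε ω) v ↔
      ∀ t, HasDerivAt v (landauField (magB B₀ f ε ω t) (v t)) t := by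
  rw [isHamiltonSol_hLandau_iff]
  refine forall_congr' fun t => ?_
  constructor
  · rintro ⟨h1, h2, h3, h4⟩
    refine HasDerivAt.prodMk (f₁ := fun s => (v s).1) (f₂ := fun s => (v s).2) ?_ ?_
    · rw [hasDerivAt_pi, Fin.forall_fin_two]
      exact ⟨by simpa [landauField] using h1, by simpa [landauField] using h2⟩
    · rw [hasDerivAt_pi, Fin.forall_fin_two]
      exact ⟨by simpa [landauField] using h3, by simpa [landauField] using h4⟩
  · intro h
    have hp := fun i => (posCLM i).hasFDerivAt.comp_hasDerivAt t h
    have hm := fun i => (momCLM i).hasFDerivAt.comp_hasDerivAt t h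
    refine ⟨?_, ?_, ?_, ?_⟩
    · exact (hp 0).congr_deriv (by simp [landauField])
    · exact (hp 1).congr_deriv (by simp [landauField])
    · exact (hm 0).congr_deriv (by simp [landauField])
    · exact (hm 1).congr_deriv (by simp [landauField])

theorem continuous_magB (B₀ : ℝ) {f : (Fin n → ℝ) → ℝ} (hf : Continuous f) (ε : ℝ)
    (ω : Fin n → ℝ) : Continuous (magB B₀ f ε ω) := by
  unfold magB
  fun_prop

/-- Hamilton's equations of a bounded continuous field are uniquely solvable. -/
theorem existsUnique_landau {B₀ : ℝ} {f : (Fin n → ℝ) → ℝ} (hf : Continuous f) {ε r : ℝ}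
    {ω : Fin n → ℝ} (hr : ∀ t, |magB B₀ f ε ω t - B₀| ≤ r) (v₀ : Phase) :
    ∃! v : ℝ → Phase, IsHamiltonSol (hLandau B₀ f ε ω) v ∧ v 0 = v₀ := by
  set A := fun t => landauField (magB B₀ f ε ω t) with hA
  have hcont : Continuous A := continuous_landauField.comp (continuous_magB B₀ hf ε ω)
  obtain ⟨K, hK⟩ : ∃ K : ℝ, ∀ t, ‖A t‖ ≤ K := by
    obtain ⟨K, hK⟩ := (isCompact_Icc (a := B₀ - r) (b := B₀ + r)).exists_bound_of_continuousOn
      continuous_landauField.continuousOn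
    refine ⟨K, fun t => hK _ ?_⟩
    have := abs_le.1 (hr t)
    constructor <;> linarith
  have hK1 : ∀ t, ‖A t‖ ≤ |K| + 1 := fun t => (hK t).trans (by linarith [le_abs_self K])
  simp only [isHamiltonSol_hLandau_iff_landauField]
  obtain ⟨v, hv0, hv⟩ := exists_solution_of_bounded hcont (by positivity) hK1 v₀
  refine ⟨v, ⟨hv, hv0⟩, fun w ⟨hw, hw0⟩ => ?_⟩
  refine ODE_solution_unique_univ (v := fun t x => A t x) (s := fun _ => Set.univ)
    (K := Real.toNNReal (|K| + 1)) (t₀ := 0) (fun t => ?_) (fun t => ⟨hw t, trivial⟩)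
    (fun t => ⟨hv t, trivial⟩) (hw0.trans hv0.symm)
  refine LipschitzWith.lipschitzOnWith (((A t).lipschitz).weaken ?_)
  rw [← NNReal.coe_le_coe, Real.coe_toNNReal _ (by positivity)]
  exact hK1 t

end Hamilton

/-! ### The normal form transformation -/

theorem mom_eq_of_isHamiltonSol {n : ℕ} {B₀ ε : ℝ} {f : (Fin n → ℝ) → ℝ} {ω : Fin n → ℝ}
    {v : ℝ → Phase} (hv : IsHamiltonSol (hLandau B₀ f ε ω) v) (t : ℝ) : (v t).2 0 = (v 0).2 0 := by
  have hd := fun t => (isHamiltonSol_hLandau_iff.1 hv t).2.2.1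
  exact is_const_of_deriv_eq_zero (fun t => (hd t).differentiableAt) (fun t => (hd t).deriv) t 0

namespace FloquetData

variable {n : ℕ} (d : FloquetData) (B₀ b : ℝ)

/-- The position relative to the response to the constant momentum. -/
def homPos (t : ℝ) : Phase →L[ℝ] ℝ := posCLM 1 - d.q t • momCLM 0

/-- The momentum relative to the response to the constant momentum. -/
def homMom (t : ℝ) : Phase →L[ℝ] ℝ := momCLM 1 - (d.r t / 2) • momCLM 0

/-- The first coordinate of the rotating frame. -/
def rotPos (t : ℝ) : Phase →L[ℝ] ℝ := d.Δ t • d.homPos t - d.β t • d.homMom t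

/-- The second coordinate of the rotating frame. -/
def rotMom (t : ℝ) : Phase →L[ℝ] ℝ := d.A t • d.homMom t - d.C t • d.homPos t

/-- The position in normal form coordinates, relative to the guiding centre. -/
def freePos : Phase →L[ℝ] ℝ := posCLM 1 - B₀⁻¹ • momCLM 0

/-- The transformation to normal form coordinates. -/
def toNormal (t : ℝ) : Phase →L[ℝ] Phase :=
  (ContinuousLinearMap.pi ![posCLM 0 - d.s t • momCLM 0 + B₀⁻¹ • d.rotMom t -
      d.q t • d.homMom t + (d.r t / 2) • d.homPos t, d.rotPos t + B₀⁻¹ • momCLM 0]).prod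
    (ContinuousLinearMap.pi ![momCLM 0, d.rotMom t])

/-- The transformation from normal form coordinates. -/
def ofNormal (t : ℝ) : Phase →L[ℝ] Phase :=
  (ContinuousLinearMap.pi ![posCLM 0 + d.s t • momCLM 0 - B₀⁻¹ • momCLM 1 +
      d.q t • (d.C t • freePos B₀ + d.Δ t • momCLM 1) -
      (d.r t / 2) • (d.A t • freePos B₀ + d.β t • momCLM 1),
      d.A t • freePos B₀ + d.β t • momCLM 1 + d.q t • momCLM 0]).prod
    (ContinuousLinearMap.pi ![momCLM 0,
      d.C t • freePos B₀ + d.Δ t • momCLM 1 + (d.r t / 2) • momCLM 0])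

theorem toNormal_ofNormal {t : ℝ} (hdet : d.A t * d.Δ t - d.β t * d.C t = 1) (v : Phase) :
    d.toNormal B₀ t (d.ofNormal B₀ t v) = v := by
  refine Prod.ext (funext fun i => ?_) (funext fun i => ?_) <;> fin_cases i <;>
    simp [toNormal, ofNormal, rotPos, rotMom, homPos, homMom, freePos]
  · linear_combination B₀⁻¹ * v.2 1 * hdet
  · linear_combination (v.1 1 - B₀⁻¹ * v.2 0) * hdet
  · linear_combination v.2 1 * hdet

theorem ofNormal_toNormal {t : ℝ} (hdet : d.A t * d.Δ t - d.β t * d.C t = 1) (v : Phase) :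
    d.ofNormal B₀ t (d.toNormal B₀ t v) = v := by
  refine Prod.ext (funext fun i => ?_) (funext fun i => ?_) <;> fin_cases i <;>
    simp [toNormal, ofNormal, rotPos, rotMom, homPos, homMom, freePos]
  · linear_combination (d.q t * (v.2 1 - d.r t / 2 * v.2 0) -
      d.r t / 2 * (v.1 1 - d.q t * v.2 0)) * hdet
  · linear_combination (v.1 1 - d.q t * v.2 0) * hdet
  · linear_combination (v.2 1 - d.r t / 2 * v.2 0) * hdet

/-- The block acting on the relative position and momentum is symplectic since its determinant is
one. The terms added to `x₁` are those that compensate the shifts by `q p₁` and `r p₁ / 2`. -/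
theorem sympForm_ofNormal {t : ℝ} (hdet : d.A t * d.Δ t - d.β t * d.C t = 1) (u v : Phase) :
    sympForm (d.ofNormal B₀ t u) (d.ofNormal B₀ t v) = sympForm u v := by
  have e1 : ∀ w : Phase, (d.ofNormal B₀ t w).1 0 = w.1 0 + d.s t * w.2 0 - B₀⁻¹ * w.2 1 +
      d.q t * (d.C t * (w.1 1 - B₀⁻¹ * w.2 0) + d.Δ t * w.2 1) -
      d.r t / 2 * (d.A t * (w.1 1 - B₀⁻¹ * w.2 0) + d.β t * w.2 1) := fun w => by
    simp [ofNormal, freePos]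
    ring
  have e2 : ∀ w : Phase, (d.ofNormal B₀ t w).1 1 =
      d.A t * (w.1 1 - B₀⁻¹ * w.2 0) + d.β t * w.2 1 + d.q t * w.2 0 := fun w => by
    simp [ofNormal, freePos]
  have e3 : ∀ w : Phase, (d.ofNormal B₀ t w).2 0 = w.2 0 := fun w => by simp [ofNormal]
  have e4 : ∀ w : Phase, (d.ofNormal B₀ t w).2 1 =
      d.C t * (w.1 1 - B₀⁻¹ * w.2 0) + d.Δ t * w.2 1 + d.r t / 2 * w.2 0 := fun w => by
    simp [ofNormal, freePos]
  simp only [sympForm, Fin.sum_univ_two, e1, e2, e3, e4]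
  linear_combination ((u.1 1 - B₀⁻¹ * u.2 0) * v.2 1 - u.2 1 * (v.1 1 - B₀⁻¹ * v.2 0)) * hdet

/-- The transformation from normal form coordinates as an equivalence. -/
def normalEquiv (hdet : ∀ t, d.A t * d.Δ t - d.β t * d.C t = 1) (t : ℝ) : Phase ≃L[ℝ] Phase :=
  ContinuousLinearEquiv.equivOfInverse (d.ofNormal B₀ t) (d.toNormal B₀ t)
    (d.toNormal_ofNormal B₀ (hdet t)) (d.ofNormal_toNormal B₀ (hdet t))

section Flow

variable {d B₀ b} {c ε : ℝ} {f : (Fin n → ℝ) → ℝ} {ω : Fin n → ℝ}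
  (h : d.IsSolution B₀ b (-4 / B₀ * c) (magB B₀ f ε ω)) {v : ℝ → Phase}
  (hv : IsHamiltonSol (hLandau B₀ f ε ω) v)
include h hv

/-- Subtracting the response times the conserved momentum leaves a solution of the homogeneous
equation. -/
theorem hasDerivAt_homPos (t : ℝ) :
    HasDerivAt (fun s => d.homPos s (v s)) (2 * d.homMom t (v t)) t := by
  obtain ⟨-, h2, h3, -⟩ := isHamiltonSol_hLandau_iff.1 hv t
  refine (h2.sub ((h.deriv_q t).mul h3)).congr_deriv ?_
  simp [homMom]
  ring

theorem hasDerivAt_homMom (t : ℝ) :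
    HasDerivAt (fun s => d.homMom s (v s)) (-2 * magB B₀ f ε ω t ^ 2 * d.homPos t (v t)) t := by
  obtain ⟨-, -, h3, h4⟩ := isHamiltonSol_hLandau_iff.1 hv t
  refine (h4.sub (((h.deriv_r t).div_const 2).mul h3)).congr_deriv ?_
  simp [homPos]
  ring

theorem hasDerivAt_rotPos (t : ℝ) :
    HasDerivAt (fun s => d.rotPos s (v s)) (b / B₀ * d.rotMom t (v t)) t := by
  refine (((h.deriv_Δ t).mul (hasDerivAt_homPos h hv t)).sub
    ((h.deriv_β t).mul (hasDerivAt_homMom h hv t))).congr_deriv ?_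
  simp [rotMom]
  ring

theorem hasDerivAt_rotMom (t : ℝ) :
    HasDerivAt (fun s => d.rotMom s (v s)) (-(b * B₀ * d.rotPos t (v t))) t := by
  refine (((h.deriv_A t).mul (hasDerivAt_homMom h hv t)).sub
    ((h.deriv_C t).mul (hasDerivAt_homPos h hv t))).congr_deriv ?_
  simp [rotPos]
  ring

/-- The derivative of the guiding centre. -/
theorem hasDerivAt_centre (t : ℝ) :
    HasDerivAt (fun s => (v s).1 0 - d.s s * (v s).2 0 - d.q s * d.homMom s (v s) +
      d.r s / 2 * d.homPos s (v s)) (-4 / B₀ * c * (v t).2 0) t := by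
  obtain ⟨h1, -, h3, -⟩ := isHamiltonSol_hLandau_iff.1 hv t
  -- With `X` and `P` the relative position and momentum, `qP - (r/2)X` has derivative `-2BX`. This
  -- is the part of `x₁'` that depends on `X`, so only the mean drift survives.
  refine (((h1.sub ((h.deriv_s t).mul h3)).sub
    ((h.deriv_q t).mul (hasDerivAt_homMom h hv t))).add
    (((h.deriv_r t).div_const 2).mul (hasDerivAt_homPos h hv t))).congr_deriv ?_
  simp [homPos, homMom]
  ring

theorem isHamiltonSol_toNormal (hB : 0 < B₀) :
    IsHamiltonSol (fun _ => hNormal B₀ b c) (fun t => d.toNormal B₀ t (v t)) := by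
  rw [isHamiltonSol_hNormal_iff hB]
  intro t
  obtain ⟨-, -, h3, -⟩ := isHamiltonSol_hLandau_iff.1 hv t
  have hX := hasDerivAt_rotPos h hv t
  have hP := hasDerivAt_rotMom h hv t
  have hZ := hasDerivAt_centre h hv t
  have e2 : ∀ s, (d.toNormal B₀ s (v s)).1 1 = d.rotPos s (v s) + B₀⁻¹ * (v s).2 0 := fun s => by
    simp [toNormal]
  have e3 : ∀ s, (d.toNormal B₀ s (v s)).2 0 = (v s).2 0 := fun s => by simp [toNormal]
  have e4 : ∀ s, (d.toNormal B₀ s (v s)).2 1 = d.rotMom s (v s) := fun s => by simp [toNormal]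
  have e1 : ∀ s, (d.toNormal B₀ s (v s)).1 0 = ((v s).1 0 - d.s s * (v s).2 0 -
      d.q s * d.homMom s (v s) + d.r s / 2 * d.homPos s (v s)) + B₀⁻¹ * d.rotMom s (v s) := fun s => by
    simp [toNormal]
    ring
  simp only [e1, e2, e3, e4]
  refine ⟨(hZ.add (hP.const_mul B₀⁻¹)).congr_deriv ?_, (hX.add (h3.const_mul B₀⁻¹)).congr_deriv ?_,
    h3, hP.congr_deriv ?_⟩
  · field_simp
    ring
  · ring
  · field_simp
    ring

/-- In this frame the motion is a uniform rotation; the coordinates turned back by the angle `bt`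
are constant. -/
theorem rot_eq (hB : 0 < B₀) (t : ℝ) :
    d.rotPos t (v t) = Real.cos (b * t) * d.rotPos 0 (v 0) +
      Real.sin (b * t) / B₀ * d.rotMom 0 (v 0) ∧
    d.rotMom t (v t) = Real.cos (b * t) * d.rotMom 0 (v 0) -
      B₀ * Real.sin (b * t) * d.rotPos 0 (v 0) := by
  have hX := hasDerivAt_rotPos h hv
  have hP := hasDerivAt_rotMom h hv
  have hc : ∀ t, HasDerivAt (fun t => Real.cos (b * t)) (-Real.sin (b * t) * b) t := fun t => by
    simpa using ((hasDerivAt_id t).const_mul b).cos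
  have hs : ∀ t, HasDerivAt (fun t => Real.sin (b * t)) (Real.cos (b * t) * b) t := fun t => by
    simpa using ((hasDerivAt_id t).const_mul b).sin
  have h1 : ∀ t, HasDerivAt (fun t => Real.cos (b * t) * d.rotPos t (v t) -
      Real.sin (b * t) / B₀ * d.rotMom t (v t)) 0 t := fun t => by
    refine (((hc t).mul (hX t)).sub (((hs t).div_const B₀).mul (hP t))).congr_deriv ?_
    field_simp
    ring
  have h2 : ∀ t, HasDerivAt (fun t => Real.cos (b * t) * d.rotMom t (v t) +
      B₀ * Real.sin (b * t) * d.rotPos t (v t)) 0 t := fun t => by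
    refine (((hc t).mul (hP t)).add (((hs t).const_mul B₀).mul (hX t))).congr_deriv ?_
    field_simp
    ring
  have k1 := is_const_of_deriv_eq_zero (fun t => (h1 t).differentiableAt) (fun t => (h1 t).deriv) t 0
  have k2 := is_const_of_deriv_eq_zero (fun t => (h2 t).differentiableAt) (fun t => (h2 t).deriv) t 0
  simp only [mul_zero, Real.cos_zero, Real.sin_zero, zero_div, zero_mul, sub_zero, add_zero,
    one_mul] at k1 k2
  have k3 := Real.sin_sq_add_cos_sq (b * t)
  have hB' : B₀⁻¹ * B₀ = 1 := inv_mul_cancel₀ hB.ne'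
  simp only [div_eq_mul_inv] at k1 ⊢
  generalize Real.sin (b * t) = sn at *
  generalize Real.cos (b * t) = cs at *
  constructor
  · rw [← k1, ← k2]
    linear_combination (-d.rotPos t (v t)) * k3 - sn ^ 2 * d.rotPos t (v t) * hB'
  · rw [← k1, ← k2]
    linear_combination (-d.rotMom t (v t)) * k3 - sn ^ 2 * d.rotMom t (v t) * hB'

end Flow

/-- The first coordinate of the rotating frame at time `t` in terms of the initial state. -/
def flowPos (t : ℝ) : Phase →L[ℝ] ℝ :=
  Real.cos (b * t) • d.rotPos 0 + (Real.sin (b * t) / B₀) • d.rotMom 0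

/-- The second coordinate of the rotating frame at time `t` in terms of the initial state. -/
def flowMom (t : ℝ) : Phase →L[ℝ] ℝ :=
  Real.cos (b * t) • d.rotMom 0 - (B₀ * Real.sin (b * t)) • d.rotPos 0

/-- The relative position at time `t` in terms of the initial state. -/
def flowHomPos (t : ℝ) : Phase →L[ℝ] ℝ := d.A t • d.flowPos B₀ b t + d.β t • d.flowMom B₀ b t

/-- The relative momentum at time `t` in terms of the initial state. -/
def flowHomMom (t : ℝ) : Phase →L[ℝ] ℝ := d.C t • d.flowPos B₀ b t + d.Δ t • d.flowMom B₀ b t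

section Flow

variable {d B₀ b} {c ε : ℝ} {f : (Fin n → ℝ) → ℝ} {ω : Fin n → ℝ}
  (h : d.IsSolution B₀ b (-4 / B₀ * c) (magB B₀ f ε ω)) {v : ℝ → Phase}
  (hv : IsHamiltonSol (hLandau B₀ f ε ω) v)
include h hv

theorem homPos_eq (hB : 0 < B₀) (t : ℝ) : d.homPos t (v t) = d.flowHomPos B₀ b t (v 0) := by
  obtain ⟨h1, h2⟩ := rot_eq h hv hB t
  have h3 : d.flowHomPos B₀ b t (v 0) = d.A t * d.rotPos t (v t) + d.β t * d.rotMom t (v t) := by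
    rw [h1, h2]
    simp [flowHomPos, flowPos, flowMom]
    ring
  have e1 : d.rotPos t (v t) = d.Δ t * d.homPos t (v t) - d.β t * d.homMom t (v t) := by
    simp [rotPos]
  have e2 : d.rotMom t (v t) = d.A t * d.homMom t (v t) - d.C t * d.homPos t (v t) := by
    simp [rotMom]
  rw [h3, e1, e2]
  linear_combination (-d.homPos t (v t)) * h.det t

theorem homMom_eq (hB : 0 < B₀) (t : ℝ) : d.homMom t (v t) = d.flowHomMom B₀ b t (v 0) := by
  obtain ⟨h1, h2⟩ := rot_eq h hv hB t
  have h3 : d.flowHomMom B₀ b t (v 0) = d.C t * d.rotPos t (v t) + d.Δ t * d.rotMom t (v t) := by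
    rw [h1, h2]
    simp [flowHomMom, flowPos, flowMom]
    ring
  have e1 : d.rotPos t (v t) = d.Δ t * d.homPos t (v t) - d.β t * d.homMom t (v t) := by
    simp [rotPos]
  have e2 : d.rotMom t (v t) = d.A t * d.homMom t (v t) - d.C t * d.homPos t (v t) := by
    simp [rotMom]
  rw [h3, e1, e2]
  linear_combination (-d.homMom t (v t)) * h.det t

theorem pos_one_eq (hB : 0 < B₀) (t : ℝ) :
    (v t).1 1 = d.flowHomPos B₀ b t (v 0) + d.q t * (v 0).2 0 := by
  rw [← homPos_eq h hv hB, ← mom_eq_of_isHamiltonSol hv t]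
  simp [homPos]

theorem mom_one_eq (hB : 0 < B₀) (t : ℝ) :
    (v t).2 1 = d.flowHomMom B₀ b t (v 0) + d.r t / 2 * (v 0).2 0 := by
  rw [← homMom_eq h hv hB, ← mom_eq_of_isHamiltonSol hv t]
  simp [homMom]

/-- Integration of the constant velocity of the guiding centre; all other terms are bounded in time.
-/
theorem pos_zero_eq (hB : 0 < B₀) (t : ℝ) :
    (v t).1 0 = (v 0).1 0 + -4 / B₀ * c * (v 0).2 0 * t + (d.s t - d.s 0) * (v 0).2 0 +
      (d.q t * d.flowHomMom B₀ b t (v 0) - d.q 0 * d.homMom 0 (v 0)) -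
      (d.r t / 2 * d.flowHomPos B₀ b t (v 0) - d.r 0 / 2 * d.homPos 0 (v 0)) := by
  have h1 : ∀ t, HasDerivAt (fun s => ((v s).1 0 - d.s s * (v s).2 0 - d.q s * d.homMom s (v s) +
      d.r s / 2 * d.homPos s (v s)) - -4 / B₀ * c * (v 0).2 0 * s) 0 t := fun t => by
    refine ((hasDerivAt_centre h hv t).sub ((hasDerivAt_id t).const_mul _)).congr_deriv ?_
    rw [mom_eq_of_isHamiltonSol hv t]
    ring
  have k1 := is_const_of_deriv_eq_zero (fun t => (h1 t).differentiableAt) (fun t => (h1 t).deriv) t 0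
  rw [← homPos_eq h hv hB, ← homMom_eq h hv hB]
  rw [mom_eq_of_isHamiltonSol hv t] at k1
  linear_combination k1

end Flow

end FloquetData

/-! ### Estimates for the transformation -/

theorem abs_mul_le_of_le {x y a b : ℝ} (hx : |x| ≤ a) (hy : |y| ≤ b) : |x * y| ≤ a * b := by
  rw [abs_mul]
  exact mul_le_mul hx hy (abs_nonneg _) ((abs_nonneg _).trans hx)

theorem abs_sub_le_of_le {x y a b : ℝ} (hx : |x| ≤ a) (hy : |y| ≤ b) : |x - y| ≤ a + b :=
  (abs_sub _ _).trans (add_le_add hx hy)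

theorem abs_add_le_of_le {x y a b : ℝ} (hx : |x| ≤ a) (hy : |y| ≤ b) : |x + y| ≤ a + b :=
  (abs_add_le _ _).trans (add_le_add hx hy)

theorem abs_pos_le_norm (v : Phase) (i : Fin 2) : |v.1 i| ≤ ‖v‖ :=
  (norm_le_pi_norm v.1 i).trans (norm_fst_le v)

theorem abs_mom_le_norm (v : Phase) (i : Fin 2) : |v.2 i| ≤ ‖v‖ :=
  (norm_le_pi_norm v.2 i).trans (norm_snd_le v)

namespace FloquetData

/-- The constant in the estimates. -/
def scale (B₀ : ℝ) : ℝ := 1 + B₀ + B₀⁻¹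

section Bounds

variable {d : FloquetData} {B₀ b δ : ℝ} {B : ℝ → ℝ} (hB : 0 < B₀) (hδ : δ ≤ 1)
  (h : d.IsSmall B₀ B δ) (t : ℝ) (v : Phase)

include hB in
theorem scale_bounds : 1 ≤ scale B₀ ∧ B₀ ≤ scale B₀ ∧ |B₀⁻¹| ≤ scale B₀ ∧ B₀⁻¹ + 1 ≤ scale B₀ := by
  have := inv_pos.2 hB
  unfold scale
  rw [abs_of_pos this]
  refine ⟨?_, ?_, ?_, ?_⟩ <;> linarith

include h in
theorem IsSmall.nonneg : 0 ≤ δ := (abs_nonneg _).trans (h.A 0)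

include hB hδ h

theorem abs_q_le : |d.q t| ≤ scale B₀ := by
  have h1 := abs_add_le_of_le (h.q t) le_rfl (y := B₀⁻¹)
  rw [sub_add_cancel, abs_of_pos (inv_pos.2 hB)] at h1
  linarith [(scale_bounds hB).2.2.2]

theorem abs_inv_field_le : |(B t)⁻¹| ≤ scale B₀ := by
  have h1 := abs_add_le_of_le (h.field t) le_rfl (y := B₀⁻¹)
  rw [sub_add_cancel, abs_of_pos (inv_pos.2 hB)] at h1
  linarith [(scale_bounds hB).2.2.2]

theorem abs_homPos_le : |d.homPos t v| ≤ 2 * scale B₀ * ‖v‖ := by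
  obtain ⟨k1, -, -, -⟩ := scale_bounds hB
  have h1 := abs_sub_le_of_le (abs_pos_le_norm v 1)
    (abs_mul_le_of_le (abs_q_le hB hδ h t) (abs_mom_le_norm v 0))
  have e : d.homPos t v = v.1 1 - d.q t * v.2 0 := by simp [homPos]
  rw [e]
  nlinarith [norm_nonneg v]

omit hB in
theorem abs_homMom_le : |d.homMom t v| ≤ 2 * ‖v‖ := by
  have h0 : |d.r t / 2| ≤ 1 := by
    rw [abs_div, abs_two]
    linarith [h.r t]
  have h1 := abs_sub_le_of_le (abs_mom_le_norm v 1) (abs_mul_le_of_le h0 (abs_mom_le_norm v 0))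
  have e : d.homMom t v = v.2 1 - d.r t / 2 * v.2 0 := by simp [homMom]
  rw [e]
  linarith

theorem abs_rotPos_sub_le : |d.rotPos t v - freePos B₀ v| ≤ 5 * scale B₀ * (δ * ‖v‖) := by
  obtain ⟨k1, -, -, -⟩ := scale_bounds hB
  have hn : 0 ≤ δ * ‖v‖ := mul_nonneg h.nonneg (norm_nonneg v)
  have e : d.rotPos t v - freePos B₀ v = (d.Δ t - 1) * d.homPos t v - (d.q t - B₀⁻¹) * v.2 0 -
      d.β t * d.homMom t v := by
    simp [rotPos, freePos, homPos]
    ring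
  have h1 := abs_sub_le_of_le (abs_sub_le_of_le
    (abs_mul_le_of_le (h.Δ t) (abs_homPos_le hB hδ h t v))
    (abs_mul_le_of_le (h.q t) (abs_mom_le_norm v 0)))
    (abs_mul_le_of_le (h.β t) (abs_homMom_le hδ h t v))
  rw [e]
  nlinarith

theorem abs_rotMom_sub_le : |d.rotMom t v - v.2 1| ≤ 5 * scale B₀ * (δ * ‖v‖) := by
  obtain ⟨k1, -, -, -⟩ := scale_bounds hB
  have hn : 0 ≤ δ * ‖v‖ := mul_nonneg h.nonneg (norm_nonneg v)
  have e : d.rotMom t v - v.2 1 = (d.A t - 1) * d.homMom t v - d.C t * d.homPos t v -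
      d.r t * (v.2 0 / 2) := by
    simp [rotMom, homMom]
    ring
  have h0 : |v.2 0 / 2| ≤ ‖v‖ := by
    rw [abs_div, abs_two]
    linarith [abs_mom_le_norm v 0, abs_nonneg (v.2 0)]
  have h1 := abs_sub_le_of_le (abs_sub_le_of_le
    (abs_mul_le_of_le (h.A t) (abs_homMom_le hδ h t v))
    (abs_mul_le_of_le (h.C t) (abs_homPos_le hB hδ h t v)))
    (abs_mul_le_of_le (h.r t) h0)
  rw [e]
  nlinarith

omit hδ h in
theorem abs_freePos_le : |freePos B₀ v| ≤ scale B₀ * ‖v‖ := by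
  obtain ⟨-, -, -, k4⟩ := scale_bounds hB
  have h1 := abs_sub_le_of_le (abs_pos_le_norm v 1)
    (abs_mul_le_of_le (le_refl |B₀⁻¹|) (abs_mom_le_norm v 0))
  have e : freePos B₀ v = v.1 1 - B₀⁻¹ * v.2 0 := by simp [freePos]
  rw [abs_of_pos (inv_pos.2 hB)] at h1
  rw [e]
  nlinarith [norm_nonneg v]

theorem abs_rotPos_le : |d.rotPos t v| ≤ 6 * scale B₀ * ‖v‖ := by
  obtain ⟨k1, -, -, -⟩ := scale_bounds hB
  have h1 := abs_add_le_of_le (abs_rotPos_sub_le hB hδ h t v) (abs_freePos_le hB v)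
  rw [sub_add_cancel] at h1
  have hn : δ * ‖v‖ ≤ ‖v‖ := mul_le_of_le_one_left (norm_nonneg v) hδ
  nlinarith

theorem abs_rotMom_le : |d.rotMom t v| ≤ 6 * scale B₀ * ‖v‖ := by
  obtain ⟨k1, -, -, -⟩ := scale_bounds hB
  have h1 := abs_add_le_of_le (abs_rotMom_sub_le hB hδ h t v) (abs_mom_le_norm v 1)
  rw [sub_add_cancel] at h1
  have hn : δ * ‖v‖ ≤ ‖v‖ := mul_le_of_le_one_left (norm_nonneg v) hδ
  nlinarith [norm_nonneg v]

omit hδ h in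
theorem abs_sin_div_le (s : ℝ) : |Real.sin s / B₀| ≤ scale B₀ := by
  rw [div_eq_mul_inv]
  have := abs_mul_le_of_le (Real.abs_sin_le_one s) (scale_bounds hB).2.2.1
  rwa [one_mul] at this

omit hδ h in
theorem abs_mul_sin_le (s : ℝ) : |B₀ * Real.sin s| ≤ scale B₀ := by
  have h1 : |B₀| ≤ scale B₀ := by
    rw [abs_of_pos hB]
    exact (scale_bounds hB).2.1
  have := abs_mul_le_of_le h1 (Real.abs_sin_le_one s)
  rwa [mul_one] at this

theorem abs_flowPos_le : |d.flowPos B₀ b t v| ≤ 12 * (scale B₀ ^ 2 * ‖v‖) := by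
  obtain ⟨k1, -, -, -⟩ := scale_bounds hB
  have h1 := abs_add_le_of_le
    (abs_mul_le_of_le (Real.abs_cos_le_one (b * t)) (abs_rotPos_le hB hδ h 0 v))
    (abs_mul_le_of_le (abs_sin_div_le hB (b * t)) (abs_rotMom_le hB hδ h 0 v))
  have e : d.flowPos B₀ b t v = Real.cos (b * t) * d.rotPos 0 v +
      Real.sin (b * t) / B₀ * d.rotMom 0 v := by simp [flowPos]
  rw [e]
  have : scale B₀ * ‖v‖ ≤ scale B₀ ^ 2 * ‖v‖ := by gcongr; exact le_self_pow₀ k1 two_ne_zero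
  linarith

theorem abs_flowMom_le : |d.flowMom B₀ b t v| ≤ 12 * (scale B₀ ^ 2 * ‖v‖) := by
  obtain ⟨k1, -, -, -⟩ := scale_bounds hB
  have h1 := abs_sub_le_of_le
    (abs_mul_le_of_le (Real.abs_cos_le_one (b * t)) (abs_rotMom_le hB hδ h 0 v))
    (abs_mul_le_of_le (abs_mul_sin_le hB (b * t)) (abs_rotPos_le hB hδ h 0 v))
  have e : d.flowMom B₀ b t v = Real.cos (b * t) * d.rotMom 0 v -
      B₀ * Real.sin (b * t) * d.rotPos 0 v := by simp [flowMom]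
  rw [e]
  have : scale B₀ * ‖v‖ ≤ scale B₀ ^ 2 * ‖v‖ := by gcongr; exact le_self_pow₀ k1 two_ne_zero
  linarith

theorem abs_flowHomPos_le : |d.flowHomPos B₀ b t v| ≤ 36 * (scale B₀ ^ 2 * ‖v‖) := by
  have hA : |d.A t| ≤ 2 := by
    have := abs_add_le_of_le (h.A t) le_rfl (y := 1)
    rw [sub_add_cancel, abs_one] at this
    linarith
  have h1 := abs_add_le_of_le (abs_mul_le_of_le hA (abs_flowPos_le (b := b) hB hδ h t v))
    (abs_mul_le_of_le ((h.β t).trans hδ) (abs_flowMom_le (b := b) hB hδ h t v))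
  have e : d.flowHomPos B₀ b t v = d.A t * d.flowPos B₀ b t v + d.β t * d.flowMom B₀ b t v := by
    simp [flowHomPos]
  rw [e]
  linarith

theorem abs_flowHomMom_le : |d.flowHomMom B₀ b t v| ≤ 36 * (scale B₀ ^ 2 * ‖v‖) := by
  have hA : |d.Δ t| ≤ 2 := by
    have := abs_add_le_of_le (h.Δ t) le_rfl (y := 1)
    rw [sub_add_cancel, abs_one] at this
    linarith
  have h1 := abs_add_le_of_le
    (abs_mul_le_of_le ((h.C t).trans hδ) (abs_flowPos_le (b := b) hB hδ h t v))
    (abs_mul_le_of_le hA (abs_flowMom_le (b := b) hB hδ h t v))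
  have e : d.flowHomMom B₀ b t v = d.C t * d.flowPos B₀ b t v + d.Δ t * d.flowMom B₀ b t v := by
    simp [flowHomMom]
  rw [e]
  linarith

end Bounds

/-! ### The error terms -/

variable (d : FloquetData) (B₀ b : ℝ) (B : ℝ → ℝ)

/-- The error in the formula for `x₁`. -/
def errPosZero (t : ℝ) : Phase →L[ℝ] ℝ :=
  (d.s t - d.s 0) • momCLM 0 + (d.q t - (B t)⁻¹) • d.flowHomMom B₀ b t -
    (d.q 0 - (B t)⁻¹) • d.homMom 0 - (d.r t / 2) • d.flowHomPos B₀ b t +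
    (d.r 0 / 2) • d.homPos 0 - ((B t)⁻¹ * ((d.r t - d.r 0) / 2)) • momCLM 0

/-- The error in the formula for `p₂`. -/
def errMomOne (t : ℝ) : Phase →L[ℝ] ℝ :=
  d.C t • d.flowPos B₀ b t + (d.Δ t - 1) • d.flowMom B₀ b t + (d.r t / 2) • momCLM 0 +
    Real.cos (b * t) • (d.rotMom 0 - momCLM 1) -
    (B₀ * Real.sin (b * t)) • (d.rotPos 0 - freePos B₀)

/-- The error in the formula for `x₂`. -/
def errPosOne (t : ℝ) : Phase →L[ℝ] ℝ :=
  (d.A t - 1) • d.flowPos B₀ b t + d.β t • d.flowMom B₀ b t + (d.q t - (B t)⁻¹) • momCLM 0 -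
    (B₀ ^ 2 / B t ^ 2 - 1) • d.flowPos B₀ b t + (B₀ ^ 2 / B t ^ 2) •
    (Real.cos (b * t) • (d.rotPos 0 - freePos B₀) +
      (Real.sin (b * t) / B₀) • (d.rotMom 0 - momCLM 1))

section Bounds

variable {d B₀ b B} {δ : ℝ} (hB : 0 < B₀) (hδ : δ ≤ 1) (h : d.IsSmall B₀ B δ) (t : ℝ) (v : Phase)
include hB hδ h

omit hB hδ in
theorem abs_sub_inv_field_le (s : ℝ) : |d.q s - (B t)⁻¹| ≤ 2 * δ := by
  have := abs_sub_le_of_le (h.q s) (h.field t)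
  rw [sub_sub_sub_cancel_right] at this
  linarith

omit hδ in
theorem monomials_le : δ * ‖v‖ ≤ scale B₀ ^ 2 * δ * ‖v‖ ∧
    scale B₀ * (δ * ‖v‖) ≤ scale B₀ ^ 2 * δ * ‖v‖ ∧ 0 ≤ scale B₀ ^ 2 * δ * ‖v‖ := by
  obtain ⟨k1, -, -, -⟩ := scale_bounds hB
  have hn : 0 ≤ δ * ‖v‖ := mul_nonneg h.nonneg (norm_nonneg v)
  have k2 : scale B₀ ≤ scale B₀ ^ 2 := le_self_pow₀ k1 two_ne_zero
  rw [mul_assoc]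
  exact ⟨le_mul_of_one_le_left hn (k1.trans k2), by gcongr, by positivity⟩

omit hB hδ in
theorem abs_half_le (s : ℝ) : |d.r s / 2| ≤ δ := by
  rw [abs_div, abs_two]
  linarith [h.r s, h.nonneg]

theorem abs_errPosZero_le : |d.errPosZero B₀ b B t v| ≤ 200 * (scale B₀ ^ 2 * δ * ‖v‖) := by
  obtain ⟨m1, m2, m3⟩ := monomials_le hB h v
  have hs := abs_sub_le_of_le (h.s t) (h.s 0)
  have hr : |(d.r t - d.r 0) / 2| ≤ δ := by
    rw [abs_div, abs_two]
    linarith [abs_sub_le_of_le (h.r t) (h.r 0)]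
  have h1 := abs_sub_le_of_le (abs_add_le_of_le (abs_sub_le_of_le (abs_sub_le_of_le
    (abs_add_le_of_le (abs_mul_le_of_le hs (abs_mom_le_norm v 0))
      (abs_mul_le_of_le (abs_sub_inv_field_le h t t) (abs_flowHomMom_le (b := b) hB hδ h t v)))
    (abs_mul_le_of_le (abs_sub_inv_field_le h t 0) (abs_homMom_le hδ h 0 v)))
    (abs_mul_le_of_le (abs_half_le h t) (abs_flowHomPos_le (b := b) hB hδ h t v)))
    (abs_mul_le_of_le (abs_half_le h 0) (abs_homPos_le hB hδ h 0 v)))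
    (abs_mul_le_of_le (abs_mul_le_of_le (abs_inv_field_le hB hδ h t) hr) (abs_mom_le_norm v 0))
  simp only [errPosZero, ← momCLM_apply] at h1 ⊢
  refine h1.trans ?_
  linarith

theorem abs_errMomOne_le : |d.errMomOne B₀ b t v| ≤ 200 * (scale B₀ ^ 2 * δ * ‖v‖) := by
  obtain ⟨m1, m2, m3⟩ := monomials_le hB h v
  have h1 := abs_sub_le_of_le (abs_add_le_of_le (abs_add_le_of_le (abs_add_le_of_le
    (abs_mul_le_of_le (h.C t) (abs_flowPos_le (b := b) hB hδ h t v))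
    (abs_mul_le_of_le (h.Δ t) (abs_flowMom_le (b := b) hB hδ h t v)))
    (abs_mul_le_of_le (abs_half_le h t) (abs_mom_le_norm v 0)))
    (abs_mul_le_of_le (Real.abs_cos_le_one (b * t)) (abs_rotMom_sub_le hB hδ h 0 v)))
    (abs_mul_le_of_le (abs_mul_sin_le hB (b * t)) (abs_rotPos_sub_le hB hδ h 0 v))
  simp only [errMomOne, ← momCLM_apply] at h1 ⊢
  refine h1.trans ?_
  linarith

theorem abs_errPosOne_le : |d.errPosOne B₀ b B t v| ≤ 200 * (scale B₀ ^ 2 * δ * ‖v‖) := by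
  obtain ⟨m1, m2, m3⟩ := monomials_le hB h v
  have h2 : |B₀ ^ 2 / B t ^ 2| ≤ 2 := by
    have := abs_add_le_of_le (h.field_sq t) le_rfl (y := 1)
    rw [sub_add_cancel, abs_one] at this
    linarith
  have h1 := abs_add_le_of_le (abs_sub_le_of_le (abs_add_le_of_le (abs_add_le_of_le
    (abs_mul_le_of_le (h.A t) (abs_flowPos_le (b := b) hB hδ h t v))
    (abs_mul_le_of_le (h.β t) (abs_flowMom_le (b := b) hB hδ h t v)))
    (abs_mul_le_of_le (abs_sub_inv_field_le h t t) (abs_mom_le_norm v 0)))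
    (abs_mul_le_of_le (h.field_sq t) (abs_flowPos_le (b := b) hB hδ h t v)))
    (abs_mul_le_of_le h2 (abs_add_le_of_le
      (abs_mul_le_of_le (Real.abs_cos_le_one (b * t)) (abs_rotPos_sub_le hB hδ h 0 v))
      (abs_mul_le_of_le (abs_sin_div_le hB (b * t)) (abs_rotMom_sub_le hB hδ h 0 v))))
  simp only [errPosOne, ← momCLM_apply] at h1 ⊢
  refine h1.trans ?_
  linarith

theorem norm_ofNormal_sub_id_le :
    ‖d.ofNormal B₀ t - ContinuousLinearMap.id ℝ Phase‖ ≤ 100 * (scale B₀ ^ 2 * δ) := by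
  have k0 := h.nonneg
  refine ContinuousLinearMap.opNorm_le_bound _ (by positivity) fun v => ?_
  obtain ⟨m1, m2, m3⟩ := monomials_le hB h v
  obtain ⟨k1, -, k3, -⟩ := scale_bounds hB
  have hX := abs_freePos_le hB v
  have hP := abs_mom_le_norm v 1
  have hr := abs_half_le h t
  have hC : |d.C t * freePos B₀ v + (d.Δ t - 1) * v.2 1| ≤ 2 * (scale B₀ * (δ * ‖v‖)) := by
    have := abs_add_le_of_le (abs_mul_le_of_le (h.C t) hX) (abs_mul_le_of_le (h.Δ t) hP)
    nlinarith [mul_nonneg k0 (norm_nonneg v)]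
  have hA : |(d.A t - 1) * freePos B₀ v + d.β t * v.2 1| ≤ 2 * (scale B₀ * (δ * ‖v‖)) := by
    have := abs_add_le_of_le (abs_mul_le_of_le (h.A t) hX) (abs_mul_le_of_le (h.β t) hP)
    nlinarith [mul_nonneg k0 (norm_nonneg v)]
  have hn : scale B₀ * (δ * ‖v‖) ≤ scale B₀ * ‖v‖ := by
    gcongr
    exact mul_le_of_le_one_left (norm_nonneg v) hδ
  have hnn : ‖v‖ ≤ scale B₀ * ‖v‖ := le_mul_of_one_le_left (norm_nonneg v) k1
  have hC' : |d.C t * freePos B₀ v + d.Δ t * v.2 1| ≤ 3 * (scale B₀ * ‖v‖) := by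
    have := abs_add_le_of_le hC hP
    rw [show d.C t * freePos B₀ v + (d.Δ t - 1) * v.2 1 + v.2 1 =
      d.C t * freePos B₀ v + d.Δ t * v.2 1 by ring] at this
    linarith
  have hA' : |d.A t * freePos B₀ v + d.β t * v.2 1| ≤ 3 * (scale B₀ * ‖v‖) := by
    have := abs_add_le_of_le hA hX
    rw [show (d.A t - 1) * freePos B₀ v + d.β t * v.2 1 + freePos B₀ v =
      d.A t * freePos B₀ v + d.β t * v.2 1 by ring] at this
    linarith
  have e1 : ((d.ofNormal B₀ t - ContinuousLinearMap.id ℝ Phase) v).1 0 = d.s t * v.2 0 +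
      (d.q t - B₀⁻¹) * (d.C t * freePos B₀ v + d.Δ t * v.2 1) +
      B₀⁻¹ * (d.C t * freePos B₀ v + (d.Δ t - 1) * v.2 1) -
      d.r t / 2 * (d.A t * freePos B₀ v + d.β t * v.2 1) := by
    simp [ofNormal]
    ring
  have e2 : ((d.ofNormal B₀ t - ContinuousLinearMap.id ℝ Phase) v).1 1 =
      (d.A t - 1) * freePos B₀ v + d.β t * v.2 1 + (d.q t - B₀⁻¹) * v.2 0 := by
    simp [ofNormal, freePos]
    ring
  have e3 : ((d.ofNormal B₀ t - ContinuousLinearMap.id ℝ Phase) v).2 0 = 0 := by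
    simp [ofNormal]
  have e4 : ((d.ofNormal B₀ t - ContinuousLinearMap.id ℝ Phase) v).2 1 =
      d.C t * freePos B₀ v + (d.Δ t - 1) * v.2 1 + d.r t / 2 * v.2 0 := by
    simp [ofNormal]
    ring
  have hp := abs_mom_le_norm v 0
  have b1 := abs_sub_le_of_le (abs_add_le_of_le (abs_add_le_of_le
    (abs_mul_le_of_le (h.s t) hp) (abs_mul_le_of_le (h.q t) hC')) (abs_mul_le_of_le k3 hC))
    (abs_mul_le_of_le hr hA')
  have b2 := abs_add_le_of_le hA (abs_mul_le_of_le (h.q t) hp)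
  have b4 := abs_add_le_of_le hC (abs_mul_le_of_le hr hp)
  rw [← e1] at b1
  rw [← e2] at b2
  rw [← e4] at b4
  have h0 : 0 ≤ 100 * (scale B₀ ^ 2 * δ) * ‖v‖ := by linarith
  refine norm_prod_le_iff.2 ⟨(pi_norm_le_iff_of_nonneg h0).2 ?_,
    (pi_norm_le_iff_of_nonneg h0).2 ?_⟩ <;> rw [Fin.forall_fin_two] <;>
    simp only [Real.norm_eq_abs]
  · exact ⟨b1.trans (by linarith), b2.trans (by linarith)⟩
  · exact ⟨by rw [e3, abs_zero]; exact h0, b4.trans (by linarith)⟩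

end Bounds

end FloquetData

/-! ### The Landau flow -/

/-- The coefficients are the values of the functional on the basis vectors. The factor 2 accounts
for the two vectors `a` and `b`. -/
theorem eqUpTo_of_functional {h : ℝ → Phase → ℝ} {K : ℝ} {y y₀ : (ℝ → Phase) → ℝ → ℝ}
    (E : ℝ → Phase →L[ℝ] ℝ) (hE : ∀ t v, |E t v| ≤ K * ‖v‖)
    (hy : ∀ γ : ℝ → Phase, IsHamiltonSol h γ → ∀ t, y γ t = y₀ γ t + E t (γ 0)) :
    EqUpTo h (2 * K) y y₀ := by
  have hK : 0 ≤ K := by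
    have := (abs_nonneg _).trans (hE 0 (Pi.single 0 1, 0))
    rwa [Prod.norm_mk, Pi.norm_single, norm_one, norm_zero, max_eq_left zero_le_one, mul_one] at this
  refine ⟨fun t i => E t (Pi.single i 1, 0), fun t i => E t (0, Pi.single i 1), fun t => ?_,
    fun γ hγ t => ?_⟩
  · have h1 : ‖fun i => E t (Pi.single i 1, 0)‖ ≤ K := (pi_norm_le_iff_of_nonneg hK).2 fun i => by
      refine (hE t _).trans (le_of_eq ?_)
      rw [Prod.norm_mk, Pi.norm_single, norm_one, norm_zero, max_eq_left zero_le_one, mul_one]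
    have h2 : ‖fun i => E t (0, Pi.single i 1)‖ ≤ K := (pi_norm_le_iff_of_nonneg hK).2 fun i => by
      refine (hE t _).trans (le_of_eq ?_)
      rw [Prod.norm_mk, Pi.norm_single, norm_one, norm_zero, max_eq_right zero_le_one, mul_one]
    linarith
  · rw [hy γ hγ t]
    congr 1
    have e : γ 0 = ∑ i, (γ 0).1 i • ((Pi.single i 1, 0) : Phase) +
        ∑ i, (γ 0).2 i • ((0, Pi.single i 1) : Phase) := by
      refine Prod.ext (funext fun i => ?_) (funext fun i => ?_) <;> fin_cases i <;> simp
    conv_lhs => rw [e]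
    simp only [map_add, map_sum, map_smul, smul_eq_mul, mul_comm]

theorem sqrt_mul_im_zOne {B₀ : ℝ} (hB : 0 < B₀) (s : ℝ) (v : Phase) :
    Real.sqrt (2 * B₀) * (Complex.exp (-(Complex.I * (s : ℂ))) * zOne B₀ v).im =
      Real.cos s * v.2 1 - B₀ * Real.sin s * FloquetData.freePos B₀ v := by
  have hs0 : Real.sqrt (2 * B₀) ≠ 0 := (Real.sqrt_pos.2 (by positivity)).ne'
  have e : -(Complex.I * (s : ℂ)) = ((-s : ℝ) : ℂ) * Complex.I := by push_cast; ring
  unfold zOne FloquetData.freePos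
  generalize Real.sqrt (2 * B₀) = r at hs0
  rw [e, Complex.mul_im, Complex.exp_ofReal_mul_I_re, Complex.exp_ofReal_mul_I_im, Complex.add_re,
    Complex.add_im, Complex.ofReal_re, Complex.ofReal_im, Complex.I_mul_re, Complex.I_mul_im,
    Complex.ofReal_re, Complex.ofReal_im, Real.cos_neg, Real.sin_neg]
  simp
  field_simp
  ring

theorem sqrt_mul_re_zOne {B₀ : ℝ} (hB : 0 < B₀) (s : ℝ) (v : Phase) :
    Real.sqrt 2 * B₀ ^ (3 / 2 : ℝ) * (Complex.exp (-(Complex.I * (s : ℂ))) * zOne B₀ v).re =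
      B₀ ^ 2 * (Real.cos s * FloquetData.freePos B₀ v + Real.sin s / B₀ * v.2 1) := by
  have hs0 : Real.sqrt (2 * B₀) ≠ 0 := (Real.sqrt_pos.2 (by positivity)).ne'
  have h1 : Real.sqrt 2 * B₀ ^ (3 / 2 : ℝ) = Real.sqrt (2 * B₀) * B₀ := by
    rw [Real.sqrt_mul zero_le_two, show (3 / 2 : ℝ) = 1 / 2 + 1 by norm_num, Real.rpow_add hB,
      Real.rpow_one, ← Real.sqrt_eq_rpow]
    ring
  have e : -(Complex.I * (s : ℂ)) = ((-s : ℝ) : ℂ) * Complex.I := by push_cast; ring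
  rw [h1]
  unfold zOne FloquetData.freePos
  generalize Real.sqrt (2 * B₀) = r at hs0
  rw [e, Complex.mul_re, Complex.exp_ofReal_mul_I_re, Complex.exp_ofReal_mul_I_im, Complex.add_re,
    Complex.add_im, Complex.ofReal_re, Complex.ofReal_im, Complex.I_mul_re, Complex.I_mul_im,
    Complex.ofReal_re, Complex.ofReal_im, Real.cos_neg, Real.sin_neg]
  simp
  field_simp

namespace FloquetData

variable {n : ℕ} {d : FloquetData} {B₀ b c ε δ : ℝ} {f : (Fin n → ℝ) → ℝ} {ω : Fin n → ℝ}

theorem conjugatedToNormal (h : d.IsSolution B₀ b (-4 / B₀ * c) (magB B₀ f ε ω)) (hB : 0 < B₀)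
    (hδ : δ ≤ 1) (hs : d.IsSmall B₀ (magB B₀ f ε ω) δ) :
    ConjugatedToNormal B₀ f ε ω b c (100 * (scale B₀ ^ 2 * δ)) :=
  ⟨d.normalEquiv B₀ h.det, fun t u v => d.sympForm_ofNormal B₀ (h.det t) u v,
    fun t => norm_ofNormal_sub_id_le hB hδ hs t, fun _ hγ => isHamiltonSol_toNormal h hγ hB⟩

theorem landauFlow (h : d.IsSolution B₀ b (-4 / B₀ * c) (magB B₀ f ε ω)) (hB : 0 < B₀)
    (hδ : δ ≤ 1) (hs : d.IsSmall B₀ (magB B₀ f ε ω) δ) :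
    LandauFlow B₀ f ε ω (-4 / B₀) b c (2 * (200 * (scale B₀ ^ 2 * δ))) := by
  refine ⟨?_, ?_, ?_, fun γ hγ t => mom_eq_of_isHamiltonSol hγ t, ?_⟩
  · obtain ⟨T, h1, h2, h3⟩ := conjugatedToNormal h hB hδ hs
    refine ⟨T, h1, fun t => (h2 t).trans ?_, h3⟩
    have : 0 ≤ scale B₀ ^ 2 * δ := mul_nonneg (sq_nonneg _) hs.nonneg
    linarith
  · refine eqUpTo_of_functional (d.errPosZero B₀ b (magB B₀ f ε ω))
      (fun t v => (abs_errPosZero_le hB hδ hs t v).trans_eq (by ring)) fun γ hγ t => ?_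
    -- In the exact formula `q` is replaced by `1/B(t)`, both at time `t` and at time `0`, and the
    -- relative momentum by `p₂`; each replacement costs `O(δ)`.
    have e : d.homMom 0 (γ 0) = (γ 0).2 1 - d.r 0 / 2 * (γ 0).2 0 := by simp [homMom]
    rw [pos_zero_eq h hγ hB t, mom_one_eq h hγ hB t]
    simp [errPosZero, e]
    ring
  · refine eqUpTo_of_functional (d.errMomOne B₀ b)
      (fun t v => (abs_errMomOne_le hB hδ hs t v).trans_eq (by ring)) fun γ hγ t => ?_
    rw [sqrt_mul_im_zOne hB, mom_one_eq h hγ hB t]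
    simp [errMomOne, flowHomMom, flowMom]
    ring
  · refine eqUpTo_of_functional (d.errPosOne B₀ b (magB B₀ f ε ω))
      (fun t v => (abs_errPosOne_le hB hδ hs t v).trans_eq (by ring)) fun γ hγ t => ?_
    rw [div_mul_eq_mul_div, sqrt_mul_re_zOne hB, pos_one_eq h hγ hB t]
    simp [errPosOne, flowHomPos, flowPos]
    ring

end FloquetData

theorem LandauFlow.mono {n : ℕ} {B₀ ε α b c δ δ' : ℝ} {f : (Fin n → ℝ) → ℝ} {ω : Fin n → ℝ}
    (h : LandauFlow B₀ f ε ω α b c δ) (hδ : δ ≤ δ') : LandauFlow B₀ f ε ω α b c δ' := by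
  obtain ⟨⟨T, h1, h2, h3⟩, ⟨a₁, b₁, h4, h5⟩, ⟨a₂, b₂, h6, h7⟩, h8, ⟨a₃, b₃, h9, h10⟩⟩ := h
  exact ⟨⟨T, h1, fun t => (h2 t).trans hδ, h3⟩, ⟨a₁, b₁, fun t => (h4 t).trans hδ, h5⟩,
    ⟨a₂, b₂, fun t => (h6 t).trans hδ, h7⟩, h8, ⟨a₃, b₃, fun t => (h9 t).trans hδ, h10⟩⟩

/-- The Landau flow with an error that need not be small. -/
theorem FloquetData.landauFlow_of_isSmall {n : ℕ} {d : FloquetData} {B₀ b c ε δ : ℝ}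
    {f : (Fin n → ℝ) → ℝ} {ω : Fin n → ℝ}
    (h : d.IsSolution B₀ b (-4 / B₀ * c) (magB B₀ f ε ω)) (hB : 0 < B₀)
    (h1 : d.IsSmall B₀ (magB B₀ f ε ω) 1) (hs : d.IsSmall B₀ (magB B₀ f ε ω) δ) :
    LandauFlow B₀ f ε ω (-4 / B₀) b c (400 * FloquetData.scale B₀ ^ 2 * δ) := by
  rcases le_total δ 1 with hδ | hδ
  · exact (d.landauFlow h hB hδ hs).mono (le_of_eq (by ring))
  -- For `δ > 1` the uniform bound with 1 is already better. Hence `ε₀` need not be shrunk as the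
  -- nonresonance class varies.
  · refine (d.landauFlow h hB le_rfl h1).mono ?_
    have : FloquetData.scale B₀ ^ 2 ≤ FloquetData.scale B₀ ^ 2 * δ :=
      le_mul_of_one_le_right (sq_nonneg _) hδ
    linarith

/-! ### Linear growth -/

/-- A function that differs from a linear function by a bounded function. -/
theorem tendsto_div_of_bounded_sub {x : ℝ → ℝ} {m M : ℝ} (h : ∀ t, |x t - m * t| ≤ M)
    {l : Filter ℝ} (hl : Tendsto (fun t : ℝ => |t|) l atTop) :
    Tendsto (fun t => x t / t) l (𝓝 m) := by
  have h1 : Tendsto (fun t : ℝ => M / |t|) l (𝓝 0) := hl.const_div_atTop M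
  rw [tendsto_iff_norm_sub_tendsto_zero]
  refine squeeze_zero' (Eventually.of_forall fun _ => norm_nonneg _) ?_ h1
  filter_upwards [hl.eventually_gt_atTop 0] with t ht
  have ht0 : t ≠ 0 := abs_pos.1 ht
  have e : x t / t - m = (x t - m * t) / t := by field_simp
  rw [e, Real.norm_eq_abs, abs_div]
  gcongr
  exact h t

theorem not_isBounded_of_bounded_sub {x : ℝ → ℝ} {m M : ℝ} (h : ∀ t, |x t - m * t| ≤ M)
    (hm : m ≠ 0) : ¬ Bornology.IsBounded (x '' Set.Ici 0) := by
  intro hb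
  obtain ⟨R, hR⟩ := hb.exists_norm_le
  have hm0 : 0 < |m| := abs_pos.2 hm
  have hRM : 0 ≤ R + M + 1 := by
    have h1 := (norm_nonneg _).trans (hR _ ⟨0, Set.mem_Ici.2 le_rfl, rfl⟩)
    have h2 := (abs_nonneg _).trans (h 0)
    linarith
  -- At this time the linear part equals `R + M + 1` in modulus, which exceeds the two bounds
  -- together.
  have h1 := hR _ ⟨(R + M + 1) / |m|, Set.mem_Ici.2 (by positivity), rfl⟩
  have h2 := h ((R + M + 1) / |m|)
  rw [Real.norm_eq_abs] at h1
  have h3 : |m * ((R + M + 1) / |m|)| = R + M + 1 := by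
    rw [abs_mul, abs_div, abs_abs, abs_of_nonneg hRM]
    field_simp
  have h4 := abs_sub_le_of_le h1 h2
  rw [sub_sub_cancel, h3] at h4
  linarith

theorem FloquetData.exists_bound_pos_zero {n : ℕ} {d : FloquetData} {B₀ b c ε : ℝ}
    {f : (Fin n → ℝ) → ℝ} {ω : Fin n → ℝ}
    (h : d.IsSolution B₀ b (-4 / B₀ * c) (magB B₀ f ε ω)) (hB : 0 < B₀)
    (h1 : d.IsSmall B₀ (magB B₀ f ε ω) 1) {v : ℝ → Phase}
    (hv : IsHamiltonSol (hLandau B₀ f ε ω) v) :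
    ∃ M : ℝ, ∀ t, |(v t).1 0 - -4 / B₀ * c * (v 0).2 0 * t| ≤ M := by
  have hr := abs_half_le h1
  refine ⟨|(v 0).1 0| + ((1 + 1) * |(v 0).2 0| +
    (scale B₀ * (36 * (scale B₀ ^ 2 * ‖v 0‖)) + |d.q 0 * d.homMom 0 (v 0)|) +
    (1 * (36 * (scale B₀ ^ 2 * ‖v 0‖)) + |d.r 0 / 2 * d.homPos 0 (v 0)|)), fun t => ?_⟩
  rw [pos_zero_eq h hv hB t]
  have hb := abs_add_le_of_le (le_refl |(v 0).1 0|) (abs_sub_le_of_le (abs_add_le_of_le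
    (abs_mul_le_of_le (abs_sub_le_of_le (h1.s t) (h1.s 0)) (le_refl |(v 0).2 0|))
    (abs_sub_le_of_le (abs_mul_le_of_le (abs_q_le hB le_rfl h1 t)
      (abs_flowHomMom_le (b := b) hB le_rfl h1 t (v 0))) (le_refl |d.q 0 * d.homMom 0 (v 0)|)))
    (abs_sub_le_of_le (abs_mul_le_of_le (hr t) (abs_flowHomPos_le (b := b) hB le_rfl h1 t (v 0)))
      (le_refl |d.r 0 / 2 * d.homPos 0 (v 0)|)))
  refine le_trans (le_of_eq ?_) hb
  congr 1
  ring

end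

/-! ### Uniformity of the error terms and linear growth -/

theorem mainTheorem5 (B₀ : ℝ) (hB₀ : 0 < B₀) :
    ∃ α : ℝ, α ≠ 0 ∧
      ∀ (n : ℕ) (f : (Fin n → ℝ) → ℝ), TorusAnalytic f → fourierCoef f 0 = 0 →
        ∃ (ε₀ : ℝ) (C : ℝ → Set (Fin n → ℝ)) (b c : ℝ → (Fin n → ℝ) → ℝ),
          0 < ε₀ ∧
          -- the magnetic field is positive
          (∀ ε : ℝ, |ε| < ε₀ → ∀ (ω : Fin n → ℝ) (t : ℝ), 0 < magB B₀ f ε ω t) ∧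
          -- the flow exists
          (∀ ε : ℝ, |ε| < ε₀ → ∀ (ω : Fin n → ℝ) (v₀ : Phase),
            ∃! v : ℝ → Phase, IsHamiltonSol (hLandau B₀ f ε ω) v ∧ v 0 = v₀) ∧
          -- asymptotically full measure
          (∀ ε : ℝ, |ε| < ε₀ → MeasurableSet (C ε) ∧ C ε ⊆ nonresonant B₀ n) ∧
          Tendsto (fun ε => volume (nonresonant B₀ n \ C ε)) (𝓝[≠] 0) (𝓝 0) ∧
          -- errors of order `ε`, uniformly in time and in the frequencies with fixed constants
          (∀ γ τ : ℝ, 0 < γ → 0 < τ → ∃ K : ℝ, ∀ ε : ℝ, |ε| < ε₀ →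
            ∀ ω ∈ C ε ∩ diophantine B₀ n γ τ,
              |b ε ω - 2 * B₀| ≤ K * |ε| ^ 2 ∧
              ‖(c ε ω : ℂ) - cOmega B₀ f ω * (ε : ℂ) ^ 2‖ ≤ K * |ε| ^ 3 ∧
              LandauFlow B₀ f ε ω α (b ε ω) (c ε ω) (K * |ε|)) ∧
          -- uniformly on the whole of `C ε`, with an arbitrarily small loss in the exponents
          (∀ η : ℝ, 0 < η → η < 1 → ∃ K : ℝ, ∀ ε : ℝ, |ε| < ε₀ → ∀ ω ∈ C ε,
              |b ε ω - 2 * B₀| ≤ K * |ε| ^ (2 - η) ∧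
              ‖(c ε ω : ℂ) - cOmega B₀ f ω * (ε : ℂ) ^ 2‖ ≤ K * |ε| ^ (3 - η) ∧
              LandauFlow B₀ f ε ω α (b ε ω) (c ε ω) (K * |ε| ^ (1 - η))) ∧
          -- linear growth
          (∀ ω ∈ nonresonant B₀ n, cOmega B₀ f ω ≠ 0 →
            ∃ ε₁ : ℝ, 0 < ε₁ ∧ ∀ ε : ℝ, ε ≠ 0 → |ε| < ε₁ → ω ∈ C ε →
              ∀ v : ℝ → Phase, IsHamiltonSol (hLandau B₀ f ε ω) v → (v 0).2 0 ≠ 0 →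
                α * c ε ω * (v 0).2 0 ≠ 0 ∧
                Tendsto (fun t => (v t).1 0 / t) atTop (𝓝 (α * c ε ω * (v 0).2 0)) ∧
                Tendsto (fun t => (v t).1 0 / t) atBot (𝓝 (α * c ε ω * (v 0).2 0)) ∧
                ¬ Bornology.IsBounded ((fun t => (v t).1 0) '' Set.Ici 0)) := by
  refine ⟨-4 / B₀, div_ne_zero (by norm_num) hB₀.ne', fun n f hf h0 => ?_⟩
  obtain ⟨ε₀, δ, P, L, C, b, c, d, hε₀, hε₁, hδ, hP, hfield, hC, hmeas, hmain⟩ :=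
    FourierAlg.exists_floquetData hB₀ hf h0
  set κ := 400 * FloquetData.scale B₀ ^ 2 with hκ
  have hκ0 : 0 ≤ κ := by positivity
  have huniform : ∀ η : ℝ, 0 < η → η < 1 → ∃ K : ℝ, ∀ ε : ℝ, |ε| < ε₀ → ∀ ω ∈ C ε,
      |b ε ω - 2 * B₀| ≤ K * |ε| ^ (2 - η) ∧
      ‖(c ε ω : ℂ) - cOmega B₀ f ω * (ε : ℂ) ^ 2‖ ≤ K * |ε| ^ (3 - η) ∧
      LandauFlow B₀ f ε ω (-4 / B₀) (b ε ω) (c ε ω) (K * |ε| ^ (1 - η)) := fun η hη _ => by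
    -- The divisor constant available on all of `C ε` carries a squared logarithm and enters with at
    -- most the fifth power.
    obtain ⟨K, hK, hlog⟩ := exists_logFac_pow_mul_le 10 hη
    -- The summand 1 serves the bounds on `b` and `c`, the summand `κ` the bound on the flow.
    refine ⟨(1 + κ) * (P * |L| ^ 5 * K), fun ε hε ω hω => ?_⟩
    obtain ⟨hfree, hsol, hone, hl⟩ := hmain ε hε ω hω
    obtain ⟨hsmall, hb, hc⟩ := hl _ hfree
    have hl1 := hfree.one_le
    have hbound : ∀ j : ℕ, j ≠ 0 → P * (L * logFac ε ^ 2) ^ 5 * |ε| ^ j ≤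
        P * |L| ^ 5 * K * |ε| ^ ((j : ℝ) - η) := fun j hj => by
      have h1 : (L * logFac ε ^ 2) ^ 5 ≤ |L| ^ 5 * logFac ε ^ 10 :=
        calc (L * logFac ε ^ 2) ^ 5 ≤ (|L| * logFac ε ^ 2) ^ 5 := by
              gcongr
              exact le_abs_self L
          _ = _ := by ring
      calc _ ≤ P * (|L| ^ 5 * logFac ε ^ 10) * |ε| ^ j := by gcongr
        _ = P * |L| ^ 5 * (logFac ε ^ 10 * |ε| ^ j) := by ring
        _ ≤ P * |L| ^ 5 * (K * |ε| ^ ((j : ℝ) - η)) :=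
            mul_le_mul_of_nonneg_left (hlog ε (hε.le.trans hε₁) j hj) (by positivity)
        _ = _ := by ring
    have hgrow : ∀ x : ℝ, 0 ≤ x → P * |L| ^ 5 * K * x ≤ (1 + κ) * (P * |L| ^ 5 * K) * x :=
      fun x hx => by
        refine mul_le_mul_of_nonneg_right (le_mul_of_one_le_left (by positivity) ?_) hx
        linarith
    have h1 := hbound 1 one_ne_zero
    have h2 := hbound 2 two_ne_zero
    have h3 := hbound 3 three_ne_zero
    rw [pow_one, Nat.cast_one] at h1
    rw [Nat.cast_ofNat] at h2 h3
    refine ⟨(hb.trans ?_).trans (h2.trans (hgrow _ (by positivity))),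
      (hc.trans ?_).trans (h3.trans (hgrow _ (by positivity))),
      (FloquetData.landauFlow_of_isSmall hsol hB₀ hone hsmall).mono ?_⟩
    · gcongr
      norm_num
    · gcongr
      norm_num
    · refine (mul_le_mul_of_nonneg_left h1 hκ0).trans ?_
      rw [← mul_assoc]
      gcongr
      linarith
  refine ⟨ε₀, C, b, c, hε₀, fun ε hε ω t => ?_, fun ε hε ω v₀ =>
    existsUnique_landau hf.continuous (hfield ε hε ω) v₀, hC, hmeas, fun γ τ hγ hτ => ?_, huniform,
    fun ω hω hcω => ?_⟩
  · have := abs_le.1 (hfield ε hε ω t)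
    linarith
  -- This divisor constant depends on `γ` and `τ` but not on `ε`, so no logarithm appears.
  · set l := FourierAlg.divConst n ⌈τ⌉₊ (min γ 1 / 2) δ
    refine ⟨(1 + κ) * (P * l ^ 5), fun ε hε ω hω => ?_⟩
    obtain ⟨-, hsol, hone, hl⟩ := hmain ε hε ω hω.1
    have hfree : FourierAlg.FreeResBound B₀ ω l δ :=
      FourierAlg.freeResBound_of_mem_diophantine hγ hτ.le hδ hω.2
    obtain ⟨hsmall, hb, hc⟩ := hl _ hfree
    have hl1 := hfree.one_le
    have hgrow : ∀ m ≤ 5, P * l ^ m ≤ (1 + κ) * (P * l ^ 5) := fun m hm =>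
      calc P * l ^ m ≤ P * l ^ 5 := by gcongr
        _ ≤ _ := le_mul_of_one_le_left (by positivity) (by linarith)
    refine ⟨hb.trans ?_, hc.trans ?_,
      (FloquetData.landauFlow_of_isSmall hsol hB₀ hone hsmall).mono ?_⟩
    · exact mul_le_mul_of_nonneg_right (hgrow 3 (by norm_num)) (by positivity)
    · exact mul_le_mul_of_nonneg_right (hgrow 4 (by norm_num)) (by positivity)
    · rw [← mul_assoc]
      gcongr
      linarith
  -- Any loss below 1 would do: an error `O(|ε|^(5/2))` in `c` is still small compared with `c_ω
  -- ε²`.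
  · obtain ⟨K, hK⟩ := huniform (1 / 2) (by norm_num) (by norm_num)
    have hcω0 : 0 < ‖cOmega B₀ f ω‖ := norm_pos_iff.2 hcω
    -- This threshold ensures `(|K| + 1) √|ε| < ‖c_ω‖`, which is incompatible with `c = 0`.
    refine ⟨min ε₀ ((‖cOmega B₀ f ω‖ / (|K| + 1)) ^ 2), by positivity,
      fun ε hε0 hε hω v hv hp => ?_⟩
    have hεε := hε.trans_le (min_le_left _ _)
    obtain ⟨-, hsol, hone, -⟩ := hmain ε hεε ω hω
    have he : 0 < |ε| := abs_pos.2 hε0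
    have hc0 : c ε ω ≠ 0 := fun hc0 => by
      have h1 := (hK ε hεε ω hω).2.1
      rw [hc0, Complex.ofReal_zero, zero_sub, norm_neg, norm_mul, norm_pow, Complex.norm_real,
        Real.norm_eq_abs, show (3 - 1 / 2 : ℝ) = 1 / 2 + (2 : ℕ) by norm_num, Real.rpow_add he,
        Real.rpow_natCast, ← Real.sqrt_eq_rpow, ← mul_assoc] at h1
      have h2 := le_of_mul_le_mul_right h1 (by positivity)
      have h3 : Real.sqrt |ε| < ‖cOmega B₀ f ω‖ / (|K| + 1) :=
        (Real.sqrt_lt' (by positivity)).2 (hε.trans_le (min_le_right _ _))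
      rw [lt_div_iff₀ (by positivity)] at h3
      nlinarith [le_abs_self K, Real.sqrt_nonneg |ε|]
    have hm : -4 / B₀ * c ε ω * (v 0).2 0 ≠ 0 :=
      mul_ne_zero (mul_ne_zero (div_ne_zero (by norm_num) hB₀.ne') hc0) hp
    obtain ⟨M, hM⟩ := FloquetData.exists_bound_pos_zero hsol hB₀ hone hv
    exact ⟨hm, tendsto_div_of_bounded_sub hM tendsto_abs_atTop_atTop,
      tendsto_div_of_bounded_sub hM tendsto_abs_atBot_atTop, not_isBounded_of_bounded_sub hM hm⟩
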